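/- **Proposition (Euler characteristic of knitted surfaces of degree 2).** Let $\Gamma\subset S^2$ be a knit chart of degree $2$: a finite embedded graph (circle edges without vertices allowed) with oriented $\sigma$-edges and unoriented $\tau$-edges, such that each vertex has degree $1$ (a black $\sigma$- or $\tau$-vertex), or degree $3$ with one $\sigma$-edge end and two $\tau$-edge ends, or degree $3$ with three $\tau$-edge ends. Let $F\subset D^2\times S^2$ be a knitted surface of degree $2$ with chart $\Gamma$, i.e. up to fibre-preserving ambient isotopy of $D^2\times S^2$ over $S^2$ the surface is obtained by decomposing $S^2$ into finitely many disks $E\cong I\times I$ in each of which $\Gamma$ is empty, a single $\sigma$- or $\tau$-edge, or a neighbourhood of one vertex, and putting over $E$ respectively the trivial surface $\{2\text{ points}\}\times E$, the geometric $2$-knit $\sigma_1^{\pm1}$ or the hook pair $\tau_1$ times an interval, or the surface given by the transformation $\sigma_1^{\pm1}\to e$, $\tau_1\to e$, $\tau_1\to\sigma_1^{\pm1}\tau_1$ or $\tau_1\tau_1\to\tau_1$ of $2$-knits. Let $\Gamma_\tau$ be the union of the $\tau$-edges, let the regions be the closures of the connected components of $S^2\setminus\Gamma_\tau$, and for a regular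 neighbourhood $N$ of $\Gamma_\tau$ and a region $R$ put $R'=\overline{R\setminus N}$. Then there are finitely many regions $R_1,\dots,R_m$, and, with $F_j$ the part of $F$ over $R_j$: 1. $F=F_1\cup\dots\cup F_m$, and $F$ is a split union of $F_1,\dots,F_m$ in $\mathbb R^4$, where $D^2\times S^2\subset\mathbb R^4$ is the standard tubular neighbourhood of the standard $2$-sphere: a smooth ambient isotopy of $\mathbb R^4$ moves $F_1,\dots,F_m$ into pairwise disjoint balls. 2. For a suitable regular neighbourhood $N$ of $\Gamma_\tau$, each $F_j$ is, up to fibre-preserving ambient isotopy of $D^2\times S^2$, the plat closure of a knitted surface of degree $2$ over $R_j'$ with chart $\Gamma^j\cap R_j'$, where $\Gamma^j=\Gamma\cap R_j$. Here the plat closure is obtained by attaching, over a collar of $\partial R_j'$ outside $R_j'$, the surface swept out by the semicircles (wickets) that join the two points of the surface over each point of $\partial R_j'$. 3. For every regular neighbourhood $N$ of $\Gamma_\tau$ and every $j$, the Euler characteristics of $R_j'$ and $F_j$ are defined and $$\chi(F_j)=2\chi(R_j')-b(\Gamma^j),$$ where $b(\Gamma^j)$ is the number of black $\sigma$-vertices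 of $\Gamma$ in $R_j$. -/

import Mathlib

open Set
open scoped ContDiff

noncomputable section

namespace Knit

/-- Euclidean 3-space. -/
abbrev E3 : Type := EuclideanSpace ℝ (Fin 3)

/-- Euclidean 4-space. -/
abbrev E4 : Type := EuclideanSpace ℝ (Fin 4)

/-- The unit 2-sphere. -/
abbrev S2 : Type := Metric.sphere (0 : E3) 1

/-! ### Charts of degree 2 on the sphere -/

/-- The two kinds of edges: `sigma` (oriented) and `tau` (unoriented). -/
inductive Label where
  | sigma
  | tau

/-- A (knit) chart of degree 2 on the 2-sphere: a finite graph embedded in the sphere. The edge `e`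
is parametrised by `path e` on `[0,1]`; a `sigma`-edge is oriented by increasing parameter, while
the direction of a `tau`-edge carries no meaning. An edge is either an arc running between vertices
(possibly twice the same vertex) or a circle that contains no vertex, parametrised with period 1.
Every vertex has degree 1, or degree 3 with edge ends `sigma, tau, tau` or `tau, tau, tau`. -/
structure Chart where
  vertices : Finset S2
  numEdges : ℕ
  label : Fin numEdges → Label
  circle : Fin numEdges → Prop
  path : Fin numEdges → ℝ → S2
  continuous_path : ∀ e, Continuous (path e)
  injOn_arc : ∀ e, ¬ circle e → InjOn (path e) (Ioo 0 1)
  endpoint_arc : ∀ e, ¬ circle e → path e 0 ∈ vertices ∧ path e 1 ∈ vertices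
  interior_arc : ∀ e, ¬ circle e → ∀ t ∈ Ioo (0 : ℝ) 1, path e t ∉ vertices
  periodic_circle : ∀ e, circle e → Function.Periodic (path e) 1
  injOn_circle : ∀ e, circle e → InjOn (path e) (Ico 0 1)
  interior_circle : ∀ e, circle e → ∀ t, path e t ∉ vertices
  disjoint_edges : ∀ e e', e ≠ e' → ∀ t ∈ Icc (0 : ℝ) 1, ∀ t' ∈ Icc (0 : ℝ) 1,
    path e t = path e' t' → path e t ∈ vertices
  vertex_type : ∀ v ∈ vertices,
    ({x : Fin numEdges × Bool | label x.1 = .sigma ∧ ¬ circle x.1 ∧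
        path x.1 (if x.2 then 1 else 0) = v}.ncard,
      {x : Fin numEdges × Bool | label x.1 = .tau ∧ ¬ circle x.1 ∧
        path x.1 (if x.2 then 1 else 0) = v}.ncard) ∈
      ({(1, 0), (0, 1), (1, 2), (0, 3)} : Set (ℕ × ℕ))

namespace Chart

variable (Γ : Chart)

/-- The number of ends of edges with label `l` at the point `v`. -/
def ends (l : Label) (v : S2) : ℕ :=
  {x : Fin Γ.numEdges × Bool | Γ.label x.1 = l ∧ ¬ Γ.circle x.1 ∧
    Γ.path x.1 (if x.2 then 1 else 0) = v}.ncard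

/-- The union of all (closed) edges with label `l`. -/
def carrier (l : Label) : Set S2 :=
  {p | ∃ e, Γ.label e = l ∧ p ∈ Γ.path e '' Icc 0 1}

/-- The underlying set of the `τ`-chart `Γ_τ`. -/
def tauChart : Set S2 := Γ.carrier .tau

/-- The regions of the `τ`-chart: closures of the components of its complement. -/
def regions : Set (Set S2) :=
  {R | ∃ p ∈ Γ.tauChartᶜ, R = closure (connectedComponentIn Γ.tauChartᶜ p)}

/-- The number of black `σ`-vertices of `Γ` that lie in `R`. -/
def numBlackSigma (R : Set S2) : ℕ :=
  {v : S2 | v ∈ Γ.vertices ∧ Γ.ends .sigma v = 1 ∧ Γ.ends .tau v = 0 ∧ v ∈ R}.ncard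

end Chart

/-! ### The local pieces of knitted surfaces of degree 2

The square `[0,1] × [0,1]` has coordinates `x = (a, b)`, where `a` is the direction in which the
letters of a knit are read and `b` is the time of the motion picture. A surface over the square is
described by its fibres in the complex plane; the slice at time `b` is the union over `a` of the
fibres over `(a, b)`. The two base points are `1/2` and `-1/2`. -/

/-- The closed square. -/
def square : Set (ℝ × ℝ) := Icc 0 1 ×ˢ Icc 0 1

/-- The open square. -/
def openSquare : Set (ℝ × ℝ) := Ioo 0 1 ×ˢ Ioo 0 1

/-- A smooth function that increases from `0` to `1` on the interval `[3/8, 5/8]`, and is constant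
elsewhere: the progress of the half twist of the letter `σ`. -/
def twist (a : ℝ) : ℝ := Real.smoothTransition (4 * a - 3 / 2)

/-- A smooth function that is `0` outside `[1/8, 7/8]`, is `1` on `[3/16, 13/16]` and is monotone
between: it describes the gap between the two hooks of the letter `τ`. -/
def gap (a : ℝ) : ℝ := Real.smoothTransition (16 * a - 2) * Real.smoothTransition (14 - 16 * a)

/-- The rotation by the angle `ε π t`. -/
def rot (ε : ℤˣ) (t : ℝ) : ℂ := Complex.exp (((ε : ℤ) : ℂ) * Real.pi * t * Complex.I)

/-- The points `± √((1 - 2 g) / 4) · u` in the line spanned by `u`: a pair of points if `g < 1/2`,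
the single point `0` if `g = 1/2`, and the empty set if `g > 1/2`. -/
def pair (g : ℝ) (u : ℂ) : Set ℂ := {z | ∃ x : ℝ, x ^ 2 = (1 - 2 * g) / 4 ∧ z = x * u}

/-- The kinds of squares: no edge; an edge crossing the square (`σ`, `σ⁻¹` or `τ`); a black vertex;
a mixed trivalent vertex with `σ`-edge of sign `ε`; a trivalent `τ`-vertex. -/
inductive Piece where
  | empty
  | sigmaEdge (ε : ℤˣ)
  | tauEdge
  | blackSigma (ε : ℤˣ)
  | blackTau
  | mixed (ε : ℤˣ)
  | trivalentTau

namespace Piece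

/-- The fibre of the surface over a point of the square:
* `empty`: the trivial knitted surface `{1/2, -1/2} × square`;
* `sigmaEdge ε`, `tauEdge`: the geometric knit `σ^ε` (a half twist), respectively `τ` (a pair of
  hooks with a gap between them), times the time interval;
* `blackSigma ε`: the transformation `σ^ε → e`, with one simple branch point over `(1/2, 1/2)`;
* `blackTau`: the transformation `τ → e`, that closes the gap by a saddle;
* `mixed ε`: the transformation `τ → σ^ε τ`;
* `trivalentTau`: the transformation `τ τ → τ`, in which a circle dies. -/
def fibre : Piece → ℝ × ℝ → Set ℂ
  | empty, _ => pair 0 1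
  | sigmaEdge ε, x => pair 0 (rot ε (twist x.1))
  | tauEdge, x => pair (gap x.1) 1
  | blackSigma ε, x =>
      let s : ℝ := Real.smoothTransition (2 * x.2 - 1 / 2)
      {z | z ^ 2 = ((1 - s) * rot ε (twist x.1) ^ 2 + s) / 4}
  | blackTau, x =>
      let s : ℝ := Real.smoothTransition (4 * x.2 - 2)
      pair ((1 - s) * gap x.1) 1
  | mixed ε, x =>
      let s : ℝ := Real.smoothTransition (16 * x.2 - 14)
      pair ((1 - s) * gap x.1 + s * gap (2 * x.1 - 1)) (rot ε (twist (2 * x.1)))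
  | trivalentTau, x =>
      let s : ℝ := Real.smoothTransition (8 * x.2 - 1)
      pair ((1 - s) * (gap (2 * x.1) + gap (2 * x.1 - 1)) + s * gap x.1) 1

/-- The `σ`-edge in the square, if there is one, parametrised by `[0,1]` from the end at the smaller
time to the end at the larger time, together with its sign. -/
def sigmaArc : Piece → Option (ℤˣ × (ℝ → ℝ × ℝ))
  | sigmaEdge ε => some (ε, fun t => (1 / 2, t))
  | blackSigma ε => some (ε, fun t => (1 / 2, t / 2))
  | mixed ε => some (ε, fun t => (1 / 4, (1 + t) / 2))
  | _ => none

/-- The part of the `τ`-chart in the square. -/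
def tauSet : Piece → Set (ℝ × ℝ)
  | tauEdge => segment ℝ (1 / 2, 0) (1 / 2, 1)
  | blackTau => segment ℝ (1 / 2, 0) (1 / 2, 1 / 2)
  | mixed _ => segment ℝ (1 / 2, 0) (1 / 4, 1 / 2) ∪ segment ℝ (1 / 4, 1 / 2) (3 / 4, 1)
  | trivalentTau => segment ℝ (1 / 4, 0) (1 / 2, 1 / 2) ∪ segment ℝ (3 / 4, 0) (1 / 2, 1 / 2) ∪
      segment ℝ (1 / 2, 1 / 2) (1 / 2, 1)
  | _ => ∅

/-- The vertices in the square. -/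
def vertexSet : Piece → Set (ℝ × ℝ)
  | blackSigma _ => {(1 / 2, 1 / 2)}
  | blackTau => {(1 / 2, 1 / 2)}
  | mixed _ => {(1 / 4, 1 / 2)}
  | trivalentTau => {(1 / 2, 1 / 2)}
  | _ => ∅

end Piece

/-- `h` is an orientation preserving smooth embedding of the closed square into the sphere. -/
def IsSquareChart (h : ℝ × ℝ → E3) : Prop :=
  ContDiff ℝ ∞ h ∧ MapsTo h square (Metric.sphere 0 1) ∧ InjOn h square ∧
    ∀ x ∈ square, 0 < (Matrix.of
      ![(h x).ofLp, (fderiv ℝ h x (1, 0)).ofLp, (fderiv ℝ h x (0, 1)).ofLp]).det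

/-- The disk in the sphere parametrised by `h`. -/
def disk (h : ℝ × ℝ → E3) : Set S2 := {p | (p : E3) ∈ h '' square}

/-- The chart `Γ` restricted to the disk parametrised by `h` is the model chart of the piece `κ`,
where a `σ`-edge of sign `1` is oriented towards increasing time, one of sign `-1` towards
decreasing time. -/
def Chart.LooksLike (Γ : Chart) (h : ℝ × ℝ → E3) (κ : Piece) : Prop :=
  (∀ x ∈ square, ∀ p : S2, (p : E3) = h x →
    ((p ∈ Γ.vertices ↔ x ∈ κ.vertexSet) ∧ (p ∈ Γ.tauChart ↔ x ∈ κ.tauSet) ∧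
      (p ∈ Γ.carrier .sigma ↔ ∃ a ∈ κ.sigmaArc, x ∈ a.2 '' Icc 0 1))) ∧
  ∀ a ∈ κ.sigmaArc, ∃ e, Γ.label e = .sigma ∧ ∃ θ : ℝ → ℝ,
    ContinuousOn θ (Icc 0 1) ∧ StrictMonoOn θ (Icc 0 1) ∧
    (Γ.circle e ∨ MapsTo θ (Icc 0 1) (Icc 0 1)) ∧
    ∀ t ∈ Icc (0 : ℝ) 1,
      (Γ.path e (θ t) : E3) = h (a.2 (if a.1 = 1 then t else 1 - t))

/-! ### Knitted surfaces of degree 2 and their plat closures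

Surfaces are subsets of `D² × S²`, where `D²` is the closed unit disk of the complex plane. -/

/-- `S` is built from the chart `Γ` over the set `B`: the set `B` is decomposed into finitely many
disks, identified with the square, that have disjoint interiors and meet each other in finitely
many points and arcs; `Γ` restricted to each disk is one of the model charts, and `S` is the union
of the corresponding model surfaces. -/
def IsBuiltFrom (B : Set S2) (Γ : Chart) (S : Set (ℂ × S2)) : Prop :=
  ∃ (n : ℕ) (h : Fin n → ℝ × ℝ → E3) (κ : Fin n → Piece),
    (∀ k, IsSquareChart (h k)) ∧
    (⋃ k, disk (h k)) = B ∧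
    (∀ k l, k ≠ l → ∀ x ∈ openSquare, h k x ∉ h l '' square) ∧
    (∀ k l, Finite (ConnectedComponents ↥(disk (h k) ∩ disk (h l)))) ∧
    (∀ k, Γ.LooksLike (h k) (κ k)) ∧
    (∀ q ∈ S, q.2 ∈ B) ∧
    ∀ k, ∀ x ∈ square, ∀ p : S2, (p : E3) = h k x →
      ∀ z : ℂ, (z, p) ∈ S ↔ z ∈ (κ k).fibre x

/-- `S` and `S'` are related by a smooth ambient isotopy of `D² × S²`, fixing the boundary, that
preserves each fibre of the projection to `S²`. -/
def Equivalent (S S' : Set (ℂ × S2)) : Prop :=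
  ∃ Φ Ψ : ℝ → ℂ → E3 → ℂ,
    ContDiff ℝ ∞ (fun q : ℝ × ℂ × E3 => Φ q.1 q.2.1 q.2.2) ∧
    ContDiff ℝ ∞ (fun q : ℝ × ℂ × E3 => Ψ q.1 q.2.1 q.2.2) ∧
    (∀ p : S2, ∀ t z, Ψ t (Φ t z p) p = z ∧ Φ t (Ψ t z p) p = z) ∧
    (∀ p : S2, ∀ z, Φ 0 z p = z) ∧
    (∀ p : S2, ∀ t z, 1 ≤ ‖z‖ → Φ t z p = z) ∧
    S' = (fun q : ℂ × S2 => (Φ 1 q.1 q.2, q.2)) '' S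

/-- `S` is a knitted surface of degree 2 over `B` whose chart is `Γ` (restricted to `B`). -/
def IsKnittedSurface (B : Set S2) (Γ : Chart) (S : Set (ℂ × S2)) : Prop :=
  ∃ S₀, IsBuiltFrom B Γ S₀ ∧ Equivalent S₀ S

/-- The fibre of `S` over `p`. -/
def fibre (S : Set (ℂ × S2)) (p : S2) : Set ℂ := {z | (z, p) ∈ S}

/-- `P` is the plat closure of the surface `S` over the compact surface `M ⊆ S²`, where `S` restricts
to a closed 2-braid over each boundary circle of `M`. Outside `M` a collar `c` of the boundary is
attached to `M`. Over the collar line that starts at the boundary point `x`, the surface `P` is the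
semicircle (wicket) that joins the two points of `S` over `x` and meets the fibre of `x`
orthogonally. -/
def IsPlatClosure (M : Set S2) (S P : Set (ℂ × S2)) : Prop :=
  (∀ x ∈ frontier M, ∃ z₁ z₂, z₁ ≠ z₂ ∧ fibre S x = {z₁, z₂}) ∧
  ∃ c : S2 → ℝ → S2,
    ContinuousOn (fun q : S2 × ℝ => c q.1 q.2) (frontier M ×ˢ Icc 0 1) ∧
    InjOn (fun q : S2 × ℝ => c q.1 q.2) (frontier M ×ˢ Icc 0 1) ∧
    (∀ x ∈ frontier M, c x 0 = x) ∧
    (∀ x ∈ frontier M, ∀ s ∈ Ioc (0 : ℝ) 1, c x s ∉ M) ∧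
    P = S ∪ {q | ∃ x ∈ frontier M, ∃ s ∈ Icc (0 : ℝ) 1, ∃ (z₁ z₂ : ℂ) (r : ℝ),
      fibre S x = {z₁, z₂} ∧ r ^ 2 + s ^ 2 = 1 ∧
      q = ((z₁ + z₂) / 2 + r * ((z₁ - z₂) / 2), c x s)}

/-- `N` is a regular neighbourhood of `G` in the sphere: a compact neighbourhood that is the mapping
cylinder of a map from its frontier to `G`. -/
def IsRegularNhd (G N : Set S2) : Prop :=
  IsCompact N ∧ G ⊆ interior N ∧
  ∃ r : S2 → ℝ → S2,
    ContinuousOn (fun q : S2 × ℝ => r q.1 q.2) (frontier N ×ˢ Icc 0 1) ∧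
    (∀ x ∈ frontier N, r x 0 = x) ∧
    BijOn (fun q : S2 × ℝ => r q.1 q.2) (frontier N ×ˢ Ico 0 1) (N \ G) ∧
    MapsTo (fun x => r x 1) (frontier N) G

/-- The region `R` with the neighbourhood `N` of the `τ`-chart removed. -/
def trim (R N : Set S2) : Set S2 := closure (R ∩ Nᶜ)

/-- The part of `F` over the set `R`. -/
def part (F : Set (ℂ × S2)) (R : Set S2) : Set (ℂ × S2) := {q ∈ F | q.2 ∈ R}

/-! ### Surfaces in 4-space -/

/-- The standard embedding of `D² × S²` in Euclidean 4-space, as a tubular neighbourhood of the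
standard 2-sphere. -/
def toE4 (q : ℂ × S2) : E4 :=
  !₂[(1 + q.1.re / 2) * (q.2 : E3) 0, (1 + q.1.re / 2) * (q.2 : E3) 1,
    (1 + q.1.re / 2) * (q.2 : E3) 2, q.1.im / 2]

/-- The union of the sets `X j` is a split union of the `X j`: a smooth ambient isotopy of 4-space
moves them into pairwise disjoint round balls. -/
def IsSplitUnion {J : Type} (X : J → Set E4) : Prop :=
  ∃ H K : ℝ → E4 → E4,
    ContDiff ℝ ∞ (fun q : ℝ × E4 => H q.1 q.2) ∧
    ContDiff ℝ ∞ (fun q : ℝ × E4 => K q.1 q.2) ∧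
    (∀ t y, K t (H t y) = y ∧ H t (K t y) = y) ∧
    (∀ y, H 0 y = y) ∧
    ∃ (c : J → E4) (r : J → ℝ),
      (∀ j, MapsTo (H 1) (X j) (Metric.closedBall (c j) (r j))) ∧
      Pairwise fun i j => Disjoint (Metric.closedBall (c i) (r i)) (Metric.closedBall (c j) (r j))

/-! ### Euler characteristic -/

/-- The Euler characteristic of `Y` is `n`: the space `Y` has the homotopy type of a finite CW
complex for which the alternating sum of the numbers of cells is `n`. -/
def HasEulerChar (Y : Type) [TopologicalSpace Y] (n : ℤ) : Prop :=
  ∃ (X : Type) (_ : TopologicalSpace X) (_ : T2Space X) (C : Set X)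
    (_ : Topology.CWComplex C) (_ : Topology.RelCWComplex.Finite C),
    Nonempty (ContinuousMap.HomotopyEquiv Y C) ∧
    n = ∑ᶠ k : ℕ, (-1) ^ k * (Nat.card (Topology.RelCWComplex.cell C k) : ℤ)

end Knit

end

noncomputable section

namespace Knit

open Filter Topology

/-! ### Finite cell decompositions -/

/-! Except at a black `σ`-vertex, the fibre of a model piece is `pair g u`: the opposite points `±
√((1 - 2g)/4) · u`, where `g` is `Piece.gapFun` and `u` a unit complex number. The gap `g` is 1 on
the `τ`-chart, so the fibres there are empty and the surface splits into its parts over the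
components `U` of the complement of the `τ`-chart. The supports of these parts in the sphere are
disjoint compact sets. The cones over them in 3-space are disjoint as well, and a shear along the
fourth coordinate, by a smooth amount that is constant on each cone, moves the parts into disjoint
balls (`isSplitUnion_of_disjoint`).

For the plat closure, the open set `g > 0` is filled by arcs that run from its border `g = 0` to the
`τ`-chart. Along each arc `g` increases strictly and `u` is constant up to sign as long as there are
sheets. Substituting `g = s ^ 2 / 2` turns the fibre into `± (r / 2) u` with `r ^ 2 + s ^ 2 = 1`, so
over each arc the surface is exactly a wicket. In every model square the arcs are arranged in
finitely many sectors (`exists_sectors`). Away from the `τ`-chart the ends of sectors lie on open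
sides of the squares, and a point on an open side of one disk lies on open sides of at most one
other (`Tiling.no_three`). Hence the ends are glued in pairs and the parameters can be made to agree
(`Tiling.exists_glued`). The sectors together form a regular neighbourhood (`Glued.isRegularNhd_N`).
The trimmed region is the set of points of `U` with zero gap; it is tiled by rectangles that carry
pieces without `τ`-edges (`Tiling.isBuiltFrom`), and the wickets complete the surface to a plat
closure (`Glued.isPlatClosure`).

For the Euler characteristic, the surface over the trimmed region is a double cover branched at the
black `σ`-vertices, so counting cells gives twice the Euler characteristic of the region minus the
number of branch points. The wickets over a sector form one extra 2-cell, and each glued pair of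
sector ends gives one extra 1-cell; there are as many pairs as sectors, so these cancel
(`exists_eulerChar`, `Glued.exists_hasEulerChar`). For an arbitrary regular neighbourhood, `U`
deformation retracts onto the trimmed region along the lines of the mapping cylinder, so all trimmed
regions of `U` are homotopy equivalent (`HasEulerChar.trim`). -/

lemma continuousOn_invFunOn_of_isCompact {A X : Type*} [TopologicalSpace A] [Nonempty A]
    [TopologicalSpace X] [T2Space X] {f : A → X} {K B : Set A} (hK : IsCompact K)
    (hf : ContinuousOn f K) (hBK : B ⊆ K) (hinj : InjOn f B)
    (hdisj : ∀ x ∈ B, ∀ y ∈ K, f x = f y → y ∈ B) :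
    ContinuousOn (Function.invFunOn f B) (f '' B) := by
  rw [continuousOn_iff_isClosed]
  intro t ht
  -- The preimage of a closed `t` under the inverse is the trace of this compact set on `f '' B`.
  -- `B` need not be closed, because `hdisj` makes it saturated in `K`.
  refine ⟨f '' (K ∩ t), ((hK.inter_right ht).image_of_continuousOn
    (hf.mono inter_subset_left)).isClosed, ?_⟩
  ext y
  constructor
  · rintro ⟨hy, x, hx, rfl⟩
    refine ⟨⟨x, ⟨hBK hx, ?_⟩, rfl⟩, mem_image_of_mem _ hx⟩
    have := Function.invFunOn_apply_eq (f := f) hx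
    have h2 := Function.invFunOn_mem (f := f) (s := B) (b := f x) ⟨x, hx, rfl⟩
    rw [← hinj h2 hx this]; exact hy
  · rintro ⟨⟨z, ⟨hzK, hzt⟩, hz⟩, x, hx, rfl⟩
    refine ⟨?_, mem_image_of_mem _ hx⟩
    have hzB : z ∈ B := hdisj x hx z hzK hz.symm
    have := Function.invFunOn_apply_eq (f := f) hx
    have h2 := Function.invFunOn_mem (f := f) (s := B) (b := f x) ⟨x, hx, rfl⟩
    have : Function.invFunOn f B (f x) = z := hinj h2 hzB (this.trans hz.symm)
    rw [mem_preimage, this]; exact hzt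

/-- The closed unit balls of the sup norm serve as closed cells. `hself` supplies the saturation
that makes the inverse continuous on an open cell. -/
lemma hasEulerChar_of_cubes {X : Type} [TopologicalSpace X] [T2Space X] (C : Set X)
    (cell : ℕ → Type) [hfin : ∀ n, Finite (cell n)] (hempty : ∀ n, 3 ≤ n → IsEmpty (cell n))
    (φ : ∀ n, cell n → (Fin n → ℝ) → X)
    (hcont : ∀ n i, ContinuousOn (φ n i) (Metric.closedBall 0 1))
    (hinj : ∀ n i, InjOn (φ n i) (Metric.ball 0 1))
    (hdisj : ∀ n i m j, (⟨n, i⟩ : Σ n, cell n) ≠ ⟨m, j⟩ → ∀ x ∈ Metric.ball (0 : Fin n → ℝ) 1,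
      ∀ y ∈ Metric.ball (0 : Fin m → ℝ) 1, φ n i x ≠ φ m j y)
    (hself : ∀ n i, ∀ x ∈ Metric.ball (0 : Fin n → ℝ) 1,
      ∀ y ∈ Metric.sphere (0 : Fin n → ℝ) 1, φ n i x ≠ φ n i y)
    (hbd : ∀ n i, MapsTo (φ n i) (Metric.sphere 0 1)
      (⋃ (m < n) (j : cell m), φ m j '' Metric.closedBall 0 1))
    (hun : ⋃ (n : ℕ) (j : cell n), φ n j '' Metric.closedBall 0 1 = C) :
    HasEulerChar C (Nat.card (cell 0) - Nat.card (cell 1) + Nat.card (cell 2)) := by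
  let pe : ∀ n, cell n → PartialEquiv (Fin n → ℝ) X := fun n i => (hinj n i).toPartialEquiv _ _
  have h1 : ∀ n i, (pe n i).source = Metric.ball 0 1 := fun n i => rfl
  have h2 : ∀ n i, ContinuousOn (pe n i) (Metric.closedBall 0 1) := hcont
  have h3 : ∀ n i, ContinuousOn (pe n i).symm (pe n i).target := by
    intro n i
    refine continuousOn_invFunOn_of_isCompact (isCompact_closedBall 0 1) (hcont n i)
      Metric.ball_subset_closedBall (hinj n i) ?_
    intro x hx y hy hxy
    rcases (Metric.mem_closedBall.1 hy).lt_or_eq with h | h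
    · exact h
    · exact absurd hxy (hself n i x hx y h)
  have h4 : (univ : Set (Σ n, cell n)).PairwiseDisjoint
      (fun ni ↦ pe ni.1 ni.2 '' Metric.ball 0 1) := by
    rintro ⟨n, i⟩ - ⟨m, j⟩ - hne
    rw [Function.onFun, Set.disjoint_left]
    rintro _ ⟨x, hx, rfl⟩ ⟨y, hy, h⟩
    exact hdisj n i m j hne x hx y hy h.symm
  have h0 : ∀ᶠ n in Filter.atTop, IsEmpty (cell n) :=
    Filter.eventually_atTop.2 ⟨3, hempty⟩
  let cw := Topology.CWComplex.mkFinite C cell pe h0 hfin h1 h2 h3 h4 hbd hun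
  have hcwf := Topology.CWComplex.finite_mkFinite C cell pe h0 hfin h1 h2 h3 h4 hbd hun
  refine ⟨X, inferInstance, inferInstance, C, cw, hcwf,
    ⟨ContinuousMap.HomotopyEquiv.refl _⟩, ?_⟩
  have hcell : ∀ k, Topology.RelCWComplex.cell C k = cell k := fun k => rfl
  rw [finsum_eq_sum_of_support_subset (s := Finset.range 3)]
  · simp only [Finset.sum_range_succ, hcell]
    simp; ring
  · intro k hk
    by_contra hk'
    have : 3 ≤ k := by simpa using hk'
    have := hempty k this
    apply hk
    simp only [hcell, Nat.card_of_isEmpty]; simp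

lemma mem_ball_fin_one {x : Fin 1 → ℝ} : x ∈ Metric.ball (0 : Fin 1 → ℝ) 1 ↔
    (x 0 + 1) / 2 ∈ Ioo (0 : ℝ) 1 := by
  rw [mem_ball_zero_iff, pi_norm_lt_iff one_pos]
  simp only [Fin.forall_fin_one, Real.norm_eq_abs, abs_lt, mem_Ioo]
  constructor <;> rintro ⟨h1, h2⟩ <;> constructor <;> linarith

lemma mem_closedBall_fin_one {x : Fin 1 → ℝ} : x ∈ Metric.closedBall (0 : Fin 1 → ℝ) 1 ↔
    (x 0 + 1) / 2 ∈ Icc (0 : ℝ) 1 := by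
  rw [mem_closedBall_zero_iff, pi_norm_le_iff_of_nonneg zero_le_one]
  simp only [Fin.forall_fin_one, Real.norm_eq_abs, abs_le, mem_Icc]
  constructor <;> rintro ⟨h1, h2⟩ <;> constructor <;> linarith

lemma mem_ball_fin_two {x : Fin 2 → ℝ} : x ∈ Metric.ball (0 : Fin 2 → ℝ) 1 ↔
    ((x 0 + 1) / 2, (x 1 + 1) / 2) ∈ openSquare := by
  rw [mem_ball_zero_iff, pi_norm_lt_iff one_pos]
  simp only [Fin.forall_fin_two, Real.norm_eq_abs, abs_lt, mem_Ioo, openSquare, mem_prod]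
  constructor <;> rintro ⟨⟨h1, h2⟩, h3, h4⟩ <;> refine ⟨⟨?_, ?_⟩, ?_, ?_⟩ <;> linarith

lemma mem_closedBall_fin_two {x : Fin 2 → ℝ} : x ∈ Metric.closedBall (0 : Fin 2 → ℝ) 1 ↔
    ((x 0 + 1) / 2, (x 1 + 1) / 2) ∈ square := by
  rw [mem_closedBall_zero_iff, pi_norm_le_iff_of_nonneg zero_le_one]
  simp only [Fin.forall_fin_two, Real.norm_eq_abs, abs_le, mem_Icc, square, mem_prod]
  constructor <;> rintro ⟨⟨h1, h2⟩, h3, h4⟩ <;> refine ⟨⟨?_, ?_⟩, ?_, ?_⟩ <;> linarith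

lemma isCompact_square : IsCompact square := isCompact_Icc.prod isCompact_Icc

lemma openSquare_subset : openSquare ⊆ square := prod_mono Ioo_subset_Icc_self Ioo_subset_Icc_self

/-- The Euler characteristic of a Hausdorff space that is decomposed into finitely many cells of
dimension at most two. -/
lemma hasEulerChar_of_cells {X : Type} [TopologicalSpace X] [T2Space X] (C : Set X)
    {I₀ I₁ I₂ : Type} [Finite I₀] [Finite I₁] [Finite I₂]
    (v : I₀ → X) (e : I₁ → ℝ → X) (f : I₂ → ℝ × ℝ → X) (hv : Function.Injective v)
    (hec : ∀ i, ContinuousOn (e i) (Icc 0 1))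
    (hei : ∀ i j, ∀ s ∈ Ioo (0 : ℝ) 1, ∀ t ∈ Ioo (0 : ℝ) 1, e i s = e j t → i = j ∧ s = t)
    (hev : ∀ i, ∀ t ∈ Ioo (0 : ℝ) 1, e i t ∉ range v)
    (heb : ∀ i, e i 0 ∈ range v ∧ e i 1 ∈ range v)
    (hfc : ∀ i, ContinuousOn (f i) square)
    (hfi : ∀ i j, ∀ x ∈ openSquare, ∀ y ∈ openSquare, f i x = f j y → i = j ∧ x = y)
    (hfv : ∀ i, ∀ x ∈ openSquare, f i x ∉ range v)
    (hfe : ∀ i, ∀ x ∈ openSquare, ∀ j, ∀ t ∈ Icc (0 : ℝ) 1, f i x ≠ e j t)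
    (hfb : ∀ i, ∀ x ∈ square, x ∉ openSquare →
      f i x ∈ range v ∨ ∃ j, ∃ t ∈ Icc (0 : ℝ) 1, f i x = e j t)
    (hvC : ∀ i, v i ∈ C) (heC : ∀ i, ∀ t ∈ Icc (0 : ℝ) 1, e i t ∈ C)
    (hfC : ∀ i, ∀ x ∈ square, f i x ∈ C)
    (hC : ∀ p ∈ C, p ∈ range v ∨ (∃ j, ∃ t ∈ Icc (0 : ℝ) 1, p = e j t) ∨
      ∃ i, ∃ x ∈ square, p = f i x) :
    HasEulerChar C (Nat.card I₀ - Nat.card I₁ + Nat.card I₂) := by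
  let cell : ℕ → Type := fun n => match n with
    | 0 => I₀ | 1 => I₁ | 2 => I₂ | _ + 3 => PEmpty
  let φ : ∀ n, cell n → (Fin n → ℝ) → X := fun n => match n with
    | 0 => fun i _ => v i
    | 1 => fun i x => e i ((x 0 + 1) / 2)
    | 2 => fun i x => f i ((x 0 + 1) / 2, (x 1 + 1) / 2)
    | _ + 3 => fun i => i.elim
  have hfin : ∀ n, Finite (cell n) := by
    intro n
    match n with
    | 0 => exact ‹Finite I₀›
    | 1 => exact ‹Finite I₁›
    | 2 => exact ‹Finite I₂›
    | _ + 3 => exact inferInstanceAs (Finite PEmpty)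
  have hempty : ∀ n, 3 ≤ n → IsEmpty (cell n) := by
    intro n hn
    match n, hn with
    | _ + 3, _ => exact inferInstanceAs (IsEmpty PEmpty)
  have img1 : ∀ (i : I₁) (t : ℝ), t ∈ Icc (0 : ℝ) 1 →
      e i t ∈ φ 1 i '' Metric.closedBall 0 1 := by
    intro i t ht
    have h1 : ((2 * t - 1) + 1) / 2 = t := by ring
    refine ⟨fun _ => 2 * t - 1, mem_closedBall_fin_one.2 ?_, ?_⟩
    · simp only [h1]; exact ht
    · change e i (((2 * t - 1) + 1) / 2) = _
      rw [h1]
  have img2 : ∀ (i : I₂) (x : ℝ × ℝ), x ∈ square →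
      f i x ∈ φ 2 i '' Metric.closedBall 0 1 := by
    intro i x hx
    have h1 : ∀ t : ℝ, ((2 * t - 1) + 1) / 2 = t := by intro t; ring
    refine ⟨![2 * x.1 - 1, 2 * x.2 - 1], mem_closedBall_fin_two.2 ?_, ?_⟩
    · simpa only [Matrix.cons_val_zero, Matrix.cons_val_one, h1] using hx
    · change f i (((2 * x.1 - 1) + 1) / 2, ((2 * x.2 - 1) + 1) / 2) = _
      rw [h1, h1]
  have img0 : ∀ (i : I₀), v i ∈ φ 0 i '' Metric.closedBall 0 1 := by
    intro i
    exact ⟨0, by simp, rfl⟩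
  have sph1 : ∀ x : Fin 1 → ℝ, x ∈ Metric.sphere (0 : Fin 1 → ℝ) 1 →
      (x 0 + 1) / 2 = 0 ∨ (x 0 + 1) / 2 = 1 := by
    intro x hx
    have h1 := mem_closedBall_fin_one.1 (Metric.sphere_subset_closedBall hx)
    have h2 : ¬ (x 0 + 1) / 2 ∈ Ioo (0 : ℝ) 1 := by
      rw [← mem_ball_fin_one]
      intro h
      exact (Metric.mem_ball.1 h).ne (Metric.mem_sphere.1 hx)
    rcases h1.1.eq_or_lt with h | h
    · exact Or.inl h.symm
    · rcases h1.2.eq_or_lt with h' | h'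
      · exact Or.inr h'
      · exact absurd ⟨h, h'⟩ h2
  have sph2 : ∀ x : Fin 2 → ℝ, x ∈ Metric.sphere (0 : Fin 2 → ℝ) 1 →
      ((x 0 + 1) / 2, (x 1 + 1) / 2) ∈ square ∧ ((x 0 + 1) / 2, (x 1 + 1) / 2) ∉ openSquare := by
    intro x hx
    refine ⟨mem_closedBall_fin_two.1 (Metric.sphere_subset_closedBall hx), ?_⟩
    rw [← mem_ball_fin_two]
    intro h
    exact (Metric.mem_ball.1 h).ne (Metric.mem_sphere.1 hx)
  refine hasEulerChar_of_cubes C cell hempty φ ?_ ?_ ?_ ?_ ?_ ?_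
  · intro n i
    match n, i with
    | 0, i => exact continuousOn_const
    | 1, i =>
      refine (hec i).comp (f := fun x : Fin 1 → ℝ => (x 0 + 1) / 2) (by fun_prop) ?_
      intro x hx; exact mem_closedBall_fin_one.1 hx
    | 2, i =>
      refine (hfc i).comp (f := fun x : Fin 2 → ℝ => ((x 0 + 1) / 2, (x 1 + 1) / 2))
        (by fun_prop) ?_
      intro x hx; exact mem_closedBall_fin_two.1 hx
    | _ + 3, i => exact i.elim
  · intro n i
    match n, i with
    | 0, i => intro x _ y _ _; exact Subsingleton.elim _ _
    | 1, i =>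
      intro x hx y hy h
      have := (hei i i _ (mem_ball_fin_one.1 hx) _ (mem_ball_fin_one.1 hy) h).2
      funext k; fin_cases k; simpa using this
    | 2, i =>
      intro x hx y hy h
      have := (hfi i i _ (mem_ball_fin_two.1 hx) _ (mem_ball_fin_two.1 hy) h).2
      simp only [Prod.mk.injEq] at this
      funext k; fin_cases k
      · simpa using this.1
      · simpa using this.2
    | _ + 3, i => exact i.elim
  · intro n i m j hne x hx y hy h
    match n, i, m, j with
    | 0, i, 0, j => exact hne (by rw [hv h])
    | 0, i, 1, j => exact hev j _ (mem_ball_fin_one.1 hy) ⟨i, h⟩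
    | 0, i, 2, j => exact hfv j _ (mem_ball_fin_two.1 hy) ⟨i, h⟩
    | 1, i, 0, j => exact hev i _ (mem_ball_fin_one.1 hx) ⟨j, h.symm⟩
    | 1, i, 1, j =>
      exact hne (by rw [(hei i j _ (mem_ball_fin_one.1 hx) _ (mem_ball_fin_one.1 hy) h).1])
    | 1, i, 2, j =>
      exact hfe j _ (mem_ball_fin_two.1 hy) i _
        (Ioo_subset_Icc_self (mem_ball_fin_one.1 hx)) h.symm
    | 2, i, 0, j => exact hfv i _ (mem_ball_fin_two.1 hx) ⟨j, h.symm⟩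
    | 2, i, 1, j =>
      exact hfe i _ (mem_ball_fin_two.1 hx) j _ (Ioo_subset_Icc_self (mem_ball_fin_one.1 hy)) h
    | 2, i, 2, j =>
      exact hne (by rw [(hfi i j _ (mem_ball_fin_two.1 hx) _ (mem_ball_fin_two.1 hy) h).1])
    | _ + 3, i, _, _ => exact i.elim
    | _, _, _ + 3, j => exact j.elim
  · intro n i x hx y hy h
    match n, i with
    | 0, i =>
      rw [Metric.mem_sphere, Subsingleton.elim y 0, dist_self] at hy
      exact absurd hy zero_ne_one
    | 1, i =>
      rcases sph1 y hy with h' | h'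
      · have h2 : φ 1 i y = e i 0 := by change e i ((y 0 + 1) / 2) = _; rw [h']
        exact hev i _ (mem_ball_fin_one.1 hx) (by have := (heb i).1; rwa [← h2, ← h] at this)
      · have h2 : φ 1 i y = e i 1 := by change e i ((y 0 + 1) / 2) = _; rw [h']
        exact hev i _ (mem_ball_fin_one.1 hx) (by have := (heb i).2; rwa [← h2, ← h] at this)
    | 2, i =>
      obtain ⟨h1, h2⟩ := sph2 y hy
      rcases hfb i _ h1 h2 with h3 | ⟨j, t, ht, h3⟩
      · exact hfv i _ (mem_ball_fin_two.1 hx) (by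
          have h5 : f i ((x 0 + 1) / 2, (x 1 + 1) / 2) = f i ((y 0 + 1) / 2, (y 1 + 1) / 2) := h
          rw [h5]; exact h3)
      · exact hfe i _ (mem_ball_fin_two.1 hx) j t ht (h.trans h3)
    | _ + 3, i => exact i.elim
  · intro n i y hy
    match n, i with
    | 0, i =>
      rw [Metric.mem_sphere, Subsingleton.elim y 0, dist_self] at hy
      exact absurd hy zero_ne_one
    | 1, i =>
      have : φ 1 i y ∈ range v := by
        rcases sph1 y hy with h' | h'
        · have h2 : φ 1 i y = e i 0 := by change e i ((y 0 + 1) / 2) = _; rw [h']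
          rw [h2]; exact (heb i).1
        · have h2 : φ 1 i y = e i 1 := by change e i ((y 0 + 1) / 2) = _; rw [h']
          rw [h2]; exact (heb i).2
      obtain ⟨k, hk⟩ := this
      rw [← hk]
      exact mem_iUnion₂.2 ⟨0, one_pos, mem_iUnion.2 ⟨k, img0 k⟩⟩
    | 2, i =>
      obtain ⟨h1, h2⟩ := sph2 y hy
      rcases hfb i _ h1 h2 with ⟨k, hk⟩ | ⟨j, t, ht, h3⟩
      · change f i _ ∈ _
        rw [← hk]
        exact mem_iUnion₂.2 ⟨0, two_pos, mem_iUnion.2 ⟨k, img0 k⟩⟩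
      · change f i _ ∈ _
        rw [h3]
        exact mem_iUnion₂.2 ⟨1, one_lt_two, mem_iUnion.2 ⟨j, img1 j t ht⟩⟩
    | _ + 3, i => exact i.elim
  · ext p
    simp only [mem_iUnion]
    constructor
    · rintro ⟨n, i, x, hx, rfl⟩
      match n, i with
      | 0, i => exact hvC i
      | 1, i => exact heC i _ (mem_closedBall_fin_one.1 hx)
      | 2, i => exact hfC i _ (mem_closedBall_fin_two.1 hx)
      | _ + 3, i => exact i.elim
    · intro hp
      rcases hC p hp with ⟨i, rfl⟩ | ⟨j, t, ht, rfl⟩ | ⟨i, x, hx, rfl⟩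
      · exact ⟨0, i, img0 i⟩
      · exact ⟨1, j, img1 j t ht⟩
      · exact ⟨2, i, img2 i x hx⟩

/-! ### Sets with finitely many components in the boundary of the square -/

/-- A set that is a finite union of preconnected sets. -/
def IsPieced {X : Type*} [TopologicalSpace X] (K : Set X) : Prop :=
  ∃ F : Set (Set X), F.Finite ∧ (∀ c ∈ F, IsPreconnected c) ∧ ⋃₀ F = K

lemma isPieced_of_finite_connectedComponents {X : Type*} [TopologicalSpace X] {K : Set X}
    (h : Finite (ConnectedComponents K)) : IsPieced K := by
  refine ⟨range fun c : ConnectedComponents K =>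
    (Subtype.val '' ((↑) ⁻¹' {c} : Set K)), finite_range _, ?_, ?_⟩
  · rintro _ ⟨c, rfl⟩
    obtain ⟨x, rfl⟩ := ConnectedComponents.surjective_coe c
    change IsPreconnected (Subtype.val '' (ConnectedComponents.mk ⁻¹' {ConnectedComponents.mk x}))
    rw [connectedComponents_preimage_singleton]
    exact isPreconnected_connectedComponent.image _ continuous_subtype_val.continuousOn
  · ext x
    simp only [sUnion_range, mem_iUnion, mem_image, mem_preimage, mem_singleton_iff, Subtype.exists]
    constructor
    · rintro ⟨c, y, hy, -, rfl⟩; exact hy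
    · intro hx; exact ⟨_, x, hx, rfl, rfl⟩

/-- Each preconnected piece lies in a single component, so choosing a piece through a point of each
component is an injective choice. -/
lemma IsPieced.finite_connectedComponents {X : Type*} [TopologicalSpace X] {K : Set X}
    (h : IsPieced K) : Finite (ConnectedComponents K) := by
  obtain ⟨F, hF, hc, rfl⟩ := h
  have : ∀ c : ConnectedComponents ↥(⋃₀ F), ∃ s : F, ∃ x : ↥(⋃₀ F), (x : X) ∈ s.1 ∧ (x : _) = c := by
    intro c
    obtain ⟨x, rfl⟩ := ConnectedComponents.surjective_coe c
    obtain ⟨s, hs, hx⟩ := x.2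
    exact ⟨⟨s, hs⟩, x, hx, rfl⟩
  choose g y hy hg using this
  have := hF.to_subtype
  refine Finite.of_injective g fun c d hcd => ?_
  rw [← hg c, ← hg d, ConnectedComponents.coe_eq_coe']
  have hpre : IsPreconnected (Subtype.val ⁻¹' (g c).1 : Set ↥(⋃₀ F)) := by
    rw [← Topology.IsInducing.subtypeVal.isPreconnected_image, Subtype.image_preimage_coe,
      inter_eq_right.2 (subset_sUnion_of_mem (g c).2)]
    exact hc _ (g c).2
  exact hpre.subset_connectedComponent (by rw [mem_preimage, hcd]; exact hy d) (hy c)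

lemma IsPieced.image {X Y : Type*} [TopologicalSpace X] [TopologicalSpace Y] {K : Set X}
    (h : IsPieced K) {f : X → Y} (hf : ContinuousOn f K) : IsPieced (f '' K) := by
  obtain ⟨F, hF, hc, rfl⟩ := h
  refine ⟨(f '' ·) '' F, hF.image _, ?_, ?_⟩
  · rintro _ ⟨c, hcF, rfl⟩
    exact (hc c hcF).image _ (hf.mono (subset_sUnion_of_mem hcF))
  · rw [sUnion_image, sUnion_eq_biUnion, image_iUnion₂]

lemma isPieced_iUnion {X ι : Type*} [TopologicalSpace X] [Finite ι] {K : ι → Set X}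
    (h : ∀ i, IsPieced (K i)) : IsPieced (⋃ i, K i) := by
  choose F hF hc hK using h
  refine ⟨⋃ i, F i, finite_iUnion hF, ?_, ?_⟩
  · intro c hc'
    obtain ⟨i, hi⟩ := mem_iUnion.1 hc'
    exact hc i c hi
  · rw [sUnion_iUnion]; exact iUnion_congr hK

lemma finite_frontier_of_ordConnected {s : Set ℝ} (h : s.OrdConnected) : (frontier s).Finite := by
  have := (isPreconnected_iff_ordConnected.2 h).mem_intervals
  simp only [mem_insert_iff, mem_singleton_iff] at this
  have key : ∀ a b : ℝ, frontier s ⊆ {a, b} → (frontier s).Finite := fun a b hab =>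
    (toFinite {a, b}).subset hab
  rcases this with h | h | h | h | h | h | h | h | h | h
  · by_cases hle : sInf s ≤ sSup s
    · rw [h, frontier_Icc hle]; exact toFinite _
    · rw [h, Icc_eq_empty hle]; simp
  · by_cases hle : sInf s < sSup s
    · rw [h, frontier_Ico hle]; exact toFinite _
    · rw [h, Ico_eq_empty hle]; simp
  · by_cases hle : sInf s < sSup s
    · rw [h, frontier_Ioc hle]; exact toFinite _
    · rw [h, Ioc_eq_empty hle]; simp
  · by_cases hle : sInf s < sSup s
    · rw [h, frontier_Ioo hle]; exact toFinite _
    · rw [h, Ioo_eq_empty hle]; simp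
  · rw [h, frontier_Ici]; exact toFinite _
  · rw [h, frontier_Ioi]; exact toFinite _
  · rw [h, frontier_Iic]; exact toFinite _
  · rw [h, frontier_Iio]; exact toFinite _
  · rw [h]; simp
  · rw [h]; simp

/-- The four sides of the square. -/
def side : Fin 4 → ℝ → ℝ × ℝ
  | 0, t => (t, 0)
  | 1, t => (t, 1)
  | 2, t => (0, t)
  | 3, t => (1, t)

/-- The coordinate along a side. -/
def along : Fin 4 → ℝ × ℝ → ℝ
  | 0, x => x.1
  | 1, x => x.1
  | 2, x => x.2
  | 3, x => x.2

/-- The distance from a side. -/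
def depth : Fin 4 → ℝ × ℝ → ℝ
  | 0, x => x.2
  | 1, x => 1 - x.2
  | 2, x => x.1
  | 3, x => 1 - x.1

lemma fin_four_cases (d : Fin 4) : d = 0 ∨ d = 1 ∨ d = 2 ∨ d = 3 := by
  fin_cases d <;> simp

lemma continuous_side (d : Fin 4) : Continuous (side d) := by
  rcases fin_four_cases d with rfl | rfl | rfl | rfl <;> unfold side <;> fun_prop

lemma continuous_along (d : Fin 4) : Continuous (along d) := by
  rcases fin_four_cases d with rfl | rfl | rfl | rfl <;> unfold along <;> fun_prop

lemma continuous_depth (d : Fin 4) : Continuous (depth d) := by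
  rcases fin_four_cases d with rfl | rfl | rfl | rfl <;> unfold depth <;> fun_prop

lemma along_side (d : Fin 4) (t : ℝ) : along d (side d t) = t := by
  rcases fin_four_cases d with rfl | rfl | rfl | rfl <;> rfl

lemma depth_side (d : Fin 4) (t : ℝ) : depth d (side d t) = 0 := by
  rcases fin_four_cases d with rfl | rfl | rfl | rfl <;> simp [depth, side]

lemma eq_side_of_depth {d : Fin 4} {x : ℝ × ℝ} (h : depth d x = 0) : x = side d (along d x) := by
  rcases fin_four_cases d with rfl | rfl | rfl | rfl <;> simp only [depth, side, along, Prod.ext_iff] at * <;> simp <;> linarith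

lemma side_mem_square (d : Fin 4) {t : ℝ} (ht : t ∈ Icc (0 : ℝ) 1) : side d t ∈ square := by
  rcases fin_four_cases d with rfl | rfl | rfl | rfl <;> simp only [side, square, mem_prod, mem_Icc] at * <;> simp [ht.1, ht.2]

lemma side_notMem_openSquare (d : Fin 4) (t : ℝ) : side d t ∉ openSquare := by
  rcases fin_four_cases d with rfl | rfl | rfl | rfl <;> simp [side, openSquare]

lemma exists_side {x : ℝ × ℝ} (hx : x ∈ square) (hx' : x ∉ openSquare) :
    ∃ d : Fin 4, ∃ t ∈ Icc (0 : ℝ) 1, x = side d t := by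
  obtain ⟨a, b⟩ := x
  simp only [square, openSquare, mem_prod, mem_Icc, mem_Ioo] at hx hx'
  obtain ⟨⟨h1, h2⟩, h3, h4⟩ := hx
  rcases h1.eq_or_lt with rfl | h1'
  · exact ⟨2, b, ⟨h3, h4⟩, rfl⟩
  rcases h2.eq_or_lt with rfl | h2'
  · exact ⟨3, b, ⟨h3, h4⟩, rfl⟩
  rcases h3.eq_or_lt with rfl | h3'
  · exact ⟨0, a, ⟨h1, h2⟩, rfl⟩
  rcases h4.eq_or_lt with rfl | h4'
  · exact ⟨1, a, ⟨h1, h2⟩, rfl⟩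
  exact absurd ⟨⟨h1', h2'⟩, h3', h4'⟩ hx'

/-- With the coordinate along side `d` strictly inside, a boundary point can only lie on this side
or on the opposite one, and the opposite one has depth 1. -/
lemma depth_eq_zero_of {d : Fin 4} {x : ℝ × ℝ} (hx : x ∈ square) (hx' : x ∉ openSquare)
    (h0 : 0 < along d x) (h1 : along d x < 1) (h2 : depth d x < 1) : depth d x = 0 := by
  obtain ⟨e, t, ht, rfl⟩ := exists_side hx hx'
  rcases fin_four_cases d with rfl | rfl | rfl | rfl <;>
    rcases fin_four_cases e with rfl | rfl | rfl | rfl <;> simp [along, depth, side] at *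

lemma depth_nonneg {d : Fin 4} {x : ℝ × ℝ} (hx : x ∈ square) : 0 ≤ depth d x := by
  simp only [square, mem_prod, mem_Icc] at hx
  rcases fin_four_cases d with rfl | rfl | rfl | rfl <;> simp only [depth] <;> linarith [hx.1.1, hx.1.2, hx.2.1, hx.2.2]

/-- A preconnected subset of the boundary of the square does not contain points of a side on both
sides of two of its gaps. -/
lemma no_alternation {C : Set (ℝ × ℝ)} (hC : IsPreconnected C) (hCs : C ⊆ square \ openSquare)
    (d : Fin 4) {u v x y : ℝ} (hu : u ∈ Icc (0 : ℝ) 1) (hv : v ∈ Icc (0 : ℝ) 1)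
    (huC : side d u ∉ C) (hvC : side d v ∉ C) (hxC : side d x ∈ C) (hyC : side d y ∈ C)
    (hux : u < x) (hxv : x < v) (hy : y < u ∨ v < y) : False := by
  -- On the boundary, removing the points at `u` and `v` disconnects the segment between them from
  -- the rest. The bound on the depth keeps the opposite side, which has the same coordinate along
  -- `d`, out of `U₁`.
  let U₁ : Set (ℝ × ℝ) := {p | u < along d p ∧ along d p < v ∧ depth d p < 1}
  let U₂ : Set (ℝ × ℝ) := {p | along d p < u ∨ v < along d p ∨ 0 < depth d p}
  have ho1 : IsOpen U₁ := (isOpen_lt continuous_const (continuous_along d)).inter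
    ((isOpen_lt (continuous_along d) continuous_const).inter
      (isOpen_lt (continuous_depth d) continuous_const))
  have ho2 : IsOpen U₂ := (isOpen_lt (continuous_along d) continuous_const).union
    ((isOpen_lt continuous_const (continuous_along d)).union
      (isOpen_lt continuous_const (continuous_depth d)))
  have hcov : C ⊆ U₁ ∪ U₂ := by
    intro p hp
    by_contra hcon
    simp only [U₁, U₂, mem_union, mem_ofPred_eq, not_or, not_lt] at hcon
    obtain ⟨h1, h2, h3, h4⟩ := hcon
    have hd : depth d p = 0 := le_antisymm h4 (depth_nonneg (hCs hp).1)
    have hp' := eq_side_of_depth hd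
    rcases h2.eq_or_lt with h | h
    · rw [← h] at hp'; exact huC (hp' ▸ hp)
    · rcases h3.eq_or_lt with h' | h'
      · rw [h'] at hp'; exact hvC (hp' ▸ hp)
      · exact h1 ⟨h, h', by rw [hd]; norm_num⟩
  obtain ⟨p, hpC, hp1, hp2⟩ := hC U₁ U₂ ho1 ho2 hcov
    ⟨_, hxC, by simp only [U₁, mem_ofPred_eq, along_side, depth_side]; exact ⟨hux, hxv, one_pos⟩⟩
    ⟨_, hyC, by simp only [U₂, mem_ofPred_eq, along_side]; tauto⟩
  have hd := depth_eq_zero_of (d := d) (hCs hpC).1 (hCs hpC).2 (by linarith [hp1.1, hu.1])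
    (by linarith [hp1.2.1, hv.2]) hp1.2.2
  rcases hp2 with h | h | h
  · exact lt_asymm h hp1.1
  · exact lt_asymm h hp1.2.1
  · exact h.ne' hd

/-- The boundary of the square is a circle, where a connected set is an arc. An arc either meets a
side in an interval or leaves out an interval of it, and in the second case two intervals remain. -/
lemma exists_ordConnected_of_side {C : Set (ℝ × ℝ)} (hC : IsPreconnected C)
    (hCs : C ⊆ square \ openSquare) (d : Fin 4) :
    ∃ J₁ J₂ : Set ℝ, J₁.OrdConnected ∧ J₂.OrdConnected ∧
      {t | t ∈ Icc (0 : ℝ) 1 ∧ side d t ∈ C} = J₁ ∪ J₂ := by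
  set A := {t | t ∈ Icc (0 : ℝ) 1 ∧ side d t ∈ C} with hA
  by_cases h : A.OrdConnected
  · exact ⟨A, ∅, h, ordConnected_empty, (union_empty _).symm⟩
  -- If neither `A` nor its complement in the side were an interval, there would be four consecutive
  -- points alternating between the two, which `no_alternation` forbids.
  have hB : (Icc (0 : ℝ) 1 \ A).OrdConnected := by
    by_contra hB
    rw [ordConnected_def] at h hB
    push Not at h hB
    obtain ⟨x, hx, y, hy, hxy⟩ := h
    obtain ⟨u, hu, v, hv, huv⟩ := hB
    obtain ⟨w, hw, hwA⟩ := not_subset.1 hxy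
    obtain ⟨z, hz, hzB⟩ := not_subset.1 huv
    have hw01 : w ∈ Icc (0 : ℝ) 1 := ⟨hx.1.1.trans hw.1, hw.2.trans hy.1.2⟩
    have hz01 : z ∈ Icc (0 : ℝ) 1 := ⟨hu.1.1.trans hz.1, hz.2.trans hv.1.2⟩
    have hzA : z ∈ A := by by_contra h; exact hzB ⟨hz01, h⟩
    have hwC : side d w ∉ C := fun h => hwA ⟨hw01, h⟩
    have huC : side d u ∉ C := fun h => hu.2 ⟨hu.1, h⟩
    have hvC : side d v ∉ C := fun h => hv.2 ⟨hv.1, h⟩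
    have ne : ∀ {s t : ℝ}, side d s ∉ C → side d t ∈ C → s ≠ t := by
      rintro s t hs ht rfl; exact hs ht
    have hxw : x < w := lt_of_le_of_ne hw.1 (ne hwC hx.2).symm
    have hwy : w < y := lt_of_le_of_ne hw.2 (ne hwC hy.2)
    have huz : u < z := lt_of_le_of_ne hz.1 (ne huC hzA.2)
    have hzv : z < v := lt_of_le_of_ne hz.2 (ne hvC hzA.2).symm
    have hux : u < x := by
      by_contra hcon
      have : x < u := lt_of_le_of_ne (not_lt.1 hcon) (ne huC hx.2).symm
      exact no_alternation hC hCs d hu.1 hv.1 huC hvC hzA.2 hx.2 huz hzv (Or.inl this)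
    exact no_alternation hC hCs d hu.1 hw01 huC hwC hx.2 hy.2 hux hxw (Or.inr hwy)
  refine ⟨{t ∈ A | ∀ s ∈ Icc (0 : ℝ) 1 \ A, t < s}, {t ∈ A | ∀ s ∈ Icc (0 : ℝ) 1 \ A, s < t},
    ⟨?_⟩, ⟨?_⟩, ?_⟩
  · rintro x ⟨hx, hx'⟩ y ⟨hy, hy'⟩ z ⟨hxz, hzy⟩
    have hz01 : z ∈ Icc (0 : ℝ) 1 := ⟨hx.1.1.trans hxz, hzy.trans hy.1.2⟩
    have : z ∈ A := by
      by_contra h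
      exact absurd (hy' z ⟨hz01, h⟩) (not_lt.2 hzy)
    exact ⟨this, fun s hs => lt_of_le_of_lt hzy (hy' s hs)⟩
  · rintro x ⟨hx, hx'⟩ y ⟨hy, hy'⟩ z ⟨hxz, hzy⟩
    have hz01 : z ∈ Icc (0 : ℝ) 1 := ⟨hx.1.1.trans hxz, hzy.trans hy.1.2⟩
    have : z ∈ A := by
      by_contra h
      exact absurd (hx' z ⟨hz01, h⟩) (not_lt.2 hxz)
    exact ⟨this, fun s hs => lt_of_lt_of_le (hx' s hs) hxz⟩
  · ext t
    constructor
    · intro ht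
      by_contra hcon
      simp only [mem_union, mem_ofPred_eq, not_or, not_and, not_forall, not_lt] at hcon
      obtain ⟨⟨s, hs, hst⟩, hcon2⟩ := And.intro (hcon.1 ht) (hcon.2 ht)
      obtain ⟨s', hs', hst'⟩ := hcon2
      exact (hB.out hs hs' ⟨hst, hst'⟩).2 ht
    · rintro (h | h) <;> exact h.1

lemma exists_ordConnected_family {K : Set (ℝ × ℝ)} (hK : IsPieced K)
    (hKs : K ⊆ square \ openSquare) (d : Fin 4) :
    ∃ F : Set (Set ℝ), F.Finite ∧ (∀ J ∈ F, J.OrdConnected) ∧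
      {t | t ∈ Icc (0 : ℝ) 1 ∧ side d t ∈ K} = ⋃₀ F := by
  obtain ⟨G, hG, hGc, rfl⟩ := hK
  have : ∀ C : G, ∃ J₁ J₂ : Set ℝ, J₁.OrdConnected ∧ J₂.OrdConnected ∧
      {t | t ∈ Icc (0 : ℝ) 1 ∧ side d t ∈ C.1} = J₁ ∪ J₂ := fun C =>
    exists_ordConnected_of_side (hGc _ C.2) ((subset_sUnion_of_mem C.2).trans hKs) d
  choose J₁ J₂ h1 h2 h3 using this
  have := hG.to_subtype
  refine ⟨range J₁ ∪ range J₂, (finite_range _).union (finite_range _), ?_, ?_⟩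
  · rintro _ (⟨C, rfl⟩ | ⟨C, rfl⟩)
    exacts [h1 C, h2 C]
  · ext t
    rw [sUnion_union, sUnion_range, sUnion_range, ← iUnion_union_distrib]
    simp only [← h3, mem_iUnion, mem_ofPred_eq, mem_sUnion, Subtype.exists, exists_prop]
    constructor
    · rintro ⟨h, C, hC, hC'⟩; exact ⟨C, hC, h, hC'⟩
    · rintro ⟨C, hC, h, hC'⟩; exact ⟨h, C, hC, hC'⟩

lemma finite_frontier_side {K : Set (ℝ × ℝ)} (hK : IsPieced K)
    (hKs : K ⊆ square \ openSquare) (d : Fin 4) :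
    (frontier {t | t ∈ Icc (0 : ℝ) 1 ∧ side d t ∈ K}).Finite := by
  obtain ⟨F, hF, hJ, h⟩ := exists_ordConnected_family hK hKs d
  rw [h]
  clear h
  induction F, hF using Set.Finite.induction_on with
  | empty => simp
  | @insert J F _ hF ih =>
    rw [sUnion_insert]
    exact ((finite_frontier_of_ordConnected (hJ J (mem_insert _ _))).union
      (ih fun J' h => hJ J' (mem_insert_of_mem _ h))).subset
      ((frontier_union_subset _ _).trans (union_subset_union inter_subset_left inter_subset_right))

lemma convex_preimage_side {Q : Set (ℝ × ℝ)} (hQ : Convex ℝ Q) (d : Fin 4) :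
    (side d ⁻¹' Q).OrdConnected := by
  rw [← convex_iff_ordConnected]
  intro x hx y hy a b ha hb hab
  have : side d (a • x + b • y) = a • side d x + b • side d y := by
    rcases fin_four_cases d with rfl | rfl | rfl | rfl <;> simp [side, hab]
  rw [mem_preimage, this]
  exact hQ hx hy ha hb hab

/-- Each side meets `K` in finitely many intervals, and a convex set cuts each of them in an
interval. This transfers finiteness from the overlaps of disks to those of subrectangles and sides.
-/
lemma IsPieced.inter_convex {K Q : Set (ℝ × ℝ)} (hK : IsPieced K)
    (hKs : K ⊆ square \ openSquare) (hQ : Convex ℝ Q) : IsPieced (K ∩ Q) := by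
  have : K ∩ Q = ⋃ d : Fin 4, side d '' ({t | t ∈ Icc (0 : ℝ) 1 ∧ side d t ∈ K} ∩ side d ⁻¹' Q) := by
    ext x
    simp only [mem_iUnion]
    constructor
    · rintro ⟨hx, hxQ⟩
      obtain ⟨d, t, ht, rfl⟩ := exists_side (hKs hx).1 (hKs hx).2
      exact ⟨d, t, ⟨⟨ht, hx⟩, hxQ⟩, rfl⟩
    · rintro ⟨d, t, ⟨⟨-, h⟩, h'⟩, rfl⟩
      exact ⟨h, h'⟩
  rw [this]
  refine isPieced_iUnion fun d => IsPieced.image ?_ (continuous_side d).continuousOn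
  obtain ⟨F, hF, hJ, h⟩ := exists_ordConnected_family hK hKs d
  rw [h]
  refine ⟨(· ∩ side d ⁻¹' Q) '' F, hF.image _, ?_, ?_⟩
  · rintro _ ⟨J, hJF, rfl⟩
    exact isPreconnected_iff_ordConnected.2 ((hJ J hJF).inter (convex_preimage_side hQ d))
  · rw [sUnion_image, sUnion_eq_biUnion, iUnion₂_inter]

section Embedded

variable {Z : Type*} [TopologicalSpace Z] [T2Space Z] {H : ℝ × ℝ → Z}

lemma IsPieced.preimage_square (hc : ContinuousOn H square) (hi : InjOn H square) {K : Set Z}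
    (hK : IsPieced K) (hKs : K ⊆ H '' square) : IsPieced (square ∩ H ⁻¹' K) := by
  have h1 := continuousOn_invFunOn_of_isCompact isCompact_square hc subset_rfl hi
    (fun _ _ y hy _ => hy)
  have : square ∩ H ⁻¹' K = Function.invFunOn H square '' K := by
    ext x
    constructor
    · rintro ⟨hx, hxK⟩
      refine ⟨H x, hxK, hi (Function.invFunOn_mem ⟨x, hx, rfl⟩) hx
        (Function.invFunOn_apply_eq hx)⟩
    · rintro ⟨y, hy, rfl⟩
      have h2 := hKs hy
      exact ⟨Function.invFunOn_mem h2, by rw [mem_preimage, Function.invFunOn_eq h2]; exact hy⟩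
  rw [this]
  exact hK.image (h1.mono hKs)

lemma IsPieced.inter_image_convex (hc : ContinuousOn H square) (hi : InjOn H square) {K : Set Z}
    (hK : IsPieced K) (hKs : K ⊆ H '' (square \ openSquare)) {Q : Set (ℝ × ℝ)} (hQ : Convex ℝ Q)
    (hQs : Q ⊆ square) : IsPieced (K ∩ H '' Q) := by
  have h1 := hK.preimage_square hc hi (hKs.trans (image_mono sdiff_subset))
  have h2 : square ∩ H ⁻¹' K ⊆ square \ openSquare := by
    rintro x ⟨hx, hxK⟩
    obtain ⟨y, hy, hxy⟩ := hKs hxK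
    rw [← hi hy.1 hx hxy]; exact hy
  have h3 := (h1.inter_convex h2 hQ).image (f := H) (hc.mono fun x hx => hx.1.1)
  convert h3 using 1
  ext z
  constructor
  · rintro ⟨hz, x, hx, rfl⟩; exact ⟨x, ⟨⟨hQs hx, hz⟩, hx⟩, rfl⟩
  · rintro ⟨x, ⟨⟨hx, hz⟩, hxQ⟩, rfl⟩; exact ⟨hz, x, hxQ, rfl⟩

lemma finite_frontier_of_isPieced (hc : ContinuousOn H square) (hi : InjOn H square) {K : Set Z}
    (hK : IsPieced K) (hKs : K ⊆ H '' (square \ openSquare)) (d : Fin 4) :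
    (frontier {t | t ∈ Icc (0 : ℝ) 1 ∧ H (side d t) ∈ K}).Finite := by
  have h1 := hK.preimage_square hc hi (hKs.trans (image_mono sdiff_subset))
  have h2 : square ∩ H ⁻¹' K ⊆ square \ openSquare := by
    rintro x ⟨hx, hxK⟩
    obtain ⟨y, hy, hxy⟩ := hKs hxK
    rw [← hi hy.1 hx hxy]; exact hy
  convert finite_frontier_side h1 h2 d using 2
  ext t
  simp only [mem_ofPred_eq, mem_inter_iff, mem_preimage]
  exact ⟨fun h => ⟨h.1, side_mem_square d h.1, h.2⟩, fun h => ⟨h.1, h.2.2⟩⟩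

end Embedded

/-! ### Subdividing a finite family of arcs, and surfaces over a complex of squares -/

lemma subset_of_frontier_disjoint {I A : Set ℝ} (hI : IsPreconnected I)
    (hd : ∀ t ∈ I, t ∉ frontier A) {t : ℝ} (ht : t ∈ I) (htA : t ∈ A) : I ⊆ A := by
  have h1 : I ⊆ interior A ∪ (closure A)ᶜ := by
    intro s hs
    by_cases h : s ∈ closure A
    · left
      by_contra h'
      exact hd s hs ⟨h, h'⟩
    · exact Or.inr h
  have h2 := hI.subset_left_of_subset_union isOpen_interior isClosed_closure.isOpen_compl
    (disjoint_compl_right.mono_left interior_subset_closure) h1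
    ⟨t, ht, by
      rcases h1 ht with h | h
      · exact h
      · exact absurd (subset_closure htA) h⟩
  exact h2.trans interior_subset

/-- The arcs may overlap in subarcs, so they are cut at their end points and at the frontier points
of all pairwise overlaps. Between consecutive cuts a piece lies entirely on another arc or misses
it, hence two open pieces coincide or are disjoint. -/
lemma exists_subdivision {Z : Type*} [TopologicalSpace Z] [T2Space Z] {J : Type} [Finite J]
    (γ : J → ℝ → Z) (hc : ∀ j, ContinuousOn (γ j) (Icc 0 1)) (hi : ∀ j, InjOn (γ j) (Icc 0 1))
    (hf : ∀ i j, (frontier {t | t ∈ Icc (0 : ℝ) 1 ∧ γ i t ∈ γ j '' Icc 0 1}).Finite)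
    (V₀ : Set Z) (hV₀ : V₀.Finite) (hV₀' : V₀ ⊆ ⋃ j, γ j '' Icc 0 1) :
    ∃ (V : Set Z) (E : Type) (_ : Finite E) (i : E → J) (a b : E → ℝ),
      V.Finite ∧ V₀ ⊆ V ∧ V ⊆ (⋃ j, γ j '' Icc 0 1) ∧
      (∀ ε, 0 ≤ a ε ∧ a ε < b ε ∧ b ε ≤ 1) ∧
      (∀ ε, γ (i ε) (a ε) ∈ V ∧ γ (i ε) (b ε) ∈ V) ∧
      (∀ ε, ∀ t ∈ Ioo (a ε) (b ε), γ (i ε) t ∉ V) ∧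
      (∀ ε ε' t t', t ∈ Ioo (a ε) (b ε) → t' ∈ Ioo (a ε') (b ε') →
        γ (i ε) t = γ (i ε') t' → ε = ε') ∧
      (∀ j, ∀ t ∈ Icc (0 : ℝ) 1, γ j t ∈ V ∨
        ∃ ε, ∃ s ∈ Ioo (a ε) (b ε), γ j t = γ (i ε) s) := by
  let A : J → J → Set ℝ := fun i j => {t | t ∈ Icc (0 : ℝ) 1 ∧ γ i t ∈ γ j '' Icc 0 1}
  have hfA : ∀ i j, frontier (A i j) ⊆ Icc 0 1 := fun i j =>
    frontier_subset_closure.trans (closure_minimal (fun t ht => ht.1) isClosed_Icc)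
  let V : Set Z := V₀ ∪ (⋃ j, {γ j 0, γ j 1}) ∪ ⋃ i, ⋃ j, γ i '' frontier (A i j)
  have hVfin : V.Finite := (hV₀.union (finite_iUnion fun j => toFinite _)).union
    (finite_iUnion fun i => finite_iUnion fun j => (hf i j).image _)
  have h0V : ∀ j, γ j 0 ∈ V := fun j => Or.inl (Or.inr (mem_iUnion.2 ⟨j, Or.inl rfl⟩))
  have h1V : ∀ j, γ j 1 ∈ V := fun j => Or.inl (Or.inr (mem_iUnion.2 ⟨j, Or.inr rfl⟩))
  have hVX : V ⊆ ⋃ j, γ j '' Icc 0 1 := by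
    rintro p ((hp | hp) | hp)
    · exact hV₀' hp
    · obtain ⟨j, rfl | rfl⟩ := mem_iUnion.1 hp
      · exact mem_iUnion.2 ⟨j, 0, ⟨le_rfl, zero_le_one⟩, rfl⟩
      · exact mem_iUnion.2 ⟨j, 1, ⟨zero_le_one, le_rfl⟩, rfl⟩
    · obtain ⟨i, hp⟩ := mem_iUnion.1 hp
      obtain ⟨j, t, ht, rfl⟩ := mem_iUnion.1 hp
      exact mem_iUnion.2 ⟨i, t, hfA i j ht, rfl⟩
  let Gap : J → ℝ → ℝ → Prop := fun i a b => 0 ≤ a ∧ a < b ∧ b ≤ 1 ∧ γ i a ∈ V ∧ γ i b ∈ V ∧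
    ∀ t ∈ Ioo a b, γ i t ∉ V
  let T : J → Set ℝ := fun j => {t | t ∈ Icc (0 : ℝ) 1 ∧ γ j t ∈ V}
  have hT : ∀ j, (T j).Finite := fun j =>
    Finite.of_finite_image (hVfin.subset (by rintro _ ⟨t, ht, rfl⟩; exact ht.2))
      ((hi j).mono fun t ht => ht.1)
  -- Edges are recorded as subsets of `Z`, so that a piece shared by several arcs counts once.
  let 𝓢 : Set (Set Z) := {s | ∃ i a b, Gap i a b ∧ s = γ i '' Ioo a b}
  have h𝓢 : 𝓢.Finite := by
    refine (finite_iUnion fun j : J => ((hT j).prod (hT j)).image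
      (fun x : ℝ × ℝ => γ j '' Ioo x.1 x.2)).subset ?_
    rintro s ⟨i, a, b, ⟨h1, h2, h3, h4, h5, h6⟩, rfl⟩
    exact mem_iUnion.2 ⟨i, (a, b), ⟨⟨⟨h1, by linarith⟩, h4⟩, ⟨by linarith, h3⟩, h5⟩, rfl⟩
  -- If two open pieces meet, the first lies on the whole arc `j`. In the parameter of `γ j` it is
  -- an interval that meets `Ioo a' b'` and avoids the cuts `a'` and `b'`.
  have key : ∀ i a b j a' b', Gap i a b → Gap j a' b' → ∀ t ∈ Ioo a b, ∀ t' ∈ Ioo a' b',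
      γ i t = γ j t' → γ i '' Ioo a b ⊆ γ j '' Ioo a' b' := by
    rintro i a b j a' b' ⟨h1, h2, h3, h4, h5, h6⟩ ⟨k1, k2, k3, k4, k5, k6⟩ t ht t' ht' htt
    have hIcc : Ioo a b ⊆ Icc 0 1 := fun s hs => ⟨by linarith [hs.1], by linarith [hs.2]⟩
    have hIcc' : Ioo a' b' ⊆ Icc 0 1 := fun s hs => ⟨by linarith [hs.1], by linarith [hs.2]⟩
    have hsub : Ioo a b ⊆ A i j := subset_of_frontier_disjoint isPreconnected_Ioo
      (fun s hs hsf => h6 s hs (Or.inr (mem_iUnion.2 ⟨i, mem_iUnion.2 ⟨j, s, hsf, rfl⟩⟩)))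
      ht ⟨hIcc ht, t', hIcc' ht', htt.symm⟩
    have hM : γ i '' Ioo a b ⊆ γ j '' Icc 0 1 := by
      rintro _ ⟨s, hs, rfl⟩; exact (hsub hs).2
    have hg := continuousOn_invFunOn_of_isCompact isCompact_Icc (hc j) subset_rfl (hi j)
      (fun _ _ y hy _ => hy)
    have hpre : IsPreconnected (Function.invFunOn (γ j) (Icc 0 1) '' (γ i '' Ioo a b)) :=
      (isPreconnected_Ioo.image _ ((hc i).mono hIcc)).image _ (hg.mono hM)
    have hord := isPreconnected_iff_ordConnected.1 hpre
    have hinv : ∀ x ∈ γ i '' Ioo a b, γ j (Function.invFunOn (γ j) (Icc 0 1) x) = x :=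
      fun x hx => Function.invFunOn_eq (hM hx)
    have hnot : ∀ c, γ j c ∈ V → c ∉ Function.invFunOn (γ j) (Icc 0 1) '' (γ i '' Ioo a b) := by
      rintro _ hcV ⟨x, ⟨s, hs, rfl⟩, rfl⟩
      rw [hinv _ ⟨s, hs, rfl⟩] at hcV
      exact h6 s hs hcV
    have ht'mem : t' ∈ Function.invFunOn (γ j) (Icc 0 1) '' (γ i '' Ioo a b) := by
      refine ⟨γ i t, ⟨t, ht, rfl⟩, ?_⟩
      rw [htt]
      exact hi j (Function.invFunOn_mem ⟨t', hIcc' ht', rfl⟩) (hIcc' ht')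
        (Function.invFunOn_apply_eq (hIcc' ht'))
    rintro _ ⟨s, hs, rfl⟩
    refine ⟨_, ?_, hinv _ ⟨s, hs, rfl⟩⟩
    have hgs : Function.invFunOn (γ j) (Icc 0 1) (γ i s) ∈
      Function.invFunOn (γ j) (Icc 0 1) '' (γ i '' Ioo a b) := ⟨_, ⟨s, hs, rfl⟩, rfl⟩
    constructor
    · by_contra hcon
      exact hnot a' k4 (hord.out hgs ht'mem ⟨not_lt.1 hcon, ht'.1.le⟩)
    · by_contra hcon
      exact hnot b' k5 (hord.out ht'mem hgs ⟨ht'.2.le, not_lt.1 hcon⟩)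
  have hchoose : ∀ s : 𝓢, ∃ i a b, Gap i a b ∧ s.1 = γ i '' Ioo a b := fun s => s.2
  choose i a b hG hs using hchoose
  have := h𝓢.to_subtype
  obtain ⟨n, ⟨eq⟩⟩ := Finite.exists_equiv_fin 𝓢
  refine ⟨V, Fin n, inferInstance, i ∘ eq.symm, a ∘ eq.symm, b ∘ eq.symm, hVfin,
    fun p hp => Or.inl (Or.inl hp), hVX,
    fun ε => ⟨(hG _).1, (hG _).2.1, (hG _).2.2.1⟩,
    fun ε => ⟨(hG _).2.2.2.1, (hG _).2.2.2.2.1⟩, fun ε => (hG _).2.2.2.2.2, ?_, ?_⟩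
  · intro ε ε' t t' ht ht' htt
    have h1 := key _ _ _ _ _ _ (hG (eq.symm ε)) (hG (eq.symm ε')) t ht t' ht' htt
    have h2 := key _ _ _ _ _ _ (hG (eq.symm ε')) (hG (eq.symm ε)) t' ht' t ht htt.symm
    apply eq.symm.injective
    apply Subtype.ext
    rw [hs, hs]
    exact h1.antisymm h2
  · intro j t ht
    by_cases htV : γ j t ∈ V
    · exact Or.inl htV
    right
    obtain ⟨a₀, ha₀, ha₀'⟩ := exists_max_image (T j ∩ Iic t) id ((hT j).inter_of_left _)
      ⟨0, ⟨⟨le_rfl, zero_le_one⟩, h0V j⟩, ht.1⟩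
    obtain ⟨b₀, hb₀, hb₀'⟩ := exists_min_image (T j ∩ Ici t) id ((hT j).inter_of_left _)
      ⟨1, ⟨⟨zero_le_one, le_rfl⟩, h1V j⟩, ht.2⟩
    have hat : a₀ < t := lt_of_le_of_ne ha₀.2 (by rintro rfl; exact htV ha₀.1.2)
    have htb : t < b₀ := lt_of_le_of_ne hb₀.2 (by rintro rfl; exact htV hb₀.1.2)
    have hgap : Gap j a₀ b₀ := by
      refine ⟨ha₀.1.1.1, hat.trans htb, hb₀.1.1.2, ha₀.1.2, hb₀.1.2, fun s hs hsV => ?_⟩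
      have hs01 : s ∈ Icc (0 : ℝ) 1 := ⟨ha₀.1.1.1.trans hs.1.le, hs.2.le.trans hb₀.1.1.2⟩
      rcases le_total s t with h | h
      · exact absurd (ha₀' s ⟨⟨hs01, hsV⟩, h⟩) (not_le.2 hs.1)
      · exact absurd (hb₀' s ⟨⟨hs01, hsV⟩, h⟩) (not_le.2 hs.2)
    have hmem : γ j t ∈ (⟨γ j '' Ioo a₀ b₀, j, a₀, b₀, hgap, rfl⟩ : 𝓢).1 := ⟨t, ⟨hat, htb⟩, rfl⟩
    rw [hs] at hmem
    obtain ⟨s, hs', hst⟩ := hmem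
    refine ⟨eq ⟨γ j '' Ioo a₀ b₀, j, a₀, b₀, hgap, rfl⟩, s, ?_, ?_⟩
    · simpa using hs'
    · simpa using hst.symm

/-- The sign `1` or `-1`. -/
def sgn (b : Bool) : ℂ := if b then 1 else -1

lemma sgn_cases (b : Bool) : sgn b = 1 ∨ sgn b = -1 := by cases b <;> simp [sgn]

lemma sgn_mul_inj {b c : Bool} {z : ℂ} (hz : z ≠ 0) (h : sgn b * z = sgn c * z) : b = c := by
  have h' := mul_right_cancel₀ hz h
  cases b <;> cases c <;> simp only [sgn, if_true, if_false, Bool.false_eq_true] at h' ⊢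
  · norm_num at h'
  · norm_num at h'

/-- `S` is a double cover of `B` with sheets `± f`, branched at the zeros. If the zeros are
vertices, then `S` has twice as many edges and faces as `B`, and twice as many vertices minus one
for each zero. `P` adds the faces `G w` and the edges `A w`, and no vertices once the ends of the `A
w` lie over vertices of `B`. -/
lemma exists_eulerChar {Z : Type} [TopologicalSpace Z] [T2Space Z] {Φ Ws Wv : Type} [Finite Φ]
    [Finite Ws] [Finite Wv] (H : Φ → ℝ × ℝ → Z) (f : Φ → ℝ × ℝ → ℂ) (B : Set Z)
    (S P : Set (ℂ × Z)) (G : Ws → ℝ × ℝ → ℂ × Z) (A : Wv → ℝ → ℂ × Z)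
    (hHc : ∀ φ, ContinuousOn (H φ) square) (hHi : ∀ φ, InjOn (H φ) square)
    (hopen : ∀ φ ψ, φ ≠ ψ → ∀ x ∈ openSquare, H φ x ∉ H ψ '' square)
    (hfin : ∀ φ ψ, φ ≠ ψ → IsPieced (H φ '' square ∩ H ψ '' square))
    (hB : (⋃ φ, H φ '' square) = B) (hfc : ∀ φ, ContinuousOn (f φ) square)
    (hS : ∀ q ∈ S, q.2 ∈ B)
    (hSf : ∀ φ, ∀ x ∈ square, ∀ z, (z, H φ x) ∈ S ↔ z = f φ x ∨ z = -f φ x)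
    (hf0 : ∀ φ, ∀ x ∈ openSquare, f φ x ≠ 0) (hZr : {p | ((0 : ℂ), p) ∈ S}.Finite)
    (hGc : ∀ w, ContinuousOn (G w) square) (hAc : ∀ w, ContinuousOn (A w) (Icc 0 1))
    (hGi : ∀ w w', ∀ x ∈ openSquare, ∀ y ∈ openSquare, G w x = G w' y → w = w' ∧ x = y)
    (hAi : ∀ w w', ∀ s ∈ Ioo (0 : ℝ) 1, ∀ t ∈ Ioo (0 : ℝ) 1, A w s = A w' t → w = w' ∧ s = t)
    (hGB : ∀ w, ∀ x ∈ openSquare, (G w x).2 ∉ B)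
    (hAB : ∀ w, ∀ t ∈ Ioo (0 : ℝ) 1, (A w t).2 ∉ B)
    (hGA : ∀ w, ∀ x ∈ openSquare, ∀ w', ∀ t ∈ Icc (0 : ℝ) 1, G w x ≠ A w' t)
    (hA0 : ∀ w, A w 0 ∈ S ∧ ∀ φ, ∀ x ∈ openSquare, H φ x ≠ (A w 0).2)
    (hA1 : ∀ w, A w 1 ∈ S ∧ ∀ φ, ∀ x ∈ openSquare, H φ x ≠ (A w 1).2)
    (hGb : ∀ w, ∀ x ∈ square, x ∉ openSquare →
      (G w x ∈ S ∧ ∀ φ, ∀ y ∈ openSquare, H φ y ≠ (G w x).2) ∨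
        ∃ w', ∃ t ∈ Icc (0 : ℝ) 1, G w x = A w' t)
    (hP : P = S ∪ ⋃ w, G w '' square) (hAP : ∀ w, ∀ t ∈ Icc (0 : ℝ) 1, A w t ∈ P) :
    ∃ n : ℤ, HasEulerChar B n ∧ HasEulerChar P
      (2 * n - {p | ((0 : ℂ), p) ∈ S}.ncard + Nat.card Ws - Nat.card Wv) := by
  set Zr := {p | ((0 : ℂ), p) ∈ S} with hZrdef
  let γ : Φ × Fin 4 → ℝ → Z := fun j t => H j.1 (side j.2 t)
  have hγc : ∀ j, ContinuousOn (γ j) (Icc 0 1) := fun j =>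
    (hHc j.1).comp (continuous_side j.2).continuousOn fun t ht => side_mem_square _ ht
  have hγi : ∀ j, InjOn (γ j) (Icc 0 1) := by
    intro j s hs t ht h
    have := hHi j.1 (side_mem_square _ hs) (side_mem_square _ ht) h
    rw [← along_side j.2 s, this, along_side]
  -- points of open faces are not in the boundary of a face
  have hface : ∀ φ, ∀ x ∈ openSquare, ∀ ψ, ∀ y ∈ square, H φ x = H ψ y → φ = ψ ∧ x = y := by
    intro φ x hx ψ y hy h
    by_cases hφ : φ = ψ
    · subst hφ; exact ⟨rfl, hHi φ (openSquare_subset hx) hy h⟩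
    · exact absurd ⟨y, hy, h.symm⟩ (hopen φ ψ hφ x hx)
  have hconv : ∀ d : Fin 4, Convex ℝ (side d '' Icc 0 1) := by
    intro d
    rintro _ ⟨s, hs, rfl⟩ _ ⟨t, ht, rfl⟩ a b ha hb hab
    refine ⟨a • s + b • t, (convex_Icc (0 : ℝ) 1) hs ht ha hb hab, ?_⟩
    rcases fin_four_cases d with rfl | rfl | rfl | rfl <;> simp [side, hab]
  have hside : ∀ d : Fin 4, side d '' Icc 0 1 ⊆ square := by
    rintro d _ ⟨t, ht, rfl⟩; exact side_mem_square d ht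
  -- Two sides of the same face are segments in one square. For different faces, the side of `ψ` is
  -- convex and cuts a pieced set out of the overlap of the two faces, which lies in the boundary of
  -- both.
  have hfront : ∀ i j, (frontier {t | t ∈ Icc (0 : ℝ) 1 ∧ γ i t ∈ γ j '' Icc 0 1}).Finite := by
    rintro ⟨φ, d⟩ ⟨ψ, d'⟩
    have himg : γ (ψ, d') '' Icc 0 1 = H ψ '' (side d' '' Icc 0 1) := (image_image _ _ _).symm
    by_cases hφ : φ = ψ
    · subst hφ
      have : {t | t ∈ Icc (0 : ℝ) 1 ∧ γ (φ, d) t ∈ γ (φ, d') '' Icc 0 1} =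
          Icc 0 1 ∩ side d ⁻¹' (side d' '' Icc 0 1) := by
        ext t
        constructor
        · rintro ⟨ht, s, hs, hst⟩
          refine ⟨ht, s, hs, ?_⟩
          exact hHi φ (side_mem_square _ hs) (side_mem_square _ ht) hst
        · rintro ⟨ht, s, hs, hst⟩
          exact ⟨ht, s, hs, by simp only [γ]; rw [hst]⟩
      rw [this]
      exact finite_frontier_of_ordConnected (ordConnected_Icc.inter
        (convex_preimage_side (hconv d') d))
    · have hbd : ∀ φ ψ, φ ≠ ψ → H φ '' square ∩ H ψ '' square ⊆ H φ '' (square \ openSquare) := by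
        rintro φ ψ hne _ ⟨⟨x, hx, rfl⟩, hx2⟩
        exact ⟨x, ⟨hx, fun h => hopen φ ψ hne x h hx2⟩, rfl⟩
      have h1 := (hfin ψ φ (Ne.symm hφ)).inter_image_convex (hHc ψ) (hHi ψ)
        (hbd ψ φ (Ne.symm hφ)) (hconv d') (hside d')
      have h2 : H ψ '' square ∩ H φ '' square ∩ H ψ '' (side d' '' Icc 0 1) ⊆
          H φ '' (square \ openSquare) := fun p hp => hbd φ ψ hφ ⟨hp.1.2, hp.1.1⟩
      have h3 := finite_frontier_of_isPieced (hHc φ) (hHi φ) h1 h2 d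
      convert h3 using 2
      ext t
      simp only [himg, mem_ofPred_eq, mem_inter_iff, γ]
      constructor
      · rintro ⟨ht, h⟩
        exact ⟨ht, ⟨image_mono (hside d') h, _, side_mem_square _ ht, rfl⟩, h⟩
      · rintro ⟨ht, -, h⟩
        exact ⟨ht, h⟩
  have hX : ∀ p ∈ B, (∀ φ, ∀ x ∈ openSquare, H φ x ≠ p) → p ∈ ⋃ j, γ j '' Icc 0 1 := by
    intro p hp hne
    rw [← hB] at hp
    obtain ⟨φ, x, hx, rfl⟩ := mem_iUnion.1 hp
    obtain ⟨d, t, ht, rfl⟩ := exists_side hx (fun h => hne φ x h rfl)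
    exact mem_iUnion.2 ⟨(φ, d), t, ht, rfl⟩
  have hZX : Zr ⊆ ⋃ j, γ j '' Icc 0 1 := by
    intro p hp
    refine hX p (hS _ hp) ?_
    rintro φ x hx rfl
    have := (hSf φ x (openSquare_subset hx) 0).1 hp
    apply hf0 φ x hx
    rcases this with h | h
    · exact h.symm
    · exact neg_eq_zero.1 h.symm
  -- The branch points and the projections of the ends of the arcs `A w` are forced to be vertices.
  obtain ⟨V, E, hE, i, a, b, hVfin, hV₀, hVX, hab, hends, hint, hdis, hcov⟩ :=
    exists_subdivision γ hγc hγi hfront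
      (Zr ∪ ((range fun w => (A w 0).2) ∪ range fun w => (A w 1).2))
      (hZr.union ((finite_range _).union (finite_range _)))
      (union_subset hZX (union_subset
        (by rintro _ ⟨w, rfl⟩; exact hX _ (hS _ (hA0 w).1) (hA0 w).2)
        (by rintro _ ⟨w, rfl⟩; exact hX _ (hS _ (hA1 w).1) (hA1 w).2)))
  have hZV : Zr ⊆ V := fun p hp => hV₀ (Or.inl hp)
  have hA0V : ∀ w, (A w 0).2 ∈ V := fun w => hV₀ (Or.inr (Or.inl ⟨w, rfl⟩))
  have hA1V : ∀ w, (A w 1).2 ∈ V := fun w => hV₀ (Or.inr (Or.inr ⟨w, rfl⟩))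
  have hXB : (⋃ j, γ j '' Icc 0 1) ⊆ B := by
    rw [← hB]
    refine iUnion_subset fun j => ?_
    rintro _ ⟨t, ht, rfl⟩
    exact mem_iUnion.2 ⟨j.1, _, side_mem_square _ ht, rfl⟩
  have hVB : V ⊆ B := hVX.trans hXB
  have hfaceX : ∀ φ, ∀ x ∈ openSquare, H φ x ∉ ⋃ j, γ j '' Icc 0 1 := by
    intro φ x hx h
    obtain ⟨j, t, ht, h⟩ := mem_iUnion.1 h
    have := (hface φ x hx j.1 _ (side_mem_square _ ht) h.symm).2
    rw [this] at hx
    exact side_notMem_openSquare _ _ hx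
  -- affine reparametrisation of the edges
  let ρ : E → ℝ → ℝ := fun ε t => a ε + t * (b ε - a ε)
  have hρc : ∀ ε, Continuous (ρ ε) := fun ε => by simp only [ρ]; fun_prop
  have hρo : ∀ ε, ∀ t ∈ Ioo (0 : ℝ) 1, ρ ε t ∈ Ioo (a ε) (b ε) := by
    intro ε t ht
    have := (hab ε).2.1
    constructor <;> simp only [ρ] <;> nlinarith [ht.1, ht.2]
  have hρI : ∀ ε, ∀ t ∈ Icc (0 : ℝ) 1, ρ ε t ∈ Icc (0 : ℝ) 1 := by
    intro ε t ht
    obtain ⟨h1, h2, h3⟩ := hab ε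
    constructor <;> simp only [ρ] <;> nlinarith [ht.1, ht.2]
  have hρs : ∀ ε, ∀ s ∈ Ioo (a ε) (b ε), ∃ t ∈ Ioo (0 : ℝ) 1, ρ ε t = s := by
    intro ε s hs
    have h2 : 0 < b ε - a ε := sub_pos.2 (hab ε).2.1
    refine ⟨(s - a ε) / (b ε - a ε), ⟨div_pos (sub_pos.2 hs.1) h2, ?_⟩, ?_⟩
    · rw [div_lt_one h2]; linarith [hs.2]
    · simp only [ρ]; field_simp; ring
  have hρi : ∀ ε s t, ρ ε s = ρ ε t → s = t := by
    intro ε s t h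
    have h2 : b ε - a ε ≠ 0 := (sub_pos.2 (hab ε).2.1).ne'
    simp only [ρ, add_right_inj] at h
    exact mul_right_cancel₀ h2 h
  have hρ0 : ∀ ε, ρ ε 0 = a ε := fun ε => by simp [ρ]
  have hρ1 : ∀ ε, ρ ε 1 = b ε := fun ε => by simp [ρ]
  let eb : E → ℝ → Z := fun ε t => γ (i ε) (ρ ε t)
  have hebc : ∀ ε, ContinuousOn (eb ε) (Icc 0 1) := fun ε =>
    (hγc _).comp (hρc ε).continuousOn (hρI ε)
  have hebi : ∀ ε ε', ∀ s ∈ Ioo (0 : ℝ) 1, ∀ t ∈ Ioo (0 : ℝ) 1, eb ε s = eb ε' t →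
      ε = ε' ∧ s = t := by
    intro ε ε' s hs t ht h
    have := hdis ε ε' _ _ (hρo ε s hs) (hρo ε' t ht) h
    subst this
    exact ⟨rfl, hρi ε _ _ (hγi _ (hρI ε s (Ioo_subset_Icc_self hs))
      (hρI ε t (Ioo_subset_Icc_self ht)) h)⟩
  have hebV : ∀ ε, ∀ t ∈ Ioo (0 : ℝ) 1, eb ε t ∉ V := fun ε t ht => hint ε _ (hρo ε t ht)
  have hebX : ∀ ε, ∀ t ∈ Icc (0 : ℝ) 1, eb ε t ∈ ⋃ j, γ j '' Icc 0 1 := fun ε t ht =>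
    mem_iUnion.2 ⟨i ε, _, hρI ε t ht, rfl⟩
  have heb01 : ∀ ε, eb ε 0 ∈ V ∧ eb ε 1 ∈ V := by
    intro ε; simp only [eb, hρ0, hρ1]; exact hends ε
  have hcovX : ∀ p ∈ ⋃ j, γ j '' Icc 0 1, p ∈ V ∨ ∃ ε, ∃ t ∈ Ioo (0 : ℝ) 1, p = eb ε t := by
    intro p hp
    obtain ⟨j, t, ht, rfl⟩ := mem_iUnion.1 hp
    rcases hcov j t ht with h | ⟨ε, s, hs, h⟩
    · exact Or.inl h
    · obtain ⟨t', ht', rfl⟩ := hρs ε s hs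
      exact Or.inr ⟨ε, t', ht', h⟩
  have := hVfin.to_subtype
  refine ⟨Nat.card V - Nat.card E + Nat.card Φ, ?_, ?_⟩
  · refine hasEulerChar_of_cells B (fun v : V => (v : Z)) eb H Subtype.val_injective hebc hebi
      ?_ ?_ hHc ?_ ?_ ?_ ?_ (fun v => hVB v.2) (fun ε t ht => hXB (hebX ε t ht)) ?_ ?_
    · intro ε t ht; simpa using hebV ε t ht
    · intro ε; simpa using heb01 ε
    · intro φ ψ x hx y hy h
      exact hface φ x hx ψ y (openSquare_subset hy) h
    · intro φ x hx; simpa using fun h => hfaceX φ x hx (hVX h)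
    · intro φ x hx ε t ht h
      exact hfaceX φ x hx (h ▸ hebX ε t ht)
    · intro φ x hx hx'
      obtain ⟨d, t, ht, rfl⟩ := exists_side hx hx'
      rcases hcovX (H φ (side d t)) (mem_iUnion.2 ⟨(φ, d), t, ht, rfl⟩) with h | ⟨ε, s, hs, h⟩
      · left; simpa using h
      · exact Or.inr ⟨ε, s, Ioo_subset_Icc_self hs, h⟩
    · intro φ x hx
      rw [← hB]; exact mem_iUnion.2 ⟨φ, x, hx, rfl⟩
    · intro p hp
      by_cases h : ∀ φ, ∀ x ∈ openSquare, H φ x ≠ p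
      · rcases hcovX p (hX p hp h) with h | ⟨ε, s, hs, h⟩
        · left; simpa using h
        · exact Or.inr (Or.inl ⟨ε, s, Ioo_subset_Icc_self hs, h⟩)
      · push Not at h
        obtain ⟨φ, x, hx, h⟩ := h
        exact Or.inr (Or.inr ⟨φ, x, openSquare_subset hx, h.symm⟩)
  -- the surface
  have hsec : ∀ p ∈ B, ∃ z : ℂ, ∀ w, (w, p) ∈ S ↔ w = z ∨ w = -z := by
    intro p hp
    rw [← hB] at hp
    obtain ⟨φ, x, hx, rfl⟩ := mem_iUnion.1 hp
    exact ⟨f φ x, hSf φ x hx⟩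
  choose! ζ hζ using hsec
  -- The vertices of the surface are the points over `V`. They form two graphs `± ζ` over `V` that
  -- meet exactly at the branch points, and inclusion-exclusion counts them.
  let I₀ : Set (ℂ × Z) := {q | q ∈ S ∧ q.2 ∈ V}
  have hI₀ : I₀ = (fun v => (ζ v, v)) '' V ∪ (fun v => (-ζ v, v)) '' V := by
    ext ⟨z, p⟩
    constructor
    · rintro ⟨hq, hp⟩
      rcases (hζ p (hVB hp) z).1 hq with rfl | rfl
      · exact Or.inl ⟨p, hp, rfl⟩
      · exact Or.inr ⟨p, hp, rfl⟩
    · rintro (⟨v, hv, h⟩ | ⟨v, hv, h⟩) <;> simp only [Prod.mk.injEq] at h <;>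
        obtain ⟨rfl, rfl⟩ := h
      · exact ⟨(hζ _ (hVB hv) _).2 (Or.inl rfl), hv⟩
      · exact ⟨(hζ _ (hVB hv) _).2 (Or.inr rfl), hv⟩
  have hI₀' : (fun v => (ζ v, v)) '' V ∩ (fun v => (-ζ v, v)) '' V =
      (fun v => ((0 : ℂ), v)) '' Zr := by
    ext ⟨z, p⟩
    constructor
    · rintro ⟨⟨v, hv, h⟩, v', hv', h'⟩
      simp only [Prod.mk.injEq] at h h'
      obtain ⟨rfl, rfl⟩ := h
      obtain ⟨h', rfl⟩ := h'
      have h0 : ζ v' = 0 := neg_eq_self.1 h'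
      refine ⟨v', (hζ _ (hVB hv) 0).2 (Or.inl h0.symm), ?_⟩
      simp [h0]
    · rintro ⟨v, hv, h⟩
      simp only [Prod.mk.injEq] at h
      obtain ⟨rfl, rfl⟩ := h
      have h0 : ζ v = 0 := by
        rcases (hζ v (hS _ hv) 0).1 hv with h | h
        · exact h.symm
        · exact neg_eq_zero.1 h.symm
      exact ⟨⟨v, hZV hv, by simp [h0]⟩, v, hZV hv, by simp [h0]⟩
  have hI₀fin : I₀.Finite := by rw [hI₀]; exact (hVfin.image _).union (hVfin.image _)
  have hcard : (Nat.card I₀ : ℤ) = 2 * Nat.card V - Zr.ncard := by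
    have h1 := ncard_union_add_ncard_inter _ _ (hVfin.image fun v => (ζ v, v))
      (hVfin.image fun v => (-ζ v, v))
    rw [← hI₀, hI₀', ncard_image_of_injective _ (fun v w h => (Prod.mk.inj h).2),
      ncard_image_of_injective _ (fun v w h => (Prod.mk.inj h).2),
      ncard_image_of_injective _ (fun v w h => (Prod.mk.inj h).2)] at h1
    rw [Nat.card_coe_set_eq, Nat.card_coe_set_eq]
    omega
  have := hI₀fin.to_subtype
  let F : Φ × Bool → ℝ × ℝ → ℂ × Z := fun φ x => (sgn φ.2 * f φ.1 x, H φ.1 x)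
  let e : E × Bool → ℝ → ℂ × Z := fun ε t =>
    (sgn ε.2 * f (i ε.1).1 (side (i ε.1).2 (ρ ε.1 t)), eb ε.1 t)
  have hFc : ∀ φ, ContinuousOn (F φ) square := fun φ =>
    (continuousOn_const.mul (hfc _)).prodMk (hHc _)
  have hec : ∀ ε, ContinuousOn (e ε) (Icc 0 1) := fun ε =>
    (continuousOn_const.mul ((hfc _).comp ((continuous_side _).comp (hρc _)).continuousOn
      fun t ht => side_mem_square _ (hρI _ _ ht))).prodMk (hebc _)
  have hsgnS : ∀ φ, ∀ x ∈ square, ∀ c : Bool, (sgn c * f φ x, H φ x) ∈ S := by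
    intro φ x hx c
    rw [hSf φ x hx]
    rcases sgn_cases c with h | h <;> simp [h]
  have hSsgn : ∀ φ, ∀ x ∈ square, ∀ z, (z, H φ x) ∈ S → ∃ c : Bool, z = sgn c * f φ x := by
    intro φ x hx z hz
    rcases (hSf φ x hx z).1 hz with h | h
    · exact ⟨true, by simp [sgn, h]⟩
    · exact ⟨false, by simp [sgn, h]⟩
  have heS : ∀ ε, ∀ t ∈ Icc (0 : ℝ) 1, e ε t ∈ S := fun ε t ht =>
    hsgnS _ _ (side_mem_square _ (hρI _ _ ht)) _
  have hcovS : ∀ q ∈ S, q.2 ∈ (⋃ j, γ j '' Icc 0 1) →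
      q ∈ range (fun v : I₀ => (v : ℂ × Z)) ∨
        ∃ ε : E × Bool, ∃ t ∈ Icc (0 : ℝ) 1, q = e ε t := by
    rintro ⟨z, p⟩ hq hp
    rcases hcovX p hp with h | ⟨ε, t, ht, h⟩
    · exact Or.inl ⟨⟨(z, p), hq, h⟩, rfl⟩
    · have ht' := Ioo_subset_Icc_self ht
      change p = H _ _ at h
      subst h
      obtain ⟨c, hc⟩ := hSsgn _ _ (side_mem_square _ (hρI _ _ ht')) z hq
      exact Or.inr ⟨(ε, c), t, ht', Prod.ext hc rfl⟩
  have hres := hasEulerChar_of_cells P (fun v : I₀ => (v : ℂ × Z)) (Sum.elim e A) (Sum.elim F G)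
    Subtype.val_injective ?_ ?_ ?_ ?_ ?_ ?_ ?_ ?_ ?_ ?_ ?_ ?_ ?_
  · convert hres using 1
    rw [Nat.card_sum, Nat.card_sum, Nat.card_prod, Nat.card_prod, hcard]
    simp only [Nat.card_eq_fintype_card, Fintype.card_bool]
    push_cast
    ring
  · rintro (ε | w)
    exacts [hec ε, hAc w]
  · rintro (ε | w) (ε' | w') s hs t ht h
    · have h2 := congrArg Prod.snd h
      obtain ⟨h3, h4⟩ := hebi _ _ s hs t ht h2
      subst h4
      have h1 := congrArg Prod.fst h
      obtain ⟨ε, c⟩ := ε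
      obtain ⟨ε', c'⟩ := ε'
      simp only at h3
      subst h3
      refine ⟨?_, rfl⟩
      -- Zeros are vertices, so `f` does not vanish on an open edge and the two lifts of the edge
      -- are disjoint.
      have hne : f (i ε).1 (side (i ε).2 (ρ ε s)) ≠ 0 := by
        intro h0
        refine hebV ε s hs (hZV ?_)
        have := hsgnS (i ε).1 _ (side_mem_square (i ε).2 (hρI ε s (Ioo_subset_Icc_self hs))) true
        rw [h0, mul_zero] at this
        exact this
      have hcc : c = c' := sgn_mul_inj hne h1
      rw [hcc]
    · refine absurd (?_ : (A w' t).2 ∈ B) (hAB w' t ht)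
      rw [show A w' t = e ε s from h.symm]
      exact hXB (hebX ε.1 s (Ioo_subset_Icc_self hs))
    · refine absurd (?_ : (A w s).2 ∈ B) (hAB w s hs)
      rw [show A w s = e ε' t from h]
      exact hXB (hebX ε'.1 t (Ioo_subset_Icc_self ht))
    · obtain ⟨h1, h2⟩ := hAi w w' s hs t ht h
      exact ⟨by rw [h1], h2⟩
  · rintro (ε | w) t ht ⟨v, hv⟩
    · have : (e ε t).2 ∈ V := by
        have := v.2.2
        rw [show (v : ℂ × Z) = e ε t from hv] at this
        exact this
      exact hebV _ t ht this
    · have := v.2.2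
      rw [show (v : ℂ × Z) = A w t from hv] at this
      exact hAB w t ht (hVB this)
  · rintro (ε | w)
    · have h01 := heb01 ε.1
      have z0 : (0 : ℝ) ∈ Icc (0 : ℝ) 1 := ⟨le_rfl, zero_le_one⟩
      have z1 : (1 : ℝ) ∈ Icc (0 : ℝ) 1 := ⟨zero_le_one, le_rfl⟩
      exact ⟨⟨⟨_, heS ε 0 z0, h01.1⟩, rfl⟩, ⟨_, heS ε 1 z1, h01.2⟩, rfl⟩
    · exact ⟨⟨⟨_, (hA0 w).1, hA0V w⟩, rfl⟩, ⟨_, (hA1 w).1, hA1V w⟩, rfl⟩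
  · rintro (φ | w)
    exacts [hFc φ, hGc w]
  · rintro (φ | w) (φ' | w') x hx y hy h
    · obtain ⟨h3, h4⟩ := hface _ x hx _ y (openSquare_subset hy) (congrArg Prod.snd h)
      subst h4
      obtain ⟨φ, c⟩ := φ
      obtain ⟨φ', c'⟩ := φ'
      simp only at h3
      subst h3
      have h1 := congrArg Prod.fst h
      have hcc : c = c' := sgn_mul_inj (hf0 φ x hx) h1
      exact ⟨by rw [hcc], rfl⟩
    · refine absurd (?_ : (G w' y).2 ∈ B) (hGB w' y hy)
      have h' : F φ x = G w' y := h
      rw [← h']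
      exact hS _ (hsgnS φ.1 x (openSquare_subset hx) φ.2)
    · refine absurd (?_ : (G w x).2 ∈ B) (hGB w x hx)
      have h' : G w x = F φ' y := h
      rw [h']
      exact hS _ (hsgnS φ'.1 y (openSquare_subset hy) φ'.2)
    · obtain ⟨h1, h2⟩ := hGi w w' x hx y hy h
      exact ⟨by rw [h1], h2⟩
  · rintro (φ | w) x hx ⟨v, hv⟩
    · have := v.2.2
      rw [show (v : ℂ × Z) = F φ x from hv] at this
      exact hfaceX φ.1 x hx (hVX this)
    · have := v.2.2
      rw [show (v : ℂ × Z) = G w x from hv] at this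
      exact hGB w x hx (hVB this)
  · rintro (φ | w) x hx (ε | w') t ht h
    · have : H φ.1 x = eb ε.1 t := congrArg Prod.snd h
      exact hfaceX φ.1 x hx (this ▸ hebX ε.1 t ht)
    · have h' : F φ x = A w' t := h
      have hFB : (A w' t).2 ∈ B := by
        rw [← h']; exact hS _ (hsgnS φ.1 x (openSquare_subset hx) φ.2)
      rcases ht.1.eq_or_lt with h0 | h0
      · subst h0
        exact (hA0 w').2 φ.1 x hx (congrArg Prod.snd h')
      · rcases ht.2.eq_or_lt with h1 | h1
        · subst h1
          exact (hA1 w').2 φ.1 x hx (congrArg Prod.snd h')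
        · exact hAB w' t ⟨h0, h1⟩ hFB
    · have h' : G w x = e ε t := h
      refine hGB w x hx ?_
      rw [h']
      exact hXB (hebX ε.1 t ht)
    · exact hGA w x hx w' t ht h
  · rintro (φ | w) x hx hx'
    · have hXx : H φ.1 x ∈ ⋃ j, γ j '' Icc 0 1 := by
        obtain ⟨d, t, ht, rfl⟩ := exists_side hx hx'
        exact mem_iUnion.2 ⟨(φ.1, d), t, ht, rfl⟩
      rcases hcovS _ (hsgnS φ.1 x hx φ.2) hXx with h | ⟨ε, t, ht, h⟩
      · exact Or.inl h
      · exact Or.inr ⟨Sum.inl ε, t, ht, h⟩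
    · rcases hGb w x hx hx' with ⟨h1, h2⟩ | ⟨w', t, ht, h⟩
      · rcases hcovS _ h1 (hX _ (hS _ h1) h2) with h | ⟨ε, t, ht, h⟩
        · exact Or.inl h
        · exact Or.inr ⟨Sum.inl ε, t, ht, h⟩
      · exact Or.inr ⟨Sum.inr w', t, ht, h⟩
  · rintro ⟨q, hq, -⟩
    rw [hP]; exact Or.inl hq
  · rintro (ε | w) t ht
    · rw [hP]; exact Or.inl (heS ε t ht)
    · exact hAP w t ht
  · rintro (φ | w) x hx
    · rw [hP]; exact Or.inl (hsgnS φ.1 x hx φ.2)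
    · rw [hP]; exact Or.inr (mem_iUnion.2 ⟨w, x, hx, rfl⟩)
  · intro q hq
    rw [hP] at hq
    rcases hq with hq | hq
    · by_cases h : ∀ φ, ∀ x ∈ openSquare, H φ x ≠ q.2
      · rcases hcovS q hq (hX q.2 (hS q hq) h) with h | ⟨ε, s, hs, h⟩
        · exact Or.inl h
        · exact Or.inr (Or.inl ⟨Sum.inl ε, s, hs, h⟩)
      · push Not at h
        obtain ⟨φ, x, hx, h⟩ := h
        obtain ⟨z, p⟩ := q
        simp only at h
        subst h
        obtain ⟨c, hc⟩ := hSsgn φ x (openSquare_subset hx) z hq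
        exact Or.inr (Or.inr ⟨Sum.inl (φ, c), x, openSquare_subset hx, Prod.ext hc rfl⟩)
    · obtain ⟨w, x, hx, rfl⟩ := mem_iUnion.1 hq
      exact Or.inr (Or.inr ⟨Sum.inr w, x, hx, rfl⟩)

/-! ### The gap function and the zero set of the hooks -/

lemma smoothTransition_strictMonoOn : StrictMonoOn Real.smoothTransition (Icc 0 1) := by
  intro x hx y hy hxy
  have hpos : ∀ z, 0 < expNegInvGlue z + expNegInvGlue (1 - z) := Real.smoothTransition.pos_denom
  have h1 : expNegInvGlue x < expNegInvGlue y := by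
    have hy0 : 0 < y := hx.1.trans_lt hxy
    rcases hx.1.eq_or_lt with h | h
    · rw [← h, expNegInvGlue.zero]; exact expNegInvGlue.pos_of_pos hy0
    · simp only [expNegInvGlue, not_le.2 h, not_le.2 hy0, if_false]
      exact Real.exp_lt_exp.2 (neg_lt_neg (inv_strictAnti₀ h hxy))
  have h2 : expNegInvGlue (1 - y) ≤ expNegInvGlue (1 - x) :=
    expNegInvGlue.monotone (by linarith)
  have h3 : 0 < expNegInvGlue (1 - x) := expNegInvGlue.pos_of_pos (by linarith [hy.2])
  have h4 := expNegInvGlue.nonneg x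
  have h5 := expNegInvGlue.nonneg (1 - y)
  unfold Real.smoothTransition
  rw [div_lt_div_iff₀ (hpos x) (hpos y)]
  nlinarith

lemma gap_eq_left {a : ℝ} (h : a ≤ 13 / 16) : gap a = Real.smoothTransition (16 * a - 2) := by
  rw [gap, Real.smoothTransition.one_of_one_le (x := 14 - 16 * a) (by linarith), mul_one]

lemma gap_nonneg (a : ℝ) : 0 ≤ gap a :=
  mul_nonneg (Real.smoothTransition.nonneg _) (Real.smoothTransition.nonneg _)

lemma gap_le_one (a : ℝ) : gap a ≤ 1 :=
  mul_le_one₀ (Real.smoothTransition.le_one _) (Real.smoothTransition.nonneg _)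
    (Real.smoothTransition.le_one _)

lemma gap_symm (a : ℝ) : gap (1 - a) = gap a := by
  unfold gap
  rw [mul_comm]
  congr 2 <;> ring

lemma continuous_gap : Continuous gap := by
  have := Real.smoothTransition.continuous
  unfold gap; fun_prop

lemma gap_pos_iff {a : ℝ} : 0 < gap a ↔ 1 / 8 < a ∧ a < 7 / 8 := by
  constructor
  · intro h
    constructor <;> by_contra hcon
    · rw [gap, Real.smoothTransition.zero_of_nonpos (x := 16 * a - 2) (by linarith)] at h
      simp at h
    · rw [gap, Real.smoothTransition.zero_of_nonpos (x := 14 - 16 * a) (by linarith)] at h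
      simp at h
  · rintro ⟨h1, h2⟩
    exact mul_pos (Real.smoothTransition.pos_of_pos (by linarith))
      (Real.smoothTransition.pos_of_pos (by linarith))

lemma gap_eq_zero {a : ℝ} (h : a ≤ 1 / 8 ∨ 7 / 8 ≤ a) : gap a = 0 := by
  refine le_antisymm (not_lt.1 fun h' => ?_) (gap_nonneg a)
  have := gap_pos_iff.1 h'
  rcases h with h | h <;> linarith [this.1, this.2]

lemma gap_eq_one {a : ℝ} (h1 : 3 / 16 ≤ a) (h2 : a ≤ 13 / 16) : gap a = 1 := by
  rw [gap_eq_left h2, Real.smoothTransition.one_of_one_le (by linarith)]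

lemma gap_mono_left {a a' : ℝ} (h : a ≤ a') (h' : a' ≤ 13 / 16) : gap a ≤ gap a' := by
  rw [gap_eq_left h', gap_eq_left (h.trans h')]
  exact Real.smoothTransition.monotone (by linarith)

/-- `gap` increases strictly on `[1/8, 3/16]` and stays at 1 up to `13/16`, so on this side it grows
strictly from any value below 1. -/
lemma gap_strict_left {a a' : ℝ} (h0 : 1 / 8 ≤ a) (h : a < a') (h' : a' ≤ 13 / 16)
    (h1 : gap a < 1) : gap a < gap a' := by
  have ha : a < 3 / 16 := by
    by_contra hcon
    exact h1.ne (gap_eq_one (not_lt.1 hcon) (h.le.trans h'))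
  rcases lt_or_ge a' (3 / 16) with h2 | h2
  · rw [gap_eq_left h', gap_eq_left (h.le.trans h')]
    exact smoothTransition_strictMonoOn ⟨by linarith, by linarith⟩ ⟨by linarith, by linarith⟩
      (by linarith)
  · rwa [gap_eq_one h2 h']

lemma gap_mono_right {a a' : ℝ} (h : a ≤ a') (h' : 3 / 16 ≤ a) : gap a' ≤ gap a := by
  rw [← gap_symm a, ← gap_symm a']
  exact gap_mono_left (by linarith) (by linarith)

lemma gap_strict_right {a a' : ℝ} (h0 : a' ≤ 7 / 8) (h : a < a') (h' : 3 / 16 ≤ a)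
    (h1 : gap a' < 1) : gap a' < gap a := by
  rw [← gap_symm a, ← gap_symm a']
  exact gap_strict_left (by linarith) (by linarith) (by linarith) (by rwa [gap_symm])

/-- The progress of the transformation in the square of each kind. -/
def prog (c d b : ℝ) : ℝ := Real.smoothTransition (c * b - d)

lemma prog_nonneg (c d b : ℝ) : 0 ≤ prog c d b := Real.smoothTransition.nonneg _

lemma prog_le_one (c d b : ℝ) : prog c d b ≤ 1 := Real.smoothTransition.le_one _

lemma prog_pos_iff {c d b : ℝ} : 0 < prog c d b ↔ d < c * b := by
  rw [prog, (Real.smoothTransition.nonneg _).lt_iff_ne, ne_comm, Ne,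
    Real.smoothTransition.zero_iff_nonpos]
  constructor <;> intro h <;> [(have := not_le.1 h; linarith); (push Not; linarith)]

lemma prog_lt_one_iff {c d b : ℝ} : prog c d b < 1 ↔ c * b < d + 1 := by
  rw [prog, (Real.smoothTransition.le_one _).lt_iff_ne, Ne,
    Real.smoothTransition.eq_one_iff_one_le]
  constructor <;> intro h <;> [(have := not_le.1 h; linarith); (push Not; linarith)]

lemma prog_eq_zero {c d b : ℝ} (h : c * b ≤ d) : prog c d b = 0 :=
  Real.smoothTransition.zero_of_nonpos (by linarith)

lemma prog_eq_one {c d b : ℝ} (h : d + 1 ≤ c * b) : prog c d b = 1 :=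
  Real.smoothTransition.one_of_one_le (by linarith)

lemma prog_mono {c d b b' : ℝ} (hc : 0 ≤ c) (h : b ≤ b') : prog c d b ≤ prog c d b' :=
  Real.smoothTransition.monotone (by nlinarith)

/-- `hne` says that the two times are neither both before nor both after the transformation. -/
lemma prog_strict {c d b b' : ℝ} (hc : 0 < c) (h : b < b')
    (hne : d < c * b' ∧ c * b < d + 1) : prog c d b < prog c d b' := by
  have hcb : c * b < c * b' := mul_lt_mul_of_pos_left h hc
  rcases lt_or_ge (c * b) d with h2 | h2
  · rw [prog_eq_zero h2.le]; exact prog_pos_iff.2 hne.1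
  rcases lt_or_ge (d + 1) (c * b') with h3 | h3
  · rw [prog_eq_one h3.le]; exact prog_lt_one_iff.2 hne.2
  exact smoothTransition_strictMonoOn ⟨by linarith, by linarith⟩ ⟨by linarith, by linarith⟩
    (by linarith)

lemma continuous_prog (c d : ℝ) : Continuous (prog c d) := by
  have := Real.smoothTransition.continuous
  unfold prog; fun_prop

namespace Piece

/-- The pieces that contain a part of the `τ`-chart. -/
def IsTau : Piece → Prop
  | tauEdge => True
  | blackTau => True
  | mixed _ => True
  | trivalentTau => True
  | _ => False

/-- The gap between the two sheets. -/
def gapFun : Piece → ℝ × ℝ → ℝ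
  | tauEdge, x => gap x.1
  | blackTau, x => (1 - prog 4 2 x.2) * gap x.1
  | mixed _, x => (1 - prog 16 14 x.2) * gap x.1 + prog 16 14 x.2 * gap (2 * x.1 - 1)
  | trivalentTau, x => (1 - prog 8 1 x.2) * (gap (2 * x.1) + gap (2 * x.1 - 1)) +
      prog 8 1 x.2 * gap x.1
  | _, _ => 0

/-- The direction of the two sheets. -/
def dir : Piece → ℝ × ℝ → ℂ
  | mixed ε, x => rot ε (twist (2 * x.1))
  | sigmaEdge ε, x => rot ε (twist x.1)
  | _, _ => 1

/-- The pieces other than a black `σ`-vertex. -/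
def IsPlain : Piece → Prop
  | blackSigma _ => False
  | _ => True

lemma IsTau.isPlain {κ : Piece} (h : κ.IsTau) : κ.IsPlain := by
  cases κ <;> trivial

lemma fibre_eq {κ : Piece} (h : κ.IsPlain) (x : ℝ × ℝ) :
    κ.fibre x = pair (κ.gapFun x) (κ.dir x) := by
  cases κ <;> first | exact h.elim | rfl

lemma continuous_gapFun (κ : Piece) : Continuous κ.gapFun := by
  have h1 := continuous_gap
  have h2 := fun c d => continuous_prog c d
  cases κ <;> unfold gapFun <;> fun_prop

lemma gapFun_nonneg (κ : Piece) (x : ℝ × ℝ) : 0 ≤ κ.gapFun x := by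
  have h1 := gap_nonneg
  have h2 := fun c d b => sub_nonneg.2 (prog_le_one c d b)
  have h3 := prog_nonneg
  cases κ <;> simp only [gapFun]
  · exact le_rfl
  · exact le_rfl
  · exact h1 _
  · exact le_rfl
  · exact mul_nonneg (h2 _ _ _) (h1 _)
  · exact add_nonneg (mul_nonneg (h2 _ _ _) (h1 _)) (mul_nonneg (h3 _ _ _) (h1 _))
  · exact add_nonneg (mul_nonneg (h2 _ _ _) (add_nonneg (h1 _) (h1 _)))
      (mul_nonneg (h3 _ _ _) (h1 _))

lemma mul_pos_iff_of_nonneg {a b : ℝ} (ha : 0 ≤ a) (hb : 0 ≤ b) : 0 < a * b ↔ 0 < a ∧ 0 < b :=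
  ⟨fun h => ⟨ha.lt_of_ne (by rintro rfl; simp at h), hb.lt_of_ne (by rintro rfl; simp at h)⟩,
    fun h => mul_pos h.1 h.2⟩

lemma add_pos_iff_of_nonneg {a b : ℝ} (ha : 0 ≤ a) (hb : 0 ≤ b) : 0 < a + b ↔ 0 < a ∨ 0 < b := by
  constructor
  · intro h
    by_contra hcon
    push Not at hcon
    linarith
  · rintro (h | h) <;> linarith

/-- The rectangles where the gap is positive. -/
def posSet : Piece → Set (ℝ × ℝ)
  | tauEdge => {x | 1 / 8 < x.1 ∧ x.1 < 7 / 8}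
  | blackTau => {x | x.2 < 3 / 4 ∧ 1 / 8 < x.1 ∧ x.1 < 7 / 8}
  | mixed _ => {x | (x.2 < 15 / 16 ∧ 1 / 8 < x.1 ∧ x.1 < 7 / 8) ∨
      (7 / 8 < x.2 ∧ 9 / 16 < x.1 ∧ x.1 < 15 / 16)}
  | trivalentTau => {x | (x.2 < 1 / 4 ∧ ((1 / 16 < x.1 ∧ x.1 < 7 / 16) ∨
      (9 / 16 < x.1 ∧ x.1 < 15 / 16))) ∨ (1 / 8 < x.2 ∧ 1 / 8 < x.1 ∧ x.1 < 7 / 8)}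
  | _ => ∅

/-- All terms are nonnegative, so a sum is positive when some product is, and a product when both
factors are. This turns the condition into inequalities between coordinates. -/
lemma gapFun_pos_iff (κ : Piece) (x : ℝ × ℝ) : 0 < κ.gapFun x ↔ x ∈ κ.posSet := by
  have h1 := gap_nonneg
  have h2 := fun c d b => sub_nonneg.2 (prog_le_one c d b)
  have h3 := prog_nonneg
  cases κ <;> simp only [gapFun, posSet]
  · simp
  · simp
  · exact gap_pos_iff
  · simp
  · rw [mul_pos_iff_of_nonneg (h2 _ _ _) (h1 _), sub_pos, prog_lt_one_iff, gap_pos_iff]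
    simp only [mem_ofPred_eq]
    grind
  · rw [add_pos_iff_of_nonneg (mul_nonneg (h2 _ _ _) (h1 _)) (mul_nonneg (h3 _ _ _) (h1 _)),
      mul_pos_iff_of_nonneg (h2 _ _ _) (h1 _), mul_pos_iff_of_nonneg (h3 _ _ _) (h1 _), sub_pos,
      prog_lt_one_iff, prog_pos_iff, gap_pos_iff, gap_pos_iff]
    simp only [mem_ofPred_eq]
    grind
  · rw [add_pos_iff_of_nonneg (mul_nonneg (h2 _ _ _) (add_nonneg (h1 _) (h1 _)))
      (mul_nonneg (h3 _ _ _) (h1 _)),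
      mul_pos_iff_of_nonneg (h2 _ _ _) (add_nonneg (h1 _) (h1 _)),
      mul_pos_iff_of_nonneg (h3 _ _ _) (h1 _), add_pos_iff_of_nonneg (h1 _) (h1 _), sub_pos,
      prog_lt_one_iff, prog_pos_iff, gap_pos_iff, gap_pos_iff, gap_pos_iff]
    simp only [mem_ofPred_eq]
    grind

end Piece

/-! ### Rectangles that tile the zero set of the gap -/

/-- A rectangle `[a₀, a₁] × [b₀, b₁]` labelled with a piece. -/
structure Rect where
  a₀ : ℝ
  a₁ : ℝ
  b₀ : ℝ
  b₁ : ℝ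
  piece : Piece

namespace Rect

/-- The affine map from the square to the rectangle. -/
def toFun (r : Rect) (x : ℝ × ℝ) : ℝ × ℝ :=
  (r.a₀ + x.1 * (r.a₁ - r.a₀), r.b₀ + x.2 * (r.b₁ - r.b₀))

/-- The rectangle as a set. -/
def carrier (r : Rect) : Set (ℝ × ℝ) := Icc r.a₀ r.a₁ ×ˢ Icc r.b₀ r.b₁

/-- A nondegenerate rectangle in the square. -/
def Good (r : Rect) : Prop := 0 ≤ r.a₀ ∧ r.a₀ < r.a₁ ∧ r.a₁ ≤ 1 ∧ 0 ≤ r.b₀ ∧ r.b₀ < r.b₁ ∧ r.b₁ ≤ 1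

variable {r : Rect}

lemma Good.image_square (h : r.Good) : r.toFun '' square = r.carrier := by
  obtain ⟨h1, h2, h3, h4, h5, h6⟩ := h
  ext ⟨a, b⟩
  simp only [carrier, mem_image, mem_prod, square, Prod.exists, toFun, Prod.mk.injEq, mem_Icc]
  constructor
  · rintro ⟨s, t, ⟨⟨k1, k2⟩, k3, k4⟩, rfl, rfl⟩
    refine ⟨⟨?_, ?_⟩, ?_, ?_⟩ <;> nlinarith
  · rintro ⟨⟨k1, k2⟩, k3, k4⟩
    have p1 : 0 < r.a₁ - r.a₀ := by linarith
    have p2 : 0 < r.b₁ - r.b₀ := by linarith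
    refine ⟨(a - r.a₀) / (r.a₁ - r.a₀), (b - r.b₀) / (r.b₁ - r.b₀), ⟨⟨?_, ?_⟩, ?_, ?_⟩, ?_, ?_⟩
    · exact div_nonneg (by linarith) p1.le
    · rw [div_le_one p1]; linarith
    · exact div_nonneg (by linarith) p2.le
    · rw [div_le_one p2]; linarith
    · field_simp; ring
    · field_simp; ring

lemma Good.mem_carrier (h : r.Good) {x : ℝ × ℝ} (hx : x ∈ square) : r.toFun x ∈ r.carrier := by
  rw [← h.image_square]; exact mem_image_of_mem _ hx

lemma Good.mem_open (h : r.Good) {x : ℝ × ℝ} (hx : x ∈ openSquare) :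
    r.toFun x ∈ Ioo r.a₀ r.a₁ ×ˢ Ioo r.b₀ r.b₁ := by
  obtain ⟨h1, h2, h3, h4, h5, h6⟩ := h
  simp only [openSquare, mem_prod, mem_Ioo, toFun] at *
  obtain ⟨⟨k1, k2⟩, k3, k4⟩ := hx
  refine ⟨⟨?_, ?_⟩, ?_, ?_⟩ <;> nlinarith

lemma Good.carrier_subset (h : r.Good) : r.carrier ⊆ square := by
  obtain ⟨h1, h2, h3, h4, h5, h6⟩ := h
  exact prod_mono (Icc_subset_Icc h1 h3) (Icc_subset_Icc h4 h6)

lemma Good.injective (h : r.Good) : Function.Injective r.toFun := by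
  obtain ⟨h1, h2, h3, h4, h5, h6⟩ := h
  intro x y hxy
  simp only [toFun, Prod.mk.injEq, add_right_inj] at hxy
  exact Prod.ext (mul_right_cancel₀ (by linarith) hxy.1) (mul_right_cancel₀ (by linarith) hxy.2)

lemma continuous_toFun : Continuous r.toFun := by
  unfold toFun; fun_prop

lemma convex_carrier : Convex ℝ r.carrier := (convex_Icc _ _).prod (convex_Icc _ _)

/-- The interiors of two rectangles are separated by a line. -/
def Sep (r r' : Rect) : Prop := r.a₁ ≤ r'.a₀ ∨ r'.a₁ ≤ r.a₀ ∨ r.b₁ ≤ r'.b₀ ∨ r'.b₁ ≤ r.b₀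

lemma Sep.symm {r r' : Rect} (h : r.Sep r') : r'.Sep r := by
  unfold Sep at *; tauto

lemma Sep.notMem {r r' : Rect} (hr : r.Good) (h : r.Sep r') {x : ℝ × ℝ}
    (hx : x ∈ openSquare) : r.toFun x ∉ r'.carrier := by
  rintro ⟨⟨h1, h2⟩, h3, h4⟩
  obtain ⟨⟨k1, k2⟩, k3, k4⟩ := hr.mem_open hx
  rcases h with h | h | h | h <;> linarith

end Rect

namespace Piece

/-- The rectangles that make up the part of the square where the gap is zero, with the model charts
that they carry. -/
def rects : Piece → List Rect
  | tauEdge => [⟨0, 1 / 8, 0, 1, empty⟩, ⟨7 / 8, 1, 0, 1, empty⟩]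
  | blackTau => [⟨0, 1 / 8, 0, 3 / 4, empty⟩, ⟨7 / 8, 1, 0, 3 / 4, empty⟩, ⟨0, 1, 3 / 4, 1, empty⟩]
  | mixed ε => [⟨0, 1 / 8, 0, 15 / 16, empty⟩, ⟨0, 1 / 2, 15 / 16, 1, sigmaEdge ε⟩,
      ⟨1 / 2, 9 / 16, 15 / 16, 1, empty⟩, ⟨7 / 8, 1, 0, 7 / 8, empty⟩,
      ⟨15 / 16, 1, 7 / 8, 1, empty⟩]
  | trivalentTau => [⟨0, 1 / 16, 0, 1 / 4, empty⟩, ⟨0, 1 / 8, 1 / 4, 1, empty⟩,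
      ⟨7 / 16, 9 / 16, 0, 1 / 8, empty⟩, ⟨15 / 16, 1, 0, 1 / 4, empty⟩,
      ⟨7 / 8, 1, 1 / 4, 1, empty⟩]
  | κ => [⟨0, 1, 0, 1, κ⟩]

lemma rects_good (κ : Piece) : ∀ r ∈ κ.rects, r.Good := by
  cases κ <;> simp [rects, Rect.Good] <;> norm_num

lemma rects_pairwise (κ : Piece) : κ.rects.Pairwise Rect.Sep := by
  cases κ <;> simp [rects, Rect.Sep] <;> norm_num

lemma mem_rects_iff (κ : Piece) {x : ℝ × ℝ} (hx : x ∈ square) :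
    (∃ r ∈ κ.rects, x ∈ r.carrier) ↔ x ∉ κ.posSet := by
  obtain ⟨a, b⟩ := x
  simp only [square, mem_prod, mem_Icc] at hx
  obtain ⟨⟨h1, h2⟩, h3, h4⟩ := hx
  cases κ <;> simp only [rects, Rect.carrier, posSet, List.mem_cons, List.not_mem_nil, or_false,
    exists_eq_or_imp, exists_eq_left, mem_prod, mem_Icc, mem_ofPred_eq, mem_empty_iff_false,
    not_false_eq_true, h1, h2, h3, h4, true_and, and_true]
  all_goals grind

lemma gapFun_eq_zero_of_mem {κ : Piece} {r : Rect} (hr : r ∈ κ.rects) {x : ℝ × ℝ}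
    (hx : x ∈ r.carrier) : κ.gapFun x = 0 := by
  refine le_antisymm (not_lt.1 fun h => ?_) (κ.gapFun_nonneg x)
  rw [gapFun_pos_iff] at h
  exact (κ.mem_rects_iff ((rects_good κ r hr).carrier_subset hx)).1 ⟨r, hr, hx⟩ h

lemma pair_neg (g : ℝ) (u : ℂ) : pair g (-u) = pair g u := by
  ext z
  constructor
  · rintro ⟨x, hx, rfl⟩; exact ⟨-x, by rw [neg_sq, hx], by push_cast; ring⟩
  · rintro ⟨x, hx, rfl⟩; exact ⟨-x, by rw [neg_sq, hx], by push_cast; ring⟩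

lemma rot_zero (ε : ℤˣ) : rot ε 0 = 1 := by simp [rot]

lemma rot_one (ε : ℤˣ) : rot ε 1 = -1 := by
  rcases Int.units_eq_one_or ε with rfl | rfl
  · simp [rot, Complex.exp_pi_mul_I]
  · simp only [rot]
    rw [show (((-1 : ℤˣ) : ℤ) : ℂ) * Real.pi * ((1 : ℝ) : ℂ) * Complex.I = -(Real.pi * Complex.I) by
      push_cast; ring, Complex.exp_neg, Complex.exp_pi_mul_I]
    norm_num

lemma twist_eq_zero {a : ℝ} (h : a ≤ 3 / 8) : twist a = 0 :=
  Real.smoothTransition.zero_of_nonpos (by linarith)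

lemma twist_eq_one {a : ℝ} (h : 5 / 8 ≤ a) : twist a = 1 :=
  Real.smoothTransition.one_of_one_le (by linarith)

lemma rects_of_not_isTau {κ : Piece} (h : ¬ κ.IsTau) : κ.rects = [⟨0, 1, 0, 1, κ⟩] := by
  cases κ <;> first | rfl | exact absurd trivial h

lemma toFun_unit (κ : Piece) (x : ℝ × ℝ) : Rect.toFun ⟨0, 1, 0, 1, κ⟩ x = x := by
  simp [Rect.toFun]

lemma rects_not_isTau {κ : Piece} : ∀ r ∈ κ.rects, ¬ r.piece.IsTau := by
  cases κ <;> simp [rects, IsTau]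

/-- On the zero set of the gap only the direction of the sheets matters, and it is constant for all
`τ`-pieces but the mixed one. There the half twist takes place over `3/16 ≤ a ≤ 5/16`, which meets
the zero set only in `[0, 1/2] × [15/16, 1]`, the rectangle labelled `sigmaEdge`. In the rectangles
further right the direction is `-1`, which gives the same pair as `1`. -/
lemma fibre_rect {κ : Piece} {r : Rect} (hr : r ∈ κ.rects) {x : ℝ × ℝ} (hx : x ∈ square) :
    r.piece.fibre x = κ.fibre (r.toFun x) := by
  by_cases hκ : κ.IsTau
  · rw [fibre_eq hκ.isPlain, gapFun_eq_zero_of_mem hr ((rects_good κ r hr).mem_carrier hx)]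
    obtain ⟨a, b⟩ := x
    simp only [square, mem_prod, mem_Icc] at hx
    obtain ⟨⟨h1, h2⟩, h3, h4⟩ := hx
    cases κ <;> simp only [IsTau] at hκ <;> simp only [rects, List.mem_cons, List.not_mem_nil,
      or_false] at hr
    · rcases hr with rfl | rfl <;> rfl
    · rcases hr with rfl | rfl | rfl <;> rfl
    · rename_i ε
      rcases hr with rfl | rfl | rfl | rfl | rfl <;> simp only [dir, Rect.toFun, fibre]
      · rw [twist_eq_zero (by linarith), rot_zero]
      · congr 3; ring
      · rw [twist_eq_one (by linarith), rot_one, pair_neg]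
      · rw [twist_eq_one (by linarith), rot_one, pair_neg]
      · rw [twist_eq_one (by linarith), rot_one, pair_neg]
    · rcases hr with rfl | rfl | rfl | rfl | rfl <;> rfl
  · rw [rects_of_not_isTau hκ, List.mem_singleton] at hr
    subst hr
    rw [toFun_unit]

lemma mem_segment_iff {p q₁ p' q₂ : ℝ} (h : q₁ < q₂) (x : ℝ × ℝ) :
    x ∈ segment ℝ (p, q₁) (p', q₂) ↔
      (q₁ ≤ x.2 ∧ x.2 ≤ q₂) ∧ (x.1 - p) * (q₂ - q₁) = (p' - p) * (x.2 - q₁) := by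
  rw [segment_eq_image_lineMap]
  obtain ⟨a, b⟩ := x
  have h' : 0 < q₂ - q₁ := by linarith
  simp only [AffineMap.lineMap_apply, mem_image, mem_Icc, vsub_eq_sub, vadd_eq_add, Prod.mk_sub_mk,
    Prod.smul_mk, smul_eq_mul, Prod.mk_add_mk, Prod.mk.injEq]
  constructor
  · rintro ⟨t, ⟨ht0, ht1⟩, rfl, rfl⟩
    refine ⟨⟨?_, ?_⟩, by ring⟩ <;> nlinarith
  · rintro ⟨⟨h1, h2⟩, h3⟩
    refine ⟨(b - q₁) / (q₂ - q₁), ⟨div_nonneg (by linarith) h'.le, ?_⟩, ?_, ?_⟩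
    · rw [div_le_one h']; linarith
    · field_simp; linarith
    · field_simp; ring

/-- Coordinates of the part of the `τ`-chart in the square. -/
lemma mem_tauSet_iff (κ : Piece) (x : ℝ × ℝ) : x ∈ κ.tauSet ↔ match κ with
    | tauEdge => (0 ≤ x.2 ∧ x.2 ≤ 1) ∧ x.1 = 1 / 2
    | blackTau => (0 ≤ x.2 ∧ x.2 ≤ 1 / 2) ∧ x.1 = 1 / 2
    | mixed _ => ((0 ≤ x.2 ∧ x.2 ≤ 1 / 2) ∧ x.1 = 1 / 2 - x.2 / 2) ∨
        ((1 / 2 ≤ x.2 ∧ x.2 ≤ 1) ∧ x.1 = x.2 - 1 / 4)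
    | trivalentTau => (((0 ≤ x.2 ∧ x.2 ≤ 1 / 2) ∧ x.1 = 1 / 4 + x.2 / 2) ∨
        ((0 ≤ x.2 ∧ x.2 ≤ 1 / 2) ∧ x.1 = 3 / 4 - x.2 / 2)) ∨
        ((1 / 2 ≤ x.2 ∧ x.2 ≤ 1) ∧ x.1 = 1 / 2)
    | _ => False := by
  cases κ <;> simp only [tauSet, mem_empty_iff_false]
  · rw [mem_segment_iff (by norm_num)]; grind
  · rw [mem_segment_iff (by norm_num)]; grind
  · rw [mem_union, mem_segment_iff (by norm_num), mem_segment_iff (by norm_num)]; grind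
  · rw [mem_union, mem_union, mem_segment_iff (by norm_num), mem_segment_iff (by norm_num),
      mem_segment_iff (by norm_num)]; grind

/-- Before and after a transition one gap pattern counts, and it is 1 on the `τ`-chart; during a
transition the chart runs where both interpolated patterns are 1. -/
lemma gapFun_eq_one_of_mem_tauSet {κ : Piece} {x : ℝ × ℝ} (hx : x ∈ κ.tauSet) : κ.gapFun x = 1 := by
  rw [mem_tauSet_iff] at hx
  cases κ <;> simp only [gapFun] at *
  · exact gap_eq_one (by linarith [hx.2]) (by linarith [hx.2])
  · rw [prog_eq_zero (by linarith), gap_eq_one (by linarith [hx.2]) (by linarith [hx.2])]; norm_num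
  · rcases hx with ⟨h, h'⟩ | ⟨h, h'⟩
    · rw [prog_eq_zero (by linarith), gap_eq_one (by linarith) (by linarith)]; norm_num
    · rcases le_total x.2 (7 / 8) with h2 | h2
      · rw [prog_eq_zero (by linarith), gap_eq_one (by linarith) (by linarith)]; norm_num
      · rw [gap_eq_one (by linarith) (by linarith), gap_eq_one (by linarith) (by linarith)]
        ring
  · rcases hx with (⟨h, h'⟩ | ⟨h, h'⟩) | ⟨h, h'⟩
    · rcases le_total x.2 (1 / 8) with h2 | h2
      · rw [prog_eq_zero (by linarith), gap_eq_one (a := 2 * x.1) (by linarith) (by linarith),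
          gap_eq_zero (a := 2 * x.1 - 1) (by left; linarith)]; norm_num
      · rcases le_total x.2 (1 / 4) with h3 | h3
        · rw [gap_eq_one (a := 2 * x.1) (by linarith) (by linarith),
            gap_eq_zero (a := 2 * x.1 - 1) (by left; linarith),
            gap_eq_one (a := x.1) (by linarith) (by linarith)]; ring
        · rw [prog_eq_one (by linarith), gap_eq_one (a := x.1) (by linarith) (by linarith)]; norm_num
    · rcases le_total x.2 (1 / 8) with h2 | h2
      · rw [prog_eq_zero (by linarith), gap_eq_zero (a := 2 * x.1) (by right; linarith),
          gap_eq_one (a := 2 * x.1 - 1) (by linarith) (by linarith)]; norm_num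
      · rcases le_total x.2 (1 / 4) with h3 | h3
        · rw [gap_eq_zero (a := 2 * x.1) (by right; linarith),
            gap_eq_one (a := 2 * x.1 - 1) (by linarith) (by linarith),
            gap_eq_one (a := x.1) (by linarith) (by linarith)]; ring
        · rw [prog_eq_one (by linarith), gap_eq_one (a := x.1) (by linarith) (by linarith)]; norm_num
    · rw [prog_eq_one (by linarith), gap_eq_one (a := x.1) (by linarith) (by linarith)]; norm_num

lemma tauSet_subset_posSet (κ : Piece) : κ.tauSet ⊆ κ.posSet := fun x hx => by
  rw [← gapFun_pos_iff, gapFun_eq_one_of_mem_tauSet hx]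
  exact one_pos

lemma tauSet_eq_empty {κ : Piece} (h : ¬ κ.IsTau) : κ.tauSet = ∅ := by
  cases κ <;> first | rfl | exact absurd trivial h

lemma posSet_eq_empty {κ : Piece} (h : ¬ κ.IsTau) : κ.posSet = ∅ := by
  cases κ <;> first | rfl | exact absurd trivial h

lemma notMem_tauSet_of_rect {κ : Piece} {r : Rect} (hr : r ∈ κ.rects) {x : ℝ × ℝ}
    (hx : x ∈ r.carrier) : x ∉ κ.tauSet := fun h => by
  have h1 := gapFun_eq_one_of_mem_tauSet h
  rw [gapFun_eq_zero_of_mem hr hx] at h1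
  exact zero_ne_one h1

lemma vertexSet_rect {κ : Piece} {r : Rect} (hr : r ∈ κ.rects) {x : ℝ × ℝ} (hx : x ∈ square) :
    r.toFun x ∈ κ.vertexSet ↔ x ∈ r.piece.vertexSet := by
  by_cases hκ : κ.IsTau
  · obtain ⟨a, b⟩ := x
    simp only [square, mem_prod, mem_Icc] at hx
    obtain ⟨⟨h1, h2⟩, h3, h4⟩ := hx
    cases κ <;> simp only [IsTau] at hκ <;> simp only [rects, List.mem_cons, List.not_mem_nil,
      or_false] at hr
    · rcases hr with rfl | rfl <;> simp [vertexSet]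
    · rcases hr with rfl | rfl | rfl <;> simp [vertexSet, Rect.toFun] <;> intros <;> linarith
    · rcases hr with rfl | rfl | rfl | rfl | rfl <;> simp [vertexSet, Rect.toFun] <;> intros <;> linarith
    · rcases hr with rfl | rfl | rfl | rfl | rfl <;> simp [vertexSet, Rect.toFun] <;> intros <;> linarith
  · rw [rects_of_not_isTau hκ, List.mem_singleton] at hr
    subst hr
    rw [toFun_unit]

lemma sigmaArc_rect {κ : Piece} {r : Rect} (hr : r ∈ κ.rects) {x : ℝ × ℝ} (hx : x ∈ square) :
    (∃ a ∈ κ.sigmaArc, r.toFun x ∈ a.2 '' Icc 0 1) ↔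
      ∃ a ∈ r.piece.sigmaArc, x ∈ a.2 '' Icc 0 1 := by
  by_cases hκ : κ.IsTau
  · obtain ⟨a, b⟩ := x
    simp only [square, mem_prod, mem_Icc] at hx
    obtain ⟨⟨h1, h2⟩, h3, h4⟩ := hx
    cases κ <;> simp only [IsTau] at hκ <;> simp only [rects, List.mem_cons, List.not_mem_nil,
      or_false] at hr
    · rcases hr with rfl | rfl <;> simp [sigmaArc]
    · rcases hr with rfl | rfl | rfl <;> simp [sigmaArc]
    · rename_i ε
      rcases hr with rfl | rfl | rfl | rfl | rfl <;>
        simp only [sigmaArc, Rect.toFun, Option.mem_def, Option.some.injEq, exists_eq_left',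
          mem_image, mem_Icc, Prod.mk.injEq, reduceCtorEq, false_and, exists_false, iff_false,
          not_exists, not_and]
      · intro t ht h; exfalso; linarith
      · constructor
        · rintro ⟨t, ht, h, h'⟩; exact ⟨b, ⟨h3, h4⟩, by linarith, rfl⟩
        · rintro ⟨t, ht, h, h'⟩
          exact ⟨7 / 8 + b / 8, ⟨by linarith, by linarith⟩, by linarith, by ring⟩
      · intro t ht h; exfalso; linarith
      · intro t ht h; exfalso; linarith
      · intro t ht h; exfalso; linarith
    · rcases hr with rfl | rfl | rfl | rfl | rfl <;> simp [sigmaArc]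
  · rw [rects_of_not_isTau hκ, List.mem_singleton] at hr
    subst hr
    rw [toFun_unit]

lemma exists_subarc {κ : Piece} {r : Rect} (hr : r ∈ κ.rects) {a : ℤˣ × (ℝ → ℝ × ℝ)}
    (ha : a ∈ r.piece.sigmaArc) : ∃ a' ∈ κ.sigmaArc, a'.1 = a.1 ∧ ∃ t₀ t₁ : ℝ, 0 ≤ t₀ ∧ t₀ < t₁ ∧
      t₁ ≤ 1 ∧ ∀ t, r.toFun (a.2 t) = a'.2 (t₀ + t * (t₁ - t₀)) := by
  by_cases hκ : κ.IsTau
  · cases κ <;> simp only [IsTau] at hκ <;> simp only [rects, List.mem_cons, List.not_mem_nil,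
      or_false] at hr
    · rcases hr with rfl | rfl <;> simp [sigmaArc] at ha
    · rcases hr with rfl | rfl | rfl <;> simp [sigmaArc] at ha
    · rename_i ε
      rcases hr with rfl | rfl | rfl | rfl | rfl <;> simp [sigmaArc] at ha
      subst ha
      -- The `σ`-edge of the mixed piece is at height `(1 + t) / 2`, which reaches the bottom
      -- `15/16` of the rectangle at `t = 7/8`.
      refine ⟨_, rfl, rfl, 7 / 8, 1, by norm_num, by norm_num, le_rfl, fun t => ?_⟩
      simp only [Rect.toFun, Prod.mk.injEq]
      constructor <;> ring
    · rcases hr with rfl | rfl | rfl | rfl | rfl <;> simp [sigmaArc] at ha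
  · rw [rects_of_not_isTau hκ, List.mem_singleton] at hr
    subst hr
    exact ⟨a, ha, rfl, 0, 1, le_rfl, one_pos, le_rfl, fun t => by simp [toFun_unit]⟩

end Piece

/-! ### A transversal function on the square -/

/-- A bump that vanishes on `[3/16, 7/16]`. -/
def chi (a : ℝ) : ℝ := max 0 (max (3 / 16 - a) (a - 7 / 16))

lemma chi_nonneg (a : ℝ) : 0 ≤ chi a := le_max_left _ _

/-- A Lipschitz constant of 1 is enough: `bandFun` adds only `t / 4 ≤ 1 / 4` times `chi` to `a`, so
it stays strictly increasing in `a`. -/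
lemma chi_lipschitz {a a' : ℝ} (h : a ≤ a') : chi a ≤ chi a' + (a' - a) ∧
    chi a' ≤ chi a + (a' - a) := by
  unfold chi
  grind

lemma chi_eq_zero {a : ℝ} (h : 3 / 16 ≤ a) (h' : a ≤ 7 / 16) : chi a = 0 := by
  unfold chi
  grind

lemma chi_pos {a : ℝ} (h : a < 3 / 16 ∨ 7 / 16 < a) : 0 < chi a := by
  unfold chi
  grind

lemma chi_le {a : ℝ} (h : 0 ≤ a) (h' : a ≤ 1) : chi a ≤ 9 / 16 := by
  unfold chi
  grind

/-- The transversal function on the band `7/8 ≤ b ≤ 15/16`. -/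
def bandFun (a t : ℝ) : ℝ := a + chi a * t / 4

lemma bandFun_strict {a a' t : ℝ} (h : a < a') (h0 : 0 ≤ t) (h1 : t ≤ 1) :
    bandFun a t < bandFun a' t := by
  have := (chi_lipschitz h.le).1
  unfold bandFun
  nlinarith

lemma bandFun_mono {a t t' : ℝ} (h : t ≤ t') : bandFun a t ≤ bandFun a t' := by
  have := chi_nonneg a
  unfold bandFun
  nlinarith

lemma bandFun_pos {a t : ℝ} (ha : 0 ≤ a) (ht : 7 / 8 ≤ t) : 0 < bandFun a t := by
  unfold bandFun
  rcases lt_or_ge a (3 / 16) with h | h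
  · have := chi_pos (Or.inl h); positivity
  · have := chi_nonneg a; positivity

lemma bandFun_lt_two {a t : ℝ} (ha : 0 ≤ a) (ha' : a ≤ 1) (ht : 0 ≤ t) (ht' : t ≤ 1) :
    bandFun a t < 2 := by
  have := chi_le ha ha'
  have := chi_nonneg a
  unfold bandFun
  nlinarith

/-- A function on the square that is constant on the bottom and on the top, and increases to the
right and upwards, strictly with few exceptions. -/
def trans (x : ℝ × ℝ) : ℝ :=
  bandFun x.1 (max (7 / 8) (min x.2 (15 / 16))) * min 1 (min (8 * x.2 / 7) (16 * (1 - x.2))) +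
    max 0 (32 * x.2 - 30)

lemma continuous_trans : Continuous trans := by
  unfold trans bandFun chi
  fun_prop

lemma trans_low {a b : ℝ} (h : b ≤ 7 / 8) : trans (a, b) = bandFun a (7 / 8) * (8 * b / 7) := by
  simp only [trans]
  rw [max_eq_left ((min_le_left _ _).trans h), min_eq_left (a := 8 * b / 7) (by linarith),
    min_eq_right (by linarith), max_eq_left (by linarith), add_zero]

/-- The level lines of `trans` will be the arcs of sectors. In this band the gap of the mixed piece
depends on time alone for `3/16 ≤ a ≤ 7/16`, while the direction of its sheets still turns with `a`.
Because `chi` vanishes there, the level lines are vertical and the direction is constant along them.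
-/
lemma trans_mid {a b : ℝ} (h : 7 / 8 ≤ b) (h' : b ≤ 15 / 16) : trans (a, b) = bandFun a b := by
  simp only [trans]
  rw [min_eq_left h', max_eq_right h, min_eq_left (le_min (by linarith) (by linarith)),
    max_eq_left (by linarith), mul_one, add_zero]

lemma trans_high {a b : ℝ} (h : 15 / 16 ≤ b) :
    trans (a, b) = bandFun a (15 / 16) * (16 * (1 - b)) + (32 * b - 30) := by
  simp only [trans]
  rw [min_eq_right h, max_eq_right (by norm_num), min_eq_right (a := 8 * b / 7) (by linarith),
    min_eq_right (by linarith), max_eq_right (by linarith)]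

lemma trans_zero (a : ℝ) : trans (a, 0) = 0 := by rw [trans_low (by norm_num)]; ring

lemma trans_one (a : ℝ) : trans (a, 1) = 2 := by rw [trans_high (by norm_num)]; ring

lemma trans_strict_fst {a a' b : ℝ} (h : a < a') (h0 : 0 < b) (h1 : b < 1) :
    trans (a, b) < trans (a', b) := by
  rcases le_total b (7 / 8) with h2 | h2
  · rw [trans_low h2, trans_low h2]
    exact mul_lt_mul_of_pos_right (bandFun_strict h (by norm_num) (by norm_num)) (by linarith)
  rcases le_total b (15 / 16) with h3 | h3
  · rw [trans_mid h2 h3, trans_mid h2 h3]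
    exact bandFun_strict h h0.le h1.le
  · rw [trans_high h3, trans_high h3]
    have := mul_lt_mul_of_pos_right (bandFun_strict h (t := 15 / 16) (by norm_num) (by norm_num))
      (show 0 < 16 * (1 - b) by linarith)
    linarith

lemma trans_mono_fst {a a' b : ℝ} (h : a ≤ a') (h0 : 0 ≤ b) (h1 : b ≤ 1) :
    trans (a, b) ≤ trans (a', b) := by
  rcases h0.eq_or_lt with rfl | h0
  · rw [trans_zero, trans_zero]
  rcases h1.eq_or_lt with rfl | h1
  · rw [trans_one, trans_one]
  rcases h.eq_or_lt with rfl | h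
  · exact le_rfl
  · exact (trans_strict_fst h h0 h1).le

lemma trans_strict_low {a b b' : ℝ} (ha : 0 ≤ a) (h : b < b') (h' : b' ≤ 7 / 8) :
    trans (a, b) < trans (a, b') := by
  rw [trans_low (h.le.trans h'), trans_low h']
  exact mul_lt_mul_of_pos_left (by linarith) (bandFun_pos ha le_rfl)

lemma trans_strict_high {a b b' : ℝ} (ha : 0 ≤ a) (ha' : a ≤ 1) (h : b < b') (h' : 15 / 16 ≤ b) :
    trans (a, b) < trans (a, b') := by
  rw [trans_high h', trans_high (h'.trans h.le)]
  have := bandFun_lt_two ha ha' (t := 15 / 16) (by norm_num) (by norm_num)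
  nlinarith

lemma trans_mono_snd {a b b' : ℝ} (ha : 0 ≤ a) (ha' : a ≤ 1) (h : b ≤ b') :
    trans (a, b) ≤ trans (a, b') := by
  have low : ∀ {b b' : ℝ}, b ≤ b' → b' ≤ 7 / 8 → trans (a, b) ≤ trans (a, b') := by
    intro b b' h h'
    rcases h.eq_or_lt with rfl | h
    exacts [le_rfl, (trans_strict_low ha h h').le]
  have mid : ∀ {b b' : ℝ}, 7 / 8 ≤ b → b ≤ b' → b' ≤ 15 / 16 → trans (a, b) ≤ trans (a, b') := by
    intro b b' h1 h2 h3
    rw [trans_mid h1 (h2.trans h3), trans_mid (h1.trans h2) h3]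
    exact bandFun_mono h2
  have high : ∀ {b b' : ℝ}, b ≤ b' → 15 / 16 ≤ b → trans (a, b) ≤ trans (a, b') := by
    intro b b' h h'
    rcases h.eq_or_lt with rfl | h
    exacts [le_rfl, (trans_strict_high ha ha' h h').le]
  have e : (7 / 8 : ℝ) ≤ 15 / 16 := by norm_num
  rcases le_total b' (7 / 8) with k1 | k1
  · exact low h k1
  rcases le_total b' (15 / 16) with k2 | k2
  · rcases le_total b (7 / 8) with k3 | k3
    · exact (low k3 le_rfl).trans (mid le_rfl k1 k2)
    · exact mid k3 h k2
  · rcases le_total b (7 / 8) with k3 | k3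
    · exact (low k3 le_rfl).trans ((mid le_rfl e le_rfl).trans (high k2 le_rfl))
    · rcases le_total b (15 / 16) with k4 | k4
      · exact (mid k3 k4 le_rfl).trans (high k2 le_rfl)
      · exact high h k4

lemma trans_strict_snd {a b b' : ℝ} (ha : 0 ≤ a) (ha' : a ≤ 1) (h : b < b')
    (hne : ¬ (3 / 16 ≤ a ∧ a ≤ 7 / 16 ∧ 7 / 8 ≤ b ∧ b' ≤ 15 / 16)) :
    trans (a, b) < trans (a, b') := by
  rcases lt_or_ge b (7 / 8) with h1 | h1
  · rcases le_total b' (7 / 8) with h2 | h2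
    · exact trans_strict_low ha h h2
    · exact (trans_strict_low ha h1 le_rfl).trans_le (trans_mono_snd ha ha' h2)
  rcases lt_or_ge (15 / 16) b' with h2 | h2
  · rcases le_total b (15 / 16) with h3 | h3
    · exact (trans_mono_snd ha ha' h3).trans_lt (trans_strict_high ha ha' h2 le_rfl)
    · exact trans_strict_high ha ha' h h3
  · rw [trans_mid h1 (h.le.trans h2), trans_mid (h1.trans h.le) h2]
    have : 0 < chi a := by
      apply chi_pos
      by_contra hcon
      push Not at hcon
      exact hne ⟨hcon.1, hcon.2, h1, h2⟩
    unfold bandFun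
    nlinarith

lemma trans_mem {x : ℝ × ℝ} (hx : x ∈ square) : trans x ∈ Icc (0 : ℝ) 2 := by
  obtain ⟨a, b⟩ := x
  obtain ⟨⟨h1, h2⟩, h3, h4⟩ := hx
  constructor
  · rw [← trans_zero a]; exact trans_mono_snd h1 h2 h3
  · rw [← trans_one a]; exact trans_mono_snd h1 h2 h4

lemma trans_le {x y : ℝ × ℝ} (hx : x ∈ square) (hy : y ∈ square) (h1 : x.1 ≤ y.1)
    (h2 : x.2 ≤ y.2) : trans x ≤ trans y :=
  (trans_mono_snd hx.1.1 hx.1.2 h2).trans (trans_mono_fst h1 hy.2.1 hy.2.2)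

lemma trans_lt {x y : ℝ × ℝ} (hx : x ∈ square) (hy : y ∈ square) (h1 : x.1 ≤ y.1)
    (h2 : x.2 ≤ y.2) (hne : x ≠ y) (h3 : x.1 = y.1 → x.1 < 3 / 16 ∨ 7 / 16 < x.1)
    (h4 : x.2 = y.2 → 0 < x.2 ∧ x.2 < 1) : trans x < trans y := by
  obtain ⟨a, b⟩ := x
  obtain ⟨a', b'⟩ := y
  simp only at *
  rcases h2.eq_or_lt with rfl | h2
  · exact trans_strict_fst (lt_of_le_of_ne h1 fun h => hne (by rw [h])) (h4 rfl).1 (h4 rfl).2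
  rcases h1.eq_or_lt with rfl | h1
  · refine trans_strict_snd hx.1.1 hx.1.2 h2 fun h => ?_
    rcases h3 rfl with h' | h' <;> linarith [h.1, h.2.1]
  have hb' := hy.2
  simp only [mem_Icc] at hb'
  rcases hb'.2.eq_or_lt with h5 | h5
  · refine (trans_strict_snd hx.1.1 hx.1.2 h2 fun h => ?_).trans_le
      (trans_mono_fst h1.le hb'.1 hb'.2)
    linarith [h.2.2.2]
  · exact (trans_mono_snd hx.1.1 hx.1.2 h2.le).trans_lt
      (trans_strict_fst h1 (hx.2.1.trans_lt h2) h5)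

/-- `y` lies to the lower right of `x` on a level line of the transversal function. -/
def Lower (x y : ℝ × ℝ) : Prop :=
  (x.1 < y.1 ∧ y.2 < x.2) ∨
  (x.1 = y.1 ∧ y.2 < x.2 ∧ 3 / 16 ≤ x.1 ∧ x.1 ≤ 7 / 16 ∧ 7 / 8 ≤ y.2 ∧ x.2 ≤ 15 / 16) ∨
  (x.1 < y.1 ∧ x.2 = y.2 ∧ (x.2 = 0 ∨ x.2 = 1))

lemma Lower.le {x y : ℝ × ℝ} (h : Lower x y) : x.1 ≤ y.1 ∧ y.2 ≤ x.2 := by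
  rcases h with h | h | h
  · exact ⟨h.1.le, h.2.le⟩
  · exact ⟨h.1.le, h.2.1.le⟩
  · exact ⟨h.1.le, h.2.1.ge⟩

/-- The height along the level lines. -/
def ht (x : ℝ × ℝ) : ℝ := x.1 - x.2

lemma continuous_ht : Continuous ht := by unfold ht; fun_prop

/-- `trans` cannot stay constant when both coordinates increase. What remains is a proper descent to
the right, a vertical descent in the band, or a move along the bottom or top, which are themselves
level sets. -/
lemma lower_of_ht_lt {x y : ℝ × ℝ} (hx : x ∈ square) (hy : y ∈ square) (h : trans x = trans y)
    (hv : ht x < ht y) : Lower x y := by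
  have key : ∀ {x y : ℝ × ℝ}, x ∈ square → y ∈ square → x.1 < y.1 → x.2 < y.2 →
      trans x < trans y := fun hx hy h1 h2 =>
    trans_lt hx hy h1.le h2.le (fun h => h1.ne (by rw [h])) (fun h => absurd h h1.ne)
      fun h => absurd h h2.ne
  unfold ht at hv
  rcases lt_trichotomy x.1 y.1 with h1 | h1 | h1
  · rcases lt_trichotomy x.2 y.2 with h2 | h2 | h2
    · exact absurd h (key hx hy h1 h2).ne
    · refine Or.inr (Or.inr ⟨h1, h2, ?_⟩)
      by_contra hcon
      push Not at hcon
      refine absurd h (trans_lt hx hy h1.le h2.le (fun h => h1.ne (by rw [h]))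
        (fun h => absurd h h1.ne) fun _ => ⟨lt_of_le_of_ne hx.2.1 (Ne.symm hcon.1),
          lt_of_le_of_ne hx.2.2 hcon.2⟩).ne
    · exact Or.inl ⟨h1, h2⟩
  · have h2 : y.2 < x.2 := by linarith
    refine Or.inr (Or.inl ⟨h1, h2, ?_⟩)
    by_contra hcon
    have := trans_strict_snd hx.1.1 hx.1.2 h2 (fun h => hcon ⟨h.1, h.2.1, h.2.2.1, h.2.2.2⟩)
    have hy' : trans (x.1, y.2) = trans y := by rw [h1]
    rw [hy'] at this
    exact this.ne h.symm
  · have h2 : y.2 < x.2 := by linarith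
    exact absurd h (key hy hx h1 h2).ne'

/-- Two different points on a diagonal `a - b = const` differ in both coordinates in the same sense,
so `trans` separates them: `trans` and `ht` are coordinates on the square. -/
lemma eq_of_trans_eq_of_ht_eq {x y : ℝ × ℝ} (hx : x ∈ square) (hy : y ∈ square)
    (h : trans x = trans y) (hv : ht x = ht y) : x = y := by
  have key : ∀ {x y : ℝ × ℝ}, x ∈ square → y ∈ square → x.1 < y.1 → x.2 < y.2 →
      trans x < trans y := fun hx hy h1 h2 =>
    trans_lt hx hy h1.le h2.le (fun h => h1.ne (by rw [h])) (fun h => absurd h h1.ne)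
      fun h => absurd h h2.ne
  unfold ht at hv
  rcases lt_trichotomy x.1 y.1 with h1 | h1 | h1
  · exact absurd h (key hx hy h1 (by linarith)).ne
  · exact Prod.ext h1 (by linarith)
  · exact absurd h (key hy hx h1 (by linarith)).ne'

/-- Apply the intermediate value theorem on the diagonal `a - b = v`. An end on the bottom or top
has the extreme value 0 or 2; an end on the left side is below and to the left of `p`, and one on
the right side is above and to the right of `q`. -/
lemma exists_trans_eq_ht_eq {p q : ℝ × ℝ} (hp : p ∈ square) (hq : q ∈ square)
    (h : trans p = trans q) {v : ℝ} (hv : v ∈ Icc (ht p) (ht q)) :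
    ∃ x ∈ square, trans x = trans p ∧ ht x = v := by
  have hp' := hp
  have hq' := hq
  simp only [square, mem_prod, mem_Icc] at hp' hq'
  simp only [ht, mem_Icc] at hv
  have hle : max 0 v ≤ min 1 (1 + v) := by
    apply max_le <;> apply le_min <;> linarith
  have hmem : ∀ a ∈ Icc (max 0 v) (min 1 (1 + v)), (a, a - v) ∈ square := by
    rintro a ⟨h1, h2⟩
    simp only [max_le_iff, le_min_iff] at h1 h2
    exact ⟨⟨h1.1, h2.1⟩, by constructor <;> simp only <;> linarith⟩
  have hc : ContinuousOn (fun a : ℝ => trans (a, a - v)) (Icc (max 0 v) (min 1 (1 + v))) :=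
    (continuous_trans.comp (by fun_prop)).continuousOn
  have hlo : trans (max 0 v, max 0 v - v) ≤ trans p := by
    rcases le_total 0 v with h0 | h0
    · rw [max_eq_right h0, sub_self, trans_zero]; exact (trans_mem hp).1
    · rw [max_eq_left h0]
      refine trans_le (y := p) ?_ hp hp'.1.1 (by simp only; linarith)
      have := hmem (max 0 v) ⟨le_rfl, hle⟩
      rwa [max_eq_left h0] at this
  have hhi : trans p ≤ trans (min 1 (1 + v), min 1 (1 + v) - v) := by
    rcases le_total v 0 with h0 | h0
    · rw [min_eq_right (by linarith), add_sub_cancel_right, trans_one]; exact (trans_mem hp).2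
    · rw [min_eq_left (by linarith), h]
      refine trans_le (x := q) hq ?_ hq'.1.2 (by simp only; linarith)
      have := hmem (min 1 (1 + v)) ⟨hle, le_rfl⟩
      rwa [min_eq_left (by linarith)] at this
  obtain ⟨a, ha, hax⟩ := intermediate_value_Icc hle hc ⟨hlo, hhi⟩
  exact ⟨_, hmem a ha, hax, by simp [ht]⟩

/-- A path that is increasing for the transversal function, reparametrised by it. -/
lemma exists_graph {α : ℝ → ℝ × ℝ} {t₀ t₁ : ℝ} (h01 : t₀ ≤ t₁) (hc : ContinuousOn α (Icc t₀ t₁))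
    (hm : ∀ t ∈ Icc t₀ t₁, α t ∈ square) (hs : StrictMonoOn (fun t => trans (α t)) (Icc t₀ t₁))
    (h0 : trans (α t₀) = 0) (h1 : trans (α t₁) = 2) :
    ∃ A : ℝ → ℝ × ℝ, ContinuousOn A (Icc 0 2) ∧ (∀ w ∈ Icc (0 : ℝ) 2, trans (A w) = w) ∧
      (∀ w ∈ Icc (0 : ℝ) 2, ∃ t ∈ Icc t₀ t₁, A w = α t) ∧
      ∀ t ∈ Icc t₀ t₁, A (trans (α t)) = α t := by
  have hcw : ContinuousOn (fun t => trans (α t)) (Icc t₀ t₁) := continuous_trans.comp_continuousOn hc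
  have himg : (fun t => trans (α t)) '' Icc t₀ t₁ = Icc 0 2 := by
    apply Subset.antisymm
    · rintro _ ⟨t, ht, rfl⟩; exact trans_mem (hm t ht)
    · have := intermediate_value_Icc h01 hcw
      rwa [h0, h1] at this
  have hinv := continuousOn_invFunOn_of_isCompact isCompact_Icc hcw subset_rfl hs.injOn
    (fun _ _ y hy _ => hy)
  rw [himg] at hinv
  have hmem : ∀ w ∈ Icc (0 : ℝ) 2, Function.invFunOn (fun t => trans (α t)) (Icc t₀ t₁) w ∈
      Icc t₀ t₁ := fun w hw => Function.invFunOn_mem (by rw [← himg] at hw; exact hw)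
  refine ⟨fun w => α (Function.invFunOn (fun t => trans (α t)) (Icc t₀ t₁) w),
    hc.comp hinv hmem, ?_, fun w hw => ⟨_, hmem w hw, rfl⟩, ?_⟩
  · intro w hw
    exact Function.invFunOn_eq (f := fun t => trans (α t)) (by rw [← himg] at hw; exact hw)
  · intro t ht
    have h := Function.invFunOn_apply_eq (f := fun t => trans (α t)) ht
    have := hs.injOn (hmem _ (trans_mem (hm t ht))) ht h
    simp only at this ⊢
    rw [this]

/-- The level lines between two graphs. -/
lemma exists_lines {A T : ℝ → ℝ × ℝ} (hA : ContinuousOn A (Icc 0 2)) (hT : ContinuousOn T (Icc 0 2))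
    (hAs : ∀ w ∈ Icc (0 : ℝ) 2, A w ∈ square) (hTs : ∀ w ∈ Icc (0 : ℝ) 2, T w ∈ square)
    (hAw : ∀ w ∈ Icc (0 : ℝ) 2, trans (A w) = w) (hTw : ∀ w ∈ Icc (0 : ℝ) 2, trans (T w) = w) :
    ∃ Q : ℝ × ℝ → ℝ × ℝ, ContinuousOn Q square ∧ ∀ x ∈ square, Q x ∈ square ∧
      trans (Q x) = 2 * x.1 ∧ ht (Q x) = (1 - x.2) * ht (A (2 * x.1)) + x.2 * ht (T (2 * x.1)) := by
  let Ψ : ℝ × ℝ → ℝ × ℝ := fun x => (trans x, ht x)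
  have hΨ : ContinuousOn Ψ square := (continuous_trans.prodMk continuous_ht).continuousOn
  have hinj : InjOn Ψ square := fun x hx y hy h =>
    eq_of_trans_eq_of_ht_eq hx hy (Prod.mk.inj h).1 (Prod.mk.inj h).2
  have hinv := continuousOn_invFunOn_of_isCompact isCompact_square hΨ subset_rfl hinj
    (fun _ _ y hy _ => hy)
  let q : ℝ × ℝ → ℝ × ℝ := fun x =>
    (2 * x.1, (1 - x.2) * ht (A (2 * x.1)) + x.2 * ht (T (2 * x.1)))
  have hmaps : MapsTo (fun x : ℝ × ℝ => 2 * x.1) square (Icc 0 2) := fun x hx =>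
    ⟨by linarith [hx.1.1], by linarith [hx.1.2]⟩
  have h2 : ContinuousOn (fun x : ℝ × ℝ => 2 * x.1) square := by fun_prop
  have hA' : ContinuousOn (fun x : ℝ × ℝ => ht (A (2 * x.1))) square :=
    continuous_ht.comp_continuousOn (hA.comp h2 hmaps)
  have hT' : ContinuousOn (fun x : ℝ × ℝ => ht (T (2 * x.1))) square :=
    continuous_ht.comp_continuousOn (hT.comp h2 hmaps)
  have hq : ContinuousOn q square := h2.prodMk
    (((by fun_prop : ContinuousOn (fun x : ℝ × ℝ => 1 - x.2) square).mul hA').add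
      ((by fun_prop : ContinuousOn (fun x : ℝ × ℝ => x.2) square).mul hT'))
  have hex : ∀ x ∈ square, q x ∈ Ψ '' square := by
    intro x hx
    have hw := hmaps hx
    have hx2 := hx.2
    simp only [mem_Icc] at hx2
    have hcase : ∃ y ∈ square, trans y = 2 * x.1 ∧
        ht y = (1 - x.2) * ht (A (2 * x.1)) + x.2 * ht (T (2 * x.1)) := by
      rcases le_total (ht (A (2 * x.1))) (ht (T (2 * x.1))) with h | h
      · have := exists_trans_eq_ht_eq (hAs _ hw) (hTs _ hw) ((hAw _ hw).trans (hTw _ hw).symm)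
          (v := (1 - x.2) * ht (A (2 * x.1)) + x.2 * ht (T (2 * x.1)))
          ⟨by nlinarith, by nlinarith⟩
        rwa [hAw _ hw] at this
      · have := exists_trans_eq_ht_eq (hTs _ hw) (hAs _ hw) ((hTw _ hw).trans (hAw _ hw).symm)
          (v := (1 - x.2) * ht (A (2 * x.1)) + x.2 * ht (T (2 * x.1)))
          ⟨by nlinarith, by nlinarith⟩
        rwa [hTw _ hw] at this
    obtain ⟨y, hy, h1, h2⟩ := hcase
    exact ⟨y, hy, Prod.ext h1 h2⟩
  refine ⟨fun x => Function.invFunOn Ψ square (q x), hinv.comp hq hex, fun x hx => ?_⟩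
  have h1 := Function.invFunOn_mem (hex x hx)
  have h2 := Function.invFunOn_eq (hex x hx)
  exact ⟨h1, congrArg Prod.fst h2, congrArg Prod.snd h2⟩

/-! ### Sectors: the two-dimensional pieces of the mapping cylinder structure -/

/-- `Q` parametrises a part of the square between the zero set of the gap (`s = 0`) and the
`τ`-chart (`s = 1`), in such a way that the gap increases with `s` and the direction of the sheets
is constant as long as there are sheets. -/
structure IsSector (κ : Piece) (Q : ℝ × ℝ → ℝ × ℝ) : Prop where
  cont : ContinuousOn Q square
  mem : ∀ x ∈ square, Q x ∈ square
  fst_mem : ∀ x ∈ square, 0 < (Q x).1 ∧ (Q x).1 < 1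
  interior : ∀ x ∈ square, 0 < x.1 → x.1 < 1 → 0 < (Q x).2 ∧ (Q x).2 < 1
  ends : ∀ x ∈ square, x.1 = 0 ∨ x.1 = 1 → (Q x).2 = 0 ∨ (Q x).2 = 1
  zero : ∀ x ∈ square, x.2 = 0 → κ.gapFun (Q x) = 0
  mem_tauSet_iff : ∀ x ∈ square, Q x ∈ κ.tauSet ↔ x.2 = 1
  strictMono : ∀ x ∈ square, ∀ y ∈ square, x.1 = y.1 → x.2 < y.2 → κ.gapFun (Q x) ≤ 1 / 2 →
    κ.gapFun (Q x) < κ.gapFun (Q y)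
  dir : ∀ x ∈ square, κ.gapFun (Q x) ≤ 1 / 2 →
    κ.dir (Q x) = κ.dir (Q (x.1, 0)) ∨ κ.dir (Q x) = -κ.dir (Q (x.1, 0))
  inj : ∀ x ∈ square, ∀ y ∈ square, x.2 < 1 → y.2 < 1 → Q x = Q y → x = y

/-- The point `x` lies on its level line between the graphs `A` and `T`. -/
def Between (σ : ℝ) (A T : ℝ → ℝ × ℝ) (x : ℝ × ℝ) : Prop :=
  σ * ht (A (trans x)) ≤ σ * ht x ∧ σ * ht x ≤ σ * ht (T (trans x))

lemma snd_eq_zero_of_trans {x : ℝ × ℝ} (hx : x ∈ square) (h : trans x = 0) : x.2 = 0 := by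
  obtain ⟨a, b⟩ := x
  by_contra hne
  have hb : 0 < b := lt_of_le_of_ne hx.2.1 (Ne.symm hne)
  have := trans_strict_snd (a := a) hx.1.1 hx.1.2 hb (fun h => by linarith [h.2.2.1])
  rw [trans_zero] at this
  exact this.ne' h

lemma snd_eq_one_of_trans {x : ℝ × ℝ} (hx : x ∈ square) (h : trans x = 2) : x.2 = 1 := by
  obtain ⟨a, b⟩ := x
  by_contra hne
  have hb : b < 1 := lt_of_le_of_ne hx.2.2 hne
  have := trans_strict_snd (a := a) hx.1.1 hx.1.2 hb (fun h => by linarith [h.2.2.2])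
  rw [trans_one] at this
  exact this.ne h

/-- `A` runs in the zero set of the gap, `T` along the `τ`-chart, and each meets every level once.
The sector follows the level `2 x.1` from `A` to `T`. The sign `σ` is `1` if `T` lies to the lower
right of `A`, and `-1` if it lies to the upper left. -/
lemma exists_line_sector {κ : Piece} {A T : ℝ → ℝ × ℝ} {σ : ℝ}
    (hA : ContinuousOn A (Icc 0 2)) (hT : ContinuousOn T (Icc 0 2))
    (hAs : ∀ w ∈ Icc (0 : ℝ) 2, A w ∈ square) (hTs : ∀ w ∈ Icc (0 : ℝ) 2, T w ∈ square)
    (hAw : ∀ w ∈ Icc (0 : ℝ) 2, trans (A w) = w) (hTw : ∀ w ∈ Icc (0 : ℝ) 2, trans (T w) = w)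
    (hne : ∀ w ∈ Icc (0 : ℝ) 2, σ * ht (A w) < σ * ht (T w))
    (hz : ∀ w ∈ Icc (0 : ℝ) 2, κ.gapFun (A w) = 0)
    (hTt : ∀ w ∈ Icc (0 : ℝ) 2, T w ∈ κ.tauSet)
    (hin : ∀ x ∈ square, Between σ A T x → 0 < x.1 ∧ x.1 < 1)
    (htau : ∀ x ∈ square, Between σ A T x → x ∈ κ.tauSet → x = T (trans x))
    (hmono : ∀ x ∈ square, ∀ y ∈ square, Between σ A T x → Between σ A T y → trans x = trans y →
      σ * ht x < σ * ht y → κ.gapFun x ≤ 1 / 2 → κ.gapFun x < κ.gapFun y)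
    (hdir : ∀ x ∈ square, Between σ A T x → κ.gapFun x ≤ 1 / 2 →
      κ.dir x = κ.dir (A (trans x)) ∨ κ.dir x = -κ.dir (A (trans x))) :
    ∃ Q, IsSector κ Q ∧ (∀ x ∈ square, Between σ A T (Q x)) ∧
      ∀ y ∈ square, Between σ A T y → ∃ x ∈ square, Q x = y := by
  obtain ⟨Q, hQc, hQ⟩ := exists_lines hA hT hAs hTs hAw hTw
  have hw : ∀ x ∈ square, 2 * x.1 ∈ Icc (0 : ℝ) 2 := fun x hx =>
    ⟨by linarith [hx.1.1], by linarith [hx.1.2]⟩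
  have hbt : ∀ x ∈ square, Between σ A T (Q x) := by
    intro x hx
    obtain ⟨h1, h2, h3⟩ := hQ x hx
    have h4 := hne _ (hw x hx)
    have h5 := hx.2
    simp only [mem_Icc] at h5
    simp only [Between, h2, h3]
    constructor <;> nlinarith
  have hfoot : ∀ x ∈ square, Q (x.1, 0) = A (2 * x.1) := by
    intro x hx
    have hx' : (x.1, (0 : ℝ)) ∈ square := ⟨hx.1, by simp⟩
    obtain ⟨h1, h2, h3⟩ := hQ _ hx'
    refine eq_of_trans_eq_of_ht_eq h1 (hAs _ (hw x hx)) (h2.trans (hAw _ (hw x hx)).symm) ?_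
    simpa using h3
  have htop : ∀ x ∈ square, Q x = T (2 * x.1) ↔ x.2 = 1 := by
    intro x hx
    obtain ⟨h1, h2, h3⟩ := hQ x hx
    constructor
    · intro h
      rw [h] at h3
      have h4 := hne _ (hw x hx)
      have h5 : (1 - x.2) * (σ * ht (T (2 * x.1)) - σ * ht (A (2 * x.1))) = 0 := by
        linear_combination σ * h3
      rcases mul_eq_zero.1 h5 with h6 | h6 <;> linarith
    · intro h
      refine eq_of_trans_eq_of_ht_eq h1 (hTs _ (hw x hx)) (h2.trans (hTw _ (hw x hx)).symm) ?_
      rw [h3, h]; ring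
  refine ⟨Q, ⟨hQc, fun x hx => (hQ x hx).1, fun x hx => hin _ (hQ x hx).1 (hbt x hx), ?_, ?_, ?_,
    ?_, ?_, ?_, ?_⟩, hbt, ?_⟩
  · intro x hx h0 h1
    obtain ⟨h3, h4, -⟩ := hQ x hx
    constructor
    · refine lt_of_le_of_ne h3.2.1 fun h => ?_
      have h5 : Q x = ((Q x).1, 0) := Prod.ext rfl h.symm
      rw [h5, trans_zero] at h4
      linarith
    · refine lt_of_le_of_ne h3.2.2 fun h => ?_
      have h5 : Q x = ((Q x).1, 1) := Prod.ext rfl h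
      rw [h5, trans_one] at h4
      linarith
  · rintro x hx (h | h)
    · exact Or.inl (snd_eq_zero_of_trans (hQ x hx).1 (by rw [(hQ x hx).2.1, h, mul_zero]))
    · exact Or.inr (snd_eq_one_of_trans (hQ x hx).1 (by rw [(hQ x hx).2.1, h, mul_one]))
  · intro x hx h
    have : x = (x.1, 0) := Prod.ext rfl h
    rw [this, hfoot x hx]
    exact hz _ (hw x hx)
  · intro x hx
    rw [← htop x hx]
    constructor
    · intro h
      have := htau _ (hQ x hx).1 (hbt x hx) h
      rwa [(hQ x hx).2.1] at this
    · intro h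
      rw [h]; exact hTt _ (hw x hx)
  · intro x hx y hy hxy hlt
    obtain ⟨h1, h2, h3⟩ := hQ x hx
    obtain ⟨k1, k2, k3⟩ := hQ y hy
    refine hmono _ h1 _ k1 (hbt x hx) (hbt y hy) (by rw [h2, k2, hxy]) ?_
    rw [h3, k3, hxy]
    have h4 := hne _ (hw y hy)
    nlinarith
  · intro x hx h
    rw [hfoot x hx, ← (hQ x hx).2.1]
    exact hdir _ (hQ x hx).1 (hbt x hx) h
  · intro x hx y hy _ _ hxy
    obtain ⟨h1, h2, h3⟩ := hQ x hx
    obtain ⟨k1, k2, k3⟩ := hQ y hy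
    rw [← hxy] at k2 k3
    have h4 : x.1 = y.1 := by linarith
    rw [← h4] at k3
    have h5 := hne _ (hw x hx)
    have h6 : (x.2 - y.2) * (σ * ht (T (2 * x.1)) - σ * ht (A (2 * x.1))) = 0 := by
      linear_combination σ * (k3 - h3)
    refine Prod.ext h4 ?_
    rcases mul_eq_zero.1 h6 with h6 | h6 <;> linarith
  · intro y hy hb
    obtain ⟨h1, h2⟩ := hb
    have hwy := trans_mem hy
    have h3 := hne _ hwy
    set vA := ht (A (trans y))
    set vT := ht (T (trans y))
    have h4 : σ * vT - σ * vA > 0 := by linarith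
    have h5 : vT - vA ≠ 0 := fun h => by
      have : vT = vA := by linarith
      rw [this] at h4; linarith
    have h6 : σ ≠ 0 := by rintro rfl; simp at h4
    have h7 : (ht y - vA) / (vT - vA) = (σ * ht y - σ * vA) / (σ * vT - σ * vA) := by
      rw [← mul_sub, ← mul_sub, mul_div_mul_left _ _ h6]
    have hx : (trans y / 2, (ht y - vA) / (vT - vA)) ∈ square := by
      refine ⟨⟨by simp only; linarith [hwy.1], by simp only; linarith [hwy.2]⟩, ?_⟩
      simp only [mem_Icc, h7]
      exact ⟨div_nonneg (by linarith) h4.le, (div_le_one h4).2 (by linarith)⟩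
    refine ⟨_, hx, ?_⟩
    obtain ⟨k1, k2, k3⟩ := hQ _ hx
    have e : 2 * (trans y / 2) = trans y := by ring
    simp only [e] at k2 k3
    refine eq_of_trans_eq_of_ht_eq k1 hy k2 ?_
    rw [k3]
    change (1 - (ht y - vA) / (vT - vA)) * vA + (ht y - vA) / (vT - vA) * vT = ht y
    field_simp
    ring

/-! ### Staircases and trees -/

/-- Up along `a = l` to height `h`, across to `a = r`, and up again, parametrised by `a + b`: such a
path borders the positive set of the gap. The vertical steps avoid `[3/16, 7/16]`, where `trans` is
not strict in `b`. -/
lemma exists_stair {l r h : ℝ} (hl : 0 ≤ l) (hlr : l < r) (hr : r ≤ 1) (h0 : 0 < h) (h1 : h < 1)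
    (hl' : l < 3 / 16 ∨ 7 / 16 < l) (hr' : r < 3 / 16 ∨ 7 / 16 < r) :
    ∃ A : ℝ → ℝ × ℝ, ContinuousOn A (Icc 0 2) ∧ (∀ w ∈ Icc (0 : ℝ) 2, A w ∈ square) ∧
      (∀ w ∈ Icc (0 : ℝ) 2, trans (A w) = w) ∧
      ∀ w ∈ Icc (0 : ℝ) 2, ((A w).1 = l ∧ (A w).2 ≤ h) ∨ ((A w).2 = h ∧ l ≤ (A w).1 ∧ (A w).1 ≤ r) ∨
        ((A w).1 = r ∧ h ≤ (A w).2) := by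
  let α : ℝ → ℝ × ℝ := fun t => (max l (min r (t - h)), t - max l (min r (t - h)))
  have hc : Continuous α := by fun_prop
  have hm : ∀ t ∈ Icc l (1 + r), α t ∈ square := by
    rintro t ⟨h3, h4⟩
    simp only [α, square, mem_prod, mem_Icc]
    grind
  have hs : StrictMonoOn (fun t => trans (α t)) (Icc l (1 + r)) := by
    intro t ht t' ht' htt
    refine trans_lt (hm t ht) (hm t' ht') ?_ ?_ ?_ ?_ ?_
    · simp only [α]; grind
    · simp only [α]; grind
    · simp only [α, ne_eq, Prod.mk.injEq]; grind
    · simp only [α]; grind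
    · simp only [α]; grind
  have e0 : α l = (l, 0) := by
    simp only [α, Prod.mk.injEq]; grind
  have e1 : α (1 + r) = (r, 1) := by
    simp only [α, Prod.mk.injEq]; grind
  obtain ⟨A, hA, hAw, hAt, -⟩ := exists_graph (by linarith) hc.continuousOn hm hs
    (by rw [e0, trans_zero]) (by rw [e1, trans_one])
  refine ⟨A, hA, fun w hw => ?_, hAw, fun w hw => ?_⟩ <;> obtain ⟨t, ht, htw⟩ := hAt w hw <;>
    rw [htw]
  · exact hm t ht
  · simp only [α]; grind

/-- `trans` increases along the path `a = c b`, so the path crosses every level line once. The side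
of the path on which a point lies can then be read from `ht`. -/
lemma exists_tree {c : ℝ → ℝ} (hc : Continuous c) (hm : ∀ b ∈ Icc (0 : ℝ) 1, c b ∈ Icc (0 : ℝ) 1)
    (hs : StrictMonoOn (fun b => trans (c b, b)) (Icc 0 1)) :
    ∃ T : ℝ → ℝ × ℝ, ContinuousOn T (Icc 0 2) ∧ (∀ w ∈ Icc (0 : ℝ) 2, T w ∈ square) ∧
      (∀ w ∈ Icc (0 : ℝ) 2, trans (T w) = w) ∧ (∀ w ∈ Icc (0 : ℝ) 2, (T w).1 = c (T w).2) ∧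
      ∀ x ∈ square, (x.1 ≤ c x.2 ↔ ht x ≤ ht (T (trans x))) ∧
        (c x.2 ≤ x.1 ↔ ht (T (trans x)) ≤ ht x) := by
  obtain ⟨T, hT, hTw, hTt, -⟩ := exists_graph (α := fun b => (c b, b)) zero_le_one
    (by fun_prop) (fun t ht => ⟨hm t ht, ht⟩) hs (trans_zero _) (trans_one _)
  have hTs : ∀ w ∈ Icc (0 : ℝ) 2, T w ∈ square := by
    intro w hw
    obtain ⟨t, ht, htw⟩ := hTt w hw
    rw [htw]
    exact ⟨hm t ht, ht⟩
  have hTc : ∀ w ∈ Icc (0 : ℝ) 2, (T w).1 = c (T w).2 := by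
    intro w hw
    obtain ⟨t, ht, htw⟩ := hTt w hw
    rw [htw]
  have mono : ∀ x ∈ square, ∀ y ∈ square, x.1 = c x.2 → y.1 = c y.2 → trans x ≤ trans y →
      x.2 ≤ y.2 := by
    intro x hx y hy h1 h2 h
    by_contra hcon
    have := hs hy.2 hx.2 (not_le.1 hcon)
    simp only [← h1, ← h2] at this
    exact absurd h (not_le.2 this)
  have hle : ∀ x ∈ square, x.1 ≤ c x.2 → ht x ≤ ht (T (trans x)) := by
    intro x hx h
    have hw := trans_mem hx
    by_contra hcon
    have hl := lower_of_ht_lt (hTs _ hw) hx (hTw _ hw) (not_le.1 hcon)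
    have h1 : trans x ≤ trans (c x.2, x.2) := trans_mono_fst h hx.2.1 hx.2.2
    rw [← hTw _ hw] at h1
    have h2 := mono _ (hTs _ hw) _ (show (c x.2, x.2) ∈ square from ⟨hm _ hx.2, hx.2⟩) (hTc _ hw)
      rfl h1
    simp only at h2
    have h4 : x.2 = (T (trans x)).2 := le_antisymm hl.le.2 h2
    have h5 := hTc _ hw
    rw [← h4] at h5
    simp only [ht] at hcon
    rw [← h4] at hcon
    linarith
  have hge : ∀ x ∈ square, c x.2 ≤ x.1 → ht (T (trans x)) ≤ ht x := by
    intro x hx h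
    have hw := trans_mem hx
    by_contra hcon
    have hl := lower_of_ht_lt hx (hTs _ hw) (hTw _ hw).symm (not_le.1 hcon)
    have h1 : trans (c x.2, x.2) ≤ trans x := trans_mono_fst h hx.2.1 hx.2.2
    rw [← hTw _ hw] at h1
    have h2 := mono _ (show (c x.2, x.2) ∈ square from ⟨hm _ hx.2, hx.2⟩) _ (hTs _ hw) rfl
      (hTc _ hw) h1
    simp only at h2
    have h4 : x.2 = (T (trans x)).2 := le_antisymm h2 hl.le.2
    have h5 := hTc _ hw
    rw [← h4] at h5
    simp only [ht] at hcon
    rw [← h4] at hcon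
    linarith
  have heq : ∀ x ∈ square, ht x = ht (T (trans x)) → x.1 = c x.2 := by
    intro x hx h
    have hw := trans_mem hx
    have := eq_of_trans_eq_of_ht_eq hx (hTs _ hw) (hTw _ hw).symm h
    have h5 := hTc _ hw
    rwa [← this] at h5
  refine ⟨T, hT, hTs, hTw, hTc, fun x hx => ⟨⟨hle x hx, fun h => ?_⟩, ⟨hge x hx, fun h => ?_⟩⟩⟩
  · rcases le_total x.1 (c x.2) with h' | h'
    · exact h'
    · exact (heq x hx (le_antisymm h (hge x hx h'))).le
  · rcases le_total x.1 (c x.2) with h' | h'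
    · exact (heq x hx (le_antisymm (hle x hx h') h)).ge
    · exact h'

/-- Only the part `b ≤ 1/2`, where the path leans left, is delicate. There `trans` is a multiple of
`bandFun a (7/8) * b`, with main term `(1/2 - b/2) * b`, which increases exactly up to `b = 1/2`.
The cut at `b = 1/8` is where `a = 7/16` and `chi` becomes zero. -/
lemma strictMonoOn_mixed_tree :
    StrictMonoOn (fun b : ℝ => trans (max (1 / 2 - b / 2) (b - 1 / 4), b)) (Icc 0 1) := by
  have h1 : StrictMonoOn (fun b : ℝ => trans (max (1 / 2 - b / 2) (b - 1 / 4), b)) (Icc 0 (1 / 8)) := by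
    rintro b ⟨hb0, hb1⟩ b' ⟨hb0', hb1'⟩ hlt
    simp only
    rw [trans_low (by linarith), trans_low (by linarith), max_eq_left (by linarith),
      max_eq_left (by linarith), bandFun, bandFun, chi, chi,
      max_eq_right (a := 3 / 16 - (1 / 2 - b / 2)) (by linarith),
      max_eq_right (a := 3 / 16 - (1 / 2 - b' / 2)) (by linarith), max_eq_right (by linarith),
      max_eq_right (by linarith)]
    nlinarith
  have h2 : StrictMonoOn (fun b : ℝ => trans (max (1 / 2 - b / 2) (b - 1 / 4), b))
      (Icc (1 / 8) (1 / 2)) := by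
    rintro b ⟨hb0, hb1⟩ b' ⟨hb0', hb1'⟩ hlt
    simp only
    rw [trans_low (by linarith), trans_low (by linarith), max_eq_left (by linarith),
      max_eq_left (by linarith), bandFun, bandFun, chi_eq_zero (by linarith) (by linarith),
      chi_eq_zero (by linarith) (by linarith)]
    nlinarith
  have h3 : StrictMonoOn (fun b : ℝ => trans (max (1 / 2 - b / 2) (b - 1 / 4), b))
      (Icc (1 / 2) 1) := by
    rintro b ⟨hb0, hb1⟩ b' ⟨hb0', hb1'⟩ hlt
    simp only
    rw [max_eq_right (by linarith), max_eq_right (by linarith)]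
    refine trans_lt ?_ ?_ (by simp only; linarith) hlt.le ?_ ?_ ?_
    · constructor <;> constructor <;> simp only <;> linarith
    · constructor <;> constructor <;> simp only <;> linarith
    · intro h; exact hlt.ne (Prod.mk.inj h).2
    · intro h; simp only at h; exact absurd h (by linarith)
    · intro h; exact absurd h hlt.ne
  have h12 := h1.union h2 (isGreatest_Icc (by norm_num)) (isLeast_Icc (by norm_num))
  rw [Icc_union_Icc_eq_Icc (by norm_num) (by norm_num)] at h12
  have h123 := h12.union h3 (isGreatest_Icc (by norm_num)) (isLeast_Icc (by norm_num))
  rwa [Icc_union_Icc_eq_Icc (by norm_num) (by norm_num)] at h123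

lemma strictMonoOn_trivalent_tree :
    StrictMonoOn (fun b : ℝ => trans (min (1 / 4 + b / 2) (1 / 2), b)) (Icc 0 1) := by
  rintro b ⟨hb0, hb1⟩ b' ⟨hb0', hb1'⟩ hlt
  have hlt' : min (1 / 4 + b / 2) (1 / 2) ≤ min (1 / 4 + b' / 2) (1 / 2) :=
    min_le_min (by linarith) le_rfl
  have hpos : ∀ b : ℝ, 0 ≤ b → 0 ≤ min (1 / 4 + b / 2) (1 / 2) := fun b hb =>
    le_min (by linarith) (by norm_num)
  have hle : ∀ b : ℝ, min (1 / 4 + b / 2) (1 / 2) ≤ 1 := fun b =>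
    (min_le_right _ _).trans (by norm_num)
  refine trans_lt ⟨⟨hpos b hb0, hle b⟩, hb0, hb1⟩ ⟨⟨hpos b' hb0', hle b'⟩, hb0', hb1'⟩ hlt' hlt.le
    ?_ ?_ ?_
  · intro h; exact hlt.ne (Prod.mk.inj h).2
  · intro h
    simp only at h ⊢
    right
    rcases le_total (1 / 4 + b / 2) (1 / 2) with h1 | h1
    · rw [min_eq_left h1] at h
      have := (lt_min_iff (a := 1 / 4 + b / 2) (b := 1 / 4 + b' / 2) (c := 1 / 2))
      rcases h1.lt_or_eq with h2 | h2
      · exact absurd h (this.2 ⟨by linarith, h2⟩).ne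
      · rw [h2, min_self]; norm_num
    · rw [min_eq_right h1]; norm_num
  · intro h; exact absurd h hlt.ne

/-! ### Growth of the gap along the level lines -/

/-- Comparison of two interpolations. -/
lemma interp_lt {s s' G₁ G₁' G₂ G₂' : ℝ} (hs0 : 0 ≤ s) (hs1 : s ≤ 1) (hss : s' ≤ s)
    (h1 : G₁ ≤ G₁') (h2 : G₂ ≤ G₂') (h3 : G₂' ≤ G₁') (h4 : G₁' ≤ 1)
    (k1 : s < 1 → G₁ < 1 → G₁ < G₁') (k2 : 0 < s → s < 1 → s' < s)
    (k3 : s = 1 → G₂ < 1 → G₂ < G₂' ∨ (s' < 1 ∧ G₂ < G₁'))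
    (hg : (1 - s) * G₁ + s * G₂ ≤ 1 / 2) :
    (1 - s) * G₁ + s * G₂ < (1 - s') * G₁' + s' * G₂' := by
  -- The difference is a sum of three nonnegative terms, and the cases locate a positive one. `hg`
  -- excludes the degenerate situations in which the gap is already 1.
  have e : (1 - s') * G₁' + s' * G₂' - ((1 - s) * G₁ + s * G₂) =
      (1 - s) * (G₁' - G₁) + s * (G₂' - G₂) + (s - s') * (G₁' - G₂') := by ring
  have p1 : 0 ≤ (1 - s) * (G₁' - G₁) := mul_nonneg (by linarith) (by linarith)
  have p2 : 0 ≤ s * (G₂' - G₂) := mul_nonneg hs0 (by linarith)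
  have p3 : 0 ≤ (s - s') * (G₁' - G₂') := mul_nonneg (by linarith) (by linarith)
  rcases hs1.lt_or_eq with h | h
  · rcases lt_or_ge G₁ 1 with h5 | h5
    · have := mul_pos (sub_pos.2 h) (sub_pos.2 (k1 h h5))
      linarith
    · have e1 : G₁ = 1 := by linarith
      have e2 : G₁' = 1 := by linarith
      subst e1
      subst e2
      have hs : 0 < s := by
        rcases hs0.eq_or_lt with h6 | h6
        · rw [← h6] at hg; norm_num at hg
        · exact h6
      have h6 := k2 hs h
      have h7 : G₂ < 1 := by
        by_contra hcon
        have : G₂ = 1 := by linarith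
        rw [this] at hg; linarith
      rcases lt_or_ge G₂ G₂' with h8 | h8
      · have := mul_pos hs (sub_pos.2 h8)
        linarith
      · have := mul_pos (sub_pos.2 h6) (show 0 < 1 - G₂' by linarith)
        linarith
  · subst h
    have h7 : G₂ < 1 := by linarith
    rcases lt_or_ge G₂ G₂' with h8 | h8
    · linarith
    · rcases k3 rfl h7 with h9 | ⟨h9, h10⟩
      · linarith
      · have := mul_pos (sub_pos.2 h9) (show 0 < G₁' - G₂' by linarith)
        linarith

lemma one_ne_prog_of {c d b : ℝ} (h : c * b < d + 1) : prog c d b ≠ 1 :=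
  (prog_lt_one_iff.2 h).ne

/-- To the left of the `τ`-chart one approaches it downwards and to the right. The progress
decreases, both gap patterns grow, and at the new point the old pattern dominates the new one. The
bounds on `x` place it on the inner side of the staircase. -/
lemma gap_mixed_left {ε : ℤˣ} {x y : ℝ × ℝ} (h : Lower x y) (h1 : 1 / 8 ≤ x.1)
    (h2 : x.2 ≤ 15 / 16 ∨ 9 / 16 ≤ x.1) (h3 : y.1 ≤ 3 / 4)
    (hg : (Piece.mixed ε).gapFun x ≤ 1 / 2) :
    (Piece.mixed ε).gapFun x < (Piece.mixed ε).gapFun y := by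
  simp only [Piece.gapFun] at *
  have hle := h.le
  have hstrict : ∀ G : ℝ, (3 / 16 ≤ x.1 → x.1 ≤ 7 / 16 → gap x.1 < 1 → False) := fun _ k1 k2 k3 =>
    k3.ne (gap_eq_one k1 (by linarith))
  refine interp_lt (prog_nonneg _ _ _) (prog_le_one _ _ _) (prog_mono (by norm_num) hle.2)
    (gap_mono_left hle.1 (by linarith)) (gap_mono_left (by linarith) (by linarith))
    (gap_mono_left (by linarith) (by linarith)) (gap_le_one _) ?_ ?_ ?_ hg
  · intro hs hG
    rcases h with h | h | h
    · exact gap_strict_left h1 h.1 (by linarith) hG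
    · exact (hstrict 0 h.2.2.1 h.2.2.2.1 hG).elim
    · exact gap_strict_left h1 h.1 (by linarith) hG
  · intro hs0 hs1
    have e0 := prog_pos_iff.1 hs0
    have e1 := prog_lt_one_iff.1 hs1
    have : y.2 < x.2 := by
      rcases h with h | h | h
      · exact h.2
      · exact h.2.1
      · rcases h.2.2 with h' | h' <;> linarith
    exact prog_strict (by norm_num) this ⟨e0, by linarith⟩
  · intro hs hG
    have e0 : 15 ≤ 16 * x.2 := by
      by_contra hcon
      exact one_ne_prog_of (by linarith) hs
    rcases le_or_gt (9 / 16) x.1 with k | k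
    · left
      have : x.1 < y.1 := by
        rcases h with h | h | h
        · exact h.1
        · linarith [h.2.2.2.1]
        · exact h.1
      exact gap_strict_left (by linarith) (by linarith) (by linarith) hG
    · right
      have k2 : x.2 = 15 / 16 := by rcases h2 with h2 | h2 <;> linarith
      have hy : y.2 < x.2 ∧ 1 / 8 < y.1 := by
        rcases h with h | h | h
        · exact ⟨h.2, by linarith [h.1]⟩
        · exact ⟨h.2.1, by linarith [h.1, h.2.2.1]⟩
        · rcases h.2.2 with h' | h' <;> linarith
      refine ⟨prog_lt_one_iff.2 (by linarith), ?_⟩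
      rw [gap_eq_zero (Or.inl (by linarith))]
      exact gap_pos_iff.2 ⟨hy.2, by linarith⟩

/-- Here one approaches the `τ`-chart upwards and to the left, so the progress increases. The two
patterns exchange their roles and `interp_lt` is applied to `1 - prog`. -/
lemma gap_mixed_right {ε : ℤˣ} {x y : ℝ × ℝ} (h : Lower y x) (h1 : 1 / 4 ≤ y.1)
    (h2 : 7 / 8 < y.2 → 5 / 8 ≤ y.1) (h3 : x.1 ≤ 15 / 16) (h4 : x.1 ≤ 7 / 8 ∨ 7 / 8 ≤ x.2)
    (hg : (Piece.mixed ε).gapFun x ≤ 1 / 2) :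
    (Piece.mixed ε).gapFun x < (Piece.mixed ε).gapFun y := by
  simp only [Piece.gapFun] at *
  have hle := h.le
  have hxy : y.1 < x.1 := by
    rcases h with h | h | h
    · exact h.1
    · have := h2 (by linarith [h.2.1, h.2.2.2.2.1])
      linarith [h.2.2.2.1]
    · exact h.1
  rcases le_or_gt y.2 (7 / 8) with k | k
  · rw [prog_eq_zero (b := x.2) (by linarith)] at *
    rw [prog_eq_zero (b := y.2) (by linarith)]
    have k5 : x.1 ≤ 7 / 8 := by
      rcases h4 with h4 | h4
      · exact h4
      · rcases h with h | h | h
        · linarith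
        · linarith
        · rcases h.2.2 with h' | h' <;> linarith
    have := gap_strict_right k5 hxy (by linarith) (by linarith)
    linarith
  have k5 := h2 k
  have key := interp_lt (s := 1 - prog 16 14 x.2) (s' := 1 - prog 16 14 y.2)
    (G₁ := gap (2 * x.1 - 1)) (G₁' := gap (2 * y.1 - 1)) (G₂ := gap x.1) (G₂' := gap y.1)
    (by linarith [prog_le_one 16 14 x.2]) (by linarith [prog_nonneg 16 14 x.2])
    (by linarith [prog_mono (c := 16) (d := 14) (by norm_num) hle.2])
    (gap_mono_right (by linarith) (by linarith)) (gap_mono_right (by linarith) (by linarith))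
    (gap_mono_right (by linarith) (by linarith)) (gap_le_one _) ?_ ?_ ?_ (by linarith)
  · linarith
  · intro _ hG
    exact gap_strict_right (by linarith) (by linarith) (by linarith) hG
  · intro hs0 hs1
    have e0 := prog_lt_one_iff.1 (sub_pos.1 hs0)
    have e1 : 14 < 16 * x.2 := prog_pos_iff.1 (by linarith)
    have : x.2 < y.2 := by
      rcases h with h | h | h
      · exact h.2
      · exact h.2.1
      · rcases h.2.2 with h' | h' <;> linarith
    have := prog_strict (c := 16) (d := 14) (by norm_num) this ⟨by linarith, by linarith⟩
    linarith
  · intro hs hG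
    have e0 : 16 * x.2 ≤ 14 := by
      by_contra hcon
      have := prog_pos_iff.2 (not_le.1 hcon)
      linarith
    rcases le_or_gt x.1 (7 / 8) with k6 | k6
    · left
      exact gap_strict_right k6 hxy (by linarith) hG
    · right
      have := prog_pos_iff.2 (show (14 : ℝ) < 16 * y.2 by linarith)
      refine ⟨by linarith, ?_⟩
      rw [gap_eq_zero (a := x.1) (Or.inr (by linarith))]
      exact gap_pos_iff.2 ⟨by linarith, by linarith⟩

lemma gapFun_trivalent_left {x : ℝ × ℝ} (h : x.1 ≤ 1 / 2) : Piece.trivalentTau.gapFun x =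
    (1 - prog 8 1 x.2) * gap (2 * x.1) + prog 8 1 x.2 * gap x.1 := by
  simp only [Piece.gapFun]
  rw [gap_eq_zero (a := 2 * x.1 - 1) (Or.inl (by linarith)), add_zero]

/-- To the left of the centre only the left pair of hooks contributes, so the gap interpolates
between `gap (2 * a)` and `gap a`. -/
lemma gap_trivalent_left {x y : ℝ × ℝ} (h : Lower x y) (h1 : 1 / 16 ≤ x.1)
    (h2 : x.2 ≤ 1 / 4 ∨ 1 / 8 ≤ x.1) (h3 : y.1 ≤ 1 / 2) (h4 : y.1 ≤ 1 / 4 + y.2 / 2)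
    (hg : Piece.trivalentTau.gapFun x ≤ 1 / 2) :
    Piece.trivalentTau.gapFun x < Piece.trivalentTau.gapFun y := by
  have hle := h.le
  rw [gapFun_trivalent_left (by linarith)] at *
  rw [gapFun_trivalent_left h3]
  rcases le_or_gt (1 / 4) y.2 with k | k
  · rw [prog_eq_one (b := x.2) (by linarith)] at *
    rw [prog_eq_one (b := y.2) (by linarith)]
    have k1 : 1 / 8 ≤ x.1 := by
      rcases h2 with h2 | h2
      · rcases h with h | h | h
        · linarith
        · linarith
        · rcases h.2.2 with h' | h' <;> linarith
      · exact h2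
    have k2 : x.1 < y.1 := by
      rcases h with h | h | h
      · exact h.1
      · have := gap_eq_one h.2.2.1 (show x.1 ≤ 13 / 16 by linarith)
        rw [this] at hg
        norm_num at hg
      · exact h.1
    have := gap_strict_left k1 k2 (by linarith) (by linarith)
    linarith
  have k1 : x.1 < y.1 := by
    rcases h with h | h | h
    · exact h.1
    · linarith
    · exact h.1
  refine interp_lt (prog_nonneg _ _ _) (prog_le_one _ _ _) (prog_mono (by norm_num) hle.2)
    (gap_mono_left (by linarith) (by linarith)) (gap_mono_left hle.1 (by linarith))
    (gap_mono_left (by linarith) (by linarith)) (gap_le_one _) ?_ ?_ ?_ hg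
  · intro _ hG
    exact gap_strict_left (by linarith) (by linarith) (by linarith) hG
  · intro hs0 hs1
    have e0 := prog_pos_iff.1 hs0
    have e1 := prog_lt_one_iff.1 hs1
    have : y.2 < x.2 := by
      rcases h with h | h | h
      · exact h.2
      · exact h.2.1
      · rcases h.2.2 with h' | h' <;> linarith
    exact prog_strict (by norm_num) this ⟨e0, by linarith⟩
  · intro hs hG
    have e0 : 2 ≤ 8 * x.2 := by
      by_contra hcon
      exact one_ne_prog_of (by linarith) hs
    rcases le_or_gt (1 / 8) x.1 with k2 | k2
    · left
      exact gap_strict_left k2 k1 (by linarith) hG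
    · right
      refine ⟨prog_lt_one_iff.2 (by linarith), ?_⟩
      rw [gap_eq_zero (Or.inl (by linarith))]
      exact gap_pos_iff.2 ⟨by linarith, by linarith⟩

/-! ### The two-dimensional pieces of the trees -/

lemma lower_or_eq {x y : ℝ × ℝ} (hx : x ∈ square) (hy : y ∈ square) (h : trans x = trans y)
    (hv : ht x ≤ ht y) : x = y ∨ Lower x y := by
  rcases hv.eq_or_lt with h' | h'
  · exact Or.inl (eq_of_trans_eq_of_ht_eq hx hy h h')
  · exact Or.inr (lower_of_ht_lt hx hy h h')

/-- A sector of a model piece, together with a set that contains its interior and a set in which it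
covers everything. -/
def Covers (κ : Piece) (Q : ℝ × ℝ → ℝ × ℝ) (V C : Set (ℝ × ℝ)) : Prop :=
  IsSector κ Q ∧ (∀ x ∈ square, x.2 < 1 → Q x ∈ V) ∧
    ∀ y ∈ square, y ∈ κ.posSet → y ∈ C → ∃ x ∈ square, Q x = y

lemma mixed_tau_iff {ε : ℤˣ} {x : ℝ × ℝ} (hx : x ∈ square) : x ∈ (Piece.mixed ε).tauSet ↔
    x.1 = max (1 / 2 - x.2 / 2) (x.2 - 1 / 4) := by
  have h := hx.2
  simp only [mem_Icc] at h
  rw [Piece.mem_tauSet_iff]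
  simp only
  grind

lemma rot_twist_cases (ε : ℤˣ) {a : ℝ} (h : a ≤ 3 / 16 ∨ 5 / 16 ≤ a) :
    rot ε (twist (2 * a)) = 1 ∨ rot ε (twist (2 * a)) = -1 := by
  rcases h with h | h
  · left; rw [Piece.twist_eq_zero (by linarith), Piece.rot_zero]
  · right; rw [Piece.twist_eq_one (by linarith), Piece.rot_one]

lemma rot_twist_rel (ε : ℤˣ) {a a' : ℝ} (h : a ≤ 3 / 16 ∨ 5 / 16 ≤ a)
    (h' : a' ≤ 3 / 16 ∨ 5 / 16 ≤ a') : rot ε (twist (2 * a)) = rot ε (twist (2 * a')) ∨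
    rot ε (twist (2 * a)) = -rot ε (twist (2 * a')) := by
  rcases rot_twist_cases ε h with h | h <;> rcases rot_twist_cases ε h' with h' | h' <;>
    rw [h, h'] <;> simp

/-- For the direction of the mixed piece: within the band, a level line that starts to the left of
`5/16` either stays to the left of `3/16` or is vertical, so it cannot pass from one `a` to another
within the twisting zone. -/
lemma level_false {A x : ℝ × ℝ} (hA : A ∈ square) (hx : x ∈ square) (hw : trans A = trans x)
    (h1 : A.1 < x.1) (h2 : A.1 < 5 / 16) (h3 : 3 / 16 < x.1) (h4 : 7 / 8 < x.2)
    (h5 : A.2 ≤ 15 / 16) (h6 : x.2 < A.2) : False := by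
  obtain ⟨a, b⟩ := A
  obtain ⟨a', b'⟩ := x
  simp only at *
  rw [trans_mid (by linarith) h5, trans_mid h4.le (by linarith)] at hw
  simp only [bandFun, chi] at hw
  rcases le_total (3 / 16) a with k | k
  · rw [max_eq_left (a := 0) (b := max (3 / 16 - a) (a - 7 / 16)) (max_le (by linarith) (by linarith))] at hw
    have : 0 ≤ max 0 (max (3 / 16 - a') (a' - 7 / 16)) := le_max_left _ _
    nlinarith
  · rw [max_eq_left (a := 3 / 16 - a) (by linarith), max_eq_right (a := 0) (b := 3 / 16 - a) (by linarith)] at hw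
    have : 0 ≤ max 0 (max (3 / 16 - a') (a' - 7 / 16)) := le_max_left _ _
    nlinarith

/-- Reduces the sector between a staircase `A` and a `τ`-chart `a = c b` to its lower right to
inequalities between coordinates. `hpos` says that no point of positive gap lies on the outer side
of the staircase. -/
lemma exists_sector_left {κ : Piece} {A : ℝ → ℝ × ℝ} {c : ℝ → ℝ}
    (hA : ContinuousOn A (Icc 0 2)) (hAs : ∀ w ∈ Icc (0 : ℝ) 2, A w ∈ square)
    (hAw : ∀ w ∈ Icc (0 : ℝ) 2, trans (A w) = w)
    (hc : Continuous c) (hm : ∀ b ∈ Icc (0 : ℝ) 1, c b ∈ Icc (0 : ℝ) 1)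
    (hs : StrictMonoOn (fun b => trans (c b, b)) (Icc 0 1))
    (hz : ∀ w ∈ Icc (0 : ℝ) 2, κ.gapFun (A w) = 0)
    (hAc : ∀ w ∈ Icc (0 : ℝ) 2, (A w).1 ≤ c (A w).2)
    (htau : ∀ x ∈ square, x.1 ≤ c x.2 → (x ∈ κ.tauSet ↔ x.1 = c x.2))
    (hpos : ∀ x ∈ square, x ∈ κ.posSet → ∀ w ∈ Icc (0 : ℝ) 2, ¬ (x.1 ≤ (A w).1 ∧ (A w).2 ≤ x.2))
    (hin : ∀ x ∈ square, x.1 ≤ c x.2 → ∀ w ∈ Icc (0 : ℝ) 2, (A w).1 ≤ x.1 → 0 < x.1 ∧ x.1 < 1)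
    (hmono : ∀ x ∈ square, ∀ y ∈ square, ∀ w ∈ Icc (0 : ℝ) 2, (A w).1 ≤ x.1 → x.2 ≤ (A w).2 →
      Lower x y → y.1 ≤ c y.2 → κ.gapFun x ≤ 1 / 2 → κ.gapFun x < κ.gapFun y)
    (hdir : ∀ x ∈ square, ∀ w ∈ Icc (0 : ℝ) 2, trans x = w → Lower (A w) x → x.1 ≤ c x.2 →
      κ.gapFun x ≤ 1 / 2 → κ.dir x = κ.dir (A w) ∨ κ.dir x = -κ.dir (A w)) :
    ∃ Q, Covers κ Q {x | x.1 < c x.2} {x | x.1 ≤ c x.2} := by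
  obtain ⟨T, hT, hTs, hTw, hTc, hside⟩ := exists_tree hc hm hs
  have hTt : ∀ w ∈ Icc (0 : ℝ) 2, T w ∈ κ.tauSet := fun w hw =>
    (htau _ (hTs w hw) (hTc w hw).le).2 (hTc w hw)
  have hne : ∀ w ∈ Icc (0 : ℝ) 2, (1 : ℝ) * ht (A w) < 1 * ht (T w) := by
    intro w hw
    rw [one_mul, one_mul]
    have h1 := (hside _ (hAs w hw)).1.1 (hAc w hw)
    rw [hAw w hw] at h1
    refine lt_of_le_of_ne h1 fun h => ?_
    have h2 := eq_of_trans_eq_of_ht_eq (hAs w hw) (hTs w hw) ((hAw w hw).trans (hTw w hw).symm) h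
    have h3 := hz w hw
    rw [h2, Piece.gapFun_eq_one_of_mem_tauSet (hTt w hw)] at h3
    exact one_ne_zero h3
  have hb : ∀ x ∈ square, Between 1 A T x → (x = A (trans x) ∨ Lower (A (trans x)) x) ∧
      x.1 ≤ c x.2 := by
    intro x hx h
    have hw := trans_mem hx
    rw [Between, one_mul, one_mul, one_mul] at h
    refine ⟨?_, (hside x hx).1.2 h.2⟩
    rcases lower_or_eq (hAs _ hw) hx (hAw _ hw) h.1 with h | h
    · exact Or.inl h.symm
    · exact Or.inr h
  have hb' : ∀ x ∈ square, Between 1 A T x → (A (trans x)).1 ≤ x.1 ∧ x.2 ≤ (A (trans x)).2 := by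
    intro x hx h
    rcases (hb x hx h).1 with h | h
    · rw [← h]; exact ⟨le_rfl, le_rfl⟩
    · exact h.le
  obtain ⟨Q, hQ, hQb, hQc⟩ := exists_line_sector hA hT hAs hTs hAw hTw hne hz hTt
    (fun x hx h => hin x hx (hb x hx h).2 _ (trans_mem hx) (hb' x hx h).1)
    (fun x hx hbx h => by
      have hw := trans_mem hx
      rw [htau x hx (hb x hx hbx).2] at h
      exact eq_of_trans_eq_of_ht_eq hx (hTs _ hw) (hTw _ hw).symm
        (le_antisymm ((hside x hx).1.1 h.le) ((hside x hx).2.1 h.ge)))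
    (fun x hx y hy hbx hby hxy hlt hg => hmono x hx y hy _ (trans_mem hx) (hb' x hx hbx).1
      (hb' x hx hbx).2 (lower_of_ht_lt hx hy hxy (by linarith)) (hb y hy hby).2 hg)
    (fun x hx hbx hg => by
      rcases (hb x hx hbx).1 with h | h
      · rw [← h]; exact Or.inl rfl
      · exact hdir x hx _ (trans_mem hx) rfl h (hb x hx hbx).2 hg)
  refine ⟨Q, hQ, ?_, ?_⟩
  · intro x hx hx1
    have h1 := hQ.mem x hx
    have h2 := (hb _ h1 (hQb x hx)).2
    refine lt_of_le_of_ne h2 fun h => ?_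
    have := (hQ.mem_tauSet_iff x hx).1 ((htau _ h1 h2).2 h)
    linarith
  · intro y hy hp hyc
    have hw := trans_mem hy
    refine hQc y hy ⟨?_, ?_⟩
    · rw [one_mul, one_mul]
      by_contra hcon
      exact hpos y hy hp _ hw
        (lower_of_ht_lt hy (hAs _ hw) (hAw _ hw).symm (not_le.1 hcon)).le
    · rw [one_mul, one_mul]
      exact (hside y hy).1.1 hyc

/-- The same on the other side: the `τ`-chart is to the upper left of the staircase, and the sign in
`exists_line_sector` is `-1`. -/
lemma exists_sector_right {κ : Piece} {A : ℝ → ℝ × ℝ} {c : ℝ → ℝ}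
    (hA : ContinuousOn A (Icc 0 2)) (hAs : ∀ w ∈ Icc (0 : ℝ) 2, A w ∈ square)
    (hAw : ∀ w ∈ Icc (0 : ℝ) 2, trans (A w) = w)
    (hc : Continuous c) (hm : ∀ b ∈ Icc (0 : ℝ) 1, c b ∈ Icc (0 : ℝ) 1)
    (hs : StrictMonoOn (fun b => trans (c b, b)) (Icc 0 1))
    (hz : ∀ w ∈ Icc (0 : ℝ) 2, κ.gapFun (A w) = 0)
    (hAc : ∀ w ∈ Icc (0 : ℝ) 2, c (A w).2 ≤ (A w).1)
    (htau : ∀ x ∈ square, c x.2 ≤ x.1 → (x ∈ κ.tauSet ↔ c x.2 = x.1))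
    (hpos : ∀ x ∈ square, x ∈ κ.posSet → ∀ w ∈ Icc (0 : ℝ) 2, ¬ ((A w).1 ≤ x.1 ∧ x.2 ≤ (A w).2))
    (hin : ∀ x ∈ square, c x.2 ≤ x.1 → ∀ w ∈ Icc (0 : ℝ) 2, x.1 ≤ (A w).1 → 0 < x.1 ∧ x.1 < 1)
    (hmono : ∀ x ∈ square, ∀ y ∈ square, ∀ w ∈ Icc (0 : ℝ) 2, x.1 ≤ (A w).1 → (A w).2 ≤ x.2 →
      Lower y x → c y.2 ≤ y.1 → κ.gapFun x ≤ 1 / 2 → κ.gapFun x < κ.gapFun y)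
    (hdir : ∀ x ∈ square, ∀ w ∈ Icc (0 : ℝ) 2, trans x = w → Lower x (A w) → c x.2 ≤ x.1 →
      κ.gapFun x ≤ 1 / 2 → κ.dir x = κ.dir (A w) ∨ κ.dir x = -κ.dir (A w)) :
    ∃ Q, Covers κ Q {x | c x.2 < x.1} {x | c x.2 ≤ x.1} := by
  obtain ⟨T, hT, hTs, hTw, hTc, hside⟩ := exists_tree hc hm hs
  have hTt : ∀ w ∈ Icc (0 : ℝ) 2, T w ∈ κ.tauSet := fun w hw =>
    (htau _ (hTs w hw) (hTc w hw).ge).2 (hTc w hw).symm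
  have e : ∀ x y : ℝ, (-1 : ℝ) * x ≤ -1 * y ↔ y ≤ x := fun x y => by constructor <;> intro <;> linarith
  have hne : ∀ w ∈ Icc (0 : ℝ) 2, (-1 : ℝ) * ht (A w) < -1 * ht (T w) := by
    intro w hw
    have h1 := (hside _ (hAs w hw)).2.1 (hAc w hw)
    rw [hAw w hw] at h1
    refine lt_of_le_of_ne ((e _ _).2 h1) fun h => ?_
    have h2 := eq_of_trans_eq_of_ht_eq (hAs w hw) (hTs w hw) ((hAw w hw).trans (hTw w hw).symm)
      (by linarith)
    have h3 := hz w hw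
    rw [h2, Piece.gapFun_eq_one_of_mem_tauSet (hTt w hw)] at h3
    exact one_ne_zero h3
  have hb : ∀ x ∈ square, Between (-1) A T x → (x = A (trans x) ∨ Lower x (A (trans x))) ∧
      c x.2 ≤ x.1 := by
    intro x hx h
    have hw := trans_mem hx
    rw [Between, e, e] at h
    exact ⟨lower_or_eq hx (hAs _ hw) (hAw _ hw).symm h.1, (hside x hx).2.2 h.2⟩
  have hb' : ∀ x ∈ square, Between (-1) A T x → x.1 ≤ (A (trans x)).1 ∧ (A (trans x)).2 ≤ x.2 := by
    intro x hx h
    rcases (hb x hx h).1 with h | h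
    · rw [← h]; exact ⟨le_rfl, le_rfl⟩
    · exact h.le
  obtain ⟨Q, hQ, hQb, hQc⟩ := exists_line_sector hA hT hAs hTs hAw hTw hne hz hTt
    (fun x hx h => hin x hx (hb x hx h).2 _ (trans_mem hx) (hb' x hx h).1)
    (fun x hx hbx h => by
      have hw := trans_mem hx
      rw [htau x hx (hb x hx hbx).2] at h
      exact eq_of_trans_eq_of_ht_eq hx (hTs _ hw) (hTw _ hw).symm
        (le_antisymm ((hside x hx).1.1 h.ge) ((hside x hx).2.1 h.le)))
    (fun x hx y hy hbx hby hxy hlt hg => hmono x hx y hy _ (trans_mem hx) (hb' x hx hbx).1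
      (hb' x hx hbx).2 (lower_of_ht_lt hy hx hxy.symm (by linarith)) (hb y hy hby).2 hg)
    (fun x hx hbx hg => by
      rcases (hb x hx hbx).1 with h | h
      · rw [← h]; exact Or.inl rfl
      · exact hdir x hx _ (trans_mem hx) rfl h (hb x hx hbx).2 hg)
  refine ⟨Q, hQ, ?_, ?_⟩
  · intro x hx hx1
    have h1 := hQ.mem x hx
    have h2 := (hb _ h1 (hQb x hx)).2
    refine lt_of_le_of_ne h2 fun h => ?_
    have := (hQ.mem_tauSet_iff x hx).1 ((htau _ h1 h2).2 h)
    linarith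
  · intro y hy hp hyc
    have hw := trans_mem hy
    refine hQc y hy ⟨?_, ?_⟩
    · rw [e]
      by_contra hcon
      exact hpos y hy hp _ hw
        (lower_of_ht_lt (hAs _ hw) hy (hAw _ hw) (not_le.1 hcon)).le
    · rw [e]
      exact (hside y hy).2.1 hyc

lemma gapFun_eq_zero_iff (κ : Piece) (x : ℝ × ℝ) : κ.gapFun x = 0 ↔ x ∉ κ.posSet := by
  rw [← Piece.gapFun_pos_iff]
  exact ⟨fun h => by rw [h]; exact lt_irrefl _, fun h => le_antisymm (not_lt.1 h) (κ.gapFun_nonneg x)⟩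

lemma exists_sector_mixed_left (ε : ℤˣ) : ∃ Q, Covers (.mixed ε) Q
    {x | x.1 < max (1 / 2 - x.2 / 2) (x.2 - 1 / 4)} {x | x.1 ≤ max (1 / 2 - x.2 / 2) (x.2 - 1 / 4)} := by
  -- The upper left border of the positive set: the old gap starts at `1/8` and is closed at height
  -- `15/16`; from there on the new gap starts at `9/16 = (1 + 1/8) / 2`.
  obtain ⟨A, hA, hAs, hAw, hAp⟩ := exists_stair (l := 1 / 8) (r := 9 / 16) (h := 15 / 16)
    (by norm_num) (by norm_num) (by norm_num) (by norm_num) (by norm_num) (by norm_num)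
    (by norm_num)
  have hcm : ∀ b ∈ Icc (0 : ℝ) 1, max (1 / 2 - b / 2) (b - 1 / 4) ≤ 3 / 4 := fun b hb =>
    max_le (by linarith [hb.1]) (by linarith [hb.2])
  refine exists_sector_left (c := fun b => max (1 / 2 - b / 2) (b - 1 / 4)) hA hAs hAw (by fun_prop)
    (fun b hb => ⟨le_max_of_le_left (by linarith [hb.2]), (hcm b hb).trans (by norm_num)⟩)
    strictMonoOn_mixed_tree ?_ ?_ ?_ ?_ ?_ ?_ ?_
  · intro w hw
    rw [gapFun_eq_zero_iff]
    have := hAp w hw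
    simp only [Piece.posSet, mem_ofPred_eq]
    grind
  · intro w hw
    have h1 := hAp w hw
    have h2 := (hAs w hw).2
    simp only [mem_Icc] at h2
    rw [le_max_iff]
    rcases h1 with h1 | h1 | h1
    · rcases le_total (A w).2 (1 / 2) with h3 | h3
      · left; linarith
      · right; linarith
    · right; linarith
    · right; linarith
  · intro x hx _
    exact mixed_tau_iff hx
  · rintro x hx hp w hw ⟨h1, h2⟩
    have := hAp w hw
    simp only [Piece.posSet, mem_ofPred_eq] at hp
    grind
  · intro x hx hc w hw h
    have := hcm _ hx.2
    have := hAp w hw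
    constructor
    · rcases this with h1 | h1 | h1 <;> linarith
    · linarith
  · intro x hx y hy w hw h1 h2 hl hc hg
    have := hcm _ hy.2
    have := hAp w hw
    refine gap_mixed_left hl ?_ ?_ (by linarith) hg
    · rcases this with h1 | h1 | h1 <;> linarith
    · grind
  · intro x hx w hw hxw h hc hg
    have hle := h.le
    have hcx := hcm _ hx.2
    simp only [Piece.dir]
    rcases le_or_gt x.1 (3 / 16) with k1 | k1
    · exact rot_twist_rel ε (Or.inl k1) (Or.inl (hle.1.trans k1))
    rcases le_or_gt (5 / 16) (A w).1 with k2 | k2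
    · exact rot_twist_rel ε (Or.inr (k2.trans hle.1)) (Or.inr k2)
    rcases hle.1.eq_or_lt with k3 | k3
    · rw [k3]; exact Or.inl rfl
    -- Remaining case: the foot lies before the end of the twist, the point beyond its beginning,
    -- and they are on different verticals. The gap is at most `1/2` only above height `7/8`, and in
    -- the band such a level line does not exist.
    exfalso
    have k4 : 7 / 8 < x.2 := by
      by_contra hcon
      simp only [Piece.gapFun] at hg
      rw [prog_eq_zero (by linarith), gap_eq_one k1.le (by linarith)] at hg
      norm_num at hg
    have k5 : (A w).2 ≤ 15 / 16 := by
      rcases hAp _ hw with h' | h' | h'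
      · exact h'.2
      · exact h'.1.le
      · linarith
    have k6 : x.2 < (A w).2 := by
      rcases h with h | h | h
      · exact h.2
      · exact h.2.1
      · rcases h.2.2 with h' | h' <;> linarith [h.2.1]
    exact level_false (hAs _ hw) hx ((hAw _ hw).trans hxw.symm) k3 k2 k1 k4 k5 k6

lemma exists_sector_mixed_right (ε : ℤˣ) : ∃ Q, Covers (.mixed ε) Q
    {x | max (1 / 2 - x.2 / 2) (x.2 - 1 / 4) < x.1} {x | max (1 / 2 - x.2 / 2) (x.2 - 1 / 4) ≤ x.1} := by
  -- The lower right border: the old gap ends at `7/8`, and the new one, which opens at height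
  -- `7/8`, ends at `15/16`.
  obtain ⟨A, hA, hAs, hAw, hAp⟩ := exists_stair (l := 7 / 8) (r := 15 / 16) (h := 7 / 8)
    (by norm_num) (by norm_num) (by norm_num) (by norm_num) (by norm_num) (by norm_num)
    (by norm_num)
  have hcm : ∀ b ∈ Icc (0 : ℝ) 1, 1 / 4 ≤ max (1 / 2 - b / 2) (b - 1 / 4) ∧
      (7 / 8 < b → 5 / 8 ≤ max (1 / 2 - b / 2) (b - 1 / 4)) := by
    intro b hb
    constructor
    · rw [le_max_iff]; rcases le_total b (1 / 2) with h | h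
      · left; linarith
      · right; linarith
    · intro h; exact le_max_of_le_right (by linarith)
  refine exists_sector_right (c := fun b => max (1 / 2 - b / 2) (b - 1 / 4)) hA hAs hAw (by fun_prop)
    (fun b hb => ⟨le_max_of_le_left (by linarith [hb.2]),
      max_le (by linarith [hb.1]) (by linarith [hb.2])⟩)
    strictMonoOn_mixed_tree ?_ ?_ ?_ ?_ ?_ ?_ ?_
  · intro w hw
    rw [gapFun_eq_zero_iff]
    have := hAp w hw
    simp only [Piece.posSet, mem_ofPred_eq]
    grind
  · intro w hw
    have h1 := hAp w hw
    have h2 := (hAs w hw).2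
    simp only [mem_Icc] at h2
    simp only [max_le_iff]
    constructor <;> rcases h1 with h1 | h1 | h1 <;> linarith
  · intro x hx _
    rw [mixed_tau_iff hx, eq_comm]
  · rintro x hx hp w hw ⟨h1, h2⟩
    have := hAp w hw
    simp only [Piece.posSet, mem_ofPred_eq] at hp
    grind
  · intro x hx hc w hw h
    have := (hcm _ hx.2).1
    have := hAp w hw
    constructor
    · linarith
    · rcases this with h1 | h1 | h1 <;> linarith
  · intro x hx y hy w hw h1 h2 hl hc hg
    have h3 := hcm _ hy.2
    have := hAp w hw
    refine gap_mixed_right hl (h3.1.trans hc) (fun h => (h3.2 h).trans hc) ?_ ?_ hg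
    · rcases this with h1 | h1 | h1 <;> linarith
    · grind
  · intro x hx w hw hxw h hc hg
    have h3 := hcm _ hx.2
    have h4 : 5 / 16 ≤ (A w).1 := by rcases hAp w hw with h1 | h1 | h1 <;> linarith
    simp only [Piece.dir]
    rcases le_or_gt (5 / 16) x.1 with k1 | k1
    · exact rot_twist_rel ε (Or.inr k1) (Or.inr h4)
    exfalso
    have k2 : x.2 ≤ 7 / 8 := by
      by_contra hcon
      linarith [h3.2 (not_le.1 hcon)]
    simp only [Piece.gapFun] at hg
    rw [prog_eq_zero (by linarith), gap_eq_one (by linarith) (by linarith)] at hg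
    norm_num at hg

lemma trivalent_tau_left {x : ℝ × ℝ} (hx : x ∈ square) (h : x.1 ≤ min (1 / 4 + x.2 / 2) (1 / 2)) :
    x ∈ Piece.trivalentTau.tauSet ↔ x.1 = min (1 / 4 + x.2 / 2) (1 / 2) := by
  have h' := hx.2
  simp only [mem_Icc] at h'
  rw [Piece.mem_tauSet_iff]
  simp only
  rcases le_total x.2 (1 / 2) with k | k
  · rw [min_eq_left (by linarith)] at *
    constructor
    · rintro ((h1 | h1) | h1) <;> linarith [h1.1, h1.2]
    · intro h1; exact Or.inl (Or.inl ⟨⟨h'.1, k⟩, h1⟩)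
  · rw [min_eq_right (by linarith)] at *
    constructor
    · rintro ((h1 | h1) | h1) <;> linarith [h1.1, h1.2]
    · intro h1; exact Or.inr ⟨⟨k, h'.2⟩, h1⟩

lemma exists_sector_trivalent_left : ∃ Q, Covers .trivalentTau Q
    {x | x.1 < min (1 / 4 + x.2 / 2) (1 / 2)} {x | x.1 ≤ min (1 / 4 + x.2 / 2) (1 / 2)} := by
  -- The left one of two compressed gaps starts at `1/16` until height `1/4`; the single gap that
  -- replaces it starts at `1/8`.
  obtain ⟨A, hA, hAs, hAw, hAp⟩ := exists_stair (l := 1 / 16) (r := 1 / 8) (h := 1 / 4)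
    (by norm_num) (by norm_num) (by norm_num) (by norm_num) (by norm_num) (by norm_num)
    (by norm_num)
  refine exists_sector_left (c := fun b => min (1 / 4 + b / 2) (1 / 2)) hA hAs hAw (by fun_prop)
    (fun b hb => ⟨le_min (by linarith [hb.1]) (by norm_num), (min_le_right _ _).trans (by norm_num)⟩)
    strictMonoOn_trivalent_tree ?_ ?_ ?_ ?_ ?_ ?_ ?_
  · intro w hw
    rw [gapFun_eq_zero_iff]
    have := hAp w hw
    simp only [Piece.posSet, mem_ofPred_eq]
    grind
  · intro w hw
    have h1 := hAp w hw
    have h2 := (hAs w hw).2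
    simp only [mem_Icc] at h2
    simp only [le_min_iff]
    constructor <;> rcases h1 with h1 | h1 | h1 <;> linarith
  · intro x hx h
    exact trivalent_tau_left hx h
  · rintro x hx hp w hw ⟨h1, h2⟩
    have := hAp w hw
    simp only [Piece.posSet, mem_ofPred_eq] at hp
    grind
  · intro x hx hc w hw h
    have h1 := hAp w hw
    simp only [le_min_iff] at hc
    constructor
    · rcases h1 with h1 | h1 | h1 <;> linarith
    · linarith [hc.2]
  · intro x hx y hy w hw h1 h2 hl hc hg
    have := hAp w hw
    simp only [le_min_iff] at hc
    refine gap_trivalent_left hl ?_ ?_ hc.2 hc.1 hg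
    · rcases this with h1 | h1 | h1 <;> linarith
    · grind
  · intros
    exact Or.inl rfl

/-! ### The path around a rectangle -/

/-- First coordinate of the path up, across and down. -/
def ux (u : ℝ) : ℝ := max (-1) (min 1 (4 * u - 2))

/-- Second coordinate of the path up, across and down. -/
def uy (u : ℝ) : ℝ := min 1 (min (4 * u) (4 - 4 * u))

lemma continuous_ux : Continuous ux := by unfold ux; fun_prop

lemma continuous_uy : Continuous uy := by unfold uy; fun_prop

lemma u_cases (u : ℝ) :
    (u ≤ 1 / 4 ∧ ux u = -1 ∧ uy u = 4 * u) ∨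
    (1 / 4 ≤ u ∧ u ≤ 3 / 4 ∧ ux u = 4 * u - 2 ∧ uy u = 1) ∨
    (3 / 4 ≤ u ∧ ux u = 1 ∧ uy u = 4 - 4 * u) := by
  unfold ux uy
  rcases le_total u (1 / 4) with k | k
  · left
    refine ⟨k, ?_, ?_⟩
    · rw [min_eq_right (by linarith), max_eq_left (by linarith)]
    · rw [min_eq_left (a := 4 * u) (by linarith), min_eq_right (by linarith)]
  rcases le_total u (3 / 4) with k' | k'
  · right; left
    refine ⟨k, k', ?_, ?_⟩
    · rw [min_eq_right (by linarith), max_eq_right (by linarith)]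
    · exact min_eq_left (le_min (by linarith) (by linarith))
  · right; right
    refine ⟨k', ?_, ?_⟩
    · rw [min_eq_left (by linarith), max_eq_right (by linarith)]
    · rw [min_eq_right (a := 4 * u) (by linarith), min_eq_right (by linarith)]

lemma u_bounds {u : ℝ} (h0 : 0 ≤ u) (h1 : u ≤ 1) :
    |ux u| ≤ 1 ∧ 0 ≤ uy u ∧ uy u ≤ 1 ∧ (|ux u| = 1 ∨ uy u = 1) := by
  rcases u_cases u with ⟨h, e, e'⟩ | ⟨h, h', e, e'⟩ | ⟨h, e, e'⟩ <;> rw [e, e']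
  · norm_num; exact ⟨h0, by linarith⟩
  · refine ⟨abs_le.2 ⟨by linarith, by linarith⟩, by norm_num, le_rfl, Or.inr rfl⟩
  · norm_num; exact ⟨h1, by linarith⟩

lemma uy_pos {u : ℝ} (h0 : 0 < u) (h1 : u < 1) : 0 < uy u := by
  rcases u_cases u with ⟨h, e, e'⟩ | ⟨h, h', e, e'⟩ | ⟨h, e, e'⟩ <;> rw [e'] <;> linarith

lemma uy_zero : uy 0 = 0 := by
  rcases u_cases 0 with ⟨h, e, e'⟩ | ⟨h, h', e, e'⟩ | ⟨h, e, e'⟩ <;> linarith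

lemma uy_one : uy 1 = 0 := by
  rcases u_cases 1 with ⟨h, e, e'⟩ | ⟨h, h', e, e'⟩ | ⟨h, e, e'⟩ <;> linarith

lemma u_inj {u v : ℝ} (hx : ux u = ux v) (hy : uy u = uy v) : u = v := by
  rcases u_cases u with ⟨h, e, e'⟩ | ⟨h, h', e, e'⟩ | ⟨h, e, e'⟩ <;>
    rcases u_cases v with ⟨k, f, f'⟩ | ⟨k, k', f, f'⟩ | ⟨k, f, f'⟩ <;>
    rw [e, f] at hx <;> rw [e', f'] at hy <;> linarith

/-- The path covers the left, top and right sides of `[-1, 1] × [0, 1]`. -/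
lemma u_surj {X Y : ℝ} (hX : |X| ≤ 1) (hY0 : 0 ≤ Y) (hY1 : Y ≤ 1) (h : |X| = 1 ∨ Y = 1) :
    ∃ u ∈ Icc (0 : ℝ) 1, ux u = X ∧ uy u = Y := by
  obtain ⟨hX1, hX2⟩ := abs_le.1 hX
  have key : ∀ u ∈ Icc (0 : ℝ) 1, (u < 1 / 4 → X = -1 ∧ Y = 4 * u) →
      (1 / 4 ≤ u → u ≤ 3 / 4 → X = 4 * u - 2 ∧ Y = 1) → (3 / 4 < u → X = 1 ∧ Y = 4 - 4 * u) →
      ∃ u ∈ Icc (0 : ℝ) 1, ux u = X ∧ uy u = Y := by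
    intro u hu c1 c2 c3
    refine ⟨u, hu, ?_⟩
    rcases u_cases u with ⟨h, e, e'⟩ | ⟨h, h', e, e'⟩ | ⟨h, e, e'⟩ <;> rw [e, e']
    · rcases h.lt_or_eq with h | h
      · exact ⟨(c1 h).1.symm, (c1 h).2.symm⟩
      · have := c2 h.ge (by linarith)
        constructor <;> linarith [this.1, this.2]
    · exact ⟨(c2 h h').1.symm, (c2 h h').2.symm⟩
    · rcases h.lt_or_eq with h | h
      · exact ⟨(c3 h).1.symm, (c3 h).2.symm⟩
      · have := c2 (by linarith) h.ge
        constructor <;> linarith [this.1, this.2]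
  rcases h with h | h
  · rcases (abs_eq zero_le_one).1 h with h | h
    · refine key (1 - Y / 4) ⟨by linarith, by linarith⟩ ?_ ?_ ?_ <;> intros <;>
        constructor <;> linarith
    · refine key (Y / 4) ⟨by linarith, by linarith⟩ ?_ ?_ ?_ <;> intros <;> constructor <;> linarith
  · refine key ((X + 2) / 4) ⟨by linarith, by linarith⟩ ?_ ?_ ?_ <;> intros <;>
      constructor <;> linarith

lemma gap_abs (z : ℝ) : gap (1 / 2 + z) = gap (1 / 2 - |z|) := by
  rcases abs_cases z with ⟨h, -⟩ | ⟨h, -⟩ <;> rw [h]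
  · rw [← gap_symm]; congr 1; ring
  · congr 1; ring

/-! ### The black `τ`-vertex -/

/-- The sector of a black `τ`-vertex. -/
def blackSector (x : ℝ × ℝ) : ℝ × ℝ :=
  (1 / 2 + 3 / 8 * ((1 - x.2) * ux x.1), uy x.1 * (3 - x.2) / 4)

/-- At `s = 0` the sector goes around `[1/8, 7/8] × [0, 3/4]`, where the gap is positive, and at `s
= 1` it is folded onto the `τ`-edge from both sides; one sector is therefore enough. With growing
`s` the point moves towards the centre line and downwards, so the hooks recede and the saddle is
undone. -/
lemma isSector_black : IsSector .blackTau blackSector := by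
  have hu := fun (x : ℝ × ℝ) (hx : x ∈ square) => u_bounds hx.1.1 hx.1.2
  have hz : ∀ x ∈ square, |(1 - x.2) * ux x.1| ≤ 1 - x.2 := by
    intro x hx
    have := hx.2
    simp only [mem_Icc] at this
    rw [abs_mul, abs_of_nonneg (by linarith)]
    nlinarith [(hu x hx).1]
  have hb : ∀ x ∈ square, 0 ≤ (blackSector x).2 ∧ (blackSector x).2 ≤ 3 / 4 := by
    intro x hx
    have := hx.2
    simp only [mem_Icc] at this
    obtain ⟨-, h1, h2, -⟩ := hu x hx
    simp only [blackSector]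
    constructor <;> nlinarith
  have ha : ∀ x ∈ square, 0 < (blackSector x).1 ∧ (blackSector x).1 < 1 := by
    intro x hx
    have := hx.2
    simp only [mem_Icc] at this
    obtain ⟨h1, h2⟩ := abs_le.1 (hz x hx)
    simp only [blackSector]
    constructor <;> linarith
  refine ⟨?_, ?_, ha, ?_, ?_, ?_, ?_, ?_, ?_, ?_⟩
  · have h1 := continuous_ux
    have h2 := continuous_uy
    have : Continuous blackSector := by unfold blackSector; fun_prop
    exact this.continuousOn
  · intro x hx
    exact ⟨⟨(ha x hx).1.le, (ha x hx).2.le⟩, (hb x hx).1, by linarith [(hb x hx).2]⟩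
  · intro x hx h0 h1
    have := hx.2
    simp only [mem_Icc] at this
    refine ⟨?_, by linarith [(hb x hx).2]⟩
    have := uy_pos h0 h1
    simp only [blackSector]
    have : 0 < 3 - x.2 := by linarith
    positivity
  · rintro x hx (h | h) <;> left <;> simp only [blackSector, h, uy_zero, uy_one] <;> ring
  · intro x hx h
    rw [gapFun_eq_zero_iff]
    simp only [Piece.posSet, blackSector, h, mem_ofPred_eq]
    rintro ⟨h1, h2, h3⟩
    rcases (hu x hx).2.2.2 with h4 | h4
    · rcases (abs_eq zero_le_one).1 h4 with h5 | h5 <;> rw [h5] at h2 h3 <;> linarith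
    · rw [h4] at h1; linarith
  · intro x hx
    have h2 := hx.2
    simp only [mem_Icc] at h2
    rw [Piece.mem_tauSet_iff]
    simp only
    constructor
    · rintro ⟨⟨h3, h4⟩, h5⟩
      simp only [blackSector] at *
      have : (1 - x.2) * ux x.1 = 0 := by linarith
      rcases mul_eq_zero.1 this with h6 | h6
      · linarith
      · rcases (hu x hx).2.2.2 with h7 | h7
        · rw [h6] at h7; norm_num at h7
        · rw [h7] at h4; linarith
    · intro h
      have := (hu x hx).2.2.1
      refine ⟨⟨(hb x hx).1, ?_⟩, ?_⟩ <;> simp only [blackSector, h] <;> linarith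
  · intro x hx y hy hxy hlt hg
    have hx2 := hx.2
    have hy2 := hy.2
    simp only [mem_Icc] at hx2 hy2
    obtain ⟨k1, k2, k3, k4⟩ := hu x hx
    have e1 : gap (blackSector x).1 = gap (1 / 2 - 3 / 8 * ((1 - x.2) * |ux x.1|)) := by
      rw [blackSector, gap_abs, abs_mul, abs_mul, abs_of_nonneg (a := 1 - x.2) (by linarith),
        abs_of_nonneg (a := (3 / 8 : ℝ)) (by norm_num)]
    have e2 : gap (blackSector y).1 = gap (1 / 2 - 3 / 8 * ((1 - y.2) * |ux x.1|)) := by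
      rw [blackSector, gap_abs, abs_mul, abs_mul, abs_of_nonneg (a := 1 - y.2) (by linarith),
        abs_of_nonneg (a := (3 / 8 : ℝ)) (by norm_num), hxy]
    have hX := abs_nonneg (ux x.1)
    have hprod : (1 - y.2) * |ux x.1| ≤ (1 - x.2) * |ux x.1| :=
      mul_le_mul_of_nonneg_right (by linarith) hX
    have hgle : gap (blackSector x).1 ≤ gap (blackSector y).1 := by
      rw [e1, e2]
      have : 0 ≤ (1 - y.2) * |ux x.1| := mul_nonneg (by linarith) hX
      exact gap_mono_left (by linarith) (by linarith)
    have hb2 : (blackSector y).2 ≤ (blackSector x).2 := by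
      simp only [blackSector, ← hxy]; nlinarith
    have hb3 : (blackSector y).2 < 3 / 4 := by
      simp only [blackSector, ← hxy]; nlinarith
    have hp := prog_mono (c := 4) (d := 2) (by norm_num) hb2
    have hp1 := prog_lt_one_iff (c := 4) (d := 2) |>.2 (show 4 * (blackSector y).2 < 2 + 1 by linarith)
    simp only [Piece.gapFun] at *
    have hG0 := gap_nonneg (blackSector x).1
    have hq0 := prog_nonneg 4 2 (blackSector y).2
    rcases (gap_le_one (blackSector x).1).lt_or_eq with hG | hG
    · have hXpos : 0 < |ux x.1| := by
        refine lt_of_le_of_ne hX fun h => ?_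
        rw [e1, ← h, gap_eq_one (by norm_num) (by norm_num)] at hG
        exact lt_irrefl _ hG
      have hstr : gap (blackSector x).1 < gap (blackSector y).1 := by
        rw [e1] at hG
        rw [e1, e2]
        refine gap_strict_left ?_ ?_ ?_ hG
        · have : (1 - x.2) * |ux x.1| ≤ 1 := by nlinarith
          linarith
        · have : (1 - y.2) * |ux x.1| < (1 - x.2) * |ux x.1| :=
            mul_lt_mul_of_pos_right (by linarith) hXpos
          linarith
        · have : 0 ≤ (1 - y.2) * |ux x.1| := mul_nonneg (by linarith) hX
          linarith
      calc _ ≤ (1 - prog 4 2 (blackSector y).2) * gap (blackSector x).1 :=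
            mul_le_mul_of_nonneg_right (by linarith) hG0
        _ < _ := mul_lt_mul_of_pos_left hstr (by linarith)
    · have hG' : gap (blackSector y).1 = 1 := le_antisymm (gap_le_one _) (by linarith)
      rw [hG, mul_one] at hg ⊢
      rw [hG', mul_one]
      have h1 : 2 < 4 * (blackSector x).2 := prog_pos_iff.1 (by linarith)
      have h2 : (blackSector y).2 < (blackSector x).2 := by
        simp only [blackSector] at h1
        simp only [blackSector, ← hxy]
        have : 0 < uy x.1 := by
          refine lt_of_le_of_ne k2 fun h => ?_
          rw [← h] at h1; norm_num at h1
        nlinarith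
      have := prog_strict (c := 4) (d := 2) (by norm_num) h2 ⟨h1, by linarith⟩
      linarith
  · intros
    exact Or.inl rfl
  · rintro ⟨u, s⟩ hx ⟨v, t⟩ hy hs ht h
    simp only [blackSector, Prod.mk.injEq] at h hs ht
    obtain ⟨h1, h2⟩ := h
    have h1' : (1 - s) * ux u = (1 - t) * ux v := by linarith
    have h2' : uy u * (3 - s) = uy v * (3 - t) := by linarith
    have habs : (1 - s) * |ux u| = (1 - t) * |ux v| := by
      have := congrArg abs h1'
      rwa [abs_mul, abs_mul, abs_of_pos (a := 1 - s) (by linarith),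
        abs_of_pos (a := 1 - t) (by linarith)] at this
    have hst : s = t := by
      have aux : ∀ {u v s t : ℝ}, s < 1 → t < 1 → |ux v| ≤ 1 → uy v ≤ 1 →
          (|ux u| = 1 ∨ uy u = 1) → (1 - s) * |ux u| = (1 - t) * |ux v| →
          uy u * (3 - s) = uy v * (3 - t) → t ≤ s := by
        intro u v s t hs ht k1 k3 k4 e1 e2
        rcases k4 with k4 | k4
        · rw [k4] at e1
          nlinarith
        · rw [k4] at e2
          nlinarith
      obtain ⟨k1, -, k3, k4⟩ := hu _ hx
      obtain ⟨l1, -, l3, l4⟩ := hu _ hy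
      exact le_antisymm (aux ht hs k1 k3 l4 habs.symm h2'.symm) (aux hs ht l1 l3 k4 habs h2')
    subst hst
    have e1 : ux u = ux v := mul_left_cancel₀ (by linarith) h1'
    have e2 : uy u = uy v := mul_right_cancel₀ (by linarith) h2'
    exact Prod.ext (u_inj e1 e2) rfl

lemma covers_black {y : ℝ × ℝ} (hy : y ∈ square) (hp : y ∈ Piece.blackTau.posSet) :
    ∃ x ∈ square, blackSector x = y := by
  obtain ⟨a, b⟩ := y
  have hb0 := hy.2.1
  simp only [Piece.posSet, mem_ofPred_eq] at hp hb0
  obtain ⟨h1, h2, h3⟩ := hp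
  have hz : |a - 1 / 2| < 3 / 8 := abs_lt.2 ⟨by linarith, by linarith⟩
  by_cases h0 : a = 1 / 2 ∧ b ≤ 1 / 2
  · obtain ⟨u, hu, e1, e2⟩ := u_surj (X := 1) (Y := 2 * b) (by norm_num) (by linarith) (by linarith)
      (Or.inl (by norm_num))
    refine ⟨(u, 1), ⟨hu, by norm_num, le_rfl⟩, ?_⟩
    simp only [blackSector, e1, e2, h0.1, Prod.mk.injEq]
    constructor <;> ring
  -- `l = 1 - s` is the smallest value for which the rescaled point lies in `[-1, 1] × [0, 1]`;
  -- minimality puts it on the path. It vanishes only on the `τ`-edge, which was treated before.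
  set l := max (8 / 3 * |a - 1 / 2|) (4 * b - 2) with hl
  have hl0 : 0 < l := by
    by_contra hcon
    have k1 := (le_max_left (8 / 3 * |a - 1 / 2|) (4 * b - 2)).trans (not_lt.1 hcon)
    have k2 := (le_max_right (8 / 3 * |a - 1 / 2|) (4 * b - 2)).trans (not_lt.1 hcon)
    have k3 := abs_nonneg (a - 1 / 2)
    exact h0 ⟨by linarith [abs_eq_zero.1 (show |a - 1 / 2| = 0 by linarith)], by linarith⟩
  have hl1 : l ≤ 1 := max_le (by linarith) (by linarith)
  have e : |8 / 3 * (a - 1 / 2) / l| = 8 / 3 * |a - 1 / 2| / l := by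
    rw [abs_div, abs_mul, abs_of_pos hl0, abs_of_pos (a := (8 / 3 : ℝ)) (by norm_num)]
  have hl2 : 0 < 2 + l := by linarith
  obtain ⟨u, hu, e1, e2⟩ := u_surj (X := 8 / 3 * (a - 1 / 2) / l) (Y := 4 * b / (2 + l))
    (by rw [e, div_le_one hl0]; exact le_max_left _ _) (by positivity)
    (by rw [div_le_one hl2]; linarith [le_max_right (8 / 3 * |a - 1 / 2|) (4 * b - 2)])
    (by
      rcases max_choice (8 / 3 * |a - 1 / 2|) (4 * b - 2) with h | h
      · left; rw [e, div_eq_one_iff_eq hl0.ne', hl, h]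
      · right; rw [div_eq_one_iff_eq hl2.ne']; rw [hl, h]; ring)
  refine ⟨(u, 1 - l), ⟨hu, by simp only; linarith, by simp only; linarith⟩, ?_⟩
  simp only [blackSector, e1, e2, Prod.mk.injEq]
  constructor
  · field_simp; ring
  · field_simp; ring

/-! ### The middle sector of a trivalent vertex -/

/-- The scaling factor of the middle sector. -/
def midScale (x : ℝ × ℝ) : ℝ := (1 - x.2) + x.2 * (4 / (|ux x.1| + uy x.1))

/-- The middle sector of a trivalent vertex. -/
def midSector (x : ℝ × ℝ) : ℝ × ℝ :=
  (1 / 2 + midScale x * ux x.1 / 16, midScale x * uy x.1 / 8)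

lemma mid_norm {u : ℝ} (h0 : 0 ≤ u) (h1 : u ≤ 1) : 1 ≤ |ux u| + uy u ∧ |ux u| + uy u ≤ 2 := by
  obtain ⟨k1, k2, k3, k4⟩ := u_bounds h0 h1
  have := abs_nonneg (ux u)
  constructor
  · rcases k4 with k4 | k4 <;> linarith
  · linarith

lemma midScale_mul {x : ℝ × ℝ} (hx : x ∈ square) :
    midScale x * (|ux x.1| + uy x.1) = (1 - x.2) * (|ux x.1| + uy x.1) + 4 * x.2 := by
  have := mid_norm hx.1.1 hx.1.2
  have : |ux x.1| + uy x.1 ≠ 0 := by linarith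
  unfold midScale
  field_simp

lemma midScale_lt {x y : ℝ × ℝ} (hx : x ∈ square) (h : x.1 = y.1) (hlt : x.2 < y.2) :
    midScale x < midScale y := by
  have := mid_norm hx.1.1 hx.1.2
  have h4 : 2 ≤ 4 / (|ux x.1| + uy x.1) := by
    rw [le_div_iff₀ (by linarith)]; linarith
  unfold midScale
  rw [← h]
  nlinarith

lemma one_le_midScale {x : ℝ × ℝ} (hx : x ∈ square) : 1 ≤ midScale x := by
  have := mid_norm hx.1.1 hx.1.2
  have h4 : 2 ≤ 4 / (|ux x.1| + uy x.1) := by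
    rw [le_div_iff₀ (by linarith)]; linarith
  have := hx.2.1
  unfold midScale
  nlinarith

lemma midSector_abs {x : ℝ × ℝ} (hx : x ∈ square) :
    |(midSector x).1 - 1 / 2| = midScale x * |ux x.1| / 16 := by
  simp only [midSector]
  rw [add_sub_cancel_left, abs_div, abs_mul, abs_of_nonneg (a := midScale x) (by linarith [one_le_midScale hx]),
    abs_of_pos (a := (16 : ℝ)) (by norm_num)]

/-- The function `4 |a - 1/2| + 2 b` is homogeneous about `(1/2, 0)` and equals 1 on the two lower
branches of the `τ`-chart, so it measures how far the radial expansion has come. -/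
lemma midSector_level {x : ℝ × ℝ} (hx : x ∈ square) :
    4 * |(midSector x).1 - 1 / 2| + 2 * (midSector x).2 =
      (1 - x.2) * ((|ux x.1| + uy x.1) / 4) + x.2 := by
  rw [midSector_abs hx]
  simp only [midSector]
  have := midScale_mul hx
  linarith

/-- Near the centre line `gap a = 1`, and at most one of the two compressed gaps is open at a given
point. The form as one minus a product shows that the gap grows with the hook gap and with the
progress. -/
lemma gap_mid {x : ℝ × ℝ} (h : |x.1 - 1 / 2| ≤ 1 / 4) : Piece.trivalentTau.gapFun x =
    1 - (1 - prog 8 1 x.2) * (1 - gap (2 * |x.1 - 1 / 2|)) := by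
  obtain ⟨h1, h2⟩ := abs_le.1 h
  have e : gap (2 * x.1) + gap (2 * x.1 - 1) = gap (2 * |x.1 - 1 / 2|) := by
    rcases abs_cases (x.1 - 1 / 2) with ⟨h, h'⟩ | ⟨h, h'⟩ <;> rw [h]
    · rw [gap_eq_zero (a := 2 * x.1) (Or.inr (by linarith)), zero_add]; congr 1; ring
    · rw [gap_eq_zero (a := 2 * x.1 - 1) (Or.inl (by linarith)), add_zero, ← gap_symm]
      congr 1; ring
  simp only [Piece.gapFun]
  rw [e, gap_eq_one (a := x.1) (by linarith) (by linarith)]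
  ring

lemma trivalent_tau_mid {x : ℝ × ℝ} (hb : 0 ≤ x.2) (h : 4 * |x.1 - 1 / 2| + 2 * x.2 ≤ 1) :
    x ∈ Piece.trivalentTau.tauSet ↔ 4 * |x.1 - 1 / 2| + 2 * x.2 = 1 := by
  rw [Piece.mem_tauSet_iff]
  simp only
  rcases abs_cases (x.1 - 1 / 2) with ⟨h1, h2⟩ | ⟨h1, h2⟩ <;> rw [h1] at h ⊢
  · constructor
    · rintro ((h3 | h3) | h3) <;> linarith [h3.1.1, h3.1.2, h3.2]
    · intro h3; exact Or.inl (Or.inr ⟨⟨hb, by linarith⟩, by linarith⟩)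
  · constructor
    · rintro ((h3 | h3) | h3) <;> linarith [h3.1.1, h3.1.2, h3.2]
    · intro h3; exact Or.inl (Or.inl ⟨⟨hb, by linarith⟩, by linarith⟩)

/-- Radial expansion from `(1/2, 0)` takes the border of the rectangle `|a - 1/2| ≤ 1/16`, `b ≤ 1/8`
to the two lower branches. Both `|a - 1/2|` and `b` grow, hence so do the hook gap and the progress.
On each ray one of them grows strictly. -/
lemma isSector_mid : IsSector .trivalentTau midSector := by
  have hu := fun (x : ℝ × ℝ) (hx : x ∈ square) => u_bounds hx.1.1 hx.1.2
  have hn := fun (x : ℝ × ℝ) (hx : x ∈ square) => mid_norm hx.1.1 hx.1.2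
  have hlev : ∀ x ∈ square, 4 * |(midSector x).1 - 1 / 2| + 2 * (midSector x).2 ≤ 1 := by
    intro x hx
    rw [midSector_level hx]
    have := hn x hx
    have := hx.2
    simp only [mem_Icc] at this
    nlinarith
  have hb : ∀ x ∈ square, 0 ≤ (midSector x).2 ∧ (midSector x).2 ≤ 1 / 2 := by
    intro x hx
    constructor
    · simp only [midSector]
      have := (hu x hx).2.1
      have := one_le_midScale hx
      positivity
    · linarith [hlev x hx, abs_nonneg ((midSector x).1 - 1 / 2)]
  have habs : ∀ x ∈ square, |(midSector x).1 - 1 / 2| ≤ 1 / 4 := fun x hx => by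
    linarith [hlev x hx, (hb x hx).1]
  have ha : ∀ x ∈ square, 0 < (midSector x).1 ∧ (midSector x).1 < 1 := by
    intro x hx
    obtain ⟨h1, h2⟩ := abs_le.1 (habs x hx)
    constructor <;> linarith
  refine ⟨?_, ?_, ha, ?_, ?_, ?_, ?_, ?_, ?_, ?_⟩
  · have h1 := continuous_ux
    have h2 := continuous_uy
    have h3 : ContinuousOn midScale square := by
      unfold midScale
      refine ContinuousOn.add (by fun_prop) (ContinuousOn.mul (by fun_prop)
        (ContinuousOn.div (by fun_prop) (by fun_prop) fun x hx => ?_))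
      linarith [hn x hx]
    unfold midSector
    fun_prop
  · intro x hx
    exact ⟨⟨(ha x hx).1.le, (ha x hx).2.le⟩, (hb x hx).1, by linarith [(hb x hx).2]⟩
  · intro x hx h0 h1
    refine ⟨?_, by linarith [(hb x hx).2]⟩
    have h2 := uy_pos h0 h1
    have h3 := one_le_midScale hx
    simp only [midSector]
    positivity
  · rintro x hx (h | h) <;> left <;> simp only [midSector, h, uy_zero, uy_one] <;> ring
  · intro x hx h
    have e : midScale x = 1 := by simp [midScale, h]
    obtain ⟨k1, k2, k3, k4⟩ := hu x hx
    rw [gap_mid (habs x hx), prog_eq_zero, gap_eq_zero]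
    · ring
    · left; rw [midSector_abs hx, e]; linarith
    · simp only [midSector, e]; linarith
  · intro x hx
    rw [trivalent_tau_mid (hb x hx).1 (hlev x hx), midSector_level hx]
    have := hn x hx
    constructor
    · intro h
      have : (1 - x.2) * (1 - (|ux x.1| + uy x.1) / 4) = 0 := by linarith
      rcases mul_eq_zero.1 this with h | h <;> linarith
    · intro h; rw [h]; ring
  · intro x hx y hy hxy hlt hg
    have hsc := midScale_lt hx hxy hlt
    have h1x := one_le_midScale hx
    rw [gap_mid (habs x hx)] at *
    rw [gap_mid (habs y hy)]
    obtain ⟨k1, k2, k3, k4⟩ := hu x hx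
    have hA := midSector_abs hx
    have hA' := midSector_abs hy
    have hX := abs_nonneg (ux x.1)
    have hbx : (midSector x).2 = midScale x * uy x.1 / 8 := rfl
    have hby : (midSector y).2 = midScale y * uy x.1 / 8 := by rw [hxy]; rfl
    rw [← hxy] at hA'
    have m1 : |(midSector x).1 - 1 / 2| ≤ |(midSector y).1 - 1 / 2| := by
      rw [hA, hA']; nlinarith
    have m2 : (midSector x).2 ≤ (midSector y).2 := by
      rw [hbx, hby]; nlinarith
    have hby4 := habs y hy
    have G := gap_mono_left (a := 2 * |(midSector x).1 - 1 / 2|)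
      (a' := 2 * |(midSector y).1 - 1 / 2|) (by linarith) (by linarith)
    have P := prog_mono (c := 8) (d := 1) (by norm_num) m2
    have G1 := gap_le_one (2 * |(midSector y).1 - 1 / 2|)
    have P1 := prog_le_one 8 1 (midSector y).2
    have Gx : gap (2 * |(midSector x).1 - 1 / 2|) < 1 := by
      refine lt_of_le_of_ne (gap_le_one _) fun h => ?_
      rw [h] at hg; norm_num at hg
    have Px : prog 8 1 (midSector x).2 < 1 := by
      refine lt_of_le_of_ne (prog_le_one _ _ _) fun h => ?_
      rw [h] at hg; norm_num at hg
    have key : gap (2 * |(midSector x).1 - 1 / 2|) < gap (2 * |(midSector y).1 - 1 / 2|) ∨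
        prog 8 1 (midSector x).2 < prog 8 1 (midSector y).2 := by
      rcases k4 with k4 | k4
      · left
        refine gap_strict_left ?_ ?_ (by linarith) Gx
        · rw [hA, k4]; linarith
        · rw [hA, hA', k4]; linarith
      · right
        refine prog_strict (by norm_num) ?_ ⟨?_, prog_lt_one_iff.1 Px⟩
        · rw [hbx, hby, k4]; linarith
        · rw [hby, k4]; linarith
    rcases key with key | key <;> nlinarith
  · intros
    exact Or.inl rfl
  · rintro x hx y hy hs ht h
    have e1 : midScale x * ux x.1 = midScale y * ux y.1 := by
      have := congrArg Prod.fst h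
      simp only [midSector] at this
      linarith
    have e2 : midScale x * uy x.1 = midScale y * uy y.1 := by
      have := congrArg Prod.snd h
      simp only [midSector] at this
      linarith
    have e3 : midScale x * |ux x.1| = midScale y * |ux y.1| := by
      have := congrArg abs e1
      rwa [abs_mul, abs_mul, abs_of_nonneg (a := midScale x) (by linarith [one_le_midScale hx]),
        abs_of_nonneg (a := midScale y) (by linarith [one_le_midScale hy])] at this
    have hle : ∀ x ∈ square, ∀ y ∈ square, midScale x * |ux x.1| = midScale y * |ux y.1| →
        midScale x * uy x.1 = midScale y * uy y.1 → midScale x ≤ midScale y := by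
      intro x hx y hy e3 e2
      have := one_le_midScale hy
      obtain ⟨-, -, -, k4⟩ := hu x hx
      obtain ⟨l1, -, l3, -⟩ := hu y hy
      rcases k4 with k4 | k4
      · rw [k4] at e3; nlinarith
      · rw [k4] at e2; nlinarith
    have he := le_antisymm (hle x hx y hy e3 e2) (hle y hy x hx e3.symm e2.symm)
    have hne : midScale y ≠ 0 := by linarith [one_le_midScale hy]
    rw [he] at e1 e2
    have h1 := u_inj (mul_left_cancel₀ hne e1) (mul_left_cancel₀ hne e2)
    rcases lt_trichotomy x.2 y.2 with h2 | h2 | h2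
    · exact absurd he (midScale_lt hx h1 h2).ne
    · exact Prod.ext h1 h2
    · exact absurd he (midScale_lt hy h1.symm h2).ne'

lemma covers_mid {y : ℝ × ℝ} (hy : y ∈ square) (hp : y ∈ Piece.trivalentTau.posSet)
    (h : 4 * |y.1 - 1 / 2| + 2 * y.2 ≤ 1) : ∃ x ∈ square, midSector x = y := by
  obtain ⟨a, b⟩ := y
  have hb0 := hy.2.1
  simp only [Piece.posSet, mem_ofPred_eq] at hp hb0 h
  -- The radial factor by which the point must be divided to reach the border of the small
  -- rectangle. It exceeds 1 because the gap is positive.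
  set m := max (16 * |a - 1 / 2|) (8 * b) with hm
  have hm1 : 1 < m := by
    rw [hm, lt_max_iff]
    rcases hp with ⟨h1, ⟨h2, h3⟩ | ⟨h2, h3⟩⟩ | ⟨h1, h2, h3⟩
    · left; linarith [neg_abs_le (a - 1 / 2)]
    · left; linarith [le_abs_self (a - 1 / 2)]
    · right; linarith
  have hm0 : 0 < m := by linarith
  have e : |16 * (a - 1 / 2) / m| = 16 * |a - 1 / 2| / m := by
    rw [abs_div, abs_mul, abs_of_pos hm0, abs_of_pos (a := (16 : ℝ)) (by norm_num)]
  obtain ⟨u, hu, e1, e2⟩ := u_surj (X := 16 * (a - 1 / 2) / m) (Y := 8 * b / m)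
    (by rw [e, div_le_one hm0]; exact le_max_left _ _) (by positivity)
    (by rw [div_le_one hm0]; exact le_max_right _ _)
    (by
      rcases max_choice (16 * |a - 1 / 2|) (8 * b) with h | h
      · left; rw [e, div_eq_one_iff_eq hm0.ne', hm, h]
      · right; rw [div_eq_one_iff_eq hm0.ne', hm, h])
  have hn := mid_norm hu.1 hu.2
  set n := |ux u| + uy u with hn'
  have hmn : m * n ≤ 4 := by
    rw [hn', e1, e2, e]
    have : m * (16 * |a - 1 / 2| / m + 8 * b / m) = 16 * |a - 1 / 2| + 8 * b := by field_simp
    rw [this]; linarith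
  have h4 : 2 ≤ 4 / n := by rw [le_div_iff₀ (by linarith)]; linarith
  have hmle : m ≤ 4 / n := by rw [le_div_iff₀ (by linarith)]; exact hmn
  have hsq : (u, (m - 1) / (4 / n - 1)) ∈ square := by
    refine ⟨hu, ?_⟩
    simp only [mem_Icc]
    constructor
    · exact div_nonneg (by linarith) (by linarith)
    · rw [div_le_one (by linarith)]; linarith
  refine ⟨_, hsq, ?_⟩
  have hsc : midScale (u, (m - 1) / (4 / n - 1)) = m := by
    simp only [midScale]
    rw [← hn']
    have : 4 / n - 1 ≠ 0 := by linarith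
    generalize 4 / n = q at *
    field_simp
    ring
  simp only [midSector, hsc, e1, e2, Prod.mk.injEq]
  constructor
  · field_simp; ring
  · field_simp

/-! ### Mirror images and the sectors of a `τ`-edge -/

/-- The reflection of the square. -/
def mirror (x : ℝ × ℝ) : ℝ × ℝ := (1 - x.1, x.2)

lemma mirror_mirror (x : ℝ × ℝ) : mirror (mirror x) = x := by simp [mirror]

lemma mirror_mem {x : ℝ × ℝ} (hx : x ∈ square) : mirror x ∈ square :=
  ⟨⟨by simp only [mirror]; linarith [hx.1.2], by simp only [mirror]; linarith [hx.1.1]⟩, hx.2⟩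

lemma Covers.mirror {κ : Piece} {Q : ℝ × ℝ → ℝ × ℝ} {V C : Set (ℝ × ℝ)} (h : Covers κ Q V C)
    (hg : ∀ x, κ.gapFun (mirror x) = κ.gapFun x)
    (ht : ∀ x, mirror x ∈ κ.tauSet ↔ x ∈ κ.tauSet) (hd : ∀ x y, κ.dir x = κ.dir y) :
    Covers κ (fun x => mirror (Q x)) (mirror ⁻¹' V) (mirror ⁻¹' C) := by
  obtain ⟨h, hV, hC⟩ := h
  have hc : Continuous Knit.mirror := by unfold Knit.mirror; fun_prop
  refine ⟨⟨hc.comp_continuousOn h.cont, fun x hx => mirror_mem (h.mem x hx), fun x hx => ?_,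
    h.interior, h.ends, fun x hx hx2 => (hg _).trans (h.zero x hx hx2),
    fun x hx => (ht _).trans (h.mem_tauSet_iff x hx), fun x hx y hy => ?_,
    fun _ _ _ => Or.inl (hd _ _), fun x hx y hy hx2 hy2 e => h.inj x hx y hy hx2 hy2 ?_⟩, ?_, ?_⟩
  · have := h.fst_mem x hx
    constructor <;> simp only [Knit.mirror] <;> linarith
  · simp only [hg]; exact h.strictMono x hx y hy
  · rw [← mirror_mirror (Q x), e, mirror_mirror]
  · intro x hx hx2
    simp only [mem_preimage, mirror_mirror]
    exact hV x hx hx2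
  · intro y hy hp hyC
    rw [← Piece.gapFun_pos_iff, ← hg, Piece.gapFun_pos_iff] at hp
    obtain ⟨x, hx, e⟩ := hC _ (mirror_mem hy) hp hyC
    exact ⟨x, hx, by simp only [e, mirror_mirror]⟩

lemma gapFun_mirror_trivalent (x : ℝ × ℝ) :
    Piece.trivalentTau.gapFun (mirror x) = Piece.trivalentTau.gapFun x := by
  simp only [Piece.gapFun, mirror]
  rw [gap_symm x.1, ← gap_symm (2 * (1 - x.1)), ← gap_symm (2 * (1 - x.1) - 1)]
  rw [show 1 - 2 * (1 - x.1) = 2 * x.1 - 1 by ring, show 1 - (2 * (1 - x.1) - 1) = 2 * x.1 by ring]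
  ring

lemma mem_tauSet_mirror_trivalent (x : ℝ × ℝ) :
    mirror x ∈ Piece.trivalentTau.tauSet ↔ x ∈ Piece.trivalentTau.tauSet := by
  rw [Piece.mem_tauSet_iff, Piece.mem_tauSet_iff]
  simp only [mirror]
  constructor
  · rintro ((h | h) | h)
    · exact Or.inl (Or.inr ⟨h.1, by linarith [h.2]⟩)
    · exact Or.inl (Or.inl ⟨h.1, by linarith [h.2]⟩)
    · exact Or.inr ⟨h.1, by linarith [h.2]⟩
  · rintro ((h | h) | h)
    · exact Or.inl (Or.inr ⟨h.1, by linarith [h.2]⟩)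
    · exact Or.inl (Or.inl ⟨h.1, by linarith [h.2]⟩)
    · exact Or.inr ⟨h.1, by linarith [h.2]⟩

lemma covers_tauEdge_left : Covers .tauEdge (fun x => (1 / 8 + 3 * x.2 / 8, x.1))
    {x | x.1 < 1 / 2} {x | x.1 ≤ 1 / 2} := by
  refine ⟨⟨by fun_prop, ?_, ?_, ?_, ?_, ?_, ?_, ?_, ?_, ?_⟩, ?_, ?_⟩
  · rintro ⟨u, s⟩ ⟨h, h1, h2⟩
    simp only at h1 h2
    exact ⟨⟨by simp only; linarith, by simp only; linarith⟩, h⟩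
  · rintro ⟨u, s⟩ ⟨h, h1, h2⟩
    simp only at h1 h2
    exact ⟨by simp only; linarith, by simp only; linarith⟩
  · rintro ⟨u, s⟩ - h0 h1
    exact ⟨h0, h1⟩
  · rintro ⟨u, s⟩ - h
    exact h
  · rintro ⟨u, s⟩ - h
    simp only at h
    simp only [Piece.gapFun, h]
    exact gap_eq_zero (Or.inl (by norm_num))
  · rintro ⟨u, s⟩ ⟨⟨h1, h2⟩, -⟩
    rw [Piece.mem_tauSet_iff]
    simp only at *
    constructor
    · intro h; linarith [h.2]
    · intro h; exact ⟨⟨h1, h2⟩, by rw [h]; norm_num⟩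
  · rintro ⟨u, s⟩ ⟨-, h1, h2⟩ ⟨v, t⟩ ⟨-, h3, h4⟩ - hlt hg
    simp only [Piece.gapFun] at *
    exact gap_strict_left (by linarith) (by linarith) (by linarith) (by linarith)
  · intros; exact Or.inl rfl
  · rintro ⟨u, s⟩ - ⟨v, t⟩ - - - h
    simp only [Prod.mk.injEq] at h
    exact Prod.ext h.2 (by simp only; linarith [h.1])
  · rintro ⟨u, s⟩ - h
    simp only [mem_ofPred_eq] at *
    linarith
  · rintro ⟨a, b⟩ hy hp h
    simp only [Piece.posSet, mem_ofPred_eq] at hp h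
    refine ⟨(b, (a - 1 / 8) * (8 / 3)), ⟨hy.2, by simp only; linarith, by simp only; linarith⟩, ?_⟩
    simp only [Prod.mk.injEq, and_true]
    ring

/-- The sectors of a model piece. -/
theorem exists_sectors {κ : Piece} (hκ : κ.IsTau) : ∃ (d : ℕ) (Q : Fin d → ℝ × ℝ → ℝ × ℝ),
    (∀ i, IsSector κ (Q i)) ∧
    (∀ i j, ∀ x ∈ square, ∀ y ∈ square, x.2 < 1 → y.2 < 1 → Q i x = Q j y → i = j) ∧
    ∀ y ∈ square, y ∈ κ.posSet → ∃ i, ∃ x ∈ square, Q i x = y := by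
  have two : ∀ {Q Q' V V' C C'}, Covers κ Q V C → Covers κ Q' V' C' → Disjoint V V' →
      C ∪ C' = univ → ∃ (d : ℕ) (Q : Fin d → ℝ × ℝ → ℝ × ℝ), (∀ i, IsSector κ (Q i)) ∧
      (∀ i j, ∀ x ∈ square, ∀ y ∈ square, x.2 < 1 → y.2 < 1 → Q i x = Q j y → i = j) ∧
      ∀ y ∈ square, y ∈ κ.posSet → ∃ i, ∃ x ∈ square, Q i x = y := by
    intro Q Q' V V' C C' h h' hd hu
    refine ⟨2, ![Q, Q'], ?_, ?_, ?_⟩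
    · rw [Fin.forall_fin_two]; exact ⟨h.1, h'.1⟩
    · rw [Fin.forall_fin_two]
      simp only [Fin.forall_fin_two]
      refine ⟨⟨fun _ _ _ _ _ _ _ => trivial, fun x hx y hy hx2 hy2 e => ?_⟩,
        ⟨fun x hx y hy hx2 hy2 e => ?_, fun _ _ _ _ _ _ _ => trivial⟩⟩
      · have h1 := h.2.1 x hx hx2
        simp only [Matrix.cons_val_zero, Matrix.cons_val_one] at e
        rw [e] at h1
        exact (disjoint_left.1 hd h1 (h'.2.1 y hy hy2)).elim
      · have h1 := h.2.1 y hy hy2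
        simp only [Matrix.cons_val_zero, Matrix.cons_val_one] at e
        rw [← e] at h1
        exact (disjoint_left.1 hd h1 (h'.2.1 x hx hx2)).elim
    · intro y hy hp
      rw [Fin.exists_fin_two]
      have : y ∈ C ∪ C' := by rw [hu]; trivial
      rcases this with hC | hC
      · exact Or.inl (h.2.2 y hy hp hC)
      · exact Or.inr (h'.2.2 y hy hp hC)
  cases κ with
  | tauEdge =>
    have h := covers_tauEdge_left
    refine two h (h.mirror (fun x => ?_) (fun x => ?_) (fun _ _ => rfl)) ?_ ?_
    · simp only [Piece.gapFun, mirror, gap_symm]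
    · rw [Piece.mem_tauSet_iff, Piece.mem_tauSet_iff]
      simp only [mirror]
      constructor <;> intro h <;> exact ⟨h.1, by linarith [h.2]⟩
    · rw [disjoint_left]
      intro x h1 h2
      simp only [mem_ofPred_eq, mem_preimage, mirror] at h1 h2
      linarith
    · ext x
      simp only [mem_union, mem_ofPred_eq, mem_preimage, mirror, mem_univ, iff_true]
      rcases le_total x.1 (1 / 2) with h | h
      · exact Or.inl h
      · right; linarith
  | blackTau =>
    exact ⟨1, fun _ => blackSector, fun _ => isSector_black, fun i j _ _ _ _ _ _ _ =>
      Subsingleton.elim i j, fun y hy hp => ⟨0, covers_black hy hp⟩⟩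
  | mixed ε =>
    obtain ⟨Q, hQ⟩ := exists_sector_mixed_left ε
    obtain ⟨Q', hQ'⟩ := exists_sector_mixed_right ε
    refine two hQ hQ' ?_ ?_
    · rw [disjoint_left]
      intro x h1 h2
      simp only [mem_ofPred_eq] at h1 h2
      exact lt_asymm h1 h2
    · ext x
      simp only [mem_union, mem_ofPred_eq, mem_univ, iff_true]
      exact le_total _ _
  | trivalentTau =>
    -- The three sectors are the one on the left, its mirror image, and the one between the two
    -- lower branches.
    obtain ⟨Q, hQ⟩ := exists_sector_trivalent_left
    have hQ' := hQ.mirror gapFun_mirror_trivalent mem_tauSet_mirror_trivalent (fun _ _ => rfl)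
    have hM : ∀ x ∈ square, x.2 < 1 →
        4 * |(midSector x).1 - 1 / 2| + 2 * (midSector x).2 < 1 := by
      intro x hx hx2
      rw [midSector_level hx]
      have := mid_norm hx.1.1 hx.1.2
      have := hx.2.1
      nlinarith
    have habs1 := fun x : ℝ => neg_abs_le (x - 1 / 2)
    have habs2 := fun x : ℝ => le_abs_self (x - 1 / 2)
    have hQv := hQ.2.1
    have hQv' := hQ'.2.1
    simp only [mem_ofPred_eq, mem_preimage, lt_min_iff] at hQv hQv'
    simp only [mirror] at hQv'
    have d1 : ∀ x ∈ square, ∀ y ∈ square, x.2 < 1 → y.2 < 1 → Q x ≠ mirror (Q y) := by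
      intro x hx y hy hx2 hy2 e
      have h1 := hQv x hx hx2
      have h2 := hQv y hy hy2
      rw [e] at h1
      simp only [mirror] at h1
      linarith [h1.2, h2.2]
    have d2 : ∀ x ∈ square, ∀ y ∈ square, x.2 < 1 → y.2 < 1 → Q x ≠ midSector y := by
      intro x hx y hy hx2 hy2 e
      have h1 := hQv x hx hx2
      have h2 := hM y hy hy2
      rw [← e] at h2
      linarith [h1.1, habs1 (Q x).1]
    have d3 : ∀ x ∈ square, ∀ y ∈ square, x.2 < 1 → y.2 < 1 → mirror (Q x) ≠ midSector y := by
      intro x hx y hy hx2 hy2 e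
      have h1 := hQv x hx hx2
      have h2 := hM y hy hy2
      rw [← e] at h2
      simp only [mirror] at h2
      linarith [h1.1, habs2 (1 - (Q x).1)]
    refine ⟨3, ![Q, fun x => mirror (Q x), midSector], ?_, ?_, ?_⟩
    · intro i
      fin_cases i
      exacts [hQ.1, hQ'.1, isSector_mid]
    · intro i j x hx y hy hx2 hy2 e
      fin_cases i <;> fin_cases j <;> first
        | rfl
        | exact (d1 x hx y hy hx2 hy2 e).elim
        | exact (d1 y hy x hx hy2 hx2 e.symm).elim
        | exact (d2 x hx y hy hx2 hy2 e).elim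
        | exact (d2 y hy x hx hy2 hx2 e.symm).elim
        | exact (d3 x hx y hy hx2 hy2 e).elim
        | exact (d3 y hy x hx hy2 hx2 e.symm).elim
    · intro y hy hp
      by_cases h1 : y.1 ≤ min (1 / 4 + y.2 / 2) (1 / 2)
      · obtain ⟨x, hx, e⟩ := hQ.2.2 y hy hp h1
        exact ⟨0, x, hx, e⟩
      by_cases h2 : 1 - y.1 ≤ min (1 / 4 + y.2 / 2) (1 / 2)
      · obtain ⟨x, hx, e⟩ := hQ'.2.2 y hy hp h2
        exact ⟨1, x, hx, e⟩
      rw [le_min_iff, not_and_or] at h1 h2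
      obtain ⟨x, hx, e⟩ := covers_mid hy hp (by
        rcases abs_cases (y.1 - 1 / 2) with ⟨h, h'⟩ | ⟨h, h'⟩ <;> rw [h] <;>
          rcases h1 with h1 | h1 <;> rcases h2 with h2 | h2 <;> linarith)
      exact ⟨2, x, hx, e⟩
  | empty => exact hκ.elim
  | sigmaEdge ε => exact hκ.elim
  | blackSigma ε => exact hκ.elim

/-! ### Square charts are local diffeomorphisms -/

/-- The extended chart `(c, x) ↦ c • h x` maps a three-dimensional space to `E3`, and its derivative
at `(1, x)` is invertible because the determinant in `IsSquareChart` is not zero. `G` is a component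
of its local inverse. The point may lie on the border of the square, since `h` is smooth on the
plane. -/
lemma IsSquareChart.exists_local_inverse {h : ℝ × ℝ → E3} (hh : IsSquareChart h) {x : ℝ × ℝ}
    (hx : x ∈ square) : ∃ (G : E3 → ℝ × ℝ) (r : E3 → ℝ) (L : E3 →L[ℝ] ℝ × ℝ),
    HasFDerivAt G L (h x) ∧ G (h x) = x ∧ Function.Surjective L ∧
    (∀ᶠ q in 𝓝 (h x), 0 < r q ∧ r q • h (G q) = q) ∧
    ∀ᶠ p : ℝ × (ℝ × ℝ) in 𝓝 (1, x), G (p.1 • h p.2) = p.2 := by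
  obtain ⟨hc, -, -, hdet⟩ := hh
  have hdet := hdet x hx
  let Φ : ℝ × (ℝ × ℝ) → E3 := fun p => p.1 • h p.2
  have hΦ : ContDiff ℝ ∞ Φ := contDiff_fst.smul (hc.comp contDiff_snd)
  have hhd : HasFDerivAt h (fderiv ℝ h x) x :=
    (hc.differentiable (by simp)).differentiableAt.hasFDerivAt
  let D : ℝ × (ℝ × ℝ) →L[ℝ] E3 :=
    (1 : ℝ) • (fderiv ℝ h x).comp (ContinuousLinearMap.snd ℝ ℝ (ℝ × ℝ)) +
      (ContinuousLinearMap.fst ℝ ℝ (ℝ × ℝ)).smulRight (h x)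
  have hD : HasFDerivAt Φ D (1, x) := by
    have h1 : HasFDerivAt (fun p : ℝ × (ℝ × ℝ) => p.1) (ContinuousLinearMap.fst ℝ ℝ (ℝ × ℝ)) (1, x) :=
      hasFDerivAt_fst
    have h2 : HasFDerivAt (fun p : ℝ × (ℝ × ℝ) => h p.2)
        ((fderiv ℝ h x).comp (ContinuousLinearMap.snd ℝ ℝ (ℝ × ℝ))) (1, x) :=
      HasFDerivAt.comp (1, x) (f := Prod.snd) hhd hasFDerivAt_snd
    exact h1.smul h2
  have hDs : HasStrictFDerivAt Φ D (1, x) := hΦ.contDiffAt.hasStrictFDerivAt' hD (by simp)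
  have hDa : ∀ c a b : ℝ, D (c, a, b) =
      c • h x + (a • fderiv ℝ h x (1, 0) + b • fderiv ℝ h x (0, 1)) := by
    intro c a b
    have : ((a, b) : ℝ × ℝ) = a • (1, 0) + b • (0, 1) := by simp
    simp only [D, add_apply, one_smul,
      ContinuousLinearMap.comp_apply, ContinuousLinearMap.coe_snd', this, map_add, map_smul,
      ContinuousLinearMap.smulRight_apply, ContinuousLinearMap.coe_fst']
    rw [add_comm]
  have hinj : Function.Injective D := by
    rw [injective_iff_map_eq_zero]
    rintro ⟨c, a, b⟩ h0
    rw [hDa] at h0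
    have hv := Matrix.eq_zero_of_vecMul_eq_zero (M := Matrix.of
      ![(h x).ofLp, (fderiv ℝ h x (1, 0)).ofLp, (fderiv ℝ h x (0, 1)).ofLp]) hdet.ne'
      (v := ![c, a, b]) (by
        ext i
        have := congrArg (fun v : E3 => v i) h0
        simp only [PiLp.add_apply, PiLp.smul_apply, smul_eq_mul, PiLp.zero_apply] at this
        simp [Matrix.vecMul, dotProduct, Fin.sum_univ_three]
        linarith)
    have e0 := congrFun hv 0
    have e1 := congrFun hv 1
    have e2 := congrFun hv 2
    simp at e0 e1 e2
    simp [e0, e1, e2]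
  have hdim : Module.finrank ℝ (ℝ × (ℝ × ℝ)) = Module.finrank ℝ E3 := by simp
  have hsurj : Function.Surjective D :=
    (LinearMap.injective_iff_surjective_of_finrank_eq_finrank (f := D.toLinearMap) hdim).1 hinj
  let e : (ℝ × (ℝ × ℝ)) ≃L[ℝ] E3 := ContinuousLinearEquiv.ofBijective D
    (LinearMap.ker_eq_bot.2 hinj) (LinearMap.range_eq_top.2 hsurj)
  have he : HasStrictFDerivAt Φ (e : ℝ × (ℝ × ℝ) →L[ℝ] E3) (1, x) := by
    have : (e : ℝ × (ℝ × ℝ) →L[ℝ] E3) = D := ContinuousLinearEquiv.coe_ofBijective D _ _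
    rwa [this]
  have hx1 : Φ (1, x) = h x := one_smul _ _
  have k1 := he.to_localInverse
  have k2 := he.eventually_left_inverse
  have k3 := he.eventually_right_inverse
  have k4 := he.localInverse_apply_image
  rw [hx1] at k1 k3 k4
  refine ⟨fun q => (he.localInverse Φ e (1, x) q).2, fun q => (he.localInverse Φ e (1, x) q).1,
    (ContinuousLinearMap.snd ℝ ℝ (ℝ × ℝ)).comp (e.symm : E3 →L[ℝ] ℝ × (ℝ × ℝ)), ?_, ?_, ?_, ?_, ?_⟩
  · exact HasFDerivAt.comp (h x) (g := Prod.snd) hasFDerivAt_snd k1.hasFDerivAt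
  · exact congrArg Prod.snd k4
  · intro y
    exact ⟨e (0, y), by simp⟩
  · have hcont : ContinuousAt (fun q => (he.localInverse Φ e (1, x) q).1) (h x) :=
      continuousAt_fst.comp k1.continuousAt
    have hpos : ∀ᶠ q in 𝓝 (h x), 0 < (he.localInverse Φ e (1, x) q).1 := by
      apply hcont.eventually
      simp only [k4]
      exact lt_mem_nhds one_pos
    filter_upwards [hpos, k3] with q h1 h2 using ⟨h1, h2⟩
  · filter_upwards [k2] with p hp
    exact congrArg Prod.snd hp

/-- The linear part of the depth. -/
def depthLin : Fin 4 → ℝ × ℝ →L[ℝ] ℝ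
  | 0 => ContinuousLinearMap.snd ℝ ℝ ℝ
  | 1 => -ContinuousLinearMap.snd ℝ ℝ ℝ
  | 2 => ContinuousLinearMap.fst ℝ ℝ ℝ
  | 3 => -ContinuousLinearMap.fst ℝ ℝ ℝ

lemma hasFDerivAt_depth (d : Fin 4) (x : ℝ × ℝ) : HasFDerivAt (depth d) (depthLin d) x := by
  rcases fin_four_cases d with rfl | rfl | rfl | rfl
  · exact hasFDerivAt_snd
  · exact hasFDerivAt_snd.const_sub 1
  · exact hasFDerivAt_fst
  · exact hasFDerivAt_fst.const_sub 1

lemma depthLin_ne_zero (d : Fin 4) : ∃ v, depthLin d v ≠ 0 := by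
  refine ⟨(1, 1), ?_⟩
  rcases fin_four_cases d with rfl | rfl | rfl | rfl <;> simp [depthLin]

lemma eventually_mem_openSquare (d : Fin 4) {t : ℝ} (ht : t ∈ Ioo (0 : ℝ) 1) :
    ∀ᶠ x in 𝓝 (side d t), 0 < depth d x → x ∈ openSquare := by
  have hopen : IsOpen {x : ℝ × ℝ | 0 < along d x ∧ along d x < 1 ∧ depth d x < 1} := by
    have h1 := continuous_along d
    have h2 := continuous_depth d
    exact (isOpen_lt continuous_const h1).inter ((isOpen_lt h1 continuous_const).inter
      (isOpen_lt h2 continuous_const))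
  have hmem : side d t ∈ {x : ℝ × ℝ | 0 < along d x ∧ along d x < 1 ∧ depth d x < 1} := by
    simp only [mem_ofPred_eq, along_side, depth_side]
    exact ⟨ht.1, ht.2, one_pos⟩
  filter_upwards [hopen.mem_nhds hmem] with x hx hd
  obtain ⟨h1, h2, h3⟩ := hx
  obtain ⟨a, b⟩ := x
  rcases fin_four_cases d with rfl | rfl | rfl | rfl <;> simp only [along, depth] at h1 h2 h3 hd
  · exact ⟨⟨h1, h2⟩, hd, h3⟩
  · exact ⟨⟨h1, h2⟩, by simp only; linarith, by simp only; linarith⟩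
  · exact ⟨⟨hd, h3⟩, h1, h2⟩
  · exact ⟨⟨by simp only; linarith, by simp only; linarith⟩, h1, h2⟩

/-- The half space of the directions that lead from a point on an open side into the square. -/
lemma IsSquareChart.exists_halfSpace {h : ℝ × ℝ → E3} (hh : IsSquareChart h) (d : Fin 4) {t : ℝ}
    (ht : t ∈ Ioo (0 : ℝ) 1) : ∃ ν : E3 →L[ℝ] ℝ, ν ≠ 0 ∧ ∀ w, 0 < ν w →
      ∀ᶠ s in 𝓝[>] (0 : ℝ), ∃ y ∈ openSquare, ∃ c : ℝ, 0 < c ∧ h (side d t) + s • w = c • h y := by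
  have hx := side_mem_square d (Ioo_subset_Icc_self ht)
  obtain ⟨G, r, L, hG, hGx, hL, hr, -⟩ := hh.exists_local_inverse hx
  refine ⟨(depthLin d).comp L, ?_, ?_⟩
  · intro h0
    obtain ⟨v, hv⟩ := depthLin_ne_zero d
    obtain ⟨w, rfl⟩ := hL v
    exact hv (by simpa using congrArg (fun f : E3 →L[ℝ] ℝ => f w) h0)
  · intro w hw
    have hline : HasDerivAt (fun s : ℝ => h (side d t) + s • w) w 0 := by
      simpa using ((hasDerivAt_id (0 : ℝ)).smul_const w).const_add (h (side d t))
    have h0 : (fun s : ℝ => h (side d t) + s • w) 0 = h (side d t) := by simp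
    have hGl : HasDerivAt (fun s : ℝ => depth d (G (h (side d t) + s • w)))
        ((depthLin d).comp L w) 0 := by
      have hG' : HasFDerivAt (fun q => depth d (G q)) ((depthLin d).comp L)
          ((fun s : ℝ => h (side d t) + s • w) 0) := by
        rw [h0]
        exact HasFDerivAt.comp _ (hasFDerivAt_depth d _) hG
      exact hG'.comp_hasDerivAt 0 hline
    have hcont : Tendsto (fun s : ℝ => h (side d t) + s • w) (𝓝[>] 0) (𝓝 (h (side d t))) := by
      have := hline.continuousAt.tendsto
      simp only [zero_smul, add_zero] at this
      exact this.mono_left nhdsWithin_le_nhds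
    have hGc : Tendsto (fun s : ℝ => G (h (side d t) + s • w)) (𝓝[>] 0) (𝓝 (side d t)) := by
      have := hG.continuousAt.tendsto.comp hcont
      rwa [hGx] at this
    have hslope := (hasDerivAt_iff_tendsto_slope.1 hGl).eventually (lt_mem_nhds hw)
    have hslope' : ∀ᶠ s in 𝓝[>] (0 : ℝ), 0 < depth d (G (h (side d t) + s • w)) := by
      have hle : 𝓝[>] (0 : ℝ) ≤ 𝓝[≠] 0 := nhdsWithin_mono _ fun s hs => ne_of_gt hs
      filter_upwards [hle hslope, self_mem_nhdsWithin] with s h1 h2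
      simp only [slope, vsub_eq_sub, sub_zero, smul_eq_mul, zero_smul, add_zero, hGx,
        depth_side] at h1
      have h2 : 0 < s := h2
      exact (mul_pos_iff_of_pos_left (inv_pos.2 h2)).1 h1
    filter_upwards [hslope', hGc.eventually (eventually_mem_openSquare d ht), hcont.eventually hr]
      with s h1 h2 h3
    exact ⟨_, h2 h1, _, h3.1, h3.2.symm⟩

lemma exists_ne_zero_three {ν₁ ν₂ ν₃ : E3 →L[ℝ] ℝ} (h₁ : ν₁ ≠ 0) (h₂ : ν₂ ≠ 0) (h₃ : ν₃ ≠ 0) :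
    ∃ w, ν₁ w ≠ 0 ∧ ν₂ w ≠ 0 ∧ ν₃ w ≠ 0 := by
  have ex : ∀ f : E3 →L[ℝ] ℝ, f ≠ 0 → ∃ w, f w ≠ 0 := fun f hf => by
    by_contra hcon
    push Not at hcon
    exact hf (ContinuousLinearMap.ext hcon)
  obtain ⟨w₁, hw₁⟩ := ex _ h₁
  obtain ⟨w₂, hw₂⟩ := ex _ h₂
  obtain ⟨w₃, hw₃⟩ := ex _ h₃
  have fin : ∀ (f : E3 →L[ℝ] ℝ) (v w : E3), f v ≠ 0 ∨ f w ≠ 0 → {c : ℝ | f (v + c • w) = 0}.Finite := by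
    intro f v w hf
    by_cases h : f w = 0
    · have hv : f v ≠ 0 := by tauto
      convert Set.finite_empty
      ext c
      simp [h, hv]
    · refine Set.Subsingleton.finite fun c hc c' hc' => ?_
      simp only [mem_ofPred_eq, map_add, map_smul, smul_eq_mul] at hc hc'
      exact mul_right_cancel₀ h (by linarith)
  obtain ⟨c, hc⟩ := ((fin ν₁ w₁ w₂ (Or.inl hw₁)).union (fin ν₂ w₁ w₂ (Or.inr hw₂))).exists_notMem
  simp only [mem_union, mem_ofPred_eq, not_or] at hc
  obtain ⟨c', hc'⟩ := ((fin ν₁ (w₁ + c • w₂) w₃ (Or.inl hc.1)).union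
    ((fin ν₂ (w₁ + c • w₂) w₃ (Or.inl hc.2)).union
    (fin ν₃ (w₁ + c • w₂) w₃ (Or.inr hw₃)))).exists_notMem
  simp only [mem_union, mem_ofPred_eq, not_or] at hc'
  exact ⟨_, hc'.1, hc'.2.1, hc'.2.2⟩

/-- Two of the three half spaces meet. -/
lemma exists_pos_pair {ν₁ ν₂ ν₃ : E3 →L[ℝ] ℝ} (h₁ : ν₁ ≠ 0) (h₂ : ν₂ ≠ 0) (h₃ : ν₃ ≠ 0) :
    ∃ w, (0 < ν₁ w ∧ 0 < ν₂ w) ∨ (0 < ν₁ w ∧ 0 < ν₃ w) ∨ (0 < ν₂ w ∧ 0 < ν₃ w) := by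
  -- Of three nonzero numbers two have the same sign. If that sign is negative, `-w` serves.
  obtain ⟨w, k₁, k₂, k₃⟩ := exists_ne_zero_three h₁ h₂ h₃
  by_cases hp : (0 < ν₁ w ∧ 0 < ν₂ w) ∨ (0 < ν₁ w ∧ 0 < ν₃ w) ∨ (0 < ν₂ w ∧ 0 < ν₃ w)
  · exact ⟨w, hp⟩
  · refine ⟨-w, ?_⟩
    simp only [map_neg, Left.neg_pos_iff]
    have := lt_or_gt_of_ne k₁
    have := lt_or_gt_of_ne k₂
    have := lt_or_gt_of_ne k₃
    tauto

/-! ### Square charts as maps to the sphere -/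

instance : Nonempty S2 := (NormedSpace.sphere_nonempty.2 zero_le_one).to_subtype

open Classical in
/-- A point of Euclidean space as a point of the sphere. -/
def toSphere (q : E3) : S2 :=
  if hq : q ∈ Metric.sphere (0 : E3) 1 then ⟨q, hq⟩ else Classical.arbitrary S2

lemma coe_toSphere {q : E3} (hq : q ∈ Metric.sphere (0 : E3) 1) : (toSphere q : E3) = q := by
  rw [toSphere, dif_pos hq]

/-- The map to the sphere defined by a square chart. -/
def sphereMap (h : ℝ × ℝ → E3) (x : ℝ × ℝ) : S2 := toSphere (h x)

lemma IsSquareChart.coe_sphereMap {h : ℝ × ℝ → E3} (hh : IsSquareChart h)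
    {x : ℝ × ℝ} (hx : x ∈ square) : (sphereMap h x : E3) = h x :=
  coe_toSphere (hh.2.1 hx)

lemma IsSquareChart.eq_sphereMap_iff {h : ℝ × ℝ → E3} (hh : IsSquareChart h)
    {x : ℝ × ℝ} (hx : x ∈ square) {p : S2} :
    (p : E3) = h x ↔ p = sphereMap h x := by
  rw [← hh.coe_sphereMap hx, Subtype.ext_iff]

lemma IsSquareChart.continuousOn_sphereMap {h : ℝ × ℝ → E3} (hh : IsSquareChart h) :
    ContinuousOn (sphereMap h) square := by
  rw [Topology.IsInducing.subtypeVal.continuousOn_iff]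
  exact hh.1.continuous.continuousOn.congr fun x hx => hh.coe_sphereMap hx

lemma IsSquareChart.injOn_sphereMap {h : ℝ × ℝ → E3} (hh : IsSquareChart h) :
    InjOn (sphereMap h) square := fun x hx y hy hxy =>
  hh.2.2.1 hx hy (by rw [← hh.coe_sphereMap hx, hxy, hh.coe_sphereMap hy])

lemma IsSquareChart.disk_eq {h : ℝ × ℝ → E3} (hh : IsSquareChart h) : disk h = sphereMap h '' square := by
  ext p
  simp only [disk, mem_ofPred_eq, mem_image]
  constructor
  · rintro ⟨x, hx, e⟩; exact ⟨x, hx, ((hh.eq_sphereMap_iff hx).1 e.symm).symm⟩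
  · rintro ⟨x, hx, rfl⟩; exact ⟨x, hx, (hh.coe_sphereMap hx).symm⟩

lemma IsSquareChart.isCompact_image {h : ℝ × ℝ → E3} (hh : IsSquareChart h)
    {K : Set (ℝ × ℝ)} (hK : IsCompact K) (hKs : K ⊆ square) :
    IsCompact (sphereMap h '' K) := hK.image_of_continuousOn (hh.continuousOn_sphereMap.mono hKs)

/-- A point on the boundary of a square is the limit of points outside the square. -/
lemma IsSquareChart.not_nhds {h : ℝ × ℝ → E3} (hh : IsSquareChart h)
    {x : ℝ × ℝ} (hx : x ∈ square) (hx' : x ∉ openSquare) :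
    sphereMap h '' square ∉ 𝓝 (sphereMap h x) := by
  intro hn
  -- If the disk were a neighbourhood, points `y` outside the square near `x` would have normalised
  -- images in the disk, equal to images of points `m` of the square near `x`. The local inverse
  -- then gives `m = y`.
  obtain ⟨G, r, L, hG, hGx, hL, -, hGi⟩ := hh.exists_local_inverse hx
  have hne : (𝓝[squareᶜ] x).NeBot := by
    rw [← mem_closure_iff_nhdsWithin_neBot, closure_compl]
    rw [square, interior_prod_eq, interior_Icc]
    exact hx'
  have h1 : ‖h x‖ = 1 := by simpa using hh.2.1 hx
  have hq : ContinuousAt (fun y => ‖h y‖⁻¹ • h y) x := by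
    have hc := hh.1.continuous.continuousAt (x := x)
    exact (hc.norm.inv₀ (by rw [h1]; exact one_ne_zero)).smul hc
  have hnear : ∀ᶠ y in 𝓝 x, ‖h y‖ ≠ 0 := by
    have : ContinuousAt (fun y => ‖h y‖) x := (hh.1.continuous.norm).continuousAt
    exact this.eventually_ne (by rw [h1]; exact one_ne_zero)
  have hS : ∀ᶠ y in 𝓝 x, (toSphere (‖h y‖⁻¹ • h y) : E3) = ‖h y‖⁻¹ • h y := by
    filter_upwards [hnear] with y hy
    exact coe_toSphere (by simp [norm_smul, hy])
  have hlim : Tendsto (fun y => toSphere (‖h y‖⁻¹ • h y)) (𝓝[squareᶜ] x) (𝓝 (sphereMap h x)) := by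
    rw [tendsto_subtype_rng, hh.coe_sphereMap hx]
    have : Tendsto (fun y => ‖h y‖⁻¹ • h y) (𝓝 x) (𝓝 (h x)) := by
      have := hq.tendsto
      rwa [h1, inv_one, one_smul] at this
    refine Tendsto.mono_left ?_ nhdsWithin_le_nhds
    exact this.congr' (hS.mono fun y hy => hy.symm)
  have hin := hlim.eventually_mem hn
  have hinv := continuousOn_invFunOn_of_isCompact isCompact_square hh.continuousOn_sphereMap
    subset_rfl hh.injOn_sphereMap (fun _ _ y hy _ => hy)
  have hinvx : Function.invFunOn (sphereMap h) square (sphereMap h x) = x :=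
    hh.injOn_sphereMap (Function.invFunOn_mem (mem_image_of_mem _ hx)) hx
      (Function.invFunOn_eq (mem_image_of_mem _ hx))
  have hlim2 : Tendsto (fun y => Function.invFunOn (sphereMap h) square
      (toSphere (‖h y‖⁻¹ • h y))) (𝓝[squareᶜ] x) (𝓝 x) := by
    have h2 := (hinv _ (mem_image_of_mem _ hx)).tendsto
    rw [hinvx] at h2
    exact h2.comp (tendsto_nhdsWithin_iff.2 ⟨hlim, hin⟩)
  have hp1 : Tendsto (fun y : ℝ × ℝ => (‖h y‖⁻¹, y)) (𝓝[squareᶜ] x) (𝓝 (1, x)) := by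
    have : ContinuousAt (fun y : ℝ × ℝ => (‖h y‖⁻¹, y)) x := by
      have hc := hh.1.continuous.continuousAt (x := x)
      exact (hc.norm.inv₀ (by rw [h1]; exact one_ne_zero)).prodMk continuousAt_id
    have := this.tendsto
    rw [h1, inv_one] at this
    exact this.mono_left nhdsWithin_le_nhds
  have hp2 := Tendsto.prodMk_nhds (tendsto_const_nhds (x := (1 : ℝ)) (f := 𝓝[squareᶜ] x)) hlim2
  have hfalse : ∀ᶠ y in 𝓝[squareᶜ] x, False := by
    filter_upwards [hp1.eventually hGi, hp2.eventually hGi, hin, self_mem_nhdsWithin,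
      nhdsWithin_le_nhds hS] with y e1 e2 e3 e4 e5
    have m := Function.invFunOn_mem e3
    have e := Function.invFunOn_eq e3
    simp only [one_smul] at e1 e2
    rw [← hh.coe_sphereMap m, e, e5, e1] at e2
    rw [e2] at e4
    exact e4 m
  exact hne.ne (eventually_false_iff_eq_bot.1 hfalse)

/-- A common ray enters the open cones over both disks. Since both charts have values of norm 1, the
scaling factors agree and an interior point of one disk lies in the other. -/
lemma no_two_halfSpaces {h h' : ℝ × ℝ → E3} (hh : IsSquareChart h) (hh' : IsSquareChart h')
    (hd : ∀ x ∈ openSquare, h x ∉ h' '' square) {p w : E3}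
    (h1 : ∀ᶠ s in 𝓝[>] (0 : ℝ), ∃ y ∈ openSquare, ∃ c : ℝ, 0 < c ∧ p + s • w = c • h y)
    (h2 : ∀ᶠ s in 𝓝[>] (0 : ℝ), ∃ y ∈ openSquare, ∃ c : ℝ, 0 < c ∧ p + s • w = c • h' y) : False := by
  obtain ⟨s, ⟨y, hy, c, hc, e⟩, ⟨y', hy', c', hc', e'⟩⟩ := (h1.and h2).exists
  have n1 : ‖h y‖ = 1 := by simpa using hh.2.1 (openSquare_subset hy)
  have n2 : ‖h' y'‖ = 1 := by simpa using hh'.2.1 (openSquare_subset hy')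
  have e2 := e.symm.trans e'
  have : c = c' := by
    have := congrArg norm e2
    rwa [norm_smul, norm_smul, n1, n2, mul_one, mul_one, Real.norm_of_nonneg hc.le,
      Real.norm_of_nonneg hc'.le] at this
  subst this
  refine hd y hy ⟨y', openSquare_subset hy', ?_⟩
  exact (smul_right_injective E3 hc.ne' e2).symm

/-! ### Fibres as pairs of points -/

lemma norm_rot (ε : ℤˣ) (t : ℝ) : ‖rot ε t‖ = 1 := by
  have : rot ε t = Complex.exp ((((ε : ℤ) : ℝ) * Real.pi * t : ℝ) * Complex.I) := by
    rw [rot]; push_cast; rfl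
  rw [this, Complex.norm_exp_ofReal_mul_I]

lemma Piece.norm_dir (κ : Piece) (x : ℝ × ℝ) : ‖κ.dir x‖ = 1 := by
  cases κ <;> simp [Piece.dir, norm_rot]

lemma continuous_twist : Continuous twist := by
  have := Real.smoothTransition.continuous
  unfold twist; fun_prop

lemma continuous_rot (ε : ℤˣ) : Continuous (rot ε) := by unfold rot; fun_prop

lemma Piece.continuous_dir (κ : Piece) : Continuous κ.dir := by
  have h1 := continuous_twist
  have h2 := continuous_rot
  cases κ <;> unfold Piece.dir <;> fun_prop

lemma norm_sq_of_mem_pair {g : ℝ} {u z : ℂ} (hu : ‖u‖ = 1) (h : z ∈ pair g u) :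
    ‖z‖ ^ 2 = (1 - 2 * g) / 4 := by
  obtain ⟨x, hx, rfl⟩ := h
  rw [norm_mul, hu, mul_one, Complex.norm_real, Real.norm_eq_abs, sq_abs, hx]

lemma pair_nonempty_iff {g : ℝ} {u : ℂ} : (pair g u).Nonempty ↔ g ≤ 1 / 2 := by
  constructor
  · rintro ⟨z, x, hx, -⟩
    nlinarith [sq_nonneg x]
  · intro h
    exact ⟨_, Real.sqrt ((1 - 2 * g) / 4), Real.sq_sqrt (by linarith), rfl⟩

/-- A point of the pair determines `g` by its norm. If there is none, `g > 1/2` on both sides, and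
the cut-off values agree. -/
lemma min_eq_of_pair_eq {g g' : ℝ} {u u' : ℂ} (hu : ‖u‖ = 1) (hu' : ‖u'‖ = 1)
    (h : pair g u = pair g' u') : min g (1 / 2) = min g' (1 / 2) := by
  by_cases hne : (pair g u).Nonempty
  · obtain ⟨z, hz⟩ := hne
    have h1 := norm_sq_of_mem_pair hu hz
    rw [h] at hz
    have h2 := norm_sq_of_mem_pair hu' hz
    congr 1
    linarith
  · have h1 := mt pair_nonempty_iff.2 hne
    rw [h] at hne
    have h2 := mt pair_nonempty_iff.2 hne
    rw [min_eq_right (by linarith), min_eq_right (by linarith)]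

/-- The substitution `g = (1 - r ^ 2) / 2` makes the pair a horizontal section of a wicket: its
height `s` satisfies `r ^ 2 + s ^ 2 = 1` and `g = s ^ 2 / 2`. -/
lemma mem_pair_of_sq {r : ℝ} {u z : ℂ} : z ∈ pair ((1 - r ^ 2) / 2) u ↔
    z = r * u / 2 ∨ z = -(r * u / 2) := by
  have e : (1 - 2 * ((1 - r ^ 2) / 2)) / 4 = (r / 2) ^ 2 := by ring
  constructor
  · rintro ⟨x, hx, rfl⟩
    rw [e, sq_eq_sq_iff_eq_or_eq_neg] at hx
    rcases hx with rfl | rfl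
    · left; push_cast; ring
    · right; push_cast; ring
  · rintro (rfl | rfl)
    · exact ⟨r / 2, e.symm, by push_cast; ring⟩
    · exact ⟨-(r / 2), by rw [e, neg_sq], by push_cast; ring⟩

lemma mem_pair_zero {u z : ℂ} : z ∈ pair 0 u ↔ z = u / 2 ∨ z = -(u / 2) := by
  have := mem_pair_of_sq (r := 1) (u := u) (z := z)
  simpa using this

lemma fibre_blackSigma {ε : ℤˣ} {x : ℝ × ℝ} {z : ℂ} : z ∈ (Piece.blackSigma ε).fibre x ↔
    z ^ 2 = ((1 - (Real.smoothTransition (2 * x.2 - 1 / 2) : ℂ)) * rot ε (twist x.1) ^ 2 +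
      Real.smoothTransition (2 * x.2 - 1 / 2)) / 4 := Iff.rfl

lemma setOf_sq_eq (u : ℂ) : {z : ℂ | z ^ 2 = u ^ 2 / 4} = pair 0 u := by
  ext z
  rw [mem_pair_zero, mem_ofPred_eq, ← sq_eq_sq_iff_eq_or_eq_neg]
  constructor <;> intro h <;> rw [h] <;> ring

/-- Only the black `σ`-vertex needs an argument: on each side of its square the right-hand side of
the equation is a quarter of the square of a unit number. -/
lemma Piece.fibre_boundary (κ : Piece) {x : ℝ × ℝ} (hx : x ∈ square) (hx' : x ∉ openSquare) :
    ∃ u : ℂ, ‖u‖ = 1 ∧ κ.fibre x = pair (κ.gapFun x) u := by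
  by_cases hκ : κ.IsPlain
  · exact ⟨κ.dir x, κ.norm_dir x, fibre_eq hκ x⟩
  · cases κ with
    | blackSigma ε =>
      obtain ⟨d, t, ht, rfl⟩ := exists_side hx hx'
      have key : ∀ u : ℂ, ‖u‖ = 1 → ((1 - (Real.smoothTransition (2 * (side d t).2 - 1 / 2) : ℂ)) *
          rot ε (twist (side d t).1) ^ 2 + Real.smoothTransition (2 * (side d t).2 - 1 / 2)) / 4 =
          u ^ 2 / 4 → ∃ u : ℂ, ‖u‖ = 1 ∧ (Piece.blackSigma ε).fibre (side d t) =
            pair ((Piece.blackSigma ε).gapFun (side d t)) u := by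
        intro u hu h
        refine ⟨u, hu, ?_⟩
        simp only [gapFun]
        rw [← setOf_sq_eq, ← h]
        rfl
      rcases fin_four_cases d with rfl | rfl | rfl | rfl
      · refine key (rot ε (twist t)) (norm_rot _ _) ?_
        simp only [side]
        rw [Real.smoothTransition.zero_of_nonpos (by norm_num)]
        push_cast; ring
      · refine key 1 (by simp) ?_
        simp only [side]
        rw [Real.smoothTransition.one_of_one_le (by norm_num)]
        push_cast; ring
      · refine key 1 (by simp) ?_
        simp only [side]
        rw [twist_eq_zero (by norm_num), rot_zero]
        ring
      · refine key 1 (by simp) ?_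
        simp only [side]
        rw [twist_eq_one (by norm_num), rot_one]
        ring
    | _ => exact absurd trivial hκ

lemma Piece.gapFun_of_not_isPlain {κ : Piece} (h : ¬ κ.IsPlain) (x : ℝ × ℝ) : κ.gapFun x = 0 := by
  cases κ <;> first | rfl | exact absurd trivial h

lemma Piece.fibre_nonempty_iff (κ : Piece) (x : ℝ × ℝ) :
    (κ.fibre x).Nonempty ↔ κ.gapFun x ≤ 1 / 2 := by
  by_cases hκ : κ.IsPlain
  · rw [fibre_eq hκ, pair_nonempty_iff]
  · rw [gapFun_of_not_isPlain hκ]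
    cases κ with
    | blackSigma ε =>
      simp only [one_div, inv_nonneg, Nat.ofNat_nonneg, iff_true]
      obtain ⟨z, hz⟩ := IsAlgClosed.exists_pow_nat_eq
        (((1 - (Real.smoothTransition (2 * x.2 - 1 / 2) : ℂ)) * rot ε (twist x.1) ^ 2 +
          Real.smoothTransition (2 * x.2 - 1 / 2)) / 4) two_pos
      exact ⟨z, hz⟩
    | _ => exact absurd trivial hκ

/-! ### Decompositions of the sphere -/

/-- A surface over the sphere with a decomposition into model pieces. -/
structure Tiling (Γ : Chart) (F : Set (ℂ × S2)) where
  n : ℕ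
  h : Fin n → ℝ × ℝ → E3
  κ : Fin n → Piece
  chart : ∀ k, IsSquareChart (h k)
  cover : ∀ p : S2, ∃ k, ∃ x ∈ square, sphereMap (h k) x = p
  eq_of_open : ∀ k l, ∀ x ∈ openSquare, ∀ y ∈ square,
    sphereMap (h k) x = sphereMap (h l) y → k = l
  pieced : ∀ k l, IsPieced (sphereMap (h k) '' square ∩ sphereMap (h l) '' square)
  looks : ∀ k, Γ.LooksLike (h k) (κ k)
  mem_iff : ∀ k, ∀ x ∈ square, ∀ z : ℂ, (z, sphereMap (h k) x) ∈ F ↔ z ∈ (κ k).fibre x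

lemma IsBuiltFrom.exists_tiling {Γ : Chart} {F : Set (ℂ × S2)} (hF : IsBuiltFrom univ Γ F) :
    Nonempty (Tiling Γ F) := by
  obtain ⟨n, h, κ, h1, h2, h3, h4, h5, -, h7⟩ := hF
  refine ⟨⟨n, h, κ, h1, ?_, ?_, ?_, h5, ?_⟩⟩
  · intro p
    have : p ∈ ⋃ k, disk (h k) := by rw [h2]; trivial
    obtain ⟨k, hk⟩ := mem_iUnion.1 this
    rw [(h1 k).disk_eq] at hk
    exact ⟨k, hk⟩
  · intro k l x hx y hy e
    by_contra hne
    refine h3 k l hne x hx ⟨y, hy, ?_⟩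
    rw [← (h1 l).coe_sphereMap hy, ← e, (h1 k).coe_sphereMap (openSquare_subset hx)]
  · intro k l
    rw [← (h1 k).disk_eq, ← (h1 l).disk_eq]
    exact isPieced_of_finite_connectedComponents (h4 k l)
  · intro k x hx z
    exact h7 k x hx _ ((h1 k).coe_sphereMap hx) z

namespace Tiling

variable {Γ : Chart} {F : Set (ℂ × S2)} (T : Tiling Γ F)

/-- The map of the square onto a disk of the decomposition. -/
def H (k : Fin T.n) : ℝ × ℝ → S2 := sphereMap (T.h k)

lemma exists_H (p : S2) : ∃ k, ∃ x ∈ square, T.H k x = p := T.cover p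

lemma continuousOn_H (k : Fin T.n) : ContinuousOn (T.H k) square :=
  (T.chart k).continuousOn_sphereMap

lemma injOn_H (k : Fin T.n) : InjOn (T.H k) square := (T.chart k).injOn_sphereMap

lemma coe_H (k : Fin T.n) {x : ℝ × ℝ} (hx : x ∈ square) : (T.H k x : E3) = T.h k x :=
  (T.chart k).coe_sphereMap hx

lemma eq_of_H_eq {k l : Fin T.n} {x y : ℝ × ℝ} (hx : x ∈ openSquare) (hy : y ∈ square)
    (h : T.H k x = T.H l y) : k = l ∧ x = y := by
  have := T.eq_of_open k l x hx y hy h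
  subst this
  exact ⟨rfl, T.injOn_H k (openSquare_subset hx) hy h⟩

lemma mem_tauChart_iff (k : Fin T.n) {x : ℝ × ℝ} (hx : x ∈ square) :
    T.H k x ∈ Γ.tauChart ↔ x ∈ (T.κ k).tauSet :=
  ((T.looks k).1 x hx _ (T.coe_H k hx)).2.1

lemma mem_vertices_iff (k : Fin T.n) {x : ℝ × ℝ} (hx : x ∈ square) :
    T.H k x ∈ Γ.vertices ↔ x ∈ (T.κ k).vertexSet :=
  ((T.looks k).1 x hx _ (T.coe_H k hx)).1

/-- A set is closed if its intersection with each disk is closed. -/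
lemma isClosed_of {K : Set S2} (h : ∀ k, IsClosed (square ∩ T.H k ⁻¹' K)) : IsClosed K := by
  have : K = ⋃ k, T.H k '' (square ∩ T.H k ⁻¹' K) := by
    ext p
    simp only [mem_iUnion, mem_image, mem_inter_iff, mem_preimage]
    constructor
    · intro hp
      obtain ⟨k, x, hx, rfl⟩ := T.exists_H p
      exact ⟨k, x, ⟨hx, hp⟩, rfl⟩
    · rintro ⟨k, x, ⟨-, h⟩, rfl⟩
      exact h
  rw [this]
  refine isClosed_iUnion_of_finite fun k => IsCompact.isClosed ?_
  exact (isCompact_square.of_isClosed_subset (h k) inter_subset_left).image_of_continuousOn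
    ((T.continuousOn_H k).mono inter_subset_left)

lemma continuous_of {X : Type*} [TopologicalSpace X] {f : S2 → X}
    (h : ∀ k, ContinuousOn (fun x => f (T.H k x)) square) : Continuous f := by
  rw [continuous_iff_isClosed]
  intro C hC
  exact T.isClosed_of fun k => (h k).preimage_isClosed_of_isClosed isCompact_square.isClosed hC

/-- An interior point of a square belongs to no other square, so only boundary points matter. There
both pieces present the same fibre as a pair, which determines the gap up to the value `1/2` where
the fibre disappears; hence the cut-off. -/
lemma min_gap_eq {k l : Fin T.n} {x y : ℝ × ℝ} (hx : x ∈ square) (hy : y ∈ square)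
    (h : T.H k x = T.H l y) :
    min ((T.κ k).gapFun x) (1 / 2) = min ((T.κ l).gapFun y) (1 / 2) := by
  by_cases h1 : x ∈ openSquare
  · obtain ⟨rfl, rfl⟩ := T.eq_of_H_eq h1 hy h
    rfl
  by_cases h2 : y ∈ openSquare
  · obtain ⟨rfl, rfl⟩ := T.eq_of_H_eq h2 hx h.symm
    rfl
  obtain ⟨u, hu, e⟩ := (T.κ k).fibre_boundary hx h1
  obtain ⟨v, hv, e'⟩ := (T.κ l).fibre_boundary hy h2
  refine min_eq_of_pair_eq hu hv ?_
  rw [← e, ← e']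
  ext z
  rw [← T.mem_iff k x hx, ← T.mem_iff l y hy]
  change (z, T.H k x) ∈ F ↔ (z, T.H l y) ∈ F
  rw [h]

/-- The gap between the sheets, cut off at the value where the sheets have disappeared. -/
def gap (p : S2) : ℝ := min ((T.κ (T.cover p).choose).gapFun (T.cover p).choose_spec.choose) (1 / 2)

lemma gap_H (k : Fin T.n) {x : ℝ × ℝ} (hx : x ∈ square) :
    T.gap (T.H k x) = min ((T.κ k).gapFun x) (1 / 2) :=
  T.min_gap_eq (T.cover (T.H k x)).choose_spec.choose_spec.1 hx
    (T.cover (T.H k x)).choose_spec.choose_spec.2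

lemma continuous_gap : Continuous T.gap := T.continuous_of fun k =>
  ((((T.κ k).continuous_gapFun.min continuous_const).continuousOn).congr fun _ hx => T.gap_H k hx)

/-- The open neighbourhood of the `τ`-chart where the gap is positive. -/
def pos : Set S2 := {p | 0 < T.gap p}

lemma isOpen_pos : IsOpen T.pos := isOpen_lt continuous_const T.continuous_gap

lemma mem_pos_iff (k : Fin T.n) {x : ℝ × ℝ} (hx : x ∈ square) :
    T.H k x ∈ T.pos ↔ x ∈ (T.κ k).posSet := by
  rw [pos, mem_ofPred_eq, T.gap_H k hx, lt_min_iff, Piece.gapFun_pos_iff]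
  exact and_iff_left (by norm_num)

lemma fibre_H_nonempty_iff (k : Fin T.n) {x : ℝ × ℝ} (hx : x ∈ square) :
    (fibre F (T.H k x)).Nonempty ↔ (T.κ k).gapFun x ≤ 1 / 2 := by
  rw [← Piece.fibre_nonempty_iff]
  constructor
  · rintro ⟨z, hz⟩; exact ⟨z, (T.mem_iff k x hx z).1 hz⟩
  · rintro ⟨z, hz⟩; exact ⟨z, (T.mem_iff k x hx z).2 hz⟩

lemma isClosed_fibre_nonempty (T : Tiling Γ F) : IsClosed {p | (fibre F p).Nonempty} := by
  refine T.isClosed_of fun k => ?_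
  have : square ∩ T.H k ⁻¹' {p | (fibre F p).Nonempty} =
      square ∩ {x | (T.κ k).gapFun x ≤ 1 / 2} := by
    ext x
    simp only [mem_inter_iff, mem_preimage, mem_ofPred_eq]
    exact and_congr_right fun hx => T.fibre_H_nonempty_iff k hx
  rw [this]
  exact isCompact_square.isClosed.inter (isClosed_le ((T.κ k).continuous_gapFun) continuous_const)

lemma tauChart_subset_pos : Γ.tauChart ⊆ T.pos := by
  intro p hp
  obtain ⟨k, x, hx, rfl⟩ := T.exists_H p
  rw [T.mem_pos_iff k hx]
  exact Piece.tauSet_subset_posSet _ ((T.mem_tauChart_iff k hx).1 hp)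

lemma fibre_eq_empty_of_tauChart (T : Tiling Γ F) {p : S2} (hp : p ∈ Γ.tauChart) : ¬ (fibre F p).Nonempty := by
  obtain ⟨k, x, hx, rfl⟩ := T.exists_H p
  have := Piece.gapFun_eq_one_of_mem_tauSet ((T.mem_tauChart_iff k hx).1 hp)
  rw [T.fibre_H_nonempty_iff k hx, this]
  norm_num

/-- A boundary point of a disk lies in another disk. -/
lemma exists_other (k : Fin T.n) {x : ℝ × ℝ} (hx : x ∈ square) (hx' : x ∉ openSquare) :
    ∃ l ≠ k, ∃ y ∈ square, T.H l y = T.H k x := by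
  by_contra hcon
  push Not at hcon
  refine (T.chart k).not_nhds hx hx' ?_
  -- If no other disk contained the point, the complement of the other disks would be a
  -- neighbourhood of it inside disk `k`, contrary to `IsSquareChart.not_nhds`.
  have hcl : IsClosed (⋃ l ∈ {l | l ≠ k}, T.H l '' square) :=
    (Set.toFinite _).isClosed_biUnion fun l _ =>
      ((T.chart l).isCompact_image isCompact_square subset_rfl).isClosed
  have hmem : sphereMap (T.h k) x ∈ (⋃ l ∈ {l | l ≠ k}, T.H l '' square)ᶜ := by
    simp only [mem_compl_iff, mem_iUnion, mem_image, not_exists, not_and, exists_prop]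
    exact fun l hl y hy => hcon l hl y hy
  filter_upwards [hcl.isOpen_compl.mem_nhds hmem] with p hp
  obtain ⟨l, y, hy, rfl⟩ := T.exists_H p
  by_cases hlk : l = k
  · subst hlk; exact mem_image_of_mem _ hy
  · exact absurd (mem_biUnion (show l ∈ {l | l ≠ k} from hlk) (mem_image_of_mem _ hy)) hp

/-- A point lies on open sides of at most two disks. -/
lemma no_three {k₁ k₂ k₃ : Fin T.n} (h₁₂ : k₁ ≠ k₂) (h₁₃ : k₁ ≠ k₃) (h₂₃ : k₂ ≠ k₃)
    {d₁ d₂ d₃ : Fin 4} {t₁ t₂ t₃ : ℝ} (ht₁ : t₁ ∈ Ioo (0 : ℝ) 1) (ht₂ : t₂ ∈ Ioo (0 : ℝ) 1)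
    (ht₃ : t₃ ∈ Ioo (0 : ℝ) 1) (e₂ : T.H k₂ (side d₂ t₂) = T.H k₁ (side d₁ t₁))
    (e₃ : T.H k₃ (side d₃ t₃) = T.H k₁ (side d₁ t₁)) : False := by
  -- Each disk occupies a half space of directions at the point, and two of three half spaces
  -- overlap, so two disks would overlap in interior points.
  obtain ⟨ν₁, n₁, w₁⟩ := (T.chart k₁).exists_halfSpace d₁ ht₁
  obtain ⟨ν₂, n₂, w₂⟩ := (T.chart k₂).exists_halfSpace d₂ ht₂
  obtain ⟨ν₃, n₃, w₃⟩ := (T.chart k₃).exists_halfSpace d₃ ht₃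
  have c : ∀ (k : Fin T.n) (d : Fin 4) {t : ℝ}, t ∈ Ioo (0 : ℝ) 1 →
      (T.H k (side d t) : E3) = T.h k (side d t) := fun k d t ht =>
    T.coe_H k (side_mem_square d (Ioo_subset_Icc_self ht))
  rw [← c k₁ d₁ ht₁] at w₁
  rw [← c k₂ d₂ ht₂, e₂] at w₂
  rw [← c k₃ d₃ ht₃, e₃] at w₃
  have hd : ∀ {k l : Fin T.n}, k ≠ l → ∀ x ∈ openSquare, T.h k x ∉ T.h l '' square := by
    rintro k l hkl x hx ⟨y, hy, e⟩
    refine hkl (T.eq_of_H_eq hx hy (Subtype.ext ?_)).1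
    rw [T.coe_H k (openSquare_subset hx), T.coe_H l hy, e]
  obtain ⟨w, h | h | h⟩ := exists_pos_pair n₁ n₂ n₃
  · exact no_two_halfSpaces (T.chart k₁) (T.chart k₂) (hd h₁₂) (w₁ w h.1) (w₂ w h.2)
  · exact no_two_halfSpaces (T.chart k₁) (T.chart k₃) (hd h₁₃) (w₁ w h.1) (w₃ w h.2)
  · exact no_two_halfSpaces (T.chart k₂) (T.chart k₃) (hd h₂₃) (w₂ w h.1) (w₃ w h.2)

end Tiling

/-! ### Sectors of a decomposition and the gluing of their ends -/

/-- The sectors of all the squares of a decomposition. -/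
structure Sectors {Γ : Chart} {F : Set (ℂ × S2)} (T : Tiling Γ F) where
  ι : Type
  finite : Finite ι
  kk : ι → Fin T.n
  Q : ι → ℝ × ℝ → ℝ × ℝ
  sec : ∀ i, IsSector (T.κ (kk i)) (Q i)
  uniq : ∀ i j, kk i = kk j → ∀ x ∈ square, ∀ y ∈ square, x.2 < 1 → y.2 < 1 →
    Q i x = Q j y → i = j
  cover : ∀ k, ∀ y ∈ square, y ∈ (T.κ k).posSet → ∃ i, kk i = k ∧ ∃ x ∈ square, Q i x = y

lemma Tiling.exists_sectors {Γ : Chart} {F : Set (ℂ × S2)} (T : Tiling Γ F) :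
    Nonempty (Sectors T) := by
  have : ∀ k, ∃ (d : ℕ) (Q : Fin d → ℝ × ℝ → ℝ × ℝ), (∀ i, IsSector (T.κ k) (Q i)) ∧
      (∀ i j, ∀ x ∈ square, ∀ y ∈ square, x.2 < 1 → y.2 < 1 → Q i x = Q j y → i = j) ∧
      ∀ y ∈ square, y ∈ (T.κ k).posSet → ∃ i, ∃ x ∈ square, Q i x = y := by
    intro k
    by_cases h : (T.κ k).IsTau
    · exact Knit.exists_sectors h
    · refine ⟨0, Fin.elim0, fun i => i.elim0, fun i => i.elim0, fun y _ hy => ?_⟩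
      rw [Piece.posSet_eq_empty h] at hy
      exact hy.elim
  choose d Q h1 h2 h3 using this
  refine ⟨⟨Σ k, Fin (d k), inferInstance, Sigma.fst, fun i => Q i.1 i.2, fun i => h1 _ _, ?_, ?_⟩⟩
  · rintro ⟨k, i⟩ ⟨l, j⟩ h x hx y hy hx2 hy2 e
    simp only at h
    subst h
    simp only at e
    rw [h2 k i j x hx y hy hx2 hy2 e]
  · intro k y hy hp
    obtain ⟨i, x, hx, e⟩ := h3 k y hy hp
    exact ⟨⟨k, i⟩, rfl, x, hx, e⟩

/-- The end point of the unit interval. -/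
def pt (e : Bool) : ℝ := if e then 1 else 0

lemma pt_cases (e : Bool) : pt e = 0 ∨ pt e = 1 := by cases e <;> simp [pt]

lemma pt_mem (e : Bool) : pt e ∈ Icc (0 : ℝ) 1 := by rcases pt_cases e with h | h <;> rw [h] <;> simp

lemma pt_inj {e e' : Bool} (h : pt e = pt e') : e = e' := by cases e <;> cases e' <;> simp [pt] at *

lemma exists_pt {u : ℝ} (h : u = 0 ∨ u = 1) : ∃ e, pt e = u := by
  rcases h with h | h
  · exact ⟨false, by simp [pt, h]⟩
  · exact ⟨true, by simp [pt, h]⟩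

namespace Sectors

variable {Γ : Chart} {F : Set (ℂ × S2)} {T : Tiling Γ F} (S : Sectors T)

instance : Finite S.ι := S.finite

/-- A sector as a map to the sphere. -/
def W (i : S.ι) (x : ℝ × ℝ) : S2 := T.H (S.kk i) (S.Q i x)

lemma continuousOn_W (i : S.ι) : ContinuousOn (S.W i) square :=
  (T.continuousOn_H _).comp (S.sec i).cont (S.sec i).mem

lemma W_mem_tauChart_iff (i : S.ι) {x : ℝ × ℝ} (hx : x ∈ square) :
    S.W i x ∈ Γ.tauChart ↔ x.2 = 1 := by
  rw [W, T.mem_tauChart_iff _ ((S.sec i).mem x hx), (S.sec i).mem_tauSet_iff x hx]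

lemma snd_lt_one_iff (i : S.ι) {x : ℝ × ℝ} (hx : x ∈ square) :
    x.2 < 1 ↔ S.W i x ∉ Γ.tauChart := by
  rw [W_mem_tauChart_iff S i hx]
  exact ⟨fun h => h.ne, fun h => lt_of_le_of_ne hx.2.2 h⟩

lemma gapFun_pos_iff (i : S.ι) {x : ℝ × ℝ} (hx : x ∈ square) :
    0 < (T.κ (S.kk i)).gapFun (S.Q i x) ↔ 0 < x.2 := by
  have h0 : (x.1, (0 : ℝ)) ∈ square := ⟨hx.1, by simp⟩
  have hz := (S.sec i).zero _ h0 rfl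
  constructor
  · intro h
    refine lt_of_le_of_ne hx.2.1 fun h2 => ?_
    have : x = (x.1, 0) := Prod.ext rfl h2.symm
    rw [this, hz] at h
    exact lt_irrefl _ h
  · intro h
    have := (S.sec i).strictMono _ h0 x hx rfl h (by rw [hz]; norm_num)
    rwa [hz] at this

lemma W_mem_pos_iff (i : S.ι) {x : ℝ × ℝ} (hx : x ∈ square) : S.W i x ∈ T.pos ↔ 0 < x.2 := by
  rw [W, T.mem_pos_iff _ ((S.sec i).mem x hx), ← Piece.gapFun_pos_iff, S.gapFun_pos_iff i hx]

lemma exists_W {p : S2} (hp : p ∈ T.pos) : ∃ i, ∃ x ∈ square, S.W i x = p := by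
  obtain ⟨k, y, hy, rfl⟩ := T.exists_H p
  rw [T.mem_pos_iff k hy] at hp
  obtain ⟨i, rfl, x, hx, rfl⟩ := S.cover k y hy hp
  exact ⟨i, x, hx, rfl⟩

lemma W_eq_same {i j : S.ι} (hij : S.kk i = S.kk j) {x y : ℝ × ℝ} (hx : x ∈ square)
    (hy : y ∈ square) (hx2 : x.2 < 1) (hy2 : y.2 < 1) (h : S.W i x = S.W j y) : i = j ∧ x = y := by
  have h1 : S.Q i x = S.Q j y := by
    refine T.injOn_H (S.kk i) ((S.sec i).mem x hx) ?_ ?_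
    · exact (S.sec j).mem y hy
    · rw [W, W] at h
      rw [h, hij]
  have := S.uniq i j hij x hx y hy hx2 hy2 h1
  subst this
  exact ⟨rfl, (S.sec i).inj x hx y hy hx2 hy2 h1⟩

lemma Q_mem_openSquare (i : S.ι) {x : ℝ × ℝ} (hx : x ∈ square) (h0 : 0 < x.1) (h1 : x.1 < 1) :
    S.Q i x ∈ openSquare :=
  ⟨(S.sec i).fst_mem x hx, (S.sec i).interior x hx h0 h1⟩

lemma W_eq_interior {i j : S.ι} {x y : ℝ × ℝ} (hx : x ∈ square) (hy : y ∈ square) (h0 : 0 < x.1)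
    (h1 : x.1 < 1) (hx2 : x.2 < 1) (h : S.W i x = S.W j y) : i = j ∧ x = y := by
  refine S.W_eq_same (T.eq_of_H_eq (S.Q_mem_openSquare i hx h0 h1) ((S.sec j).mem y hy) h).1 hx hy
    hx2 ?_ h
  rw [S.snd_lt_one_iff j hy, ← h]
  exact (S.snd_lt_one_iff i hx).1 hx2

/-- The two ends of a sector. -/
def E (x : S.ι × Bool) (s : ℝ) : S2 := S.W x.1 (pt x.2, s)

lemma mem_square_pt (e : Bool) {s : ℝ} (hs : s ∈ Icc (0 : ℝ) 1) : (pt e, s) ∈ square :=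
  ⟨pt_mem e, hs⟩

lemma continuousOn_E (x : S.ι × Bool) : ContinuousOn (S.E x) (Icc 0 1) :=
  (S.continuousOn_W x.1).comp (by fun_prop) fun _ hs => mem_square_pt x.2 hs

lemma E_mem_tauChart_iff (x : S.ι × Bool) {s : ℝ} (hs : s ∈ Icc (0 : ℝ) 1) :
    S.E x s ∈ Γ.tauChart ↔ s = 1 := S.W_mem_tauChart_iff x.1 (mem_square_pt x.2 hs)

lemma E_mem_pos_iff (x : S.ι × Bool) {s : ℝ} (hs : s ∈ Icc (0 : ℝ) 1) :
    S.E x s ∈ T.pos ↔ 0 < s := S.W_mem_pos_iff x.1 (mem_square_pt x.2 hs)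

lemma E_lt_one {x y : S.ι × Bool} {s t : ℝ} (hs : s ∈ Icc (0 : ℝ) 1) (ht : t ∈ Icc (0 : ℝ) 1)
    (h : S.E x s = S.E y t) : s < 1 ↔ t < 1 := by
  have h1 := S.E_mem_tauChart_iff x hs
  have h2 := S.E_mem_tauChart_iff y ht
  rw [h] at h1
  constructor
  · intro h'; exact lt_of_le_of_ne ht.2 fun e => h'.ne (h1.1 (h2.2 e))
  · intro h'; exact lt_of_le_of_ne hs.2 fun e => h'.ne (h2.1 (h1.2 e))

lemma E_eq_same {x y : S.ι × Bool} {s t : ℝ} (hs : s ∈ Icc (0 : ℝ) 1) (ht : t ∈ Icc (0 : ℝ) 1)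
    (hs1 : s < 1) (hk : S.kk x.1 = S.kk y.1) (h : S.E x s = S.E y t) : x = y ∧ s = t := by
  obtain ⟨h1, h2⟩ := S.W_eq_same hk (mem_square_pt x.2 hs) (mem_square_pt y.2 ht) hs1
    ((S.E_lt_one hs ht h).1 hs1) h
  exact ⟨Prod.ext h1 (pt_inj (Prod.mk.inj h2).1), (Prod.mk.inj h2).2⟩

lemma injOn_E (x : S.ι × Bool) : InjOn (S.E x) (Icc 0 1) := by
  intro s hs t ht h
  by_cases h1 : s < 1
  · exact (S.E_eq_same hs ht h1 rfl h).2
  · have h2 := mt (S.E_lt_one hs ht h).2 h1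
    exact le_antisymm (hs.2.trans (not_lt.1 h2)) (ht.2.trans (not_lt.1 h1))

/-- By `fst_mem` a sector stays away from the left and right sides, so its ends avoid the corners of
the square and `Tiling.no_three` applies to them. -/
lemma E_on_side (x : S.ι × Bool) {s : ℝ} (hs : s ∈ Icc (0 : ℝ) 1) :
    ∃ d, ∃ t ∈ Ioo (0 : ℝ) 1, S.Q x.1 (pt x.2, s) = side d t := by
  have hx := mem_square_pt x.2 hs
  have h1 := (S.sec x.1).fst_mem _ hx
  rcases (S.sec x.1).ends _ hx (pt_cases x.2) with h | h
  · exact ⟨0, _, h1, Prod.ext rfl h⟩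
  · exact ⟨1, _, h1, Prod.ext rfl h⟩

/-- Within one square, ends that meet off the `τ`-chart are equal. Three distinct ends through a
point would therefore place it on open sides of three distinct disks. -/
lemma E_three {x y z : S.ι × Bool} {s t r : ℝ} (hs : s ∈ Icc (0 : ℝ) 1) (ht : t ∈ Icc (0 : ℝ) 1)
    (hr : r ∈ Icc (0 : ℝ) 1) (hs1 : s < 1) (hy : S.E y t = S.E x s) (hz : S.E z r = S.E x s) :
    x = y ∨ x = z ∨ y = z := by
  by_contra hcon
  push Not at hcon
  obtain ⟨h1, h2, h3⟩ := hcon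
  obtain ⟨d₁, t₁, ht₁, e₁⟩ := S.E_on_side x hs
  obtain ⟨d₂, t₂, ht₂, e₂⟩ := S.E_on_side y ht
  obtain ⟨d₃, t₃, ht₃, e₃⟩ := S.E_on_side z hr
  have ht1 := (S.E_lt_one ht hs hy).2 hs1
  refine T.no_three (k₁ := S.kk x.1) (k₂ := S.kk y.1) (k₃ := S.kk z.1)
    (fun h => h1 (S.E_eq_same hs ht hs1 h hy.symm).1)
    (fun h => h2 (S.E_eq_same hs hr hs1 h hz.symm).1)
    (fun h => h3 (S.E_eq_same ht hr ht1 h (hy.trans hz.symm)).1) ht₁ ht₂ ht₃ (d₁ := d₁) (d₂ := d₂)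
    (d₃ := d₃) ?_ ?_
  · rw [← e₁, ← e₂]; exact hy
  · rw [← e₁, ← e₃]; exact hz

/-- The point lies in a second disk and has positive gap, so a sector there contains it. It must be
on an end of that sector, because other points of a sector are interior to their disk. -/
lemma exists_E_other (x : S.ι × Bool) {s : ℝ} (hs : s ∈ Ioo (0 : ℝ) 1) :
    ∃ y ≠ x, ∃ t ∈ Icc (0 : ℝ) 1, S.E y t = S.E x s := by
  have hs' := Ioo_subset_Icc_self hs
  have hx := mem_square_pt x.2 hs'
  obtain ⟨d, t, ht, e⟩ := S.E_on_side x hs'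
  obtain ⟨l, hl, y, hy, e'⟩ := T.exists_other (S.kk x.1) ((S.sec x.1).mem _ hx)
    (by rw [e]; exact side_notMem_openSquare d t)
  have hpos : T.H l y ∈ T.pos := by rw [e']; exact (S.E_mem_pos_iff x hs').2 hs.1
  obtain ⟨j, rfl, v, hv, rfl⟩ := S.cover l y hy ((T.mem_pos_iff l hy).1 hpos)
  have hend : v.1 = 0 ∨ v.1 = 1 := by
    by_contra hcon
    push Not at hcon
    exact hl (T.eq_of_H_eq (S.Q_mem_openSquare j hv (lt_of_le_of_ne hv.1.1 hcon.1.symm)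
      (lt_of_le_of_ne hv.1.2 hcon.2)) ((S.sec x.1).mem _ hx) e').1
  obtain ⟨e₀, he₀⟩ := exists_pt hend
  refine ⟨(j, e₀), fun h => hl (by rw [← h]), v.2, hv.2, ?_⟩
  simp only [E]
  rw [he₀]
  exact e'

/-- The open end is covered by two closed sets: where it meets the end `y`, and where it meets some
third end. `E_three` makes them disjoint there, so by connectedness the first is everything. -/
lemma exists_E_subset (x : S.ι × Bool) : ∃ y ≠ x, S.E x '' Icc 0 1 ⊆ S.E y '' Icc 0 1 := by
  obtain ⟨y, hy, t, ht, e⟩ := S.exists_E_other x (s := 1 / 2) ⟨by norm_num, by norm_num⟩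
  refine ⟨y, hy, ?_⟩
  have hK : ∀ z, IsClosed (S.E z '' Icc 0 1) := fun z =>
    (isCompact_Icc.image_of_continuousOn (S.continuousOn_E z)).isClosed
  have hcl : ∀ K : Set S2, IsClosed K → IsClosed (Icc 0 1 ∩ S.E x ⁻¹' K) := fun K hK =>
    (S.continuousOn_E x).preimage_isClosed_of_isClosed isClosed_Icc hK
  set C := Icc 0 1 ∩ S.E x ⁻¹' (S.E y '' Icc 0 1) with hC
  set C' := Icc 0 1 ∩ S.E x ⁻¹' (⋃ z ∈ {z | z ≠ x ∧ z ≠ y}, S.E z '' Icc 0 1) with hC'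
  have hC1 : IsClosed C := hcl _ (hK y)
  have hC2 : IsClosed C' := hcl _ ((Set.toFinite _).isClosed_biUnion fun z _ => hK z)
  have hsub : Ioo (0 : ℝ) 1 ⊆ C ∪ C' := by
    intro s hs
    obtain ⟨z, hz, r, hr, e⟩ := S.exists_E_other x hs
    have hs' := Ioo_subset_Icc_self hs
    by_cases hzy : z = y
    · left; exact ⟨hs', r, hr, by rw [← hzy, e]⟩
    · right; exact ⟨hs', mem_biUnion (show z ∈ {z | z ≠ x ∧ z ≠ y} from ⟨hz, hzy⟩) ⟨r, hr, e⟩⟩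
  have hIoo : Ioo (0 : ℝ) 1 ⊆ C := by
    by_contra hcon
    obtain ⟨s, hs, hsC⟩ := not_subset.1 hcon
    obtain ⟨r, hr, ⟨hr1, r₂, hr2, hr3⟩, -, hr4⟩ := isPreconnected_closed_iff.1
      (isPreconnected_Ioo (a := (0 : ℝ)) (b := 1)) C C' hC1 hC2 hsub
      ⟨1 / 2, by norm_num, by norm_num, t, ht, e⟩ ⟨s, hs, (hsub hs).resolve_left hsC⟩
    simp only [mem_preimage, mem_iUnion, exists_prop] at hr4
    obtain ⟨z, hz, r', hr', e'⟩ := hr4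
    rcases S.E_three hr1 hr2 hr' hr.2 hr3 e' with h | h | h
    · exact hy h.symm
    · exact hz.1 h.symm
    · exact hz.2 h.symm
  have hcl2 : closure (Ioo (0 : ℝ) 1) ⊆ C := closure_minimal hIoo hC1
  rw [closure_Ioo zero_ne_one] at hcl2
  rintro _ ⟨s, hs, rfl⟩
  exact (hcl2 hs).2

/-- Each end of a sector is glued to exactly one other end. -/
lemma exists_partner (x : S.ι × Bool) : ∃ y ≠ x, S.E y '' Icc 0 1 = S.E x '' Icc 0 1 := by
  obtain ⟨y, hy, h⟩ := S.exists_E_subset x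
  -- The end of `x` is contained in that of `y`, which is contained in that of some `z`. At a common
  -- point of the three, `E_three` forces `z = x`.
  obtain ⟨z, hz, h'⟩ := S.exists_E_subset y
  refine ⟨y, hy, Subset.antisymm ?_ h⟩
  have hm : (1 / 2 : ℝ) ∈ Icc (0 : ℝ) 1 := by norm_num
  obtain ⟨t, ht, e⟩ := h (mem_image_of_mem _ hm)
  obtain ⟨r, hr, e'⟩ := h' (mem_image_of_mem _ ht)
  rcases S.E_three hm ht hr (by norm_num) e (e'.trans e) with h1 | h1 | h1
  · exact absurd h1.symm hy
  · rwa [← h1] at h'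
  · exact absurd h1.symm hz

/-- The parameters of glued ends correspond. -/
lemma exists_transition {x y : S.ι × Bool} (h : S.E x '' Icc 0 1 ⊆ S.E y '' Icc 0 1) :
    ∃ φ : ℝ → ℝ, ContinuousOn φ (Icc 0 1) ∧ MapsTo φ (Icc 0 1) (Icc 0 1) ∧
      StrictMonoOn φ (Icc 0 1) ∧ φ 0 = 0 ∧ φ 1 = 1 ∧ ∀ s ∈ Icc (0 : ℝ) 1, S.E y (φ s) = S.E x s := by
  have hinv := continuousOn_invFunOn_of_isCompact (isCompact_Icc (a := (0 : ℝ)) (b := 1))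
    (S.continuousOn_E y) subset_rfl (S.injOn_E y) (fun _ _ y hy _ => hy)
  have hmem : ∀ s ∈ Icc (0 : ℝ) 1, S.E x s ∈ S.E y '' Icc 0 1 := fun s hs => h ⟨s, hs, rfl⟩
  have m := fun s hs => Function.invFunOn_mem (hmem s hs)
  have e := fun s hs => Function.invFunOn_eq (hmem s hs)
  have z : (0 : ℝ) ∈ Icc (0 : ℝ) 1 := by norm_num
  have o : (1 : ℝ) ∈ Icc (0 : ℝ) 1 := by norm_num
  have e0 : Function.invFunOn (S.E y) (Icc 0 1) (S.E x 0) = 0 := by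
    by_contra hne
    have hp := (S.E_mem_pos_iff y (m 0 z)).2 (lt_of_le_of_ne (m 0 z).1 (Ne.symm hne))
    rw [e 0 z, S.E_mem_pos_iff x z] at hp
    exact lt_irrefl _ hp
  have e1 : Function.invFunOn (S.E y) (Icc 0 1) (S.E x 1) = 1 := by
    rw [← S.E_mem_tauChart_iff y (m 1 o), e 1 o, S.E_mem_tauChart_iff x o]
  have hc : ContinuousOn (fun s => Function.invFunOn (S.E y) (Icc 0 1) (S.E x s)) (Icc 0 1) :=
    hinv.comp (S.continuousOn_E x) hmem
  refine ⟨fun s => Function.invFunOn (S.E y) (Icc 0 1) (S.E x s), hc, m, ?_, e0, e1, e⟩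
  refine hc.strictMonoOn_of_injOn_Icc zero_le_one (by rw [e0, e1]; exact zero_le_one) ?_
  intro s hs t ht hst
  refine S.injOn_E x hs ht ?_
  rw [← e s hs, ← e t ht]
  exact congrArg _ hst

end Sectors

/-- Inverse of an increasing bijection of the unit interval. -/
lemma exists_inverse_Icc {δ : ℝ → ℝ} (hc : ContinuousOn δ (Icc 0 1)) (hs : StrictMonoOn δ (Icc 0 1))
    (h0 : δ 0 = 0) (h1 : δ 1 = 1) : ∃ ρ : ℝ → ℝ, ContinuousOn ρ (Icc 0 1) ∧
      MapsTo ρ (Icc 0 1) (Icc 0 1) ∧ StrictMonoOn ρ (Icc 0 1) ∧ ρ 0 = 0 ∧ ρ 1 = 1 ∧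
      (∀ s ∈ Icc (0 : ℝ) 1, δ (ρ s) = s) ∧ ∀ s ∈ Icc (0 : ℝ) 1, ρ (δ s) = s := by
  have z : (0 : ℝ) ∈ Icc (0 : ℝ) 1 := by norm_num
  have o : (1 : ℝ) ∈ Icc (0 : ℝ) 1 := by norm_num
  have himg : δ '' Icc 0 1 = Icc 0 1 := by
    apply Subset.antisymm
    · rintro _ ⟨s, hs', rfl⟩
      have l0 := hs.monotoneOn z hs' hs'.1
      have l1 := hs.monotoneOn hs' o hs'.2
      rw [h0] at l0
      rw [h1] at l1
      exact ⟨l0, l1⟩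
    · have := intermediate_value_Icc zero_le_one hc
      rwa [h0, h1] at this
  have hinv := continuousOn_invFunOn_of_isCompact (isCompact_Icc (a := (0 : ℝ)) (b := 1)) hc
    subset_rfl hs.injOn (fun _ _ y hy _ => hy)
  rw [himg] at hinv
  have hmem : ∀ s ∈ Icc (0 : ℝ) 1, s ∈ δ '' Icc 0 1 := fun s hs => by rwa [himg]
  have m := fun s hs => Function.invFunOn_mem (hmem s hs)
  have e := fun s hs => Function.invFunOn_eq (hmem s hs)
  have l : ∀ s ∈ Icc (0 : ℝ) 1, Function.invFunOn δ (Icc 0 1) (δ s) = s := fun s hs' => by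
    have : δ s ∈ Icc (0 : ℝ) 1 := by rw [← himg]; exact mem_image_of_mem _ hs'
    exact hs.injOn (m _ this) hs' (e _ this)
  refine ⟨Function.invFunOn δ (Icc 0 1), hinv, m, ?_, ?_, ?_, e, l⟩
  · intro s hs' t ht hst
    by_contra hcon
    have := hs.monotoneOn (m t ht) (m s hs') (not_lt.1 hcon)
    rw [e s hs', e t ht] at this
    exact absurd hst (not_lt.2 this)
  · have := l 0 z; rwa [h0] at this
  · have := l 1 o; rwa [h1] at this

lemma IsSector.reparam {κ : Piece} {Q : ℝ × ℝ → ℝ × ℝ} (h : IsSector κ Q) {R : ℝ × ℝ → ℝ}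
    (hR : ContinuousOn R square) (hm : ∀ x ∈ square, R x ∈ Icc (0 : ℝ) 1)
    (h0 : ∀ x ∈ square, x.2 = 0 → R x = 0) (h1 : ∀ x ∈ square, x.2 = 1 → R x = 1)
    (hs : ∀ x ∈ square, ∀ y ∈ square, x.1 = y.1 → x.2 < y.2 → R x < R y) :
    IsSector κ (fun x => Q (x.1, R x)) := by
  have mem : ∀ x ∈ square, (x.1, R x) ∈ square := fun x hx => ⟨hx.1, hm x hx⟩
  have lt1 : ∀ x ∈ square, x.2 < 1 → R x < 1 := fun x hx hx2 => by
    have := hs x hx (x.1, 1) ⟨hx.1, by simp⟩ rfl hx2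
    rwa [h1 (x.1, 1) ⟨hx.1, by simp⟩ rfl] at this
  refine ⟨h.cont.comp (by fun_prop) mem, fun x hx => h.mem _ (mem x hx),
    fun x hx => h.fst_mem _ (mem x hx), fun x hx => h.interior _ (mem x hx),
    fun x hx => h.ends _ (mem x hx), fun x hx hx2 => h.zero _ (mem x hx) (h0 x hx hx2), ?_, ?_, ?_, ?_⟩
  · intro x hx
    rw [h.mem_tauSet_iff _ (mem x hx)]
    refine ⟨fun e => ?_, h1 x hx⟩
    by_contra hne
    exact (lt1 x hx (lt_of_le_of_ne hx.2.2 hne)).ne e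
  · intro x hx y hy hxy hlt
    exact h.strictMono _ (mem x hx) _ (mem y hy) hxy (hs x hx y hy hxy hlt)
  · intro x hx hg
    have := h.dir _ (mem x hx) hg
    rwa [← h0 (x.1, 0) ⟨hx.1, by simp⟩ rfl] at this
  · intro x hx y hy hx2 hy2 e
    have := h.inj _ (mem x hx) _ (mem y hy) (lt1 x hx hx2) (lt1 y hy hy2) e
    simp only [Prod.mk.injEq] at this
    rcases lt_trichotomy x.2 y.2 with h3 | h3 | h3
    · exact absurd this.2 (hs x hx y hy this.1 h3).ne
    · exact Prod.ext this.1 h3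
    · exact absurd this.2 (hs y hy x hx this.1.symm h3).ne'

/-- Sectors such that the parameters of glued ends agree. -/
structure Glued {Γ : Chart} {F : Set (ℂ × S2)} (T : Tiling Γ F) extends Sectors T where
  π : ι × Bool → ι × Bool
  π_ne : ∀ x, π x ≠ x
  E_π : ∀ x, ∀ s ∈ Icc (0 : ℝ) 1, toSectors.E (π x) s = toSectors.E x s

/-- The sectors can be parametrised so that the parameters of glued ends agree. -/
theorem Tiling.exists_glued {Γ : Chart} {F : Set (ℂ × S2)} (T : Tiling Γ F) :
    Nonempty (Glued T) := by
  obtain ⟨S⟩ := T.exists_sectors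
  choose π hπ hπE using S.exists_partner
  choose φ hφc hφm hφs hφ0 hφ1 hφE using fun x => S.exists_transition (hπE x).symm.subset
  have z : (0 : ℝ) ∈ Icc (0 : ℝ) 1 := by norm_num
  have hm : (1 / 2 : ℝ) ∈ Icc (0 : ℝ) 1 := by norm_num
  have hππ : ∀ x, π (π x) = x := by
    intro x
    have h1 := hφE x _ hm
    have h2 := hφE (π x) _ (hφm x hm)
    rcases S.E_three hm (hφm x hm) (hφm (π x) (hφm x hm)) (by norm_num) h1 (h2.trans h1)
      with h | h | h
    · exact absurd h.symm (hπ x)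
    · exact h.symm
    · exact absurd h.symm (hπ _)
  have hφφ : ∀ x, ∀ s ∈ Icc (0 : ℝ) 1, φ (π x) (φ x s) = s := by
    intro x s hs
    refine S.injOn_E x (hφm _ (hφm x hs)) hs ?_
    have h1 := hφE x s hs
    have h2 := hφE (π x) _ (hφm x hs)
    rw [hππ] at h2
    rw [h2, h1]
  -- The average `(s + φ s) / 2` is symmetric under exchange of the two glued ends: at `π x`,
  -- evaluated in `φ x s`, it has the same value. Its inverses therefore satisfy `ρ (π x) = φ x ∘ ρ
  -- x`, which is agreement of the new parameters.
  have hinv := fun x => exists_inverse_Icc (δ := fun s => (s + φ x s) / 2)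
    ((continuousOn_id.add (hφc x)).div_const 2)
    (fun s hs t ht hst => by have := hφs x hs ht hst; simp only; linarith)
    (by simp only [hφ0]; norm_num) (by simp only [hφ1]; norm_num)
  choose ρ hρc hρm hρs hρ0 hρ1 hρl hρr using hinv
  have hρπ : ∀ x, ∀ s ∈ Icc (0 : ℝ) 1, ρ (π x) s = φ x (ρ x s) := by
    intro x s hs
    have h1 := hφφ x _ (hρm x hs)
    have h2 := hρr (π x) _ (hφm x (hρm x hs))
    rw [h1, add_comm, hρl x s hs] at h2
    exact h2
  -- Linear interpolation between the reparametrisations of the two ends; it stays strictly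
  -- increasing along each line.
  let R : S.ι → ℝ × ℝ → ℝ := fun i x => (1 - x.1) * ρ (i, false) x.2 + x.1 * ρ (i, true) x.2
  have hsnd : MapsTo (fun x : ℝ × ℝ => x.2) square (Icc 0 1) := fun x hx => hx.2
  have hRc : ∀ i, ContinuousOn (R i) square := fun i =>
    (ContinuousOn.mul (by fun_prop) ((hρc _).comp continuousOn_snd hsnd)).add
      (ContinuousOn.mul (by fun_prop) ((hρc _).comp continuousOn_snd hsnd))
  have hRm : ∀ i, ∀ x ∈ square, R i x ∈ Icc (0 : ℝ) 1 := by
    intro i x hx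
    have h1 := hρm (i, false) hx.2
    have h2 := hρm (i, true) hx.2
    have h3 := hx.1
    simp only [mem_Icc] at h1 h2 h3
    simp only [R, mem_Icc]
    constructor <;> nlinarith
  have hR0 : ∀ i, ∀ x ∈ square, x.2 = 0 → R i x = 0 := by
    intro i x _ h
    simp only [R, h, hρ0]
    ring
  have hR1 : ∀ i, ∀ x ∈ square, x.2 = 1 → R i x = 1 := by
    intro i x _ h
    simp only [R, h, hρ1]
    ring
  have hRs : ∀ i, ∀ x ∈ square, ∀ y ∈ square, x.1 = y.1 → x.2 < y.2 → R i x < R i y := by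
    intro i x hx y hy hxy hlt
    have h1 := hρs (i, false) hx.2 hy.2 hlt
    have h2 := hρs (i, true) hx.2 hy.2 hlt
    have h3 := hx.1
    simp only [mem_Icc] at h3
    simp only [R, ← hxy]
    have p1 : 0 ≤ x.1 * (ρ (i, true) y.2 - ρ (i, true) x.2) := mul_nonneg h3.1 (by linarith)
    rcases h3.2.lt_or_eq with h4 | h4
    · have p2 := mul_pos (sub_pos.2 h4) (sub_pos.2 h1)
      linarith
    · rw [h4]; linarith
  refine ⟨⟨⟨S.ι, S.finite, S.kk, fun i x => S.Q i (x.1, R i x),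
    fun i => (S.sec i).reparam (hRc i) (hRm i) (hR0 i) (hR1 i) (hRs i), ?_, ?_⟩, π, hπ, ?_⟩⟩
  · intro i j hij x hx y hy hx2 hy2 e
    have lt1 : ∀ i, ∀ x ∈ square, x.2 < 1 → R i x < 1 := fun i x hx hx2 => by
      have := hRs i x hx (x.1, 1) ⟨hx.1, by simp⟩ rfl hx2
      rwa [hR1 i (x.1, 1) ⟨hx.1, by simp⟩ rfl] at this
    exact S.uniq i j hij (x.1, R i x) ⟨hx.1, hRm i x hx⟩ (y.1, R j y) ⟨hy.1, hRm j y hy⟩ (lt1 i x hx hx2)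
      (lt1 j y hy hy2) e
  · intro k y hy hp
    obtain ⟨i, hi, x, hx, e⟩ := S.cover k y hy hp
    have hc : ContinuousOn (fun s => R i (x.1, s)) (Icc 0 1) :=
      (hRc i).comp (by fun_prop) fun s hs => ⟨hx.1, hs⟩
    have := intermediate_value_Icc zero_le_one hc
    rw [hR0 i (x.1, 0) ⟨hx.1, by simp⟩ rfl, hR1 i (x.1, 1) ⟨hx.1, by simp⟩ rfl] at this
    obtain ⟨s, hs, e'⟩ := this hx.2
    refine ⟨i, hi, (x.1, s), ⟨hx.1, hs⟩, ?_⟩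
    simp only at e' ⊢
    rw [e']
    exact e
  · have key : ∀ (x : S.ι × Bool) (s : ℝ), R x.1 (pt x.2, s) = ρ x s := by
      rintro ⟨i, e⟩ s
      cases e <;> simp [R, pt]
    intro x s hs
    have h1 : S.E (π x) (ρ (π x) s) = S.E x (ρ x s) := by
      rw [hρπ x s hs]; exact hφE x _ (hρm x hs)
    simp only [Sectors.E, Sectors.W]
    rw [key, key]
    exact h1

/-! ### Collars, the regular neighbourhood and the wickets -/

/-- The collar depth at which the gap is `s ^ 2 / 2`. -/
lemma IsSector.exists_depth {κ : Piece} {Q : ℝ × ℝ → ℝ × ℝ} (h : IsSector κ Q) :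
    ∃ θ : ℝ × ℝ → ℝ, ContinuousOn θ square ∧ (∀ x ∈ square, θ x ∈ Ico (0 : ℝ) 1) ∧
      (∀ x ∈ square, x.2 = 0 → θ x = 0) ∧
      ∀ x ∈ square, κ.gapFun (Q (x.1, θ x)) = x.2 ^ 2 / 2 := by
  let K : Set (ℝ × ℝ) := {y | y ∈ square ∧ κ.gapFun (Q y) ≤ 1 / 2}
  -- On the compact part `K` where sheets exist, strict growth of the gap makes `f` injective. Its
  -- inverse is continuous by compactness, without any differentiability of the sector.
  let f : ℝ × ℝ → ℝ × ℝ := fun y => (y.1, Real.sqrt (2 * κ.gapFun (Q y)))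
  have hg : ContinuousOn (fun y => κ.gapFun (Q y)) square :=
    κ.continuous_gapFun.comp_continuousOn h.cont
  have hK : IsCompact K := isCompact_square.of_isClosed_subset
    (hg.preimage_isClosed_of_isClosed isCompact_square.isClosed isClosed_Iic) fun _ hy => hy.1
  have hf : ContinuousOn f K := ContinuousOn.prodMk (by fun_prop)
    (Real.continuous_sqrt.comp_continuousOn ((continuousOn_const.mul hg).mono fun _ hy => hy.1))
  have hinj : InjOn f K := by
    rintro x ⟨hx, hx'⟩ y ⟨hy, hy'⟩ e
    simp only [f, Prod.mk.injEq] at e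
    have e2 : κ.gapFun (Q x) = κ.gapFun (Q y) := by
      have := (Real.sqrt_inj (by linarith [κ.gapFun_nonneg (Q x)])
        (by linarith [κ.gapFun_nonneg (Q y)])).1 e.2
      linarith
    rcases lt_trichotomy x.2 y.2 with h3 | h3 | h3
    · exact absurd e2 (h.strictMono x hx y hy e.1 h3 hx').ne
    · exact Prod.ext e.1 h3
    · exact absurd e2 (h.strictMono y hy x hx e.1.symm h3 hy').ne'
  have hinv := continuousOn_invFunOn_of_isCompact hK hf subset_rfl hinj (fun _ _ y hy _ => hy)
  have hex : ∀ x ∈ square, x ∈ f '' K := by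
    intro x hx
    have hc : ContinuousOn (fun s => κ.gapFun (Q (x.1, s))) (Icc 0 1) :=
      hg.comp (by fun_prop) fun s hs => ⟨hx.1, hs⟩
    have h0 : κ.gapFun (Q (x.1, 0)) = 0 := h.zero _ ⟨hx.1, by simp⟩ rfl
    have h1 : κ.gapFun (Q (x.1, 1)) = 1 :=
      Piece.gapFun_eq_one_of_mem_tauSet ((h.mem_tauSet_iff (x.1, 1) ⟨hx.1, by simp⟩).2 rfl)
    have := intermediate_value_Icc zero_le_one hc
    rw [h0, h1] at this
    have hx2 := hx.2
    simp only [mem_Icc] at hx2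
    obtain ⟨s, hs, e⟩ := this (show x.2 ^ 2 / 2 ∈ Icc (0 : ℝ) 1 from
      ⟨by positivity, by nlinarith⟩)
    simp only at e
    refine ⟨(x.1, s), ⟨⟨hx.1, hs⟩, by rw [e]; nlinarith⟩, ?_⟩
    simp only [f, e]
    rw [mul_div_cancel₀ _ two_ne_zero, Real.sqrt_sq hx2.1]
  have m := fun x hx => Function.invFunOn_mem (hex x hx)
  have e := fun x hx => Function.invFunOn_eq (hex x hx)
  have e1 : ∀ x ∈ square, (Function.invFunOn f K x).1 = x.1 := fun x hx =>
    (congrArg Prod.fst (e x hx) : (f (Function.invFunOn f K x)).1 = x.1)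
  have e2 : ∀ x ∈ square, κ.gapFun (Q (Function.invFunOn f K x)) = x.2 ^ 2 / 2 := by
    intro x hx
    have := congrArg Prod.snd (e x hx)
    simp only [f] at this
    have h2 := Real.sq_sqrt (show 0 ≤ 2 * κ.gapFun (Q (Function.invFunOn f K x)) by
      linarith [κ.gapFun_nonneg (Q (Function.invFunOn f K x))])
    rw [this] at h2
    linarith
  have e3 : ∀ x ∈ square, Function.invFunOn f K x = (x.1, (Function.invFunOn f K x).2) :=
    fun x hx => Prod.ext (e1 x hx) rfl
  refine ⟨fun x => (Function.invFunOn f K x).2,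
    continuous_snd.comp_continuousOn (hinv.mono hex), fun x hx => ?_, fun x hx hx2 => ?_,
    fun x hx => ?_⟩
  · have h1 := (m x hx).1.2
    refine ⟨h1.1, lt_of_le_of_ne h1.2 fun h2 => ?_⟩
    have h3 := Piece.gapFun_eq_one_of_mem_tauSet ((h.mem_tauSet_iff _ (m x hx).1).2 h2)
    have := (m x hx).2
    rw [h3] at this
    norm_num at this
  · have h0 : κ.gapFun (Q (x.1, 0)) = 0 := h.zero _ ⟨hx.1, by simp⟩ rfl
    have hm : (x.1, (0 : ℝ)) ∈ K := ⟨⟨hx.1, by simp⟩, by rw [h0]; norm_num⟩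
    have : f (x.1, 0) = f (Function.invFunOn f K x) := by
      rw [e x hx]
      simp only [f, h0, mul_zero, Real.sqrt_zero]
      exact Prod.ext rfl hx2.symm
    exact (congrArg Prod.snd (hinj hm (m x hx) this)).symm
  · have := e2 x hx
    rwa [e3 x hx] at this

/-- Families of arcs that agree as soon as their starting points agree define a map. -/
lemma exists_glue {ι Z : Type*} [Finite ι] [TopologicalSpace Z] [T2Space Z] (V : ι → ℝ × ℝ → Z)
    (hV : ∀ i, ContinuousOn (V i) square)
    (hcompat : ∀ i j, ∀ u ∈ Icc (0 : ℝ) 1, ∀ v ∈ Icc (0 : ℝ) 1, V i (u, 0) = V j (v, 0) →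
      ∀ s ∈ Icc (0 : ℝ) 1, V i (u, s) = V j (v, s)) :
    ∃ c : Z → ℝ → Z, (∀ i, ∀ x ∈ square, c (V i (x.1, 0)) x.2 = V i x) ∧
      ContinuousOn (fun q : Z × ℝ => c q.1 q.2)
        {q | ∃ i, ∃ x ∈ square, q = (V i (x.1, 0), x.2)} := by
  classical
  let c : Z → ℝ → Z := fun p s =>
    if h : ∃ a : ι × ℝ, a.2 ∈ Icc (0 : ℝ) 1 ∧ V a.1 (a.2, 0) = p then
      V h.choose.1 (h.choose.2, s) else p
  have hc : ∀ i, ∀ x ∈ square, c (V i (x.1, 0)) x.2 = V i x := by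
    intro i x hx
    have h : ∃ a : ι × ℝ, a.2 ∈ Icc (0 : ℝ) 1 ∧ V a.1 (a.2, 0) = V i (x.1, 0) :=
      ⟨(i, x.1), hx.1, rfl⟩
    simp only [c]
    rw [dif_pos h]
    exact hcompat _ _ _ h.choose_spec.1 _ hx.1 h.choose_spec.2 _ hx.2
  refine ⟨c, hc, ?_⟩
  rw [continuousOn_iff_isClosed]
  intro C hC
  have he : ∀ i, ContinuousOn (fun x : ℝ × ℝ => (V i (x.1, 0), x.2)) square := fun i =>
    ((hV i).comp (by fun_prop) fun x hx => ⟨hx.1, by simp⟩).prodMk continuousOn_snd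
  refine ⟨⋃ i, (fun x : ℝ × ℝ => (V i (x.1, 0), x.2)) '' (square ∩ V i ⁻¹' C), ?_, ?_⟩
  · refine isClosed_iUnion_of_finite fun i => IsCompact.isClosed ?_
    exact (isCompact_square.of_isClosed_subset
      ((hV i).preimage_isClosed_of_isClosed isCompact_square.isClosed hC)
      inter_subset_left).image_of_continuousOn ((he i).mono inter_subset_left)
  · ext q
    simp only [mem_inter_iff, mem_preimage, mem_ofPred_eq, mem_iUnion, mem_image]
    constructor
    · rintro ⟨hq, i, x, hx, rfl⟩
      simp only [hc i x hx] at hq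
      exact ⟨⟨i, x, ⟨hx, hq⟩, rfl⟩, i, x, hx, rfl⟩
    · rintro ⟨⟨i, x, ⟨hx, hq⟩, rfl⟩, -⟩
      refine ⟨?_, i, x, hx, rfl⟩
      simp only [hc i x hx]
      exact hq

namespace Tiling

variable {Γ : Chart} {F : Set (ℂ × S2)} (T : Tiling Γ F)

lemma gapFun_eq_of_le {k l : Fin T.n} {x y : ℝ × ℝ} (hx : x ∈ square) (hy : y ∈ square)
    (h : T.H k x = T.H l y) (hg : (T.κ k).gapFun x ≤ 1 / 2) :
    (T.κ l).gapFun y = (T.κ k).gapFun x := by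
  have h1 := T.min_gap_eq hx hy h
  have h2 := (T.fibre_H_nonempty_iff k hx).2 hg
  rw [h, T.fibre_H_nonempty_iff l hy] at h2
  rw [min_eq_left hg, min_eq_left h2] at h1
  exact h1.symm

end Tiling

namespace Glued

variable {Γ : Chart} {F : Set (ℂ × S2)} {T : Tiling Γ F} (S : Glued T)

/-- A point inside a sector is interior to its disk and belongs to no other sector. For a point on
an end, `E_three` applied with the partner end leaves only the end itself and the partner. -/
lemma W_eq {i j : S.ι} {x y : ℝ × ℝ} (hx : x ∈ square) (hy : y ∈ square) (hx2 : x.2 < 1)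
    (h : S.W i x = S.W j y) : (i = j ∧ x = y) ∨ (x.2 = y.2 ∧ ∃ e e', x.1 = pt e ∧ y.1 = pt e' ∧
      (j, e') = S.π (i, e)) := by
  have hy2 : y.2 < 1 := by
    rw [S.snd_lt_one_iff j hy, ← h]
    exact (S.snd_lt_one_iff i hx).1 hx2
  by_cases h1 : 0 < x.1 ∧ x.1 < 1
  · exact Or.inl (S.W_eq_interior hx hy h1.1 h1.2 hx2 h)
  by_cases h2 : 0 < y.1 ∧ y.1 < 1
  · have := S.W_eq_interior hy hx h2.1 h2.2 hy2 h.symm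
    exact Or.inl ⟨this.1.symm, this.2.symm⟩
  have ends : ∀ z ∈ square, ¬ (0 < z.1 ∧ z.1 < 1) → z.1 = 0 ∨ z.1 = 1 := by
    intro z hz h
    have := hz.1
    simp only [mem_Icc] at this
    by_contra hcon
    push Not at hcon
    exact h ⟨lt_of_le_of_ne this.1 hcon.1.symm, lt_of_le_of_ne this.2 hcon.2⟩
  obtain ⟨e, he⟩ := exists_pt (ends x hx h1)
  obtain ⟨e', he'⟩ := exists_pt (ends y hy h2)
  have hE : S.E (j, e') y.2 = S.E (i, e) x.2 := by
    simp only [Sectors.E]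
    rw [he, he']
    exact h.symm
  have hπ := S.E_π (i, e) x.2 hx.2
  rcases S.E_three hx.2 hy.2 hx.2 hx2 hE hπ with h3 | h3 | h3
  · left
    obtain ⟨h4, h5⟩ := Prod.mk.inj h3
    subst h4
    subst h5
    refine ⟨rfl, Prod.ext (by rw [← he, he']) ?_⟩
    exact (S.injOn_E _ hy.2 hx.2 hE).symm
  · exact absurd h3.symm (S.π_ne _)
  · right
    rw [← hπ, ← h3] at hE
    exact ⟨(S.injOn_E _ hy.2 hx.2 hE).symm, e, e', he.symm, he'.symm, h3⟩

/-- Lines that meet before the `τ`-chart coincide throughout, since glued ends carry the same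
parameter. This is what makes the mapping cylinder well defined. -/
lemma W_eq_line {i j : S.ι} {x y : ℝ × ℝ} (hx : x ∈ square) (hy : y ∈ square) (hx2 : x.2 < 1)
    (h : S.W i x = S.W j y) : x.2 = y.2 ∧ ∀ s ∈ Icc (0 : ℝ) 1, S.W i (x.1, s) = S.W j (y.1, s) := by
  rcases S.W_eq hx hy hx2 h with ⟨rfl, rfl⟩ | ⟨h1, e, e', h2, h3, h4⟩
  · exact ⟨rfl, fun _ _ => rfl⟩
  · refine ⟨h1, fun s hs => ?_⟩
    have := S.E_π (i, e) s hs
    rw [← h4] at this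
    rw [h2, h3]
    exact this.symm

/-- The regular neighbourhood of the `τ`-chart. -/
def N : Set S2 := ⋃ i, S.W i '' square

lemma isCompact_N : IsCompact S.N :=
  isCompact_iUnion fun i => isCompact_square.image_of_continuousOn (S.continuousOn_W i)

lemma pos_subset_N : T.pos ⊆ S.N := fun _ hp => mem_iUnion.2 (S.exists_W hp)

lemma W_mem_N (i : S.ι) {x : ℝ × ℝ} (hx : x ∈ square) : S.W i x ∈ S.N :=
  mem_iUnion.2 ⟨i, x, hx, rfl⟩

/-- The open rectangles do not meet the regular neighbourhood. -/
lemma notMem_N {k : Fin T.n} {r : Rect} (hr : r ∈ (T.κ k).rects) {z : ℝ × ℝ}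
    (hz : z ∈ openSquare) : T.H k (r.toFun z) ∉ S.N := by
  intro h
  obtain ⟨j, x, hx, e⟩ := mem_iUnion.1 h
  have hgood := Piece.rects_good _ r hr
  have hzo := hgood.mem_open hz
  have hO : Ioo r.a₀ r.a₁ ×ˢ Ioo r.b₀ r.b₁ ⊆ openSquare := by
    obtain ⟨h1, h2, h3, h4, h5, h6⟩ := hgood
    exact prod_mono (Ioo_subset_Ioo h1 h3) (Ioo_subset_Ioo h4 h6)
  obtain ⟨h1, h2⟩ := T.eq_of_H_eq (hO hzo) ((S.sec j).mem x hx) e.symm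
  -- A point of a sector with positive parameter has positive gap, and a foot is a limit of such
  -- points; neither is possible inside a rectangle where the gap vanishes.
  have hcl : Tendsto (fun s => S.Q j (x.1, s)) (𝓝[Ioo 0 1] 0) (𝓝 (S.Q j (x.1, 0))) := by
    have h3 : ContinuousOn (fun s => S.Q j (x.1, s)) (Icc 0 1) :=
      (S.sec j).cont.comp (by fun_prop) fun s hs => ⟨hx.1, hs⟩
    exact ((h3 0 (by simp)).tendsto).mono_left (nhdsWithin_mono _ Ioo_subset_Icc_self)
  have hnp : ∀ w ∈ Ioo r.a₀ r.a₁ ×ˢ Ioo r.b₀ r.b₁, w ∉ (T.κ k).posSet := fun w hw =>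
    ((T.κ k).mem_rects_iff (openSquare_subset (hO hw))).1
      ⟨r, hr, prod_mono Ioo_subset_Icc_self Ioo_subset_Icc_self hw⟩
  have hx2 : x.2 = 0 := by
    by_contra hne
    have := (S.gapFun_pos_iff j hx).2 (lt_of_le_of_ne hx.2.1 (Ne.symm hne))
    rw [Piece.gapFun_pos_iff, ← h1, ← h2] at this
    exact hnp _ hzo this
  have hx0 : x = (x.1, 0) := Prod.ext rfl hx2
  rw [← hx0, ← h2] at hcl
  have hopen : IsOpen (Ioo r.a₀ r.a₁ ×ˢ Ioo r.b₀ r.b₁) := isOpen_Ioo.prod isOpen_Ioo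
  have hne : (𝓝[Ioo (0 : ℝ) 1] 0).NeBot := by
    rw [← mem_closure_iff_nhdsWithin_neBot, closure_Ioo zero_ne_one]
    simp
  obtain ⟨s, hs1, hs2⟩ := ((hcl.eventually_mem (hopen.mem_nhds hzo)).and self_mem_nhdsWithin).exists
  have := (S.gapFun_pos_iff j (x := (x.1, s)) ⟨hx.1, Ioo_subset_Icc_self hs2⟩).2 hs2.1
  rw [Piece.gapFun_pos_iff, ← h1] at this
  exact hnp _ hs1 this

/-- Points where the gap vanishes are limits of points outside the regular neighbourhood. -/
lemma mem_closure_compl_N {p : S2} (hp : p ∉ T.pos) {V : Set S2} (hV : IsOpen V) (hpV : p ∈ V) :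
    ∃ q ∈ V, q ∉ S.N := by
  obtain ⟨k, y, hy, rfl⟩ := T.exists_H p
  rw [T.mem_pos_iff k hy] at hp
  obtain ⟨r, hr, hyr⟩ := ((T.κ k).mem_rects_iff hy).2 hp
  have hgood := Piece.rects_good _ r hr
  rw [← hgood.image_square] at hyr
  obtain ⟨z, hz, rfl⟩ := hyr
  have hc : ContinuousOn (fun z => T.H k (r.toFun z)) square :=
    (T.continuousOn_H k).comp r.continuous_toFun.continuousOn fun z hz =>
      hgood.carrier_subset (hgood.mem_carrier hz)
  have hne : (𝓝[openSquare] z).NeBot := by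
    rw [← mem_closure_iff_nhdsWithin_neBot, openSquare, closure_prod_eq, closure_Ioo zero_ne_one]
    exact hz
  have ht := (hc z hz).tendsto.mono_left (nhdsWithin_mono z openSquare_subset)
  obtain ⟨w, hw1, hw2⟩ := ((ht.eventually_mem (hV.mem_nhds hpV)).and self_mem_nhdsWithin).exists
  exact ⟨_, hw1, S.notMem_N hr hw2⟩

/-- The interior of the neighbourhood is the positive set: every point of zero gap is a limit of
points of open rectangles, which miss the neighbourhood. -/
lemma frontier_N : frontier S.N = S.N \ T.pos := by
  rw [S.isCompact_N.isClosed.frontier_eq]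
  ext p
  refine and_congr_right fun _ => not_congr ⟨fun h => ?_, fun h => ?_⟩
  · by_contra hp
    obtain ⟨q, hq, hqN⟩ := S.mem_closure_compl_N hp isOpen_interior h
    exact hqN (interior_subset hq)
  · exact interior_maximal S.pos_subset_N T.isOpen_pos h

lemma foot_mem (i : S.ι) {u : ℝ} (hu : u ∈ Icc (0 : ℝ) 1) : S.W i (u, 0) ∈ frontier S.N := by
  have hx : (u, (0 : ℝ)) ∈ square := ⟨hu, by simp⟩
  rw [S.frontier_N]
  refine ⟨S.W_mem_N i hx, ?_⟩
  rw [S.W_mem_pos_iff i hx]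
  exact lt_irrefl _

lemma exists_foot {p : S2} (hp : p ∈ frontier S.N) : ∃ i, ∃ u ∈ Icc (0 : ℝ) 1, S.W i (u, 0) = p := by
  rw [S.frontier_N] at hp
  obtain ⟨i, x, hx, rfl⟩ := mem_iUnion.1 hp.1
  refine ⟨i, x.1, hx.1, ?_⟩
  have h1 := hp.2
  rw [S.W_mem_pos_iff i hx] at h1
  rw [show (x.1, (0 : ℝ)) = x from Prod.ext rfl (le_antisymm hx.2.1 (not_lt.1 h1))]

lemma frontier_prod : frontier S.N ×ˢ Icc (0 : ℝ) 1 =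
    {q | ∃ i, ∃ x ∈ square, q = (S.W i (x.1, 0), x.2)} := by
  ext ⟨p, s⟩
  constructor
  · rintro ⟨hp, hs⟩
    obtain ⟨i, u, hu, rfl⟩ := S.exists_foot hp
    exact ⟨i, (u, s), ⟨hu, hs⟩, rfl⟩
  · rintro ⟨i, x, hx, e⟩
    rw [e]
    exact ⟨S.foot_mem i hx.1, hx.2⟩

/-- The lines of the sectors are the lines of the mapping cylinder. They start on the frontier, end
on the `τ`-chart, and are pairwise disjoint or equal before that. -/
lemma isRegularNhd_N : IsRegularNhd Γ.tauChart S.N := by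
  refine ⟨S.isCompact_N, fun p hp =>
    interior_maximal S.pos_subset_N T.isOpen_pos (T.tauChart_subset_pos hp), ?_⟩
  obtain ⟨r, hr, hrc⟩ := exists_glue S.W S.continuousOn_W fun i j u hu v hv h =>
    (S.W_eq_line (x := (u, 0)) (y := (v, 0)) ⟨hu, by simp⟩ ⟨hv, by simp⟩ one_pos h).2
  refine ⟨r, by rw [S.frontier_prod]; exact hrc, ?_, ⟨?_, ?_, ?_⟩, ?_⟩
  · intro p hp
    obtain ⟨i, u, hu, rfl⟩ := S.exists_foot hp
    exact hr i (u, 0) ⟨hu, by simp⟩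
  · rintro ⟨p, s⟩ ⟨hp, hs⟩
    simp only at hp hs
    obtain ⟨i, u, hu, rfl⟩ := S.exists_foot hp
    have hx : (u, s) ∈ square := ⟨hu, Ico_subset_Icc_self hs⟩
    simp only [hr i (u, s) hx]
    exact ⟨S.W_mem_N i hx, (S.snd_lt_one_iff i hx).1 hs.2⟩
  · rintro ⟨p, s⟩ ⟨hp, hs⟩ ⟨q, t⟩ ⟨hq, ht⟩ e
    simp only at hp hs hq ht e
    obtain ⟨i, u, hu, rfl⟩ := S.exists_foot hp
    obtain ⟨j, v, hv, rfl⟩ := S.exists_foot hq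
    have hx : (u, s) ∈ square := ⟨hu, Ico_subset_Icc_self hs⟩
    have hy : (v, t) ∈ square := ⟨hv, Ico_subset_Icc_self ht⟩
    rw [hr i (u, s) hx, hr j (v, t) hy] at e
    obtain ⟨h1, h2⟩ := S.W_eq_line hx hy hs.2 e
    exact Prod.ext (h2 0 (by simp)) h1
  · rintro p ⟨hp, hpG⟩
    obtain ⟨i, x, hx, rfl⟩ := mem_iUnion.1 hp
    exact ⟨(S.W i (x.1, 0), x.2), ⟨S.foot_mem i hx.1, hx.2.1, (S.snd_lt_one_iff i hx).2 hpG⟩,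
      hr i x hx⟩
  · intro p hp
    obtain ⟨i, u, hu, rfl⟩ := S.exists_foot hp
    have hx : (u, (1 : ℝ)) ∈ square := ⟨hu, by simp⟩
    simp only [hr i (u, 1) hx]
    exact (S.W_mem_tauChart_iff i hx).2 rfl

/-- The depth of the wickets. -/
def θ (i : S.ι) : ℝ × ℝ → ℝ := (S.sec i).exists_depth.choose

lemma continuousOn_θ (i : S.ι) : ContinuousOn (S.θ i) square :=
  (S.sec i).exists_depth.choose_spec.1

lemma θ_mem (i : S.ι) {x : ℝ × ℝ} (hx : x ∈ square) : S.θ i x ∈ Ico (0 : ℝ) 1 :=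
  (S.sec i).exists_depth.choose_spec.2.1 x hx

lemma θ_zero (i : S.ι) {u : ℝ} (hu : u ∈ Icc (0 : ℝ) 1) : S.θ i (u, 0) = 0 :=
  (S.sec i).exists_depth.choose_spec.2.2.1 (u, 0) ⟨hu, by simp⟩ rfl

lemma gapFun_θ (i : S.ι) {x : ℝ × ℝ} (hx : x ∈ square) :
    (T.κ (S.kk i)).gapFun (S.Q i (x.1, S.θ i x)) = x.2 ^ 2 / 2 :=
  (S.sec i).exists_depth.choose_spec.2.2.2 x hx

lemma mem_θ (i : S.ι) {x : ℝ × ℝ} (hx : x ∈ square) : (x.1, S.θ i x) ∈ square :=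
  ⟨hx.1, Ico_subset_Icc_self (S.θ_mem i hx)⟩

/-- The sector parametrised by the height of the wickets. -/
def C (i : S.ι) (x : ℝ × ℝ) : S2 := S.W i (x.1, S.θ i x)

lemma continuousOn_C (i : S.ι) : ContinuousOn (S.C i) square :=
  (S.continuousOn_W i).comp (continuousOn_fst.prodMk (S.continuousOn_θ i)) fun _ hx => S.mem_θ i hx

lemma C_zero (i : S.ι) {u : ℝ} (hu : u ∈ Icc (0 : ℝ) 1) : S.C i (u, 0) = S.W i (u, 0) := by
  simp only [C, S.θ_zero i hu]

lemma eq_θ (i : S.ι) {x : ℝ × ℝ} (hx : x ∈ square) {t : ℝ} (ht : t ∈ Icc (0 : ℝ) 1)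
    (h : (T.κ (S.kk i)).gapFun (S.Q i (x.1, t)) = x.2 ^ 2 / 2) : t = S.θ i x := by
  have hx2 := hx.2
  simp only [mem_Icc] at hx2
  have hle : x.2 ^ 2 / 2 ≤ 1 / 2 := by nlinarith
  have h1 := S.gapFun_θ i hx
  rcases lt_trichotomy t (S.θ i x) with h3 | h3 | h3
  · have := (S.sec i).strictMono (x.1, t) ⟨hx.1, ht⟩ _ (S.mem_θ i hx) rfl h3 (by rw [h]; exact hle)
    rw [h, h1] at this
    exact absurd this (lt_irrefl _)
  · exact h3
  · have := (S.sec i).strictMono _ (S.mem_θ i hx) (x.1, t) ⟨hx.1, ht⟩ rfl h3 (by rw [h1]; exact hle)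
    rw [h, h1] at this
    exact absurd this (lt_irrefl _)

/-- The height parameter is determined by the gap, and up to the value `1/2` the gap is read from
the surface, so it is the same in both sectors along a common line. -/
lemma C_compat (i j : S.ι) : ∀ u ∈ Icc (0 : ℝ) 1, ∀ v ∈ Icc (0 : ℝ) 1, S.C i (u, 0) = S.C j (v, 0) →
    ∀ s ∈ Icc (0 : ℝ) 1, S.C i (u, s) = S.C j (v, s) := by
  intro u hu v hv h s hs
  rw [S.C_zero i hu, S.C_zero j hv] at h
  have hline := (S.W_eq_line (x := (u, 0)) (y := (v, 0)) ⟨hu, by simp⟩ ⟨hv, by simp⟩ one_pos h).2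
  have hx : (u, s) ∈ square := ⟨hu, hs⟩
  have hy : (v, s) ∈ square := ⟨hv, hs⟩
  have e := hline _ (Ico_subset_Icc_self (S.θ_mem i hx))
  simp only [C]
  simp only at e
  rw [e]
  have hg := S.gapFun_θ i hx
  have hle : s ^ 2 / 2 ≤ 1 / 2 := by
    simp only [mem_Icc] at hs; nlinarith
  have := T.gapFun_eq_of_le ((S.sec i).mem _ (S.mem_θ i hx))
    ((S.sec j).mem (v, S.θ i (u, s)) ⟨hv, Ico_subset_Icc_self (S.θ_mem i hx)⟩) e (by rw [hg]; exact hle)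
  rw [hg] at this
  rw [S.eq_θ j hy (Ico_subset_Icc_self (S.θ_mem i hx)) this]

/-- Coordinates of the points with a nonempty fibre in the regular neighbourhood. -/
lemma exists_C {p : S2} (hp : p ∈ T.pos) (hf : (fibre F p).Nonempty) :
    ∃ i, ∃ x ∈ square, S.C i x = p := by
  obtain ⟨i, x, hx, rfl⟩ := S.exists_W hp
  have hg := (T.fibre_H_nonempty_iff (S.kk i) ((S.sec i).mem x hx)).1 hf
  have hg0 := (T.κ (S.kk i)).gapFun_nonneg (S.Q i x)
  set g := (T.κ (S.kk i)).gapFun (S.Q i x) with hgdef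
  have hs : Real.sqrt (2 * g) ∈ Icc (0 : ℝ) 1 :=
    ⟨Real.sqrt_nonneg _, Real.sqrt_le_one.2 (by linarith)⟩
  have hsq : (x.1, Real.sqrt (2 * g)) ∈ square := ⟨hx.1, hs⟩
  refine ⟨i, (x.1, Real.sqrt (2 * g)), hsq, ?_⟩
  have := S.eq_θ i hsq hx.2 (by
    simp only
    rw [Real.sq_sqrt (by linarith), ← hgdef]; ring)
  simp only [C]
  rw [← this]

lemma C_mem_pos_iff (i : S.ι) {x : ℝ × ℝ} (hx : x ∈ square) : S.C i x ∈ T.pos ↔ 0 < x.2 := by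
  rw [C, S.W_mem_pos_iff i (S.mem_θ i hx), ← S.gapFun_pos_iff i (S.mem_θ i hx), S.gapFun_θ i hx]
  constructor
  · intro h
    refine lt_of_le_of_ne hx.2.1 fun h' => ?_
    rw [← h'] at h
    norm_num at h
  · intro h; positivity

lemma C_eq {i j : S.ι} {x y : ℝ × ℝ} (hx : x ∈ square) (hy : y ∈ square)
    (h : S.C i x = S.C j y) : (i = j ∧ x = y) ∨ (x.2 = y.2 ∧ ∃ e e', x.1 = pt e ∧ y.1 = pt e' ∧
      (j, e') = S.π (i, e)) := by
  have hsq : x.2 = y.2 := by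
    have hx2 := hx.2
    have hy2 := hy.2
    simp only [mem_Icc] at hx2 hy2
    have e := T.gapFun_eq_of_le ((S.sec i).mem _ (S.mem_θ i hx)) ((S.sec j).mem _ (S.mem_θ j hy)) h
      (by rw [S.gapFun_θ i hx]; nlinarith)
    rw [S.gapFun_θ i hx, S.gapFun_θ j hy] at e
    exact (pow_left_inj₀ hx2.1 hy2.1 two_ne_zero).1 (by linarith)
  rcases S.W_eq (S.mem_θ i hx) (S.mem_θ j hy) (S.θ_mem i hx).2 h with ⟨h1, h2⟩ | ⟨-, h2⟩
  · exact Or.inl ⟨h1, Prod.ext (Prod.mk.inj h2).1 hsq⟩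
  · exact Or.inr ⟨hsq, h2⟩

lemma C_eq_foot {i j : S.ι} {x y : ℝ × ℝ} (hx : x ∈ square) (hy : y ∈ square)
    (h : S.C i x = S.C j y) : x.2 = y.2 ∧ S.W i (x.1, 0) = S.W j (y.1, 0) := by
  rcases S.C_eq hx hy h with ⟨rfl, rfl⟩ | ⟨h1, e, e', h2, h3, h4⟩
  · exact ⟨rfl, rfl⟩
  · refine ⟨h1, ?_⟩
    have := S.E_π (i, e) 0 (by simp)
    rw [← h4] at this
    rw [h2, h3]
    exact this.symm

/-- The fibres over a sector. -/
lemma mem_fibre_C (i : S.ι) {x : ℝ × ℝ} (hx : x ∈ square) {r : ℝ} (hr : r ^ 2 + x.2 ^ 2 = 1)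
    {z : ℂ} : (z, S.C i x) ∈ F ↔ z = r * (T.κ (S.kk i)).dir (S.Q i (x.1, 0)) / 2 ∨
      z = -(r * (T.κ (S.kk i)).dir (S.Q i (x.1, 0)) / 2) := by
  have hm := (S.sec i).mem _ (S.mem_θ i hx)
  have hg := S.gapFun_θ i hx
  have hplain : (T.κ (S.kk i)).IsPlain := by
    have h1 : (x.1, (1 : ℝ)) ∈ square := ⟨hx.1, by simp⟩
    have h2 := ((S.sec i).mem_tauSet_iff _ h1).2 rfl
    by_contra hcon
    rw [Piece.tauSet_eq_empty fun h => hcon h.isPlain] at h2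
    exact h2
  have hdir := (S.sec i).dir _ (S.mem_θ i hx) (by
    rw [hg]
    nlinarith [sq_nonneg r])
  have hfib : (T.κ (S.kk i)).fibre (S.Q i (x.1, S.θ i x)) =
      pair ((1 - r ^ 2) / 2) ((T.κ (S.kk i)).dir (S.Q i (x.1, 0))) := by
    rw [Piece.fibre_eq hplain, hg, show x.2 ^ 2 / 2 = (1 - r ^ 2) / 2 by linarith]
    rcases hdir with h | h
    · rw [h]
    · rw [h, Piece.pair_neg]
  rw [← mem_pair_of_sq, ← hfib]
  exact T.mem_iff (S.kk i) _ hm z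

end Glued

/-! ### Components of the complement of the `τ`-chart -/

lemma Chart.isClosed_tauChart (Γ : Chart) : IsClosed Γ.tauChart := by
  have : Γ.tauChart = ⋃ e : {e // Γ.label e = .tau}, Γ.path e '' Icc 0 1 := by
    ext p
    simp only [tauChart, carrier, mem_ofPred_eq, mem_iUnion, Subtype.exists, exists_prop]
  rw [this]
  exact isClosed_iUnion_of_finite fun e => (isCompact_Icc.image (Γ.continuous_path e)).isClosed

instance : LocallyConnectedSpace S2 := by
  have : Fact (Module.finrank ℝ E3 = 2 + 1) := ⟨by simp⟩
  exact ChartedSpace.locallyConnectedSpace (EuclideanSpace ℝ (Fin 2)) S2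

/-- The connected components of the complement of the `τ`-chart. -/
def Chart.IsComponent (Γ : Chart) (U : Set S2) : Prop :=
  ∃ p ∈ Γ.tauChartᶜ, U = connectedComponentIn Γ.tauChartᶜ p

namespace Chart.IsComponent

variable {Γ : Chart} {U V : Set S2}

lemma isOpen (h : Γ.IsComponent U) : IsOpen U := by
  obtain ⟨p, -, rfl⟩ := h
  exact Γ.isClosed_tauChart.isOpen_compl.connectedComponentIn

lemma notMem (h : Γ.IsComponent U) {q : S2} (hq : q ∈ U) : q ∉ Γ.tauChart := by
  obtain ⟨p, -, rfl⟩ := h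
  exact connectedComponentIn_subset _ _ hq

lemma eq_of_mem (h : Γ.IsComponent U) {q : S2} (hq : q ∈ U) :
    U = connectedComponentIn Γ.tauChartᶜ q := by
  obtain ⟨p, -, rfl⟩ := h
  exact connectedComponentIn_eq hq

lemma subset (h : Γ.IsComponent U) {A : Set S2} (hA : IsPreconnected A) (hAG : A ⊆ Γ.tauChartᶜ)
    {q : S2} (hq : q ∈ A) (hqU : q ∈ U) : A ⊆ U := by
  rw [h.eq_of_mem hqU]
  exact hA.subset_connectedComponentIn hq hAG

lemma eq_or_disjoint (hU : Γ.IsComponent U) (hV : Γ.IsComponent V) {q : S2} (h1 : q ∈ U)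
    (h2 : q ∈ V) : U = V := (hU.eq_of_mem h1).trans (hV.eq_of_mem h2).symm

lemma nonempty (h : Γ.IsComponent U) : U.Nonempty := by
  obtain ⟨p, hp, rfl⟩ := h
  exact ⟨p, mem_connectedComponentIn hp⟩

/-- The component of `q` is open because the sphere is locally connected, so it meets `U` and equals
it. -/
lemma mem_of_closure (h : Γ.IsComponent U) {q : S2} (hq : q ∈ closure U)
    (hqG : q ∉ Γ.tauChart) : q ∈ U := by
  have hV : Γ.IsComponent (connectedComponentIn Γ.tauChartᶜ q) := ⟨q, hqG, rfl⟩
  have hqV : q ∈ connectedComponentIn Γ.tauChartᶜ q := mem_connectedComponentIn hqG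
  obtain ⟨w, hw1, hw2⟩ := mem_closure_iff.1 hq _ hV.isOpen hqV
  rw [h.eq_or_disjoint hV hw2 hw1]
  exact hqV

lemma closure_inter (h : Γ.IsComponent U) {A : Set S2} (hA : A ⊆ Γ.tauChartᶜ) :
    closure U ∩ A = U ∩ A :=
  Subset.antisymm (fun _ hq => ⟨h.mem_of_closure hq.1 (hA hq.2), hq.2⟩)
    (inter_subset_inter_left _ subset_closure)

/-- The `τ`-chart lies in the interior of `N`, so taking the closure adds points of the frontier of
`N` but none of the frontier of `U`. -/
lemma trim_eq (h : Γ.IsComponent U) {N : Set S2} (hN : Γ.tauChart ⊆ interior N) :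
    trim (closure U) N = U \ interior N := by
  have h1 : Nᶜ ⊆ Γ.tauChartᶜ := compl_subset_compl.2 (hN.trans interior_subset)
  rw [trim, h.closure_inter h1]
  refine Subset.antisymm (fun p hp => ?_) fun p hp => mem_closure_iff.2 fun V hV hpV => ?_
  · have h2 : p ∉ interior N := by
      have := closure_mono inter_subset_right hp
      rwa [closure_compl] at this
    exact ⟨h.mem_of_closure (closure_mono inter_subset_left hp) fun hG => h2 (hN hG), h2⟩
  · by_contra hcon
    refine hp.2 (mem_interior.2 ⟨V ∩ U, fun q hq => ?_, hV.inter h.isOpen, hpV, hp.1⟩)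
    by_contra hqN
    exact hcon ⟨q, hq.1, hq.2, hqN⟩

end Chart.IsComponent

lemma Chart.mem_regions {Γ : Chart} {R : Set S2} (h : R ∈ Γ.regions) :
    ∃ U, Γ.IsComponent U ∧ R = closure U := by
  obtain ⟨p, hp, rfl⟩ := h
  exact ⟨_, ⟨p, hp, rfl⟩, rfl⟩

/-! ### The tiles and sectors of a region -/

namespace Tiling

variable {Γ : Chart} {F : Set (ℂ × S2)} (T : Tiling Γ F)

/-- The rectangles of all squares of the tiling. -/
abbrev Tile : Type := Σ k : Fin T.n, Fin (T.κ k).rects.length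

variable {T} in
/-- The rectangle of a tile. -/
def Tile.rect (q : T.Tile) : Rect := (T.κ q.1).rects.get q.2

variable {T} in
lemma Tile.rect_mem (q : T.Tile) : q.rect ∈ (T.κ q.1).rects := List.get_mem _ _

variable {T} in
lemma Tile.good (q : T.Tile) : q.rect.Good := Piece.rects_good _ _ q.rect_mem

/-- The parametrisation of a tile. -/
def V (q : T.Tile) (x : ℝ × ℝ) : S2 := T.H q.1 (q.rect.toFun x)

variable {T} in
lemma Tile.toFun_mem (q : T.Tile) {x : ℝ × ℝ} (hx : x ∈ square) : q.rect.toFun x ∈ square :=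
  q.good.carrier_subset (q.good.mem_carrier hx)

lemma continuousOn_V (q : T.Tile) : ContinuousOn (T.V q) square :=
  (T.continuousOn_H q.1).comp Rect.continuous_toFun.continuousOn fun _ hx => q.toFun_mem hx

lemma injOn_V (q : T.Tile) : InjOn (T.V q) square := fun _ hx _ hy h =>
  q.good.injective (T.injOn_H q.1 (q.toFun_mem hx) (q.toFun_mem hy) h)

lemma V_notMem_pos (q : T.Tile) {x : ℝ × ℝ} (hx : x ∈ square) : T.V q x ∉ T.pos := by
  rw [V, T.mem_pos_iff q.1 (q.toFun_mem hx), ← Piece.mem_rects_iff _ (q.toFun_mem hx)]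
  exact ⟨_, q.rect_mem, q.good.mem_carrier hx⟩

lemma exists_V {p : S2} (hp : p ∉ T.pos) : ∃ q, ∃ x ∈ square, T.V q x = p := by
  obtain ⟨k, x, hx, rfl⟩ := T.exists_H p
  rw [T.mem_pos_iff k hx] at hp
  obtain ⟨r, hr, hx⟩ := ((T.κ k).mem_rects_iff hx).2 hp
  obtain ⟨j, rfl⟩ := List.get_of_mem hr
  rw [← (Piece.rects_good _ _ hr).image_square] at hx
  obtain ⟨y, hy, rfl⟩ := hx
  exact ⟨⟨k, j⟩, y, hy, rfl⟩

lemma Tile.mem_openSquare {q : T.Tile} {x : ℝ × ℝ} (hx : x ∈ openSquare) :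
    q.rect.toFun x ∈ openSquare := by
  obtain ⟨h1, h2, h3, h4, h5, h6⟩ := q.good
  exact prod_mono (Ioo_subset_Ioo h1 h3) (Ioo_subset_Ioo h4 h6) (q.good.mem_open hx)

lemma V_ne {q q' : T.Tile} (h : q ≠ q') {x y : ℝ × ℝ} (hx : x ∈ openSquare) (hy : y ∈ square) :
    T.V q x ≠ T.V q' y := by
  intro e
  obtain ⟨k, j⟩ := q
  obtain ⟨k', j'⟩ := q'
  obtain ⟨h1, h2⟩ := T.eq_of_H_eq (Tile.mem_openSquare T hx) (Tile.toFun_mem _ hy) e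
  simp only at h1
  subst h1
  have hj : j ≠ j' := fun hj => h (by rw [hj])
  have hsep : Rect.Sep ((T.κ k).rects.get j) ((T.κ k).rects.get j') ∨
      Rect.Sep ((T.κ k).rects.get j') ((T.κ k).rects.get j) := by
    rcases lt_or_gt_of_ne hj with h3 | h3
    · exact Or.inl (List.pairwise_iff_get.1 (Piece.rects_pairwise _) _ _ h3)
    · exact Or.inr (List.pairwise_iff_get.1 (Piece.rects_pairwise _) _ _ h3)
  have hsep' : Rect.Sep ((T.κ k).rects.get j) ((T.κ k).rects.get j') := by
    rcases hsep with h3 | h3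
    · exact h3
    · exact h3.symm
  refine hsep'.notMem (Tile.good ⟨k, j⟩) hx ?_
  have := (Tile.good (T := T) ⟨k, j'⟩).mem_carrier hy
  rwa [← h2] at this

lemma isPreconnected_V (q : T.Tile) : IsPreconnected (T.V q '' square) :=
  ((convex_Icc 0 1).prod (convex_Icc 0 1)).isPreconnected.image _ (T.continuousOn_V q)

/-- The tiles in a component of the complement of the `τ`-chart. -/
def tiles (U : Set S2) : Set T.Tile := {q | T.V q (0, 0) ∈ U}

variable {U : Set S2}

/-- A tile is connected and misses the `τ`-chart, so one corner decides for the whole tile. -/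
lemma V_mem_iff (hU : Γ.IsComponent U) (q : T.Tile) {x : ℝ × ℝ} (hx : x ∈ square) :
    T.V q x ∈ U ↔ q ∈ T.tiles U := by
  have h0 : ((0 : ℝ), (0 : ℝ)) ∈ square := ⟨by simp, by simp⟩
  have hG : T.V q '' square ⊆ Γ.tauChartᶜ := by
    rintro _ ⟨y, hy, rfl⟩ h
    exact T.V_notMem_pos q hy (T.tauChart_subset_pos h)
  exact ⟨fun h => hU.subset (T.isPreconnected_V q) hG (mem_image_of_mem _ hx) h
    (mem_image_of_mem _ h0), fun h => hU.subset (T.isPreconnected_V q) hG (mem_image_of_mem _ h0) h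
    (mem_image_of_mem _ hx)⟩

lemma iUnion_tiles (hU : Γ.IsComponent U) : (⋃ q : T.tiles U, T.V q '' square) = U \ T.pos := by
  ext p
  simp only [mem_iUnion]
  constructor
  · rintro ⟨⟨q, hq⟩, x, hx, rfl⟩
    exact ⟨(T.V_mem_iff hU q hx).2 hq, T.V_notMem_pos q hx⟩
  · rintro ⟨hpU, hp⟩
    obtain ⟨q, x, hx, rfl⟩ := T.exists_V hp
    exact ⟨⟨q, (T.V_mem_iff hU q hx).1 hpU⟩, x, hx, rfl⟩

end Tiling

namespace Glued

variable {Γ : Chart} {F : Set (ℂ × S2)} {T : Tiling Γ F} (S : Glued T) {U : Set S2}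

lemma W_mem_iff (hU : Γ.IsComponent U) (i : S.ι) {x y : ℝ × ℝ} (hx : x ∈ square) (hx2 : x.2 < 1)
    (hy : y ∈ square) (hy2 : y.2 < 1) : S.W i x ∈ U ↔ S.W i y ∈ U := by
  have key : ∀ x ∈ square, x.2 < 1 → ∀ y ∈ square, y.2 < 1 → S.W i x ∈ U → S.W i y ∈ U := by
    intro x hx hx2 y hy hy2 h
    have hc : IsPreconnected (S.W i '' (Icc 0 1 ×ˢ Ico 0 1)) :=
      ((convex_Icc 0 1).prod (convex_Ico 0 1)).isPreconnected.image _
        ((S.continuousOn_W i).mono (prod_mono_right Ico_subset_Icc_self))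
    refine hU.subset hc ?_ (mem_image_of_mem _ ⟨hx.1, hx.2.1, hx2⟩) h
      (mem_image_of_mem _ ⟨hy.1, hy.2.1, hy2⟩)
    rintro _ ⟨z, hz, rfl⟩
    exact (S.snd_lt_one_iff i ⟨hz.1, Ico_subset_Icc_self hz.2⟩).1 hz.2.2
  exact ⟨key x hx hx2 y hy hy2, key y hy hy2 x hx hx2⟩

/-- The sectors in a component of the complement of the `τ`-chart. -/
def sectors (U : Set S2) : Set S.ι := {i | S.W i (0, 0) ∈ U}

lemma W_mem_iff_sectors (hU : Γ.IsComponent U) (i : S.ι) {x : ℝ × ℝ} (hx : x ∈ square)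
    (hx2 : x.2 < 1) : S.W i x ∈ U ↔ i ∈ S.sectors U :=
  S.W_mem_iff hU i hx hx2 ⟨by simp, by simp⟩ one_pos

lemma C_mem_iff (hU : Γ.IsComponent U) (i : S.ι) {x : ℝ × ℝ} (hx : x ∈ square) :
    S.C i x ∈ U ↔ i ∈ S.sectors U :=
  S.W_mem_iff_sectors hU i (S.mem_θ i hx) (S.θ_mem i hx).2

lemma trim_N (hU : Γ.IsComponent U) : trim (closure U) S.N = U \ T.pos := by
  rw [hU.trim_eq S.isRegularNhd_N.2.1]
  ext p
  refine and_congr_right fun _ => not_congr ⟨fun h => ?_, fun h => ?_⟩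
  · by_contra hp
    obtain ⟨q, hq, hqN⟩ := S.mem_closure_compl_N hp isOpen_interior h
    exact hqN (interior_subset hq)
  · exact interior_maximal S.pos_subset_N T.isOpen_pos h

lemma foot_mem_closure_pos (i : S.ι) {u : ℝ} (hu : u ∈ Icc (0 : ℝ) 1) :
    S.W i (u, 0) ∈ closure T.pos := by
  have hc : ContinuousOn (fun s => S.W i (u, s)) (Icc 0 1) :=
    (S.continuousOn_W i).comp (by fun_prop) fun s hs => ⟨hu, hs⟩
  have := hc.mono (closure_Ioo (zero_ne_one (α := ℝ))).subset
  refine closure_mono ?_ (this.image_closure ⟨0, by simp [closure_Ioo], rfl⟩)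
  rintro _ ⟨s, hs, rfl⟩
  exact (S.W_mem_pos_iff i (x := (u, s)) ⟨hu, Ioo_subset_Icc_self hs⟩).2 hs.1

/-- The feet of sectors are limits of points of positive gap, so they are not interior to the
trimmed region. -/
lemma frontier_trim (hU : Γ.IsComponent U) :
    frontier (trim (closure U) S.N) = U ∩ frontier S.N := by
  have hcl : IsClosed (trim (closure U) S.N) := isClosed_closure
  rw [hcl.frontier_eq, S.trim_N hU, S.frontier_N]
  ext p
  constructor
  · rintro ⟨⟨h1, h2⟩, h3⟩
    refine ⟨h1, ?_, h2⟩
    by_contra hN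
    refine h3 (mem_interior.2 ⟨U ∩ S.Nᶜ, fun q hq => ⟨hq.1, fun h => hq.2 (S.pos_subset_N h)⟩,
      hU.isOpen.inter S.isCompact_N.isClosed.isOpen_compl, h1, hN⟩)
  · rintro ⟨h1, h2⟩
    refine ⟨⟨h1, h2.2⟩, fun h3 => ?_⟩
    rw [← S.frontier_N] at h2
    obtain ⟨i, u, hu, rfl⟩ := S.exists_foot h2
    obtain ⟨q, hq1, hq2⟩ := mem_closure_iff.1 (S.foot_mem_closure_pos i hu) _ isOpen_interior h3
    exact (interior_subset hq1).2 hq2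

lemma exists_foot_sectors (hU : Γ.IsComponent U) {p : S2}
    (hp : p ∈ frontier (trim (closure U) S.N)) :
    ∃ i ∈ S.sectors U, ∃ u ∈ Icc (0 : ℝ) 1, S.W i (u, 0) = p := by
  rw [S.frontier_trim hU] at hp
  obtain ⟨i, u, hu, rfl⟩ := S.exists_foot hp.2
  exact ⟨i, (S.W_mem_iff_sectors hU i (x := (u, 0)) ⟨hu, by simp⟩ one_pos).1 hp.1, u, hu, rfl⟩

/-- A point of `U` with positive gap lies on a line whose foot is also in `U`, and the foot has zero
gap and lies in a tile. -/
lemma exists_tile (S : Glued T) (hU : Γ.IsComponent U) : (T.tiles U).Nonempty := by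
  have : ∃ p ∈ U, p ∉ T.pos := by
    obtain ⟨p, hp⟩ := hU.nonempty
    by_cases h : p ∈ T.pos
    · obtain ⟨i, x, hx, rfl⟩ := S.exists_W h
      have h0 : ((0 : ℝ), (0 : ℝ)) ∈ square := ⟨by simp, by simp⟩
      refine ⟨S.W i (0, 0), (S.W_mem_iff_sectors hU i h0 one_pos).2
        ((S.W_mem_iff_sectors hU i hx ((S.snd_lt_one_iff i hx).2 (hU.notMem hp))).1 hp), ?_⟩
      rw [S.W_mem_pos_iff i h0]
      exact lt_irrefl _
    · exact ⟨p, hp, h⟩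
  obtain ⟨p, hp, hpos⟩ := this
  obtain ⟨q, x, hx, rfl⟩ := T.exists_V hpos
  exact ⟨q, (T.V_mem_iff hU q hx).1 hp⟩

/-- Every component contains one of the finitely many tiles and is determined by it. -/
lemma regions_finite (S : Glued T) : Γ.regions.Finite := by
  refine (finite_range fun q : T.Tile =>
    closure (connectedComponentIn Γ.tauChartᶜ (T.V q (0, 0)))).subset fun R hR => ?_
  obtain ⟨U, hU, rfl⟩ := Chart.mem_regions hR
  obtain ⟨q, hq⟩ := S.exists_tile hU
  exact ⟨q, congrArg closure (hU.eq_of_mem hq).symm⟩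

end Glued

/-! ### The surface over a trimmed region and its plat closure -/

lemma IsSquareChart.rect {h : ℝ × ℝ → E3} (hh : IsSquareChart h) {r : Rect} (hr : r.Good) :
    IsSquareChart (h ∘ r.toFun) := by
  have hm : ∀ x ∈ square, r.toFun x ∈ square := fun x hx => hr.carrier_subset (hr.mem_carrier hx)
  have hs : ContDiff ℝ ∞ r.toFun := by unfold Rect.toFun; fun_prop
  refine ⟨hh.1.comp hs, fun x hx => hh.2.1 (hm x hx), fun x hx y hy e =>
    hr.injective (hh.2.2.1 (hm x hx) (hm y hy) e), fun x hx => ?_⟩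
  have hL : HasFDerivAt r.toFun (((r.a₁ - r.a₀) • ContinuousLinearMap.fst ℝ ℝ ℝ).prod
      ((r.b₁ - r.b₀) • ContinuousLinearMap.snd ℝ ℝ ℝ)) x := by
    refine HasFDerivAt.prodMk ?_ ?_
    · exact ((hasFDerivAt_fst.mul_const _).const_add _)
    · exact ((hasFDerivAt_snd.mul_const _).const_add _)
  have hd := (((hh.1.differentiable (by simp)) (r.toFun x)).hasFDerivAt.comp x hL).fderiv
  have h1 : fderiv ℝ (h ∘ r.toFun) x (1, 0) = (r.a₁ - r.a₀) • fderiv ℝ h (r.toFun x) (1, 0) := by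
    rw [hd, ← map_smul]; simp
  have h2 : fderiv ℝ (h ∘ r.toFun) x (0, 1) = (r.b₁ - r.b₀) • fderiv ℝ h (r.toFun x) (0, 1) := by
    rw [hd, ← map_smul]; simp
  have key := hh.2.2.2 _ (hm x hx)
  have := mul_pos (mul_pos (sub_pos.2 hr.2.1) (sub_pos.2 hr.2.2.2.2.1)) key
  rw [h1, h2]
  rw [Matrix.det_fin_three] at this ⊢
  refine this.trans_eq ?_
  simp
  ring

lemma Chart.LooksLike.rect {Γ : Chart} {h : ℝ × ℝ → E3} {κ : Piece} (hl : Γ.LooksLike h κ)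
    {r : Rect} (hr : r ∈ κ.rects) : Γ.LooksLike (h ∘ r.toFun) r.piece := by
  have hg := Piece.rects_good _ _ hr
  have hm : ∀ x ∈ square, r.toFun x ∈ square := fun x hx => hg.carrier_subset (hg.mem_carrier hx)
  refine ⟨fun x hx p hp => ?_, fun a ha => ?_⟩
  · obtain ⟨h1, h2, h3⟩ := hl.1 _ (hm x hx) p hp
    refine ⟨h1.trans (Piece.vertexSet_rect hr hx), h2.trans ?_, h3.trans (Piece.sigmaArc_rect hr hx)⟩
    rw [Piece.tauSet_eq_empty (Piece.rects_not_isTau r hr)]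
    exact iff_of_false (Piece.notMem_tauSet_of_rect hr (hg.mem_carrier hx)) (notMem_empty x)
  · obtain ⟨a', ha', ha1, t₀, t₁, h0, h01, h1, hat⟩ := Piece.exists_subarc hr ha
    obtain ⟨e, he, θ, hθc, hθm, hθ, hpath⟩ := hl.2 a' ha'
    -- An edge of sign `-1` is traversed backwards in time, so its part over `[t₀, t₁]` begins at
    -- the parameter `1 - t₁`.
    obtain ⟨s₀, hs0, hs1, hs⟩ : ∃ s₀ : ℝ, 0 ≤ s₀ ∧ s₀ + (t₁ - t₀) ≤ 1 ∧ ∀ t : ℝ,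
        r.toFun (a.2 (if a.1 = 1 then t else 1 - t)) =
          a'.2 (if a'.1 = 1 then s₀ + t * (t₁ - t₀) else 1 - (s₀ + t * (t₁ - t₀))) := by
      rw [ha1]
      by_cases h : a.1 = 1
      · exact ⟨t₀, h0, by linarith, fun t => by rw [if_pos h, if_pos h, hat]⟩
      · refine ⟨1 - t₁, by linarith, by linarith, fun t => ?_⟩
        rw [if_neg h, if_neg h, hat]
        ring_nf
    have hmap : MapsTo (fun t => s₀ + t * (t₁ - t₀)) (Icc 0 1) (Icc 0 1) := by
      rintro t ⟨h3, h4⟩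
      constructor <;> nlinarith
    refine ⟨e, he, fun t => θ (s₀ + t * (t₁ - t₀)), hθc.comp (by fun_prop) hmap,
      fun s hs' t ht hst => hθm (hmap hs') (hmap ht) ?_, hθ.imp_right fun h => h.comp hmap,
      fun t ht => ?_⟩
    · have := mul_lt_mul_of_pos_right hst (sub_pos.2 h01)
      simp only
      linarith
    · rw [hpath _ (hmap ht), Function.comp_apply, hs]

namespace Tiling

variable {Γ : Chart} {F : Set (ℂ × S2)} (T : Tiling Γ F) {U : Set S2}

/-- The overlap of two different disks lies in the boundary of both, so it can be cut first by `Q`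
in one square and then by `Q'` in the other. -/
lemma isPieced_H (k l : Fin T.n) {Q Q' : Set (ℝ × ℝ)} (hQ : Convex ℝ Q) (hQs : Q ⊆ square)
    (hQ' : Convex ℝ Q') (hQs' : Q' ⊆ square) : IsPieced (T.H k '' Q ∩ T.H l '' Q') := by
  by_cases hkl : k = l
  · subst hkl
    rw [← (T.injOn_H k).image_inter hQs hQs']
    refine ⟨{_}, finite_singleton _, fun c hc => ?_, sUnion_singleton _⟩
    rw [mem_singleton_iff.1 hc]
    exact (hQ.inter hQ').isPreconnected.image _ ((T.continuousOn_H k).mono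
      (inter_subset_left.trans hQs))
  · have hb : ∀ {k l : Fin T.n}, k ≠ l → ∀ A ⊆ T.H l '' square,
        T.H k '' square ∩ A ⊆ T.H k '' (square \ openSquare) := by
      rintro k l hkl A hA _ ⟨⟨x, hx, rfl⟩, h2⟩
      obtain ⟨y, hy, e⟩ := hA h2
      exact ⟨x, ⟨hx, fun ho => hkl (T.eq_of_H_eq ho hy e.symm).1⟩, rfl⟩
    have h1 := (T.pieced k l).inter_image_convex (T.continuousOn_H k) (T.injOn_H k)
      (hb hkl _ subset_rfl) hQ hQs
    have h2 := h1.inter_image_convex (T.continuousOn_H l) (T.injOn_H l) (fun p hp =>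
      hb (Ne.symm hkl) _ subset_rfl ⟨hp.1.2, hp.1.1⟩) hQ' hQs'
    convert h2 using 1
    ext p
    exact ⟨fun h => ⟨⟨⟨image_mono hQs h.1, image_mono hQs' h.2⟩, h.1⟩, h.2⟩,
      fun h => ⟨h.1.2, h.2⟩⟩

lemma isPieced_V (q q' : T.Tile) : IsPieced (T.V q '' square ∩ T.V q' '' square) := by
  have him : ∀ q : T.Tile, T.V q '' square = T.H q.1 '' q.rect.carrier := fun q => by
    rw [← q.good.image_square, image_image]
    rfl
  rw [him, him]
  exact T.isPieced_H _ _ (Rect.convex_carrier) q.good.carrier_subset (Rect.convex_carrier) q'.good.carrier_subset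

/-- The square chart of a tile. -/
def chartV (q : T.Tile) : ℝ × ℝ → E3 := T.h q.1 ∘ q.rect.toFun

lemma isSquareChart_chartV (q : T.Tile) : IsSquareChart (T.chartV q) := (T.chart q.1).rect q.good

lemma sphereMap_chartV (q : T.Tile) : sphereMap (T.chartV q) = T.V q := rfl

lemma mem_iff_V (q : T.Tile) {x : ℝ × ℝ} (hx : x ∈ square) (z : ℂ) :
    (z, T.V q x) ∈ F ↔ z ∈ q.rect.piece.fibre x := by
  rw [Piece.fibre_rect q.rect_mem hx]
  exact T.mem_iff q.1 _ (q.toFun_mem hx) z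

/-- The surface over the complement of the collars is built from the chart. -/
lemma isBuiltFrom (hU : Γ.IsComponent U) : IsBuiltFrom (U \ T.pos) Γ (part F (U \ T.pos)) := by
  obtain ⟨n, ⟨e⟩⟩ := Finite.exists_equiv_fin (T.tiles U)
  have hd : ∀ q, disk (T.chartV q) = T.V q '' square := fun q => (T.isSquareChart_chartV q).disk_eq
  refine ⟨n, fun k => T.chartV (e.symm k), fun k => (e.symm k).1.rect.piece,
    fun k => T.isSquareChart_chartV _, ?_, fun k l hkl x hx => ?_, fun k l => ?_,
    fun k => (T.looks _).rect (Tile.rect_mem _), fun q hq => hq.2, fun k x hx p hp z => ?_⟩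
  · simp only [hd]
    rw [← T.iUnion_tiles hU, ← e.symm.surjective.iUnion_comp fun q : T.tiles U => T.V q '' square]
  · rintro ⟨y, hy, hyx⟩
    refine T.V_ne (fun h => hkl (e.symm.injective (Subtype.ext h))) hx hy ?_
    refine Subtype.ext ?_
    rw [← T.sphereMap_chartV, ← T.sphereMap_chartV,
      (T.isSquareChart_chartV _).coe_sphereMap (openSquare_subset hx),
      (T.isSquareChart_chartV _).coe_sphereMap hy]
    exact hyx.symm
  · rw [hd, hd]
    exact (T.isPieced_V _ _).finite_connectedComponents
  · rw [(T.isSquareChart_chartV _).eq_sphereMap_iff hx, T.sphereMap_chartV] at hp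
    subst hp
    rw [← T.mem_iff_V _ hx z]
    exact and_iff_left ⟨(T.V_mem_iff hU _ hx).2 (e.symm k).2, T.V_notMem_pos _ hx⟩

end Tiling

lemma Equivalent.refl (S : Set (ℂ × S2)) : Equivalent S S :=
  ⟨fun _ z _ => z, fun _ z _ => z, by fun_prop, by fun_prop, by simp, by simp, by simp, by simp⟩

lemma part_image (Φ : ℂ → S2 → ℂ) (F : Set (ℂ × S2)) (R : Set S2) :
    part ((fun q : ℂ × S2 => (Φ q.1 q.2, q.2)) '' F) R =
      (fun q : ℂ × S2 => (Φ q.1 q.2, q.2)) '' part F R := by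
  ext q
  constructor
  · rintro ⟨⟨a, ha, rfl⟩, h⟩
    exact ⟨a, ⟨ha, h⟩, rfl⟩
  · rintro ⟨a, ⟨ha, h⟩, rfl⟩
    exact ⟨⟨a, ha, rfl⟩, h⟩

lemma Equivalent.part {F F' : Set (ℂ × S2)} (h : Equivalent F F') (R : Set S2) :
    Equivalent (part F R) (part F' R) := by
  obtain ⟨Φ, Ψ, h1, h2, h3, h4, h5, rfl⟩ := h
  exact ⟨Φ, Ψ, h1, h2, h3, h4, h5, part_image (fun z p => Φ 1 z p) _ _⟩

namespace Glued

variable {Γ : Chart} {F : Set (ℂ × S2)} {T : Tiling Γ F} (S : Glued T) {U : Set S2}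

/-- The direction of the fibre over a frontier point of the regular neighbourhood. -/
def dir (i : S.ι) (u : ℝ) : ℂ := (T.κ (S.kk i)).dir (S.Q i (u, 0))

lemma dir_ne_zero (i : S.ι) (u : ℝ) : S.dir i u ≠ 0 := fun h => by
  have : ‖S.dir i u‖ = 1 := Piece.norm_dir _ _
  rw [h] at this
  simp at this

lemma fibre_foot (i : S.ι) {u : ℝ} (hu : u ∈ Icc (0 : ℝ) 1) :
    fibre F (S.W i (u, 0)) = {S.dir i u / 2, -(S.dir i u / 2)} := by
  ext z
  have := S.mem_fibre_C i (x := (u, 0)) ⟨hu, by simp⟩ (r := 1) (by simp) (z := z)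
  rw [S.C_zero i hu] at this
  refine this.trans ?_
  simp [dir]

lemma mem_of_mem_closure (T : Tiling Γ F) (hU : Γ.IsComponent U) {q : ℂ × S2}
    (hq : q ∈ part F (closure U)) : q.2 ∈ U :=
  hU.mem_of_closure hq.2 fun h => T.fibre_eq_empty_of_tauChart h ⟨q.1, hq.1⟩

/-- Over the collars, the surface consists of wickets. -/
lemma part_closure (hU : Γ.IsComponent U) : part F (closure U) = part F (U \ T.pos) ∪
    {q | ∃ i ∈ S.sectors U, ∃ x ∈ square, ∃ r : ℝ, r ^ 2 + x.2 ^ 2 = 1 ∧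
      q = (r * (S.dir i x.1 / 2), S.C i x)} := by
  ext ⟨z, p⟩
  constructor
  · intro hq
    have hpU : p ∈ U := mem_of_mem_closure T hU hq
    by_cases hp : p ∈ T.pos
    · right
      obtain ⟨i, x, hx, rfl⟩ := S.exists_C hp ⟨z, hq.1⟩
      refine ⟨i, (S.C_mem_iff hU i hx).1 hpU, x, hx, ?_⟩
      have hsq : √(1 - x.2 ^ 2) ^ 2 + x.2 ^ 2 = 1 := by
        have h1 := hx.2.1
        have h2 := hx.2.2
        rw [Real.sq_sqrt (by nlinarith)]
        ring
      rcases (S.mem_fibre_C i hx hsq).1 hq.1 with h | h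
      · exact ⟨_, hsq, by rw [h, dir]; ring_nf⟩
      · refine ⟨-√(1 - x.2 ^ 2), by rw [neg_sq, hsq], ?_⟩
        rw [h, dir]
        push_cast
        ring_nf
    · exact Or.inl ⟨hq.1, hpU, hp⟩
  · rintro (h | ⟨i, hi, x, hx, r, hr, e⟩)
    · exact ⟨h.1, subset_closure h.2.1⟩
    · obtain ⟨rfl, rfl⟩ := Prod.mk.inj e
      refine ⟨(S.mem_fibre_C i hx hr).2 (Or.inl (mul_div_assoc _ _ _).symm), subset_closure ?_⟩
      exact (S.C_mem_iff hU i hx).2 hi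

/-- The collar parameter is the height of the wicket. The collar ends before the `τ`-chart, at gap
`1/2`, where the two sheets have met. -/
lemma isPlatClosure (hU : Γ.IsComponent U) : IsPlatClosure (trim (closure U) S.N)
    (part F (trim (closure U) S.N)) (part F (closure U)) := by
  have hfr := fun {p} (hp : p ∈ frontier (trim (closure U) S.N)) => S.exists_foot_sectors hU hp
  have hfr' : ∀ i ∈ S.sectors U, ∀ u ∈ Icc (0 : ℝ) 1,
      S.W i (u, 0) ∈ frontier (trim (closure U) S.N) := fun i hi u hu => by
    rw [S.frontier_trim hU]
    exact ⟨(S.W_mem_iff_sectors hU i (x := (u, 0)) ⟨hu, by simp⟩ one_pos).2 hi, S.foot_mem i hu⟩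
  have hfib : ∀ i ∈ S.sectors U, ∀ u ∈ Icc (0 : ℝ) 1,
      fibre (part F (trim (closure U) S.N)) (S.W i (u, 0)) =
        {S.dir i u / 2, -(S.dir i u / 2)} := fun i hi u hu => by
    rw [← S.fibre_foot i hu]
    ext z
    exact and_iff_left ((isClosed_closure.frontier_subset) (hfr' i hi u hu))
  refine ⟨fun p hp => ?_, ?_⟩
  · obtain ⟨i, hi, u, hu, rfl⟩ := hfr hp
    exact ⟨_, _, fun h => S.dir_ne_zero i u (by linear_combination h), hfib i hi u hu⟩
  obtain ⟨c, hc, hcc⟩ := exists_glue S.C S.continuousOn_C S.C_compat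
  have hcW : ∀ i, ∀ u ∈ Icc (0 : ℝ) 1, ∀ s ∈ Icc (0 : ℝ) 1, c (S.W i (u, 0)) s = S.C i (u, s) :=
    fun i u hu s hs => by rw [← S.C_zero i hu]; exact hc i (u, s) ⟨hu, hs⟩
  refine ⟨c, hcc.mono ?_, ?_, fun p hp => ?_, fun p hp s hs => ?_, ?_⟩
  · rintro ⟨p, s⟩ ⟨hp, hs⟩
    obtain ⟨i, -, u, hu, rfl⟩ := hfr hp
    exact ⟨i, (u, s), ⟨hu, hs⟩, by rw [S.C_zero i hu]⟩
  · rintro ⟨p, s⟩ ⟨hp, hs⟩ ⟨p', s'⟩ ⟨hp', hs'⟩ e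
    obtain ⟨i, -, u, hu, rfl⟩ := hfr hp
    obtain ⟨j, -, v, hv, rfl⟩ := hfr hp'
    simp only at e hs hs'
    rw [hcW i u hu s hs, hcW j v hv s' hs'] at e
    obtain ⟨h1, h2⟩ := S.C_eq_foot (x := (u, s)) (y := (v, s')) ⟨hu, hs⟩ ⟨hv, hs'⟩ e
    exact Prod.ext h2 h1
  · obtain ⟨i, -, u, hu, rfl⟩ := hfr hp
    rw [hcW i u hu 0 (by simp), S.C_zero i hu]
  · obtain ⟨i, -, u, hu, rfl⟩ := hfr hp
    rw [hcW i u hu s (Ioc_subset_Icc_self hs), S.trim_N hU]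
    exact fun h => h.2 ((S.C_mem_pos_iff i (x := (u, s)) ⟨hu, Ioc_subset_Icc_self hs⟩).2 hs.1)
  · rw [S.part_closure hU, ← S.trim_N hU]
    congr 1
    ext q
    constructor
    · rintro ⟨i, hi, x, hx, r, hr, rfl⟩
      refine ⟨_, hfr' i hi _ hx.1, x.2, hx.2, _, _, r, hfib i hi _ hx.1, hr, ?_⟩
      rw [hcW i _ hx.1 _ hx.2]
      refine Prod.ext ?_ rfl
      simp only
      ring
    · rintro ⟨p, hp, s, hs, z₁, z₂, r, hz, hr, rfl⟩
      obtain ⟨i, hi, u, hu, rfl⟩ := hfr hp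
      rw [hfib i hi u hu, eq_comm, pair_eq_pair_iff] at hz
      rw [hcW i u hu s hs]
      rcases hz with ⟨rfl, rfl⟩ | ⟨rfl, rfl⟩
      · refine ⟨i, hi, (u, s), ⟨hu, hs⟩, r, hr, Prod.ext ?_ rfl⟩
        simp only
        ring
      · refine ⟨i, hi, (u, s), ⟨hu, hs⟩, -r, by rw [neg_sq]; exact hr, Prod.ext ?_ rfl⟩
        simp only
        push_cast
        ring

end Glued

/-! ### The split union -/

lemma Piece.norm_lt_one (κ : Piece) {x : ℝ × ℝ} {z : ℂ} (h : z ∈ κ.fibre x) : ‖z‖ < 1 := by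
  have hsq : ‖z‖ ^ 2 ≤ 1 / 4 := by
    by_cases hp : κ.IsPlain
    · rw [fibre_eq hp] at h
      rw [norm_sq_of_mem_pair (κ.norm_dir x) h]
      linarith [κ.gapFun_nonneg x]
    · cases κ <;> simp only [IsPlain, not_true_eq_false] at hp
      rw [fibre_blackSigma] at h
      have h1 := Real.smoothTransition.nonneg (2 * x.2 - 1 / 2)
      have h2 := Real.smoothTransition.le_one (2 * x.2 - 1 / 2)
      rw [← norm_pow, h, norm_div]
      refine div_le_div₀ zero_le_one ((norm_add_le _ _).trans ?_) (by norm_num) (by simp)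
      rw [norm_mul, norm_pow, norm_rot, ← Complex.ofReal_one, ← Complex.ofReal_sub,
        Complex.norm_of_nonneg (by linarith), Complex.norm_of_nonneg h1]
      linarith
  nlinarith [norm_nonneg z]

lemma Tiling.norm_lt_one {Γ : Chart} {F : Set (ℂ × S2)} (T : Tiling Γ F) {q : ℂ × S2} (hq : q ∈ F) :
    ‖q.1‖ < 1 := by
  obtain ⟨z, p⟩ := q
  obtain ⟨k, x, hx, rfl⟩ := T.exists_H p
  exact (T.κ k).norm_lt_one ((T.mem_iff k x hx z).1 hq)

/-- A smooth function with prescribed values on disjoint closed sets. -/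
lemma exists_contDiff_eqOn {J : Type*} [Finite J] {A : J → Set E3} (hA : ∀ j, IsClosed (A j))
    (hd : Pairwise fun i j => Disjoint (A i) (A j)) (a : J → ℝ) :
    ∃ φ : E3 → ℝ, ContDiff ℝ ∞ φ ∧ ∀ j, ∀ y ∈ A j, φ y = a j := by
  classical
  have := Fintype.ofFinite J
  have : ∀ j, ∃ f : E3 → ℝ, ContDiff ℝ ∞ f ∧ (∀ y ∈ A j, f y = 1) ∧
      ∀ i ≠ j, ∀ y ∈ A i, f y = 0 := by
    intro j
    obtain ⟨f, h0, h1, -⟩ := exists_contMDiffMap_zero_one_of_isClosed (n := ⊤) (modelWithCornersSelf ℝ E3)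
      (isClosed_iUnion_of_finite fun i : {i // i ≠ j} => hA i) (hA j)
      (disjoint_iUnion_left.2 fun i => hd i.2)
    exact ⟨f, f.contMDiff.contDiff, h1, fun i hi y hy => h0 (mem_iUnion.2 ⟨⟨i, hi⟩, hy⟩)⟩
  choose f hf h1 h0 using this
  refine ⟨fun y => ∑ j, a j * f j y, ContDiff.sum fun j _ => contDiff_const.mul (hf j), ?_⟩
  intro j y hy
  simp only
  rw [Finset.sum_eq_single j (fun i _ hi => by rw [h0 i j hi.symm y hy, mul_zero])
    (fun h => absurd (Finset.mem_univ j) h), h1 j y hy, mul_one]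

/-- The projection to the first three coordinates. -/
def proj (y : E4) : E3 := !₂[y 0, y 1, y 2]

lemma contDiff_proj : ContDiff ℝ ∞ proj := by
  unfold proj
  rw [contDiff_euclidean]
  intro i
  fin_cases i <;> simp <;> fun_prop

/-- The point at height `s` on the last coordinate axis. -/
def axis (s : ℝ) : E4 := s • EuclideanSpace.single 3 1

lemma proj_add_axis (y : E4) (s : ℝ) : proj (y + axis s) = proj y := by
  simp [proj, axis]

lemma proj_toE4 (q : ℂ × S2) : proj (toE4 q) = (1 + q.1.re / 2) • (q.2 : E3) := by
  ext i
  fin_cases i <;> simp [proj, toE4]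

lemma norm_toE4_le {q : ℂ × S2} (hq : ‖q.1‖ < 1) : ‖toE4 q‖ ≤ 2 := by
  have h1 := abs_lt.1 ((Complex.abs_re_le_norm q.1).trans_lt hq)
  have h2 := abs_lt.1 ((Complex.abs_im_le_norm q.1).trans_lt hq)
  have h3 : (q.2 : E3) 0 ^ 2 + (q.2 : E3) 1 ^ 2 + (q.2 : E3) 2 ^ 2 = 1 := by
    have : ‖(q.2 : E3)‖ ^ 2 = 1 := by rw [norm_eq_of_mem_sphere q.2, one_pow]
    rw [EuclideanSpace.norm_sq_eq, Fin.sum_univ_three] at this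
    simpa using this
  rw [EuclideanSpace.norm_eq, Fin.sum_univ_four]
  refine Real.sqrt_le_iff.2 ⟨by norm_num, ?_⟩
  simp only [toE4, Real.norm_eq_abs, sq_abs]
  have : ((1 + q.1.re / 2) * (q.2 : E3) 0) ^ 2 + ((1 + q.1.re / 2) * (q.2 : E3) 1) ^ 2 +
      ((1 + q.1.re / 2) * (q.2 : E3) 2) ^ 2 = (1 + q.1.re / 2) ^ 2 := by
    linear_combination (1 + q.1.re / 2) ^ 2 * h3
  simp
  rw [this]
  nlinarith

/-- Surfaces over disjoint compact subsets of the sphere form a split union. -/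
lemma isSplitUnion_of_disjoint {J : Type} [Finite J] {K : J → Set S2} (hK : ∀ j, IsClosed (K j))
    (hd : Pairwise fun i j => Disjoint (K i) (K j)) {X : J → Set (ℂ × S2)}
    (hX : ∀ j, ∀ q ∈ X j, q.2 ∈ K j ∧ ‖q.1‖ < 1) : IsSplitUnion fun j => toE4 '' X j := by
  obtain ⟨n, ⟨e⟩⟩ := Finite.exists_equiv_fin J
  -- The first three coordinates of `toE4 q` lie on the ray through `q.2`, at a distance between
  -- `1/2` and `3/2`. Shells over disjoint sets of directions are disjoint.
  let A : J → Set E3 := fun j => (fun p : ℝ × S2 => p.1 • (p.2 : E3)) '' (Icc (1 / 2) (3 / 2) ×ˢ K j)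
  have hA : ∀ j, IsClosed (A j) := fun j =>
    ((isCompact_Icc.prod (hK j).isCompact).image (by fun_prop)).isClosed
  have hAd : Pairwise fun i j => Disjoint (A i) (A j) := by
    intro i j hij
    refine disjoint_left.2 ?_
    rintro _ ⟨⟨s, p⟩, ⟨hs, hp⟩, rfl⟩ ⟨⟨t, q⟩, ⟨ht, hq⟩, h⟩
    simp only at hs ht hp hq h
    have hn := congrArg norm h
    rw [norm_smul, norm_smul, norm_eq_of_mem_sphere, norm_eq_of_mem_sphere, mul_one, mul_one,
      Real.norm_of_nonneg (by linarith [ht.1]), Real.norm_of_nonneg (by linarith [hs.1])] at hn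
    subst hn
    have hqp : q = p := Subtype.ext (smul_right_injective _ (by linarith [ht.1] : t ≠ 0) h)
    subst hqp
    exact disjoint_left.1 (hd hij) hp hq
  -- All parts lie in the ball of radius 2 about the origin. Shifts by different multiples of 5 make
  -- these balls disjoint.
  obtain ⟨φ, hφ, hφA⟩ := exists_contDiff_eqOn hA hAd fun j => 5 * ((e j : ℕ) : ℝ)
  have hs : ∀ f : ℝ × E4 → ℝ, ContDiff ℝ ∞ f → ContDiff ℝ ∞ fun q : ℝ × E4 => q.2 + axis (f q) :=
    fun f hf => contDiff_snd.add (hf.smul contDiff_const)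
  have hφp : ContDiff ℝ ∞ fun q : ℝ × E4 => q.1 * φ (proj q.2) :=
    contDiff_fst.mul (hφ.comp (contDiff_proj.comp contDiff_snd))
  -- The shift depends only on the first three coordinates, which it preserves, so the opposite
  -- shift is its inverse.
  refine ⟨fun t y => y + axis (t * φ (proj y)), fun t y => y + axis (-(t * φ (proj y))),
    hs _ hφp, hs _ hφp.neg, fun t y => ?_, fun y => by simp [axis],
    fun j => axis (5 * ((e j : ℕ) : ℝ)), fun _ => 2, fun j => ?_, fun i j hij => ?_⟩
  · simp only [proj_add_axis]
    simp [axis]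
  · rintro _ ⟨q, hq, rfl⟩
    obtain ⟨h1, h2⟩ := hX j q hq
    have h3 := abs_lt.1 ((Complex.abs_re_le_norm q.1).trans_lt h2)
    have : φ (proj (toE4 q)) = 5 * ((e j : ℕ) : ℝ) := by
      rw [proj_toE4]
      exact hφA j _ ⟨(1 + q.1.re / 2, q.2), ⟨⟨by linarith, by linarith⟩, h1⟩, rfl⟩
    simp only
    rw [mem_closedBall_iff_norm, this, one_mul, add_sub_cancel_right]
    exact norm_toE4_le h2
  · refine Metric.closedBall_disjoint_closedBall ?_
    have h1 : (1 : ℝ) ≤ |((e i : ℕ) : ℝ) - ((e j : ℕ) : ℝ)| := by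
      have h2 : ((e i : ℕ) : ℤ) - ((e j : ℕ) : ℤ) ≠ 0 := fun h =>
        hij (e.injective (Fin.ext (by omega)))
      exact_mod_cast Int.one_le_abs h2
    simp only [axis]
    rw [dist_eq_norm, ← sub_smul, norm_smul, ← mul_sub, Real.norm_eq_abs, abs_mul]
    simp
    linarith

/-- The parts over the regions form a split union. -/
lemma Tiling.isSplitUnion {Γ : Chart} {F₀ F : Set (ℂ × S2)} (T : Tiling Γ F₀)
    (hfin : Γ.regions.Finite) (hF : Equivalent F₀ F) :
    IsSplitUnion (fun R : Γ.regions => toE4 '' part F R) := by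
  obtain ⟨Φ, Ψ, -, -, h3, -, h5, rfl⟩ := hF
  have := hfin.to_subtype
  -- Different regions can share points of the `τ`-chart, but fibres are empty there. Intersecting
  -- with the closed set of nonempty fibres gives disjoint closed sets.
  refine isSplitUnion_of_disjoint (K := fun R : Γ.regions => R ∩ {p | (fibre F₀ p).Nonempty})
    (fun R => ?_) (fun R R' hR => ?_) fun R => ?_
  · obtain ⟨U, -, h⟩ := Chart.mem_regions R.2
    rw [h]
    exact isClosed_closure.inter T.isClosed_fibre_nonempty
  · refine disjoint_left.2 fun p hp hp' => hR (Subtype.ext ?_)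
    have hpG : p ∉ Γ.tauChart := fun h => T.fibre_eq_empty_of_tauChart h hp.2
    obtain ⟨U, hU, h⟩ := Chart.mem_regions R.2
    obtain ⟨U', hU', h'⟩ := Chart.mem_regions R'.2
    rw [h] at hp ⊢
    rw [h'] at hp' ⊢
    rw [hU.eq_or_disjoint hU' (hU.mem_of_closure hp.1 hpG) (hU'.mem_of_closure hp'.1 hpG)]
  · rintro _ ⟨⟨q, hq, rfl⟩, hqR⟩
    refine ⟨⟨hqR, q.1, hq⟩, ?_⟩
    -- A point moved to norm at least 1 would have the same image as the fixed point at that place,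
    -- so it would have had norm at least 1 already.
    by_contra hcon
    have h1 := h5 q.2 1 _ (not_lt.1 hcon)
    have h2 := congrArg (fun z => Ψ 1 z q.2) h1
    simp only [(h3 q.2 1 _).1] at h2
    simp only [h2] at hcon
    exact hcon (T.norm_lt_one hq)

/-! ### Independence of the regular neighbourhood -/

lemma HasEulerChar.of_homotopyEquiv {Y Y' : Type} [TopologicalSpace Y] [TopologicalSpace Y'] {n : ℤ}
    (h : HasEulerChar Y n) (e : ContinuousMap.HomotopyEquiv Y Y') : HasEulerChar Y' n := by
  obtain ⟨X, t1, t2, C, t3, t4, ⟨g⟩, hn⟩ := h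
  exact ⟨X, t1, t2, C, t3, t4, ⟨e.symm.trans g⟩, hn⟩

/-- A deformation retraction is a homotopy equivalence. -/
lemma nonempty_homotopyEquiv_of_retraction {X : Type} [TopologicalSpace X] {U A : Set X} (hAU : A ⊆ U)
    {D : ℝ × X → X} (hD : ContinuousOn D (Icc 0 1 ×ˢ U))
    (hDU : ∀ t ∈ Icc (0 : ℝ) 1, ∀ p ∈ U, D (t, p) ∈ U) (h0 : ∀ p ∈ U, D (0, p) = p)
    (h1 : ∀ p ∈ U, D (1, p) ∈ A) (hA : ∀ p ∈ A, D (1, p) = p) :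
    Nonempty (ContinuousMap.HomotopyEquiv U A) := by
  have hc : Continuous fun q : unitInterval × U => D (q.1, q.2) :=
    hD.comp_continuous (by fun_prop) fun q => ⟨q.1.2, q.2.2⟩
  let ρ : C(U, A) := ⟨fun p => ⟨D (1, p), h1 p p.2⟩,
    (hc.comp (Continuous.prodMk_right 1)).subtype_mk _⟩
  let i : C(A, U) := ⟨fun p => ⟨p, hAU p.2⟩, by fun_prop⟩
  refine ⟨⟨ρ, i, ?_, ?_⟩⟩
  · refine ContinuousMap.Homotopic.symm ⟨⟨⟨fun q => ⟨D (q.1, q.2), hDU _ q.1.2 _ q.2.2⟩,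
      hc.subtype_mk _⟩, fun p => Subtype.ext (h0 p p.2), fun p => rfl⟩⟩
  · have : ρ.comp i = ContinuousMap.id A := by
      ext p
      exact hA p p.2
    rw [this]

/-- Inside `N` points are pushed back along the lines of the mapping cylinder to the frontier, and
outside `N` nothing moves. A line without its end on the `τ`-chart is connected and avoids the
chart, so the motion stays in `U`. -/
lemma Chart.IsComponent.nonempty_homotopyEquiv {Γ : Chart} {U N : Set S2} (hU : Γ.IsComponent U)
    (hN : IsRegularNhd Γ.tauChart N) :
    Nonempty (ContinuousMap.HomotopyEquiv U (trim (closure U) N)) := by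
  classical
  obtain ⟨hNc, hGN, r, hr, hr0, hbij, hr1⟩ := hN
  let f : S2 × ℝ → S2 := fun q => r q.1 q.2
  let B : Set (S2 × ℝ) := frontier N ×ˢ Ico 0 1
  let g := Function.invFunOn f B
  have hfr : IsCompact (frontier N) :=
    hNc.of_isClosed_subset isClosed_frontier hNc.isClosed.frontier_subset
  have hg : ContinuousOn g (N \ Γ.tauChart) := by
    rw [← hbij.image_eq]
    refine continuousOn_invFunOn_of_isCompact (hfr.prod isCompact_Icc) hr
      (prod_mono_right Ico_subset_Icc_self) hbij.injOn fun x hx y hy e => ⟨hy.1, hy.2.1,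
        lt_of_le_of_ne hy.2.2 fun h => ?_⟩
    have h1 := hr1 hy.1
    simp only [f, h] at e
    simp only [← e] at h1
    exact (hbij.mapsTo hx).2 h1
  have hgB : ∀ p ∈ N \ Γ.tauChart, g p ∈ B ∧ f (g p) = p := fun p hp =>
    ⟨Function.invFunOn_mem (hbij.surjOn hp), Function.invFunOn_eq (hbij.surjOn hp)⟩
  have hgf : ∀ p ∈ frontier N, g p = (p, 0) := by
    intro p hp
    have h1 : f (p, 0) = p := hr0 p hp
    have h2 : (p, (0 : ℝ)) ∈ B := ⟨hp, by simp⟩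
    have h3 := hgB p ⟨hNc.isClosed.frontier_subset hp, fun h =>
      (hNc.isClosed.frontier_eq ▸ hp).2 (hGN h)⟩
    exact hbij.injOn h3.1 h2 (h3.2.trans h1.symm)
  let D : ℝ × S2 → S2 := ({q | q.2 ∈ N} : Set (ℝ × S2)).piecewise
    (fun q => f ((g q.2).1, (1 - q.1) * (g q.2).2)) Prod.snd
  have hDN : ∀ t p, p ∈ N → D (t, p) = f ((g p).1, (1 - t) * (g p).2) := fun t p hp => if_pos hp
  have hDN' : ∀ t p, p ∉ N → D (t, p) = p := fun t p hp => if_neg hp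
  have hset : ({q | q.2 ∈ N} : Set (ℝ × S2)) = univ ×ˢ N := by ext; simp
  have hDf : ∀ t, ∀ p ∈ frontier N, D (t, p) = p := fun t p hp => by
    rw [hDN t p (hNc.isClosed.frontier_subset hp), hgf p hp]
    simp only [mul_zero]
    exact hr0 p hp
  have hBm : ∀ t ∈ Icc (0 : ℝ) 1, ∀ q ∈ B, (q.1, (1 - t) * q.2) ∈ B := fun t ht q hq =>
    ⟨hq.1, mul_nonneg (by linarith [ht.2]) hq.2.1, by nlinarith [ht.1, ht.2, hq.2.1, hq.2.2]⟩
  rw [hU.trim_eq hGN]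
  refine nonempty_homotopyEquiv_of_retraction (D := D) sdiff_subset ?_ ?_ ?_ ?_ ?_
  · refine ContinuousOn.piecewise ?_ ?_ continuousOn_snd
    · rintro ⟨t, p⟩ ⟨-, h⟩
      rw [hset, frontier_univ_prod_eq] at h
      have := hDf t p h.2
      rwa [hDN t p (hNc.isClosed.frontier_subset h.2)] at this
    · rw [hset, (isClosed_univ.prod hNc.isClosed).closure_eq]
      have h1 : ContinuousOn (fun q : ℝ × S2 => g q.2) (Icc 0 1 ×ˢ U ∩ univ ×ˢ N) :=
        hg.comp continuousOn_snd fun q hq => ⟨hq.2.2, hU.notMem hq.1.2⟩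
      refine ContinuousOn.comp (t := frontier N ×ˢ Icc 0 1) (g := f) hr
        ((continuous_fst.comp_continuousOn h1).prodMk
        ((continuousOn_const.sub continuousOn_fst).mul (continuous_snd.comp_continuousOn h1))) ?_
      intro q hq
      have := hBm q.1 hq.1.1 _ (hgB q.2 ⟨hq.2.2, hU.notMem hq.1.2⟩).1
      exact ⟨this.1, Ico_subset_Icc_self this.2⟩
  · intro t ht p hp
    by_cases hpN : p ∈ N
    · rw [hDN t p hpN]
      obtain ⟨h1, h2⟩ := hgB p ⟨hpN, hU.notMem hp⟩
      have hc : IsPreconnected ((fun s => f ((g p).1, s)) '' Ico 0 1) :=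
        isPreconnected_Ico.image _ (ContinuousOn.comp (g := f) hr (by fun_prop)
          fun s hs => ⟨h1.1, Ico_subset_Icc_self hs⟩)
      refine hU.subset hc ?_ (mem_image_of_mem _ h1.2) (by simpa only [h2] using hp)
        (mem_image_of_mem _ (hBm t ht _ h1).2)
      rintro _ ⟨s, hs, rfl⟩
      exact (hbij.mapsTo (x := ((g p).1, s)) ⟨h1.1, hs⟩).2
    · rwa [hDN' t p hpN]
  · intro p hp
    by_cases hpN : p ∈ N
    · rw [hDN 0 p hpN, sub_zero, one_mul]
      exact (hgB p ⟨hpN, hU.notMem hp⟩).2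
    · exact hDN' 0 p hpN
  · intro p hp
    by_cases hpN : p ∈ N
    · obtain ⟨h1, h2⟩ := hgB p ⟨hpN, hU.notMem hp⟩
      rw [hDN 1 p hpN, sub_self, zero_mul]
      have hc : IsPreconnected ((fun s => f ((g p).1, s)) '' Ico 0 1) :=
        isPreconnected_Ico.image _ (ContinuousOn.comp (g := f) hr (by fun_prop)
          fun s hs => ⟨h1.1, Ico_subset_Icc_self hs⟩)
      refine ⟨hU.subset hc ?_ (mem_image_of_mem _ h1.2) (by simpa only [h2] using hp)
        (mem_image_of_mem _ (by simp)), ?_⟩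
      · rintro _ ⟨s, hs, rfl⟩
        exact (hbij.mapsTo (x := ((g p).1, s)) ⟨h1.1, hs⟩).2
      · rw [show f ((g p).1, 0) = (g p).1 from hr0 _ h1.1]
        exact (hNc.isClosed.frontier_eq ▸ h1.1).2
    · rw [hDN' 1 p hpN]
      exact ⟨hp, fun h => hpN (interior_subset h)⟩
  · intro p hp
    by_cases hpN : p ∈ N
    · exact hDf 1 p (hNc.isClosed.frontier_eq ▸ ⟨hpN, hp.2⟩)
    · exact hDN' 1 p hpN

/-- The Euler characteristic of a trimmed region does not depend on the regular neighbourhood. -/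
lemma HasEulerChar.trim {Γ : Chart} {U N N' : Set S2} {n : ℤ} (hU : Γ.IsComponent U)
    (hN : IsRegularNhd Γ.tauChart N) (hN' : IsRegularNhd Γ.tauChart N')
    (h : HasEulerChar (trim (closure U) N) n) : HasEulerChar (Knit.trim (closure U) N') n := by
  obtain ⟨e⟩ := hU.nonempty_homotopyEquiv hN
  obtain ⟨e'⟩ := hU.nonempty_homotopyEquiv hN'
  exact (h.of_homotopyEquiv e.symm).of_homotopyEquiv e'

/-! ### The two sheets over the tiles and their branch points -/

lemma smoothTransition_half : Real.smoothTransition (1 / 2) = 1 / 2 := by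
  have h : 0 < expNegInvGlue (1 / 2) := expNegInvGlue.pos_of_pos (by norm_num)
  rw [Real.smoothTransition, show (1 : ℝ) - 1 / 2 = 1 / 2 by norm_num]
  field_simp
  norm_num

lemma smoothTransition_eq_half_iff {x : ℝ} : Real.smoothTransition x = 1 / 2 ↔ x = 1 / 2 := by
  refine ⟨fun h => ?_, fun h => by rw [h, smoothTransition_half]⟩
  have hx : x ∈ Icc (0 : ℝ) 1 := by
    constructor
    · by_contra hcon
      rw [Real.smoothTransition.zero_of_nonpos (not_le.1 hcon).le] at h
      norm_num at h
    · by_contra hcon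
      rw [Real.smoothTransition.one_of_one_le (not_le.1 hcon).le] at h
      norm_num at h
  exact smoothTransition_strictMonoOn.injOn hx (by norm_num) (h.trans smoothTransition_half.symm)

/-- The square root on a closed half plane `0 ≤ η * im`, with `η = ± 1`. -/
def halfSqrt (η : ℝ) (w : ℂ) : ℂ :=
  √((‖w‖ + w.re) / 2) + η * √((‖w‖ - w.re) / 2) * Complex.I

lemma continuous_halfSqrt (η : ℝ) : Continuous (halfSqrt η) := by
  unfold halfSqrt
  fun_prop

/-- The half-angle formulas fix the absolute values of the real and imaginary parts; the sign of
`w.im` must match `η` for the cross term to be right. -/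
lemma halfSqrt_sq {η : ℝ} (hη : η ^ 2 = 1) {w : ℂ} (hw : 0 ≤ η * w.im) : halfSqrt η w ^ 2 = w := by
  have h1 := abs_le.1 (Complex.abs_re_le_norm w)
  have hA := Real.sq_sqrt (show 0 ≤ (‖w‖ + w.re) / 2 by linarith)
  have hB := Real.sq_sqrt (show 0 ≤ (‖w‖ - w.re) / 2 by linarith)
  have hAB : √((‖w‖ + w.re) / 2) * √((‖w‖ - w.re) / 2) = η * w.im / 2 := by
    have hn : ‖w‖ ^ 2 = w.re * w.re + w.im * w.im := by rw [Complex.sq_norm, Complex.normSq_apply]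
    refine (pow_left_inj₀ (by positivity) (by linarith) two_ne_zero).1 ?_
    rw [mul_pow, hA, hB]
    linear_combination hn / 4 - w.im ^ 2 / 4 * hη
  unfold halfSqrt
  set A := √((‖w‖ + w.re) / 2)
  set B := √((‖w‖ - w.re) / 2)
  apply Complex.ext
  · simp [sq]
    nlinarith
  · simp [sq]
    have : A * (η * B) = w.im / 2 := by linear_combination η * hAB + w.im / 2 * hη
    linarith

namespace Piece

/-- The discriminant of a black `σ`-vertex. -/
def disc (ε : ℤˣ) (x : ℝ × ℝ) : ℂ :=
  (1 - (Real.smoothTransition (2 * x.2 - 1 / 2) : ℂ)) * rot ε (twist x.1) ^ 2 +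
    Real.smoothTransition (2 * x.2 - 1 / 2)

lemma continuous_disc (ε : ℤˣ) : Continuous (disc ε) := by
  have h1 := continuous_twist
  have h2 := continuous_rot ε
  have h3 := Real.smoothTransition.continuous
  unfold disc
  fun_prop

lemma rot_sq (ε : ℤˣ) (t : ℝ) : rot ε t ^ 2 =
    Real.cos (2 * Real.pi * t) + ((ε : ℤ) : ℝ) * Real.sin (2 * Real.pi * t) * Complex.I := by
  rw [rot, ← Complex.exp_nat_mul]
  have : ((2 : ℕ) : ℂ) * (((ε : ℤ) : ℂ) * Real.pi * t * Complex.I) =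
      ((((ε : ℤ) : ℝ) * (2 * Real.pi * t) : ℝ) : ℂ) * Complex.I := by
    push_cast; ring
  rw [this, Complex.exp_mul_I, ← Complex.ofReal_cos, ← Complex.ofReal_sin]
  rcases Int.units_eq_one_or ε with rfl | rfl <;> simp

lemma sq_units (ε : ℤˣ) : (((ε : ℤ) : ℝ)) ^ 2 = 1 := by
  rcases Int.units_eq_one_or ε with rfl | rfl <;> simp

/-- The sign of the imaginary part is that of `ε * sin (2 π twist a)` wherever the first factor is
positive. It is constant on each half of the square, which is why tiles are cut at `a = 1/2`. -/
lemma disc_im (ε : ℤˣ) (x : ℝ × ℝ) : (disc ε x).im =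
    (1 - Real.smoothTransition (2 * x.2 - 1 / 2)) * (((ε : ℤ) : ℝ) *
      Real.sin (2 * Real.pi * twist x.1)) := by
  rw [disc, rot_sq]
  simp only [Complex.add_im, Complex.ofReal_im, Complex.mul_im, Complex.sub_re, Complex.one_re,
    Complex.ofReal_re, Complex.sub_im, Complex.one_im, Complex.I_re, Complex.I_im, Complex.mul_re,
    Complex.add_re]
  ring

/-- At a zero, `1 - s` times a unit number is opposite to `s`. Norms give `s = 1/2`, hence the
middle time; then the square of the rotation is `-1`, hence half of the twist and the middle place.
-/
lemma disc_eq_zero_iff (ε : ℤˣ) (x : ℝ × ℝ) : disc ε x = 0 ↔ x = (1 / 2, 1 / 2) := by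
  constructor
  · intro h
    have h1 := Real.smoothTransition.nonneg (2 * x.2 - 1 / 2)
    have h2 := Real.smoothTransition.le_one (2 * x.2 - 1 / 2)
    set s := Real.smoothTransition (2 * x.2 - 1 / 2) with hs
    have h3 : ((1 - s : ℝ) : ℂ) * rot ε (twist x.1) ^ 2 = -(s : ℂ) := by
      rw [disc, ← hs] at h
      push_cast
      linear_combination h
    have hs2 : s = 1 / 2 := by
      have := congrArg norm h3
      rw [norm_mul, norm_pow, norm_rot, norm_neg, Complex.norm_of_nonneg (by linarith),
        Complex.norm_of_nonneg h1] at this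
      linarith
    have hb := smoothTransition_eq_half_iff.1 (hs.symm.trans hs2)
    rw [hs2, rot_sq] at h3
    have h4 := congrArg Complex.re h3
    simp only [Complex.mul_re, Complex.ofReal_re, Complex.ofReal_im, Complex.add_re, Complex.I_re,
      Complex.I_im, Complex.neg_re, Complex.mul_im] at h4
    have h5 : Real.cos (Real.pi * twist x.1) = 0 := by
      rw [show 2 * Real.pi * twist x.1 = 2 * (Real.pi * twist x.1) by ring, Real.cos_two_mul] at h4
      nlinarith
    have h6 : 0 ≤ twist x.1 := Real.smoothTransition.nonneg _
    have h7 : twist x.1 ≤ 1 := Real.smoothTransition.le_one _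
    have h8 := Real.injOn_cos (x₁ := Real.pi * twist x.1) (x₂ := Real.pi / 2)
      ⟨by positivity, by nlinarith [Real.pi_pos]⟩ ⟨by positivity, by linarith [Real.pi_pos]⟩
      (by rw [h5, Real.cos_pi_div_two])
    have h9 : twist x.1 = 1 / 2 := by
      have := Real.pi_pos
      field_simp at h8 ⊢
      linarith
    have ha := smoothTransition_eq_half_iff.1 h9
    exact Prod.ext (by simp only; linarith) (by simp only; linarith)
  · rintro rfl
    have ht : twist (1 / 2) = 1 / 2 := smoothTransition_eq_half_iff.2 (by norm_num)
    rw [disc, ht, rot_sq, smoothTransition_eq_half_iff.2 (by norm_num),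
      show 2 * Real.pi * (1 / 2) = Real.pi by ring, Real.cos_pi, Real.sin_pi]
    push_cast
    ring

/-- One of the two sheets of the surface over the left or the right half of a square without
`τ`-edges. -/
def sheet (b : Bool) : Piece → ℝ × ℝ → ℂ
  | blackSigma ε, x => halfSqrt (((ε : ℤ) : ℝ) * (if b then -1 else 1)) (disc ε x) / 2
  | κ, x => κ.dir x / 2

lemma continuous_sheet (b : Bool) (κ : Piece) : Continuous (κ.sheet b) := by
  cases κ with
  | blackSigma ε => exact ((continuous_halfSqrt _).comp (continuous_disc ε)).div_const 2
  | _ => exact (continuous_dir _).div_const 2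

/-- The angle `2 π twist a` lies in `[0, π]` on the left half and in `[π, 2 π]` on the right half,
so on each half the discriminant stays in a closed half plane with a continuous square root. -/
lemma mem_fibre_iff_sheet {κ : Piece} (hκ : ¬ κ.IsTau) {b : Bool} {x : ℝ × ℝ}
    (hx : if b then 1 / 2 ≤ x.1 else x.1 ≤ 1 / 2) {z : ℂ} :
    z ∈ κ.fibre x ↔ z = κ.sheet b x ∨ z = -κ.sheet b x := by
  cases κ with
  | blackSigma ε =>
    have h0 : 0 ≤ twist x.1 := Real.smoothTransition.nonneg _
    have h1 : twist x.1 ≤ 1 := Real.smoothTransition.le_one _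
    have h2 := Real.smoothTransition.le_one (2 * x.2 - 1 / 2)
    have hmono : ∀ a a' : ℝ, a ≤ a' → twist a ≤ twist a' := fun a a' h =>
      Real.smoothTransition.monotone (by linarith)
    have ht : twist (1 / 2) = 1 / 2 := smoothTransition_eq_half_iff.2 (by norm_num)
    have hpi := Real.pi_pos
    have hsq : halfSqrt (((ε : ℤ) : ℝ) * (if b then -1 else 1)) (disc ε x) ^ 2 = disc ε x := by
      refine halfSqrt_sq (by rw [mul_pow, sq_units]; cases b <;> simp) ?_
      rw [disc_im]
      have hs : 0 ≤ (if b then (-1 : ℝ) else 1) * Real.sin (2 * Real.pi * twist x.1) := by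
        cases b
        · have := hmono _ _ (show x.1 ≤ 1 / 2 by simpa using hx)
          rw [ht] at this
          simpa using Real.sin_nonneg_of_nonneg_of_le_pi (x := 2 * Real.pi * twist x.1)
            (by positivity) (by nlinarith)
        · have := hmono _ _ (show 1 / 2 ≤ x.1 by simpa using hx)
          rw [ht] at this
          have h3 := Real.sin_nonneg_of_nonneg_of_le_pi (x := 2 * Real.pi * twist x.1 - Real.pi)
            (by nlinarith) (by nlinarith)
          rw [Real.sin_sub_pi] at h3
          simpa using h3
      have := mul_nonneg (sub_nonneg.2 h2) hs
      refine this.trans_eq ?_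
      linear_combination -((1 - Real.smoothTransition (2 * x.2 - 1 / 2)) *
        ((if b then (-1 : ℝ) else 1) * Real.sin (2 * Real.pi * twist x.1))) * sq_units ε
    rw [fibre_blackSigma]
    change z ^ 2 = disc ε x / 4 ↔ _
    rw [← sq_eq_sq_iff_eq_or_eq_neg, sheet, div_pow, hsq]
    norm_num
  | empty => exact mem_pair_zero
  | sigmaEdge ε => exact mem_pair_zero
  | _ => exact absurd trivial hκ

lemma zero_mem_fibre_iff {κ : Piece} (hκ : ¬ κ.IsTau) (x : ℝ × ℝ) :
    0 ∈ κ.fibre x ↔ x ∈ κ.vertexSet := by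
  have hd : ∀ κ : Piece, κ.dir x ≠ 0 := fun κ h => by
    have := κ.norm_dir x
    rw [h, norm_zero] at this
    exact zero_ne_one this
  have h0 : ∀ u : ℂ, u ≠ 0 → (0 : ℂ) ∉ pair 0 u := fun u hu h => by
    rcases mem_pair_zero.1 h with h | h
    · exact hu (by linear_combination -2 * h)
    · exact hu (by linear_combination 2 * h)
  cases κ with
  | blackSigma ε =>
    rw [fibre_blackSigma]
    change (0 : ℂ) ^ 2 = disc ε x / 4 ↔ _
    rw [vertexSet, mem_singleton_iff, ← disc_eq_zero_iff ε x]
    constructor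
    · intro h
      linear_combination -4 * h
    · intro h
      rw [h]; simp
  | empty => exact iff_of_false (h0 _ (hd empty)) (notMem_empty x)
  | sigmaEdge ε => exact iff_of_false (h0 _ (hd (sigmaEdge ε))) (notMem_empty x)
  | _ => exact absurd trivial hκ

lemma vertexSet_inter_posSet {κ : Piece} {x : ℝ × ℝ} (hx : x ∈ κ.vertexSet) (hp : x ∈ κ.posSet) :
    x ∈ κ.tauSet := by
  cases κ <;> simp only [vertexSet, mem_singleton_iff, mem_empty_iff_false] at hx <;> subst hx <;>
    simp only [tauSet]
  · simp [posSet] at hp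
  · exact right_mem_segment _ _ _
  · exact Or.inl (right_mem_segment _ _ _)
  · exact Or.inr (left_mem_segment _ _ _)

end Piece

/-! ### The cells of the surface -/

/-- The affine map onto the left or right half of the square. -/
def half (b : Bool) (x : ℝ × ℝ) : ℝ × ℝ := ((x.1 + pt b) / 2, x.2)

lemma continuous_half (b : Bool) : Continuous (half b) := by
  unfold half
  fun_prop

lemma half_injective (b : Bool) : Function.Injective (half b) := fun x y h => by
  obtain ⟨h1, h2⟩ := Prod.mk.inj h
  exact Prod.ext (by linarith) h2

lemma half_mem {b : Bool} {x : ℝ × ℝ} (hx : x ∈ square) : half b x ∈ square := by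
  have h1 := hx.1.1
  have h2 := hx.1.2
  refine ⟨?_, hx.2⟩
  rcases pt_cases b with h | h <;> simp only [half, h, mem_Icc] <;> constructor <;> linarith

lemma half_mem_openSquare {b : Bool} {x : ℝ × ℝ} (hx : x ∈ openSquare) : half b x ∈ openSquare := by
  have h1 := hx.1.1
  have h2 := hx.1.2
  refine ⟨?_, hx.2⟩
  rcases pt_cases b with h | h <;> simp only [half, h, mem_Ioo] <;> constructor <;> linarith

lemma half_side {b : Bool} {x : ℝ × ℝ} (hx : x ∈ square) :
    if b then 1 / 2 ≤ (half b x).1 else (half b x).1 ≤ 1 / 2 := by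
  have h1 := hx.1.1
  have h2 := hx.1.2
  cases b <;> simp [half, pt] <;> linarith

lemma exists_half {x : ℝ × ℝ} (hx : x ∈ square) : ∃ b, ∃ y ∈ square, half b y = x := by
  have h1 := hx.1.1
  have h2 := hx.1.2
  rcases le_total x.1 (1 / 2) with h | h
  · exact ⟨false, (2 * x.1, x.2), ⟨⟨by simp only; linarith, by simp only; linarith⟩, hx.2⟩,
      by simp [half, pt]⟩
  · exact ⟨true, (2 * x.1 - 1, x.2), ⟨⟨by simp only; linarith, by simp only; linarith⟩, hx.2⟩,
      by simp [half, pt]⟩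

lemma half_ne {b b' : Bool} (h : b ≠ b') {x y : ℝ × ℝ} (hx : x ∈ openSquare) (hy : y ∈ square) :
    half b x ≠ half b' y := fun e => by
  have h1 := (Prod.mk.inj e).1
  have h2 := hx.1.1
  have h3 := hx.1.2
  have h4 := hy.1.1
  have h5 := hy.1.2
  cases b <;> cases b' <;> simp [pt] at * <;> linarith

/-- A half of a rectangle. -/
def Rect.halve (r : Rect) (b : Bool) : Rect :=
  ⟨r.a₀ + pt b / 2 * (r.a₁ - r.a₀), r.a₀ + (1 + pt b) / 2 * (r.a₁ - r.a₀), r.b₀, r.b₁, r.piece⟩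

lemma Rect.toFun_halve (r : Rect) (b : Bool) (x : ℝ × ℝ) :
    (r.halve b).toFun x = r.toFun (half b x) := by
  simp only [toFun, halve, half, Prod.mk.injEq, and_true]
  ring

lemma Rect.Good.halve {r : Rect} (h : r.Good) (b : Bool) : (r.halve b).Good := by
  obtain ⟨h1, h2, h3, h4, h5, h6⟩ := h
  rcases pt_cases b with h | h <;> simp only [Rect.halve, Rect.Good, h] <;>
    refine ⟨by linarith, by linarith, by linarith, h4, h5, h6⟩

namespace Tiling

variable {Γ : Chart} {F : Set (ℂ × S2)} (T : Tiling Γ F) {U : Set S2}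

/-- The halves of the tiles. -/
def face (φ : T.Tile × Bool) (x : ℝ × ℝ) : S2 := T.V φ.1 (half φ.2 x)

lemma continuousOn_face (φ : T.Tile × Bool) : ContinuousOn (T.face φ) square :=
  (T.continuousOn_V φ.1).comp (continuous_half φ.2).continuousOn fun _ hx => half_mem hx

lemma injOn_face (φ : T.Tile × Bool) : InjOn (T.face φ) square := fun _ hx _ hy e =>
  half_injective _ (T.injOn_V φ.1 (half_mem hx) (half_mem hy) e)

lemma face_ne {φ ψ : T.Tile × Bool} (h : φ ≠ ψ) {x y : ℝ × ℝ} (hx : x ∈ openSquare)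
    (hy : y ∈ square) : T.face φ x ≠ T.face ψ y := by
  intro e
  obtain ⟨q, b⟩ := φ
  obtain ⟨q', b'⟩ := ψ
  by_cases hq : q = q'
  · subst hq
    refine half_ne (fun hb => h (congrArg (Prod.mk q) hb)) hx hy
      (T.injOn_V q (half_mem (openSquare_subset hx)) (half_mem hy) e)
  · exact T.V_ne hq (half_mem_openSquare hx) (half_mem hy) e

lemma isPieced_face (φ ψ : T.Tile × Bool) :
    IsPieced (T.face φ '' square ∩ T.face ψ '' square) := by
  have him : ∀ φ : T.Tile × Bool, T.face φ '' square =
      T.H φ.1.1 '' (φ.1.rect.halve φ.2).carrier := fun φ => by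
    rw [← (φ.1.good.halve φ.2).image_square, image_image]
    simp only [Rect.toFun_halve]
    rfl
  rw [him, him]
  exact T.isPieced_H _ _ (Rect.convex_carrier) (Rect.Good.carrier_subset (Rect.Good.halve (Tile.good _) _))
    (Rect.convex_carrier) (Rect.Good.carrier_subset (Rect.Good.halve (Tile.good _) _))

lemma iUnion_face (hU : Γ.IsComponent U) :
    (⋃ φ : T.tiles U × Bool, T.face (φ.1, φ.2) '' square) = U \ T.pos := by
  rw [← T.iUnion_tiles hU]
  ext p
  simp only [mem_iUnion, Prod.exists]
  constructor
  · rintro ⟨q, b, x, hx, rfl⟩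
    exact ⟨q, _, half_mem hx, rfl⟩
  · rintro ⟨q, x, hx, rfl⟩
    obtain ⟨b, y, hy, rfl⟩ := exists_half hx
    exact ⟨q, b, y, hy, rfl⟩

lemma mem_iff_face (φ : T.Tile × Bool) {x : ℝ × ℝ} (hx : x ∈ square) (z : ℂ) :
    (z, T.face φ x) ∈ F ↔ z = φ.1.rect.piece.sheet φ.2 (half φ.2 x) ∨
      z = -φ.1.rect.piece.sheet φ.2 (half φ.2 x) :=
  (T.mem_iff_V φ.1 (half_mem hx) z).trans
    (Piece.mem_fibre_iff_sheet (Piece.rects_not_isTau _ φ.1.rect_mem) (half_side hx))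

lemma zero_mem_iff {p : S2} (hp : p ∉ T.pos) : ((0 : ℂ), p) ∈ F ↔ p ∈ Γ.vertices := by
  obtain ⟨q, x, hx, rfl⟩ := T.exists_V hp
  rw [T.mem_iff_V q hx, Piece.zero_mem_fibre_iff (Piece.rects_not_isTau _ q.rect_mem),
    ← Piece.vertexSet_rect q.rect_mem hx]
  exact (T.mem_vertices_iff q.1 (q.toFun_mem hx)).symm

lemma mem_tauChart_of_vertex {p : S2} (hp : p ∈ T.pos) (hv : p ∈ Γ.vertices) : p ∈ Γ.tauChart := by
  obtain ⟨k, x, hx, rfl⟩ := T.exists_H p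
  rw [T.mem_pos_iff k hx] at hp
  rw [T.mem_vertices_iff k hx] at hv
  exact (T.mem_tauChart_iff k hx).2 (Piece.vertexSet_inter_posSet hv hp)

end Tiling

lemma Chart.ends_tau_eq_zero_iff (Γ : Chart) {v : S2} (hv : v ∈ Γ.vertices) :
    Γ.ends .tau v = 0 ↔ v ∉ Γ.tauChart := by
  rw [ends, ncard_eq_zero, eq_empty_iff_forall_notMem]
  constructor
  · rintro h ⟨e, he, t, ht, rfl⟩
    by_cases hc : Γ.circle e
    · exact Γ.interior_circle e hc t hv
    · rcases eq_or_ne t 0 with rfl | h0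
      · exact h (e, false) ⟨he, hc, by simp⟩
      · rcases eq_or_ne t 1 with rfl | h1
        · exact h (e, true) ⟨he, hc, by simp⟩
        · exact Γ.interior_arc e hc t ⟨lt_of_le_of_ne ht.1 h0.symm, lt_of_le_of_ne ht.2 h1⟩ hv
  · rintro h ⟨e, b⟩ ⟨he, hc, rfl⟩
    exact h ⟨e, he, mem_image_of_mem _ (by cases b <;> simp)⟩

/-- A vertex in `U` has no `τ`-ends, and among the admissible types only `(1, 0)` has none. -/
lemma Chart.numBlackSigma_eq {Γ : Chart} {U : Set S2} (hU : Γ.IsComponent U) :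
    Γ.numBlackSigma (closure U) = {v | v ∈ Γ.vertices ∧ v ∈ U}.ncard := by
  rw [numBlackSigma]
  congr 1
  ext v
  constructor
  · rintro ⟨h1, -, h2, h3⟩
    exact ⟨h1, hU.mem_of_closure h3 ((Γ.ends_tau_eq_zero_iff h1).1 h2)⟩
  · rintro ⟨h1, h2⟩
    have h3 := (Γ.ends_tau_eq_zero_iff h1).2 (hU.notMem h2)
    refine ⟨h1, ?_, h3, subset_closure h2⟩
    have h4 : (Γ.ends .sigma v, Γ.ends .tau v) ∈
      ({(1, 0), (0, 1), (1, 2), (0, 3)} : Set (ℕ × ℕ)) := Γ.vertex_type v h1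
    rw [h3] at h4
    simpa using h4

/-! ### Strips of wickets and the count of cells -/

/-- The height over the interval `[0,1]` of the semicircle with this diameter, doubled. -/
def height (b : ℝ) : ℝ := √(1 - (2 * b - 1) ^ 2)

lemma height_mem (b : ℝ) : height b ∈ Icc (0 : ℝ) 1 :=
  ⟨Real.sqrt_nonneg _, Real.sqrt_le_one.2 (by nlinarith [sq_nonneg (2 * b - 1)])⟩

lemma height_sq {b : ℝ} (hb : b ∈ Icc (0 : ℝ) 1) : (2 * b - 1) ^ 2 + height b ^ 2 = 1 := by
  rw [height, Real.sq_sqrt (by nlinarith [hb.1, hb.2])]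
  ring

lemma height_pos {b : ℝ} (hb : b ∈ Ioo (0 : ℝ) 1) : 0 < height b :=
  Real.sqrt_pos.2 (by nlinarith [hb.1, hb.2])

lemma height_pt (e : Bool) : height (pt e) = 0 := by
  rcases pt_cases e with h | h <;> rw [height, h] <;> norm_num

lemma exists_pt_of_notMem_openSquare {x : ℝ × ℝ} (hx : x ∈ square) (hxo : x ∉ openSquare) :
    (∃ e, pt e = x.1) ∨ ∃ e, pt e = x.2 := by
  by_contra hcon
  push Not at hcon
  have h : ∀ u ∈ Icc (0 : ℝ) 1, (∀ e, pt e ≠ u) → u ∈ Ioo (0 : ℝ) 1 := fun u hu h =>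
    ⟨lt_of_le_of_ne hu.1 (h false), lt_of_le_of_ne hu.2 (h true).symm⟩
  exact hxo ⟨h _ hx.1 hcon.1, h _ hx.2 hcon.2⟩

/-- A fixed point free involution of a finite set has a set of representatives of its orbits. -/
lemma exists_representatives {α : Type*} [Finite α] {π : α → α} (hπ : ∀ x, π x ≠ x)
    (hππ : ∀ x, π (π x) = x) {A : Set α} (hA : ∀ x ∈ A, π x ∈ A) :
    ∃ B ⊆ A, (∀ x ∈ B, π x ∉ B) ∧ (∀ x ∈ A, x ∉ B → π x ∈ B) ∧ 2 * B.ncard = A.ncard := by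
  obtain ⟨n, ⟨e⟩⟩ := Finite.exists_equiv_fin α
  let B : Set α := {x | x ∈ A ∧ e x < e (π x)}
  have h1 : ∀ x ∈ B, π x ∉ B := fun x hx hx' => by
    have := hx'.2
    rw [hππ] at this
    exact lt_asymm this hx.2
  have h2 : ∀ x ∈ A, x ∉ B → π x ∈ B := fun x hx hxB => by
    refine ⟨hA x hx, ?_⟩
    rw [hππ]
    exact lt_of_le_of_ne (not_lt.1 fun h => hxB ⟨hx, h⟩) fun h => hπ x (e.injective h)
  refine ⟨B, fun x hx => hx.1, h1, h2, ?_⟩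
  have hu : A = B ∪ π '' B := by
    ext x
    constructor
    · intro hx
      by_cases hxB : x ∈ B
      · exact Or.inl hxB
      · exact Or.inr ⟨π x, h2 x hx hxB, hππ x⟩
    · rintro (hx | ⟨y, hy, rfl⟩)
      · exact hx.1
      · exact hA y hy.1
  have hd : Disjoint B (π '' B) := by
    refine disjoint_left.2 ?_
    rintro _ hx ⟨y, hy, rfl⟩
    exact h1 y hy hx
  have hinj : Function.Injective π := Function.Involutive.injective hππ
  rw [hu, ncard_union_eq hd (toFinite _) (toFinite _), ncard_image_of_injective _ hinj]
  ring

namespace Glued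

variable {Γ : Chart} {F : Set (ℂ × S2)} {T : Tiling Γ F} (S : Glued T) {U : Set S2}

/-- The three ends `x`, `π x` and `π (π x)` share a foot, and consecutive ones are different. -/
lemma π_π (x : S.ι × Bool) : S.π (S.π x) = x := by
  have h0 : (0 : ℝ) ∈ Icc (0 : ℝ) 1 := by simp
  have h1 := S.E_π x 0 h0
  have h2 := S.E_π (S.π x) 0 h0
  rcases S.E_three h0 h0 h0 one_pos h1 (h2.trans h1) with h | h | h
  · exact absurd h.symm (S.π_ne x)
  · exact h.symm
  · exact absurd h.symm (S.π_ne _)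

lemma π_mem_sectors (hU : Γ.IsComponent U) {x : S.ι × Bool} (hx : x.1 ∈ S.sectors U) :
    (S.π x).1 ∈ S.sectors U := by
  have h0 : (0 : ℝ) ∈ Icc (0 : ℝ) 1 := by simp
  rw [← S.W_mem_iff_sectors hU _ (x := (pt x.2, 0)) ⟨pt_mem _, h0⟩ one_pos] at hx
  rw [← S.W_mem_iff_sectors hU _ (x := (pt (S.π x).2, 0)) ⟨pt_mem _, h0⟩ one_pos]
  have := S.E_π x 0 h0
  simp only [Sectors.E] at this
  rwa [this]

/-- The surface over a sector. -/
def strip (i : S.ι) (x : ℝ × ℝ) : ℂ × S2 :=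
  (((2 * x.2 - 1 : ℝ) : ℂ) * (S.dir i x.1 / 2), S.C i (x.1, height x.2))

lemma strip_sq {x : ℝ × ℝ} (hx : x ∈ square) : (x.1, height x.2) ∈ square :=
  ⟨hx.1, height_mem _⟩

lemma continuousOn_strip (i : S.ι) : ContinuousOn (S.strip i) square := by
  have h1 : ContinuousOn (fun x : ℝ × ℝ => S.dir i x.1) square :=
    ((T.κ (S.kk i)).continuous_dir.comp_continuousOn (S.sec i).cont).comp
      (f := fun x : ℝ × ℝ => (x.1, (0 : ℝ))) (by fun_prop) fun x hx => ⟨hx.1, by simp⟩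
  have h2 : Continuous fun x : ℝ × ℝ => (x.1, height x.2) := by
    unfold height
    fun_prop
  exact ((Continuous.continuousOn (by fun_prop)).mul (h1.div_const 2)).prodMk
    ((S.continuousOn_C i).comp h2.continuousOn fun x hx => strip_sq hx)

lemma strip_mem (hU : Γ.IsComponent U) {i : S.ι} (hi : i ∈ S.sectors U) {x : ℝ × ℝ}
    (hx : x ∈ square) : S.strip i x ∈ part F (closure U) := by
  rw [S.part_closure hU]
  exact Or.inr ⟨i, hi, _, strip_sq hx, _, height_sq hx.2, rfl⟩

lemma part_closure_eq (hU : Γ.IsComponent U) : part F (closure U) =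
    part F (U \ T.pos) ∪ ⋃ i : S.sectors U, S.strip i '' square := by
  refine Subset.antisymm ?_ (union_subset ?_ ?_)
  · rw [S.part_closure hU]
    refine union_subset_union_right _ ?_
    rintro _ ⟨i, hi, x, hx, r, hr, rfl⟩
    have hx0 := hx.2.1
    refine mem_iUnion.2 ⟨⟨i, hi⟩, (x.1, (r + 1) / 2), ⟨hx.1, ?_, ?_⟩, ?_⟩
    · simp only; nlinarith [sq_nonneg x.2]
    · simp only; nlinarith [sq_nonneg x.2]
    · have h1 : 2 * ((r + 1) / 2) - 1 = r := by ring
      have h2 : height ((r + 1) / 2) = x.2 := by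
        rw [height, h1, show 1 - r ^ 2 = x.2 ^ 2 by linarith, Real.sqrt_sq hx0]
      simp only [strip, h1, h2]
  · exact fun q hq => ⟨hq.1, subset_closure hq.2.1⟩
  · exact iUnion_subset fun i => image_subset_iff.2 fun x hx => S.strip_mem hU i.2 hx

lemma strip_pos (i : S.ι) {x : ℝ × ℝ} (hx : x ∈ square) (hx2 : x.2 ∈ Ioo (0 : ℝ) 1) :
    (S.strip i x).2 ∈ T.pos := (S.C_mem_pos_iff i (strip_sq hx)).2 (height_pos hx2)

lemma strip_end (hU : Γ.IsComponent U) {i : S.ι} (hi : i ∈ S.sectors U) {u : ℝ}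
    (hu : u ∈ Icc (0 : ℝ) 1) (e : Bool) : S.strip i (u, pt e) ∈ part F (U \ T.pos) ∧
      ∀ φ : T.tiles U × Bool, ∀ y ∈ openSquare, T.face (φ.1, φ.2) y ≠ (S.strip i (u, pt e)).2 := by
  have h := S.strip_mem hU hi (x := (u, pt e)) ⟨hu, pt_mem e⟩
  have h2 : (S.strip i (u, pt e)).2 = S.W i (u, 0) := by
    simp only [strip, height_pt]
    exact S.C_zero i hu
  refine ⟨⟨h.1, mem_of_mem_closure T hU h, ?_⟩, fun φ y hy e' => ?_⟩
  · rw [h2, S.W_mem_pos_iff i ⟨hu, by simp⟩]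
    exact lt_irrefl _
  · rw [h2] at e'
    refine S.notMem_N φ.1.1.rect_mem (half_mem_openSquare (b := φ.2) hy) ?_
    have : T.face (φ.1, φ.2) y ∈ S.N := by
      rw [e']
      exact S.W_mem_N i ⟨hu, by simp⟩
    exact this

/-- Equal points of strips. -/
lemma strip_eq {i j : S.ι} {x y : ℝ × ℝ} (hx : x ∈ square) (hy : y ∈ square)
    (h : S.strip i x = S.strip j y) : (i = j ∧ x = y) ∨ ∃ e e', x.1 = pt e ∧ y.1 = pt e' ∧
      (j, e') = S.π (i, e) := by
  obtain ⟨h1, h2⟩ := Prod.mk.inj h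
  rcases S.C_eq (strip_sq hx) (strip_sq hy) h2 with ⟨rfl, h3⟩ | ⟨-, h3⟩
  · left
    have h4 := (Prod.mk.inj h3).1
    rw [h4] at h1
    have h5 := mul_right_cancel₀ (div_ne_zero (S.dir_ne_zero i y.1) two_ne_zero) h1
    have h6 := Complex.ofReal_injective h5
    exact ⟨rfl, Prod.ext h4 (by linarith)⟩
  · exact Or.inr h3

/-- The ends of the strips are glued in pairs. -/
lemma strip_π (x : S.ι × Bool) {b : ℝ} (hb : b ∈ Icc (0 : ℝ) 1) : ∃ b' ∈ Icc (0 : ℝ) 1,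
    S.strip x.1 (pt x.2, b) = S.strip (S.π x).1 (pt (S.π x).2, b') := by
  have h0 := S.E_π x 0 (by simp)
  simp only [Sectors.E] at h0
  have hd : S.dir x.1 (pt x.2) = S.dir (S.π x).1 (pt (S.π x).2) ∨
      S.dir x.1 (pt x.2) = -S.dir (S.π x).1 (pt (S.π x).2) := by
    have h1 := S.fibre_foot x.1 (pt_mem x.2)
    rw [← h0, S.fibre_foot _ (pt_mem _), pair_eq_pair_iff] at h1
    rcases h1 with h | h
    · left; linear_combination -2 * h.1
    · right; linear_combination -2 * h.2
  have hC : ∀ s ∈ Icc (0 : ℝ) 1, S.C x.1 (pt x.2, s) = S.C (S.π x).1 (pt (S.π x).2, s) := by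
    refine S.C_compat _ _ _ (pt_mem _) _ (pt_mem _) ?_
    rw [S.C_zero _ (pt_mem _), S.C_zero _ (pt_mem _), h0]
  -- The two sectors may see the sheets in opposite directions; this exchanges the feet of the
  -- wickets and reverses the parameter.
  rcases hd with hd | hd
  · refine ⟨b, hb, ?_⟩
    simp only [strip, hd, hC _ (height_mem b)]
  · refine ⟨1 - b, ⟨by linarith [hb.2], by linarith [hb.1]⟩, ?_⟩
    have h1 : height (1 - b) = height b := by
      rw [height, height]; ring_nf
    simp only [strip, hd, h1, hC _ (height_mem b)]
    refine Prod.ext ?_ rfl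
    push_cast
    ring

lemma zeros_eq (T : Tiling Γ F) (hU : Γ.IsComponent U) : {p | ((0 : ℂ), p) ∈ part F (U \ T.pos)} =
    {v | v ∈ Γ.vertices ∧ v ∈ U} := by
  ext p
  constructor
  · rintro ⟨h1, h2, h3⟩
    exact ⟨(T.zero_mem_iff h3).1 h1, h2⟩
  · rintro ⟨h1, h2⟩
    have h3 : p ∉ T.pos := fun h => hU.notMem h2 (T.mem_tauChart_of_vertex h h1)
    exact ⟨(T.zero_mem_iff h3).2 h1, h2, h3⟩

/-- The strips over the sectors are glued along their ends in pairs, so one arc per pair is an edge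
and there are as many edges as strips. The wickets thus contribute nothing, and only the branch
points remain. -/
lemma exists_hasEulerChar (hU : Γ.IsComponent U) : ∃ n : ℤ,
    HasEulerChar (trim (closure U) S.N) n ∧
      HasEulerChar (part F (closure U)) (2 * n - Γ.numBlackSigma (closure U)) := by
  obtain ⟨V, hV, hV1, hV2, hcard⟩ := exists_representatives S.π_ne S.π_π
    (A := {x | x.1 ∈ S.sectors U}) fun x hx => S.π_mem_sectors hU hx
  have hnot : ∀ {x y : S.ι × Bool}, x ∈ V → y ∈ V → y ≠ S.π x := fun hx hy h =>
    hV1 _ hx (h ▸ hy)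
  have hpt : ∀ {x : ℝ × ℝ}, x ∈ openSquare → ∀ e, x.1 ≠ pt e := fun hx e h => by
    have h1 := hx.1.1
    have h2 := hx.1.2
    rcases pt_cases e with h' | h' <;> rw [h, h'] at h1 h2 <;> linarith
  have hmem : ∀ (x : S.ι × Bool) {t : ℝ}, t ∈ Icc (0 : ℝ) 1 → (pt x.2, t) ∈ square := fun x t ht =>
    ⟨pt_mem _, ht⟩
  have hz := zeros_eq T hU
  rw [S.trim_N hU, Chart.numBlackSigma_eq hU, ← hz]
  have key := exists_eulerChar (Φ := T.tiles U × Bool) (Ws := S.sectors U) (Wv := V)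
    (fun φ => T.face (φ.1, φ.2)) (fun φ x => φ.1.1.rect.piece.sheet φ.2 (half φ.2 x)) (U \ T.pos)
    (part F (U \ T.pos)) (part F (closure U)) (fun i => S.strip i)
    (fun x t => S.strip x.1.1 (pt x.1.2, t))
    (fun φ => T.continuousOn_face _) (fun φ => T.injOn_face _) ?_
    (fun φ ψ _ => T.isPieced_face _ _) (T.iUnion_face hU)
    (fun φ => (Piece.continuous_sheet _ _).comp_continuousOn (continuous_half _).continuousOn)
    (fun q hq => hq.2) ?_ ?_ ?_ (fun i => S.continuousOn_strip _)
    (fun x => (S.continuousOn_strip _).comp (by fun_prop) fun t ht => hmem x ht)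
    ?_ ?_ ?_ ?_ ?_ ?_ ?_ ?_ (S.part_closure_eq hU)
    (fun x t ht => S.strip_mem hU (hV x.2) (hmem x ht))
  · have h1 : (Nat.card (S.sectors U) : ℤ) = Nat.card V := by
      have h2 : {x : S.ι × Bool | x.1 ∈ S.sectors U} = S.sectors U ×ˢ univ := by
        ext; simp
      rw [h2, ncard_prod, ncard_univ] at hcard
      simp only [Nat.card_eq_fintype_card, Fintype.card_bool] at hcard
      rw [← Nat.card_coe_set_eq, ← Nat.card_coe_set_eq] at hcard
      omega
    rw [h1] at key
    simpa using key
  · rintro φ ψ h x hx ⟨y, hy, e⟩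
    refine T.face_ne (fun h' => h ?_) hx hy e.symm
    exact Prod.ext (Subtype.ext (Prod.mk.inj h').1) (Prod.mk.inj h').2
  · intro φ x hx z
    rw [← T.mem_iff_face (φ.1, φ.2) hx z]
    refine and_iff_left ?_
    have : T.face (φ.1, φ.2) x ∈ ⋃ φ : T.tiles U × Bool, T.face (φ.1, φ.2) '' square :=
      mem_iUnion.2 ⟨φ, x, hx, rfl⟩
    rwa [T.iUnion_face hU] at this
  · intro φ x hx h0
    have hκ := Piece.rects_not_isTau _ φ.1.1.rect_mem
    have h1 := (Piece.mem_fibre_iff_sheet hκ (half_side (b := φ.2) (openSquare_subset hx))).2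
      (Or.inl h0.symm)
    rw [Piece.zero_mem_fibre_iff hκ] at h1
    have h2 : half φ.2 x = (1 / 2, 1 / 2) := by
      revert hκ h1
      cases φ.1.1.rect.piece <;> intro hκ h1 <;> first | exact absurd trivial hκ | exact h1.elim | exact h1
    have h3 := (Prod.mk.inj h2).1
    have h4 := hx.1.1
    have h5 := hx.1.2
    rcases pt_cases φ.2 with h | h <;> rw [h] at h3 <;> linarith
  · rw [hz]
    exact Γ.vertices.finite_toSet.subset fun v hv => hv.1
  · intro i j x hx y hy e
    rcases S.strip_eq (openSquare_subset hx) (openSquare_subset hy) e with h | ⟨a, _, h, -⟩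
    · exact ⟨Subtype.ext h.1, h.2⟩
    · exact absurd h (hpt hx a)
  · intro x y s hs t ht e
    rcases S.strip_eq (hmem x (Ioo_subset_Icc_self hs)) (hmem y (Ioo_subset_Icc_self ht)) e with
      ⟨h1, h2⟩ | ⟨a, a', h1, h2, h3⟩
    · obtain ⟨h3, h4⟩ := Prod.mk.inj h2
      exact ⟨Subtype.ext (Prod.ext h1 (pt_inj h3)), h4⟩
    · rw [← pt_inj h1, ← pt_inj h2] at h3
      exact absurd h3 (hnot x.2 y.2)
  · exact fun i x hx h => h.2 (S.strip_pos i (openSquare_subset hx) hx.2)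
  · exact fun x t ht h => h.2 (S.strip_pos _ (hmem x (Ioo_subset_Icc_self ht)) ht)
  · intro i x hx y t ht e
    rcases S.strip_eq (openSquare_subset hx) (hmem y ht) e with ⟨-, h⟩ | ⟨a, _, h, -⟩
    · exact hpt hx _ (congrArg Prod.fst h)
    · exact hpt hx a h
  · exact fun x => S.strip_end hU (hV x.2) (pt_mem _) false
  · exact fun x => S.strip_end hU (hV x.2) (pt_mem _) true
  · intro i x hx hxo
    rcases exists_pt_of_notMem_openSquare hx hxo with ⟨e, he⟩ | ⟨e, he⟩
    · right
      have hx' : x = (pt e, x.2) := Prod.ext he.symm rfl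
      by_cases hm : (i.1, e) ∈ V
      · exact ⟨⟨(i.1, e), hm⟩, x.2, hx.2, congrArg (S.strip i) hx'⟩
      · obtain ⟨b', hb', h⟩ := S.strip_π (i.1, e) hx.2
        exact ⟨⟨S.π (i.1, e), hV2 (i.1, e) i.2 hm⟩, b', hb', (congrArg (S.strip i) hx').trans h⟩
    · left
      have := S.strip_end hU i.2 hx.1 e
      rwa [he] at this

end Glued

lemma Equivalent.hasEulerChar {F F' : Set (ℂ × S2)} (h : Equivalent F F') {n : ℤ}
    (hF : HasEulerChar F n) : HasEulerChar F' n := by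
  obtain ⟨Φ, Ψ, h1, h2, h3, -, -, rfl⟩ := h
  have hc : ∀ G : ℝ → ℂ → E3 → ℂ, ContDiff ℝ ∞ (fun q : ℝ × ℂ × E3 => G q.1 q.2.1 q.2.2) →
      Continuous fun q : ℂ × S2 => (G 1 q.1 q.2, q.2) := fun G hG =>
    (hG.continuous.comp (f := fun q : ℂ × S2 => ((1 : ℝ), q.1, (q.2 : E3)))
      (by fun_prop)).prodMk continuous_snd
  let e : (ℂ × S2) ≃ₜ (ℂ × S2) :=
    ⟨⟨fun q => (Φ 1 q.1 q.2, q.2), fun q => (Ψ 1 q.1 q.2, q.2),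
      fun q => Prod.ext (h3 q.2 1 q.1).1 rfl, fun q => Prod.ext (h3 q.2 1 q.1).2 rfl⟩,
      hc Φ h1, hc Ψ h2⟩
  exact hF.of_homotopyEquiv (e.image F).toHomotopyEquiv

end Knit

end

/-! ### Assembly of the three claims -/

theorem mainTheorem11 (Γ : Knit.Chart) (F : Set (ℂ × Knit.S2))
    (hF : Knit.IsKnittedSurface Set.univ Γ F) :
    Γ.regions.Finite ∧
    F = ⋃ R : Γ.regions, Knit.part F R ∧
    Knit.IsSplitUnion (fun R : Γ.regions => Knit.toE4 '' Knit.part F R) ∧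
    (∃ N : Set Knit.S2, Knit.IsRegularNhd Γ.tauChart N ∧
      ∀ R : Γ.regions, ∃ S P : Set (ℂ × Knit.S2),
        Knit.IsKnittedSurface (Knit.trim R N) Γ S ∧
        Knit.IsPlatClosure (Knit.trim R N) S P ∧
        Knit.Equivalent P (Knit.part F R)) ∧
    ∀ N : Set Knit.S2, Knit.IsRegularNhd Γ.tauChart N →
      ∀ R : Γ.regions, ∃ n : ℤ,
        Knit.HasEulerChar (Knit.trim R N) n ∧
        Knit.HasEulerChar (Knit.part F R) (2 * n - Γ.numBlackSigma R) := by
  obtain ⟨F₀, h0, hE⟩ := hF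
  obtain ⟨T⟩ := h0.exists_tiling
  obtain ⟨S⟩ := T.exists_glued
  refine ⟨S.regions_finite, ?_, T.isSplitUnion S.regions_finite hE, ⟨S.N, S.isRegularNhd_N, ?_⟩, ?_⟩
  · ext ⟨z, p⟩
    simp only [Set.mem_iUnion]
    refine ⟨fun h => ?_, fun ⟨R, h⟩ => h.1⟩
    -- Over the `τ`-chart the fibres of the model are empty, and the fibre-preserving isotopy keeps
    -- them empty; every other point lies in a region.
    by_cases hp : p ∈ Γ.tauChart
    · obtain ⟨Φ, Ψ, -, -, -, -, -, rfl⟩ := hE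
      obtain ⟨⟨w, p'⟩, hw, e⟩ := h
      obtain ⟨-, rfl⟩ := Prod.mk.inj e
      exact absurd ⟨w, hw⟩ (T.fibre_eq_empty_of_tauChart hp)
    · exact ⟨⟨_, p, hp, rfl⟩, h, subset_closure (mem_connectedComponentIn hp)⟩
  · rintro ⟨R, hR⟩
    obtain ⟨U, hU, rfl⟩ := Knit.Chart.mem_regions hR
    -- The model surface over the trimmed region is already built from pieces, so no isotopy is
    -- needed for it; the given isotopy is used only to pass from the plat closure to the part of
    -- `F`.
    refine ⟨_, _, ⟨_, ?_, Knit.Equivalent.refl _⟩, S.isPlatClosure hU, hE.part _⟩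
    have := T.isBuiltFrom hU
    rwa [← S.trim_N hU] at this
  · rintro N hN ⟨R, hR⟩
    obtain ⟨U, hU, rfl⟩ := Knit.Chart.mem_regions hR
    obtain ⟨n, h1, h2⟩ := S.exists_hasEulerChar hU
    exact ⟨n, h1.trim hU S.isRegularNhd_N hN, (hE.part _).hasEulerChar h2⟩
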